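/- Let $p$ be a prime, identify $\mathbb{F}_p$ with $\{0,1,\dots,p-1\}$, and let $V$ be the $\mathbb{F}_p$-vector space of sequences $x=(x_i)_{i\in\mathbb{N}}$ in $\mathbb{F}_p$ with only finitely many nonzero entries ($\mathbb{N}=\{0,1,2,\dots\}$), with the Hamming distance $\mathrm{dist}(x,y)=|\{i : x_i\ne y_i\}|$ and the standard basis $E=(e_0,e_1,\dots)$. An ordered basis $F=(f_i)_{i\in\mathbb{N}}$ of $V$ orders $V$ as follows: for $x=\sum_i a_i f_i\neq y=\sum_i b_i f_i$, let $N$ be the largest index with $a_N\ne b_N$; then $x<_F y$ if $a_N<b_N$ as elements of $\{0,\dots,p-1\}$. For an integer $d\ge 2$ define vectors $w_F(0),w_F(1),\dots$ recursively: $w_F(a)$ is the $<_F$-minimum of all $z\in V$ with $\mathrm{dist}(z,w_F(b))\ge d$ for every $0\le b<a$. For $k\in\mathbb{N}$ let $L_{F,d}(k)=\{w_F(0),\dots,w_F(p^k-1)\}$; it is called linear if it is a linear subspace of $V$. The maximal linear dimension $D(F,d)$ is $\infty$ if $L_{F,d}(k)$ is linear for all $k$, and otherwise the maximum of the $k$ for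 which $L_{F,d}(k)$ is linear. For distinct $\xi,\eta\in\mathbb{N}$ let $F(\xi,\eta)$ be the basis with $f_i=e_i$ for $i\neq\xi$ and $f_\xi=e_\xi+e_\eta$. **Theorem.** Let $F$ be the standard basis $E$ or $F(\xi,\eta)$ for some $\xi\neq\eta$, and let $d\ge 2$. Then $D(F,d)$ is well defined (in particular, the maximum exists when the codes are not all linear), in each of the following cases, and: 1. If $p=2$, then $D(F,d)=\infty$. 2. If $p=3$ and $d=3^{k-1}d'$ with integers $k\ge 1$ and $d'\ge 2$, then $D(F,d)\ge k$. If moreover $k-1$ is the $3$-adic order of $d$ (the exponent of the largest power of $3$ dividing $d$) and $d'\ge 8$, then $D(F,d)=k$. 3. If $p\ge 5$, then $D(F,d)\le 2$. -/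

import Mathlib

noncomputable section

namespace LexCode

/-- The space of finitely supported sequences `ℕ → 𝔽_p`. -/
abbrev Vec (p : ℕ) : Type := ℕ →₀ ZMod p

/-- An ordered basis `(f_i)_{i ∈ ℕ}` of the space of finitely supported sequences. -/
abbrev OrdBasis (p : ℕ) : Type := Module.Basis ℕ (ZMod p) (Vec p)

/-- The standard basis `E = (e_0, e_1, …)`. -/
def stdBasis (p : ℕ) : OrdBasis p := Finsupp.basisSingleOne

theorem stdBasis_apply (p : ℕ) (i : ℕ) : stdBasis p i = Finsupp.single i 1 := by
  simp [stdBasis]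

theorem lapply_single_eq_zero (p : ℕ) {ξ η : ℕ} (h : ξ ≠ η) :
    (Finsupp.lapply ξ : Vec p →ₗ[ZMod p] ZMod p) (Finsupp.single η 1) = 0 := by
  simp [h.symm]

/-- The basis `F(ξ, η)`: the image of the standard basis under the linear automorphism
`x ↦ x + x_ξ e_η`; its elements are computed in `twistBasis_apply`. -/
def twistBasis (p : ℕ) (ξ η : ℕ) (h : ξ ≠ η) : OrdBasis p :=
  (stdBasis p).map (LinearEquiv.transvection (lapply_single_eq_zero p h))

/-- `f_i = e_i` for `i ≠ ξ` and `f_ξ = e_ξ + e_η`. -/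
theorem twistBasis_apply (p : ℕ) (ξ η : ℕ) (h : ξ ≠ η) (i : ℕ) :
    twistBasis p ξ η h i =
      if i = ξ then stdBasis p ξ + stdBasis p η else stdBasis p i := by
  have key : twistBasis p ξ η h i =
      Finsupp.single i 1 +
        (Finsupp.lapply ξ : Vec p →ₗ[ZMod p] ZMod p) (Finsupp.single i 1) •
          Finsupp.single η 1 := by
    rw [twistBasis, Module.Basis.map_apply, stdBasis_apply]
    exact LinearEquiv.transvection.apply (lapply_single_eq_zero p h) _
  rw [key]
  by_cases hi : i = ξ
  · subst hi
    simp [stdBasis_apply]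
  · simp [stdBasis_apply, hi]

/-- The family consisting of the standard basis and all `F(ξ, η)` with `ξ ≠ η`. -/
def basisFamily (p : ℕ) : Set (OrdBasis p) :=
  {stdBasis p} ∪ {F | ∃ (ξ η : ℕ) (h : ξ ≠ η), F = twistBasis p ξ η h}

/-- The Hamming distance: the number of coordinates (in the standard basis) that differ. -/
def hdist {p : ℕ} (x y : Vec p) : ℕ := (Finsupp.neLocus x y).card

/-- The order `x <_F y`: at the largest index at which the coordinates with respect to `F` differ,
the coordinate of `x` is smaller than that of `y`, as elements of `{0, …, p - 1}`. -/
def BasisLT {p : ℕ} (F : OrdBasis p) (x y : Vec p) : Prop :=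
  ∃ N : ℕ, (F.repr x N).val < (F.repr y N).val ∧ ∀ i, N < i → F.repr x i = F.repr y i

theorem basisLT_wf {p : ℕ} (F : OrdBasis p) : WellFounded (BasisLT F) := by
  have h : WellFounded (Finsupp.Lex (fun a b : ℕ => b < a)
      (fun a b : ZMod p => a.val < b.val)) := by
    have : Std.Trichotomous (fun a b : ℕ => b < a) := ⟨fun a b h1 h2 => by omega⟩
    refine Finsupp.Lex.wellFounded' ?_ (InvImage.wf ZMod.val Nat.lt_wfRel.wf) Nat.lt_wfRel.wf
    intro n hn
    simp at hn
  refine Subrelation.wf ?_ (InvImage.wf (fun x => F.repr x) h)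
  rintro x y ⟨N, h1, h2⟩
  exact ⟨N, h2, h1⟩

/-- The vectors at Hamming distance at least `d` from each of `w_0, …, w_{a-1}`. -/
def farFrom {p : ℕ} (d a : ℕ) (w : ∀ b, b < a → Vec p) : Set (Vec p) :=
  {z | ∀ (b : ℕ) (hb : b < a), d ≤ hdist z (w b hb)}

theorem farFrom_nonempty {p : ℕ} [Fact p.Prime] (d a : ℕ) (w : ∀ b, b < a → Vec p) :
    (farFrom d a w).Nonempty := by
  classical
  let S : Finset ℕ := Finset.univ.biUnion fun b : Fin a => (w b b.2).support
  obtain ⟨T, hT, hTc⟩ := (Set.Finite.infinite_compl S.finite_toSet).exists_subset_card_eq d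
  refine ⟨Finsupp.indicator T fun _ _ => 1, fun b hb => ?_⟩
  rw [hdist, ← hTc]
  refine Finset.card_le_card fun i hi => ?_
  have hiS : i ∉ S := hT hi
  have h0 : w b hb i = 0 := by
    by_contra hne
    exact hiS (Finset.mem_biUnion.2 ⟨⟨b, hb⟩, Finset.mem_univ _, Finsupp.mem_support_iff.2 hne⟩)
  rw [Finsupp.mem_neLocus, h0, Finsupp.indicator_of_mem hi]
  exact one_ne_zero

/-- The greedy sequence: `word F d a` is the minimum, with respect to `<_F`, of the vectors at
distance at least `d` from all `word F d b` with `b < a`. -/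
def word {p : ℕ} [Fact p.Prime] (F : OrdBasis p) (d : ℕ) (a : ℕ) : Vec p :=
  (basisLT_wf F).min (farFrom d a fun b _ => word F d b) (farFrom_nonempty d a _)
termination_by a

/-- The lexicographic code `{word 0, …, word (p ^ k - 1)}`. -/
def lexCode {p : ℕ} [Fact p.Prime] (F : OrdBasis p) (d k : ℕ) : Set (Vec p) :=
  {x | ∃ a < p ^ k, x = word F d a}

/-- A set of vectors is a linear code if it is a linear subspace. -/
def IsLinearCode {p : ℕ} (C : Set (Vec p)) : Prop :=
  ∃ W : Submodule (ZMod p) (Vec p), (W : Set (Vec p)) = C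

/-- `m` is the maximal linear dimension of `F` and `d`: it is `∞` if the codes `lexCode F d k` are
linear for all `k`, and otherwise it is the maximum of the `k` for which `lexCode F d k` is
linear. -/
def IsMaxLinearDim {p : ℕ} [Fact p.Prime] (F : OrdBasis p) (d : ℕ) (m : ℕ∞) : Prop :=
  (m = ⊤ ∧ ∀ k, IsLinearCode (lexCode F d k)) ∨
    ∃ n : ℕ, m = n ∧ IsGreatest {k : ℕ | IsLinearCode (lexCode F d k)} n

end LexCode

end

/-! ### The order, the Hamming distance and the greedy words -/

namespace LexCode

variable {p : ℕ}

/-! The basis enters only through its coordinates: they are the standard ones, except that κ x_ξ is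
subtracted at η, with κ = 0 for the standard basis (`IsTwisted`). All arguments compare a minimal
vector with a competitor at the largest index where their coordinates differ. The competitor is
obtained by exchanging, deleting or relabelling entries, with extra care at ξ and η.

If a code with p^(k+1) words is linear, the largest index at which its coordinates do not all vanish
is a pivot. Since the words increase, the preceding code is the kernel of the pivot coordinate
(`exists_pivot`). Hence linearity passes to smaller codes and the maximal linear dimension exists.
The same picture gives the test used for all negative results (`not_lt_add_word`): in a linear code,
w(p^k) + w(i) is not undercut by any vector far from the preceding code and from the smaller
translates w(p^k) + w(i').

For p = 2 one shows w(2^k + i) = w(2^k) + w(i). If z were a smaller choice, then z - w(2^k) could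
not lie below w(i), nor z - w(i) below w(2^k), and three elements of 𝔽₂ cannot satisfy this at the
top difference.

For p = 3 the same comparison leaves a few configurations at the top difference, and these are
excluded by counting. The rows w(3^l) generate a simplex code with repeated columns. Row l has t_l =
3^(k-1-l) d' new entries, all equal to 1, and takes each value exactly t_l times on each class of
equal earlier columns. The reason is an averaging argument (`IsSimplex.card_le_outWeight`): a vector
far from the code takes no value on a class more often than it has nonzero entries outside of the
support. A smaller competitor would take some value t_j + 1 times on a class of 3 t_j columns, or
else lead to a vector that deviates from a codeword in two opposite entries, which is excluded by
induction on the rows (`not_forall_far`). This gives w(s 3^j + i) = s w(3^j) + w(i)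
(`LexSimplex.word_add`). If 3 does not divide d', the sizes of the fibres must be rounded, and the
slack allows one to add the last row to the next word y with suitably varying signs, staying far
from everything relevant but below y + w(3^j) (`LexSimplex.exists_lt_add`).

For p ≥ 5 and d ≥ 3 let S be the support of w(1), whose entries are all 1. Being far from the
multiples of w(1) only bounds the size of the fibres on S, and this is invariant under permutations
of the values 𝔽_p. With at least five values there are enough permutations to beat w(p) or w(p) +
w(1), unless the twist interferes. What survives is ξ < η with entries 1 and 2 there and a single
other index of S above ξ. Adding w(2) or w(3) then forces p = d = 5. In that case the first two
basis words are lines in the affine plane over 𝔽₅, and a computation with lines determines enough of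
the third basis word to contradict linearity (`not_isLinearCode_five`). For d = 2 the first words
are computed explicitly. -/

theorem exists_top_index {x : Vec p} (hx : x ≠ 0) :
    ∃ P, x P ≠ 0 ∧ ∀ i, P < i → x i = 0 := by
  classical
  have hne : x.support.Nonempty := Finsupp.support_nonempty_iff.2 hx
  refine ⟨x.support.max' hne, Finsupp.mem_support_iff.1 (x.support.max'_mem hne), fun i hi => ?_⟩
  by_contra h
  exact absurd (x.support.le_max' i (Finsupp.mem_support_iff.2 h)) (not_le.2 hi)

theorem exists_top_diff (F : OrdBasis p) {x y : Vec p} (hxy : x ≠ y) :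
    ∃ P, F.repr x P ≠ F.repr y P ∧ ∀ i, P < i → F.repr x i = F.repr y i := by
  have hne : F.repr x - F.repr y ≠ 0 := fun h => hxy (F.repr.injective (sub_eq_zero.1 h))
  obtain ⟨P, h1, h2⟩ := exists_top_index hne
  exact ⟨P, fun h => h1 (by simp [h]), fun i hi => sub_eq_zero.1 (by simpa using h2 i hi)⟩

theorem basisLT_irrefl (F : OrdBasis p) (x : Vec p) : ¬ BasisLT F x x := fun ⟨_, h, _⟩ =>
  lt_irrefl _ h

theorem basisLT_trans {F : OrdBasis p} {x y z : Vec p} (h₁ : BasisLT F x y)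
    (h₂ : BasisLT F y z) : BasisLT F x z := by
  obtain ⟨N, hN, hN'⟩ := h₁
  obtain ⟨M, hM, hM'⟩ := h₂
  rcases lt_trichotomy N M with h | h | h
  · exact ⟨M, by rwa [hN' M h], fun i hi => (hN' i (h.trans hi)).trans (hM' i hi)⟩
  · subst h
    exact ⟨N, hN.trans hM, fun i hi => (hN' i hi).trans (hM' i hi)⟩
  · exact ⟨N, by rwa [← hM' N h], fun i hi => (hN' i hi).trans (hM' i (h.trans hi))⟩

theorem basisLT_or_of_ne [NeZero p] (F : OrdBasis p) {x y : Vec p} (h : x ≠ y) :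
    BasisLT F x y ∨ BasisLT F y x := by
  obtain ⟨P, h1, h2⟩ := exists_top_diff F h
  rcases lt_or_gt_of_ne (fun e => h1 (ZMod.val_injective p e)) with h' | h'
  · exact Or.inl ⟨P, h', h2⟩
  · exact Or.inr ⟨P, h', fun i hi => (h2 i hi).symm⟩

theorem basisLT_asymm {F : OrdBasis p} {x y : Vec p} (h : BasisLT F x y) : ¬ BasisLT F y x :=
  fun h' => basisLT_irrefl F x (basisLT_trans h h')

/-- A vector whose coordinates are weakly smaller from some index on, and strictly smaller at
that index, is smaller. -/
theorem basisLT_of_le_above [NeZero p] {F : OrdBasis p} {x y : Vec p} (N : ℕ)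
    (hN : (F.repr x N).val < (F.repr y N).val)
    (h : ∀ i, N < i → (F.repr x i).val ≤ (F.repr y i).val) : BasisLT F x y := by
  have hne : x ≠ y := fun e => by simp [e] at hN
  obtain ⟨P, h1, h2⟩ := exists_top_diff F hne
  refine ⟨P, ?_, h2⟩
  rcases lt_trichotomy P N with hP | hP | hP
  · rw [h2 N hP] at hN
    exact absurd hN (lt_irrefl _)
  · rwa [hP]
  · exact lt_of_le_of_ne (h P hP) fun e => h1 (ZMod.val_injective p e)

theorem hdist_eq_card_support (x y : Vec p) : hdist x y = (x - y).support.card := by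
  classical
  rw [hdist, Finsupp.neLocus_eq_support_sub]

@[simp] theorem hdist_self (x : Vec p) : hdist x x = 0 := by simp [hdist]

theorem hdist_eq_of_sub_eq {x y x' y' : Vec p} (h : x - y = x' - y') :
    hdist x y = hdist x' y' := by
  rw [hdist_eq_card_support, hdist_eq_card_support, h]

theorem hdist_smul [Fact p.Prime] {a : ZMod p} (ha : a ≠ 0) (x y : Vec p) :
    hdist (a • x) (a • y) = hdist x y := by
  rw [hdist_eq_card_support, hdist_eq_card_support, ← smul_sub, Finsupp.support_smul_eq ha]

section Words

variable [Fact p.Prime] {F : OrdBasis p} {d : ℕ}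

theorem word_far {a b : ℕ} (h : b < a) : d ≤ hdist (word F d a) (word F d b) := by
  have := (basisLT_wf F).min_mem (farFrom d a fun b _ => word F d b) (farFrom_nonempty d a _)
  rw [← word] at this
  exact this b h

theorem word_min {a : ℕ} {z : Vec p} (h : ∀ b < a, d ≤ hdist z (word F d b)) :
    ¬ BasisLT F z (word F d a) := by
  rw [word]
  exact (basisLT_wf F).not_lt_min _
    (show z ∈ farFrom d a fun b _ => word F d b from fun b hb => h b hb)

theorem word_ne (hd : 0 < d) {a b : ℕ} (h : a ≠ b) : word F d a ≠ word F d b := by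
  wlog hab : b < a generalizing a b
  · exact (this h.symm (by omega)).symm
  intro e
  have := word_far (F := F) (d := d) hab
  rw [e, hdist_self] at this
  omega

theorem word_injective (hd : 0 < d) : Function.Injective (word F d) := fun a b h => by
  by_contra hab
  exact word_ne hd hab h

/-- Later words remain admissible at every earlier stage, so they cannot undercut the minimum chosen
there. -/
theorem word_lt_word (hd : 0 < d) {a b : ℕ} (h : a < b) : BasisLT F (word F d a) (word F d b) := by
  refine (basisLT_or_of_ne F (word_ne hd h.ne)).resolve_right fun h' => ?_
  exact word_min (fun c hc => word_far (hc.trans h)) h'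

@[simp] theorem word_zero : word F d 0 = 0 := by
  by_contra h
  have h1 : ¬ BasisLT F 0 (word F d 0) := word_min (by simp)
  have h2 : ¬ BasisLT F (word F d 0) 0 := fun ⟨N, hN, _⟩ => by simp at hN
  exact (basisLT_or_of_ne F h).elim h2 h1

theorem mem_lexCode {k : ℕ} {x : Vec p} : x ∈ lexCode F d k ↔ ∃ a < p ^ k, x = word F d a :=
  Iff.rfl

theorem word_mem_lexCode {k a : ℕ} (h : a < p ^ k) : word F d a ∈ lexCode F d k := ⟨a, h, rfl⟩

theorem ncard_lexCode (hd : 0 < d) (k : ℕ) : (lexCode F d k).ncard = p ^ k := by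
  have : lexCode F d k = word F d '' (Finset.range (p ^ k) : Set ℕ) := by
    ext x
    simp [mem_lexCode, eq_comm]
  rw [this, Set.ncard_image_of_injective _ (word_injective hd), Set.ncard_coe_finset,
    Finset.card_range]

theorem lexCode_finite (k : ℕ) : (lexCode F d k).Finite := by
  have : lexCode F d k = word F d '' (Finset.range (p ^ k) : Set ℕ) := by
    ext x
    simp [mem_lexCode, eq_comm]
  rw [this]
  exact (Finset.finite_toSet _).image _

/-- A vector below a word is a word, or is close to a smaller word. -/
theorem exists_word_close {a : ℕ} {z : Vec p} (h : BasisLT F z (word F d a)) :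
    ∃ b < a, z = word F d b ∨ BasisLT F (word F d b) z ∧ hdist z (word F d b) < d := by
  classical
  have hex : ∃ b, ¬ BasisLT F (word F d b) z := ⟨a, basisLT_asymm h⟩
  -- The first word that is not below z. If z were far from all words before it, then z would have
  -- been admissible at that stage, and z is smaller than the choice made there.
  set b := Nat.find hex with hb
  have h1 : ¬ BasisLT F (word F d b) z := Nat.find_spec hex
  have h2 : ∀ c < b, BasisLT F (word F d c) z := fun c hc => not_not.1 (Nat.find_min hex hc)
  have hba : b ≤ a := Nat.find_min' hex (basisLT_asymm h)
  by_cases hz : z = word F d b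
  · refine ⟨b, lt_of_le_of_ne hba fun e => ?_, Or.inl hz⟩
    rw [hz, e] at h
    exact basisLT_irrefl F _ h
  · have h3 : BasisLT F z (word F d b) := (basisLT_or_of_ne F hz).resolve_right h1
    by_contra hcon
    push Not at hcon
    exact word_min (fun c hc => (hcon c (hc.trans_le hba)).2 (h2 c hc)) h3

theorem isLinearCode_lexCode_zero : IsLinearCode (lexCode F d 0) :=
  ⟨⊥, by ext x; simp [mem_lexCode]⟩

/-- If the words follow the addition of digits, then the next code is linear. -/
theorem isLinearCode_lexCode_succ {k : ℕ} (hC : IsLinearCode (lexCode F d k))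
    (h : ∀ s < p, ∀ i < p ^ k,
      word F d (s * p ^ k + i) = (s : ZMod p) • word F d (p ^ k) + word F d i) :
    IsLinearCode (lexCode F d (k + 1)) := by
  obtain ⟨W, hW⟩ := hC
  refine ⟨W ⊔ Submodule.span (ZMod p) {word F d (p ^ k)}, ?_⟩
  ext x
  rw [SetLike.mem_coe, Submodule.mem_sup, mem_lexCode]
  constructor
  · rintro ⟨c, hc, y, hy, rfl⟩
    obtain ⟨s, rfl⟩ := Submodule.mem_span_singleton.1 hy
    rw [← SetLike.mem_coe, hW] at hc
    obtain ⟨i, hi, rfl⟩ := hc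
    refine ⟨s.val * p ^ k + i, ?_, ?_⟩
    · have := ZMod.val_lt s
      calc s.val * p ^ k + i < s.val * p ^ k + p ^ k := by omega
        _ = (s.val + 1) * p ^ k := by ring
        _ ≤ p * p ^ k := Nat.mul_le_mul_right _ this
        _ = p ^ (k + 1) := by ring
    · rw [h s.val (ZMod.val_lt s) i hi, ZMod.natCast_zmod_val, add_comm]
  · rintro ⟨a, ha, rfl⟩
    have hp : 0 < p ^ k := pow_pos (Fact.out : p.Prime).pos k
    have h1 : a / p ^ k < p := by
      rw [Nat.div_lt_iff_lt_mul hp]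
      calc a < p ^ (k + 1) := ha
        _ = p * p ^ k := by ring
    have h2 := h (a / p ^ k) h1 (a % p ^ k) (Nat.mod_lt _ hp)
    rw [Nat.div_add_mod'] at h2
    refine ⟨word F d (a % p ^ k), ?_, _, Submodule.mem_span_singleton.2 ⟨_, rfl⟩,
      (h2.trans (add_comm _ _)).symm⟩
    rw [← SetLike.mem_coe, hW]
    exact word_mem_lexCode (Nat.mod_lt _ hp)

end Words

end LexCode

/-! ### Pivots of linear lexicographic codes, and the case p = 2 -/

namespace LexCode

variable {p : ℕ} [Fact p.Prime] {F : OrdBasis p} {d : ℕ}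

/-- A linear code contains a pivot index which cuts out the preceding code. -/
theorem exists_pivot (hd : 0 < d) {k : ℕ} {W : Submodule (ZMod p) (Vec p)}
    (hW : (W : Set (Vec p)) = lexCode F d (k + 1)) :
    ∃ Q, (∀ x ∈ W, ∀ i, Q < i → F.repr x i = 0) ∧
      ∀ x, x ∈ lexCode F d k ↔ x ∈ W ∧ F.repr x Q = 0 := by
  classical
  have hp := (Fact.out : p.Prime)
  have hfin : (W : Set (Vec p)).Finite := hW ▸ lexCode_finite (k + 1)
  have hcard : (W : Set (Vec p)).ncard = p ^ (k + 1) := by rw [hW, ncard_lexCode hd]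
  let U : Finset ℕ := hfin.toFinset.biUnion fun x => (F.repr x).support
  have hmem : ∀ x ∈ W, ∀ i, F.repr x i ≠ 0 → i ∈ U := fun x hx i hi =>
    Finset.mem_biUnion.2 ⟨x, by simpa using hx, Finsupp.mem_support_iff.2 hi⟩
  have hU : U.Nonempty := by
    by_contra hU
    have h0 : (W : Set (Vec p)) = {0} := by
      ext x
      constructor
      · intro hx
        apply F.repr.injective
        ext i
        by_contra h
        exact hU ⟨i, hmem x hx i (by simpa using h)⟩
      · rintro rfl
        exact W.zero_mem
    rw [h0, Set.ncard_singleton] at hcard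
    exact absurd hcard (Nat.one_lt_pow (by omega) hp.one_lt).ne
  obtain ⟨e, heW, heQ⟩ : ∃ e ∈ W, F.repr e (U.max' hU) ≠ 0 := by
    obtain ⟨x, hx, hi⟩ := Finset.mem_biUnion.1 (U.max'_mem hU)
    exact ⟨x, by simpa using hx, Finsupp.mem_support_iff.1 hi⟩
  set Q := U.max' hU with hQ
  have htop : ∀ x ∈ W, ∀ i, Q < i → F.repr x i = 0 := fun x hx i hi => by
    by_contra h
    exact absurd (U.le_max' i (hmem x hx i h)) (not_le.2 hi)
  refine ⟨Q, htop, ?_⟩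
  -- the kernel of the pivot coordinate
  let φ : W →ₗ[ZMod p] ZMod p :=
    (Finsupp.lapply Q).comp ((F.repr : Vec p →ₗ[ZMod p] (ℕ →₀ ZMod p)).comp W.subtype)
  have hφ : ∀ x : W, φ x = F.repr (x : Vec p) Q := fun x => rfl
  have hWcard : Nat.card W = p ^ (k + 1) := by rw [← hcard]; rfl
  have hfinW : Finite W := hfin
  have hsurj : Function.Surjective φ := by
    intro a
    refine ⟨(a * (F.repr e Q)⁻¹) • ⟨e, heW⟩, ?_⟩
    rw [map_smul, hφ, smul_eq_mul, mul_assoc, inv_mul_cancel₀ heQ, mul_one]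
  have hker : Nat.card (LinearMap.ker φ) = p ^ k := by
    have h1 := Submodule.card_eq_card_quotient_mul_card (LinearMap.ker φ)
    have h2 : Nat.card (W ⧸ LinearMap.ker φ) = p := by
      rw [Nat.card_congr (φ.quotKerEquivOfSurjective hsurj).toEquiv, Nat.card_zmod]
    rw [h2, hWcard, pow_succ', mul_comm (Nat.card _)] at h1
    exact (Nat.eq_of_mul_eq_mul_left hp.pos h1).symm
  let A : Finset ℕ := (Finset.range (p ^ (k + 1))).filter fun a => F.repr (word F d a) Q = 0
  have hword : ∀ a < p ^ (k + 1), word F d a ∈ W := fun a ha => by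
    rw [← SetLike.mem_coe, hW]
    exact word_mem_lexCode ha
  have hAcard : A.card = p ^ k := by
    rw [← hker, ← Fintype.card_coe, ← Nat.card_eq_fintype_card]
    refine Nat.card_congr (Equiv.ofBijective
      (fun a : A => (⟨⟨word F d a, hword a (Finset.mem_range.1 (Finset.mem_filter.1 a.2).1)⟩,
        (Finset.mem_filter.1 a.2).2⟩ : LinearMap.ker φ)) ⟨?_, ?_⟩)
    · intro a b hab
      exact Subtype.ext (word_injective hd (congrArg (fun x : LinearMap.ker φ => ((x : W) : Vec p)) hab))
    · rintro ⟨⟨x, hx⟩, hx0⟩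
      have hx' : x ∈ lexCode F d (k + 1) := hW ▸ hx
      obtain ⟨a, ha, rfl⟩ := hx'
      exact ⟨⟨a, Finset.mem_filter.2 ⟨Finset.mem_range.2 ha, hx0⟩⟩, rfl⟩
  -- As Q is the top index of the whole code, words with nonzero coordinate at Q exceed those with
  -- coordinate zero. So the latter are an initial segment of the sequence, and its length is the
  -- size of the kernel.
  have hlower : ∀ a ∈ A, ∀ b < a, b ∈ A := by
    intro a ha b hb
    obtain ⟨ha1, ha2⟩ := Finset.mem_filter.1 ha
    have hb1 : b < p ^ (k + 1) := hb.trans (Finset.mem_range.1 ha1)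
    refine Finset.mem_filter.2 ⟨Finset.mem_range.2 hb1, ?_⟩
    by_contra hne
    refine basisLT_asymm (word_lt_word (F := F) hd hb) ⟨Q, ?_, fun i hi => ?_⟩
    · rw [ha2, ZMod.val_zero]
      exact Nat.pos_of_ne_zero fun h => hne ((ZMod.val_eq_zero _).1 h)
    · rw [htop _ (hword a (Finset.mem_range.1 ha1)) i hi, htop _ (hword b hb1) i hi]
  have hA : A = Finset.range (p ^ k) := by
    refine Finset.eq_of_subset_of_card_le (fun a ha => ?_) (by rw [hAcard, Finset.card_range])
    have : Finset.range (a + 1) ⊆ A := fun b hb => by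
      rcases (Nat.lt_succ_iff.1 (Finset.mem_range.1 hb)).eq_or_lt with h | h
      · rwa [h]
      · exact hlower a ha b h
    have := Finset.card_le_card this
    rw [Finset.card_range, hAcard] at this
    exact Finset.mem_range.2 this
  intro x
  constructor
  · rintro ⟨a, ha, rfl⟩
    have : a ∈ A := by rw [hA]; exact Finset.mem_range.2 ha
    exact ⟨hword a (Finset.mem_range.1 (Finset.mem_filter.1 this).1), (Finset.mem_filter.1 this).2⟩
  · rintro ⟨hx, hx0⟩
    have hx' : x ∈ lexCode F d (k + 1) := hW ▸ hx
    obtain ⟨a, ha, rfl⟩ := hx'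
    have : a ∈ A := Finset.mem_filter.2 ⟨Finset.mem_range.2 ha, hx0⟩
    rw [hA] at this
    exact word_mem_lexCode (Finset.mem_range.1 this)

/-- The smaller code is the kernel of the pivot coordinate on the larger one. -/
theorem isLinearCode_of_succ (hd : 0 < d) {k : ℕ} (h : IsLinearCode (lexCode F d (k + 1))) :
    IsLinearCode (lexCode F d k) := by
  obtain ⟨W, hW⟩ := h
  obtain ⟨Q, -, hQ⟩ := exists_pivot hd hW
  refine ⟨W ⊓ LinearMap.ker ((Finsupp.lapply Q).comp
    (F.repr : Vec p →ₗ[ZMod p] (ℕ →₀ ZMod p))), ?_⟩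
  ext x
  rw [hQ]
  rfl

theorem isLinearCode_of_le (hd : 0 < d) {j k : ℕ} (hjk : j ≤ k)
    (h : IsLinearCode (lexCode F d k)) : IsLinearCode (lexCode F d j) := by
  induction k, hjk using Nat.le_induction with
  | base => exact h
  | succ n _ ih => exact ih (isLinearCode_of_succ hd h)

/-- Linearity descends to smaller k and holds for k = 0, so the indices of linear codes form a
nonempty initial segment of ℕ. -/
theorem exists_isMaxLinearDim (hd : 0 < d) : ∃ m, IsMaxLinearDim F d m := by
  classical
  by_cases hall : ∀ k, IsLinearCode (lexCode F d k)
  · exact ⟨⊤, Or.inl ⟨rfl, hall⟩⟩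
  · push Not at hall
    set n := Nat.find hall with hn
    have h1 : ¬ IsLinearCode (lexCode F d n) := Nat.find_spec hall
    have h0 : n ≠ 0 := fun h => h1 (h ▸ isLinearCode_lexCode_zero)
    refine ⟨_, Or.inr ⟨n - 1, rfl, ?_, fun k hk => ?_⟩⟩
    · exact not_not.1 (Nat.find_min hall (by omega : n - 1 < n))
    · by_contra hlt
      exact h1 (isLinearCode_of_le hd (by omega) hk)

theorem IsMaxLinearDim.le_of_isLinearCode {m : ℕ∞} (hm : IsMaxLinearDim F d m) {k : ℕ}
    (hk : IsLinearCode (lexCode F d k)) : (k : ℕ∞) ≤ m := by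
  rcases hm with ⟨rfl, -⟩ | ⟨n, rfl, hn⟩
  · exact le_top
  · exact_mod_cast hn.2 hk

theorem IsMaxLinearDim.le_of_not_isLinearCode (hd : 0 < d) {m : ℕ∞} (hm : IsMaxLinearDim F d m)
    {k : ℕ} (hk : ¬ IsLinearCode (lexCode F d (k + 1))) : m ≤ k := by
  rcases hm with ⟨rfl, h⟩ | ⟨n, rfl, hn⟩
  · exact absurd (h _) hk
  · have : n ≤ k := by
      by_contra hlt
      exact hk (isLinearCode_of_le hd (by omega) hn.1)
    exact_mod_cast this

theorem isMaxLinearDim_of_isLinearCode (hd : 0 < d) {k : ℕ}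
    (h₁ : IsLinearCode (lexCode F d k)) (h₂ : ¬ IsLinearCode (lexCode F d (k + 1))) :
    IsMaxLinearDim F d k :=
  Or.inr ⟨k, rfl, h₁, fun j hj => by
    by_contra hlt
    exact h₂ (isLinearCode_of_le hd (by omega) hj)⟩

/-- The vectors at distance at least `d` from all elements of a code. -/
def farSet (d : ℕ) (C : Set (Vec p)) : Set (Vec p) := {z | ∀ c ∈ C, d ≤ hdist z c}

theorem word_pow_mem_farSet (k : ℕ) : word F d (p ^ k) ∈ farSet d (lexCode F d k) := by
  rintro _ ⟨a, ha, rfl⟩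
  exact word_far ha

theorem word_pow_min {k : ℕ} {z : Vec p} (hz : z ∈ farSet d (lexCode F d k)) :
    ¬ BasisLT F z (word F d (p ^ k)) :=
  word_min fun _ hb => hz _ (word_mem_lexCode hb)

theorem add_mem_farSet {C : Submodule (ZMod p) (Vec p)} {z c : Vec p}
    (hz : z ∈ farSet d (C : Set (Vec p))) (hc : c ∈ C) : z + c ∈ farSet d (C : Set (Vec p)) := by
  intro c' hc'
  rw [hdist_eq_of_sub_eq (show z + c - c' = z - (c' - c) by abel)]
  exact hz _ (C.sub_mem hc' hc)

theorem sub_mem_farSet {C : Submodule (ZMod p) (Vec p)} {z c : Vec p}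
    (hz : z ∈ farSet d (C : Set (Vec p))) (hc : c ∈ C) : z - c ∈ farSet d (C : Set (Vec p)) := by
  rw [sub_eq_add_neg]
  exact add_mem_farSet hz (C.neg_mem hc)

theorem smul_mem_farSet {C : Submodule (ZMod p) (Vec p)} {z : Vec p} {a : ZMod p} (ha : a ≠ 0)
    (hz : z ∈ farSet d (C : Set (Vec p))) : a • z ∈ farSet d (C : Set (Vec p)) := by
  intro c hc
  rw [show c = a • (a⁻¹ • c) by rw [smul_smul, mul_inv_cancel₀ ha, one_smul], hdist_smul ha]
  exact hz _ (C.smul_mem _ hc)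

/-- In a linear code, the translate of a word by the next basis word is minimal among the vectors
far from the smaller translates. -/
theorem not_lt_add_word (hd : 0 < d) {k : ℕ} (hW : IsLinearCode (lexCode F d (k + 1))) {i : ℕ}
    (hi : i < p ^ k) {z : Vec p} (hz : z ∈ farSet d (lexCode F d k))
    (hz' : ∀ i' < i, d ≤ hdist z (word F d (p ^ k) + word F d i')) :
    ¬ BasisLT F z (word F d (p ^ k) + word F d i) := by
  have hp := (Fact.out : p.Prime)
  obtain ⟨W, hW⟩ := hW
  obtain ⟨Q, htop, hQ⟩ := exists_pivot hd hW
  have hmem : ∀ a < p ^ (k + 1), word F d a ∈ W := fun a ha => by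
    rw [← SetLike.mem_coe, hW]; exact word_mem_lexCode ha
  have hlt : p ^ k < p ^ (k + 1) := Nat.pow_lt_pow_right hp.one_lt (by omega)
  set v := word F d (p ^ k) with hv
  have hvW : v ∈ W := hmem _ hlt
  have hiW : word F d i ∈ W := hmem _ (hi.trans hlt)
  have hiQ : F.repr (word F d i) Q = 0 := ((hQ _).1 (word_mem_lexCode hi)).2
  -- the pivot coordinate of `v` is one
  have hvQ0 : F.repr v Q ≠ 0 := fun h => by
    obtain ⟨a, ha, hav⟩ := (hQ v).2 ⟨hvW, h⟩
    exact ha.ne (word_injective hd hav).symm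
  let C : Submodule (ZMod p) (Vec p) := W ⊓ LinearMap.ker ((Finsupp.lapply Q).comp
    (F.repr : Vec p →ₗ[ZMod p] (ℕ →₀ ZMod p)))
  have hC : (C : Set (Vec p)) = lexCode F d k := by
    ext x
    rw [hQ]
    rfl
  have hvfar : v ∈ farSet d (C : Set (Vec p)) := hC ▸ word_pow_mem_farSet k
  have hvmin : ∀ z ∈ farSet d (C : Set (Vec p)), ¬ BasisLT F z v := fun z hz =>
    word_pow_min (hC ▸ hz)
  have hvQ : F.repr v Q = 1 := by
    by_contra hne
    -- Dividing by the pivot coordinate stays in the far set. No coordinate above Q is involved, so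
    -- a pivot coordinate different from 1 would be improved.
    refine hvmin _ (smul_mem_farSet (inv_ne_zero hvQ0) hvfar) ⟨Q, ?_, fun i hi => ?_⟩
    · have h1p : 1 < p := hp.one_lt
      have : Fact (1 < p) := ⟨h1p⟩
      rw [map_smul, Finsupp.smul_apply, smul_eq_mul, inv_mul_cancel₀ hvQ0, ZMod.val_one]
      have h0 : (F.repr v Q).val ≠ 0 := fun h => hvQ0 ((ZMod.val_eq_zero _).1 h)
      have h1 : (F.repr v Q).val ≠ 1 := fun h => hne ((ZMod.val_eq_one h1p _).1 h)
      omega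
    · rw [map_smul, Finsupp.smul_apply, htop v hvW i hi, smul_zero]
  -- coordinates of `v` vanish at the leading indices of `C`
  have hred : ∀ e ∈ C, ∀ P, F.repr e P ≠ 0 → (∀ i, P < i → F.repr e i = 0) →
      F.repr v P = 0 := by
    intro e he P hP htopP
    by_contra hne
    refine hvmin _ (sub_mem_farSet hvfar (C.smul_mem (F.repr v P * (F.repr e P)⁻¹) he))
      ⟨P, ?_, fun i hi => ?_⟩
    · rw [map_sub, map_smul, Finsupp.sub_apply, Finsupp.smul_apply, smul_eq_mul, mul_assoc,
        inv_mul_cancel₀ hP, mul_one, sub_self, ZMod.val_zero]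
      exact Nat.pos_of_ne_zero fun h => hne ((ZMod.val_eq_zero _).1 h)
    · rw [map_sub, map_smul, Finsupp.sub_apply, Finsupp.smul_apply, htopP i hi, smul_zero,
        sub_zero]
  -- elements of the code below `v + word i`
  have hbelow : ∀ u ∈ W, BasisLT F u (v + word F d i) →
      u ∈ lexCode F d k ∨ ∃ i' < i, u = v + word F d i' := by
    intro u hu hlt'
    by_contra hcon
    push Not at hcon
    obtain ⟨huC, hcon⟩ := hcon
    have hb : u - v ∈ lexCode F d (k + 1) := hW ▸ (W.sub_mem hu hvW)
    obtain ⟨b, hb, hbu⟩ := hb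
    have hub : u = v + word F d b := by rw [← hbu]; abel
    have hib : i < b := by
      rcases lt_trichotomy b i with h | h | h
      · exact absurd hub (hcon b h)
      · rw [hub, h] at hlt'
        exact absurd hlt' (basisLT_irrefl F _)
      · exact h
    obtain ⟨P, hP, hP'⟩ := word_lt_word (F := F) hd hib
    have hbW := hmem b hb
    refine basisLT_asymm hlt' ?_
    rw [hub]
    refine ⟨P, ?_, fun j hj => by rw [map_add, map_add, Finsupp.add_apply, Finsupp.add_apply,
      hP' j hj]⟩
    rw [map_add, map_add, Finsupp.add_apply, Finsupp.add_apply]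
    set e := word F d b - word F d i with he
    have heW : e ∈ W := W.sub_mem hbW hiW
    have heP : F.repr e P ≠ 0 := by
      rw [he, map_sub, Finsupp.sub_apply]
      intro h
      rw [sub_eq_zero.1 h] at hP
      exact lt_irrefl _ hP
    have hetop : ∀ j, P < j → F.repr e j = 0 := fun j hj => by
      rw [he, map_sub, Finsupp.sub_apply, hP' j hj, sub_self]
    -- If the difference e lies in the preceding code, then v vanishes at its leading index P, so
    -- adding v does not disturb the comparison at P. Otherwise P is the pivot, where v + w(i) has
    -- coordinate 1, while that of u is neither 0, as u is not in the preceding code, nor 1.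
    by_cases heQ : F.repr e Q = 0
    · rw [hred e ⟨heW, heQ⟩ P heP hetop, zero_add, zero_add]
      exact hP
    · have hPQ : P = Q := by
        rcases lt_trichotomy P Q with h | h | h
        · exact absurd (hetop Q h) heQ
        · exact h
        · exact absurd (htop e heW P h) heP
      subst hPQ
      have huP : F.repr u P ≠ 0 := fun h => huC ((hQ u).2 ⟨hu, h⟩)
      rw [hub, map_add, Finsupp.add_apply, hvQ] at huP
      rw [hvQ, hiQ, add_zero]
      have hb0 : F.repr (word F d b) P ≠ 0 := by
        rw [he, map_sub, Finsupp.sub_apply, hiQ, sub_zero] at heP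
        exact heP
      have h1 : 1 < p := hp.one_lt
      have : Fact (1 < p) := ⟨h1⟩
      rw [ZMod.val_one]
      have h2 : (1 + F.repr (word F d b) P).val ≠ 0 := fun h => huP ((ZMod.val_eq_zero _).1 h)
      have h3 : (1 + F.repr (word F d b) P).val ≠ 1 := fun h => by
        have := (ZMod.val_eq_one h1 _).1 h
        exact hb0 (by simpa using this)
      omega
  intro hcon
  have hsum : v + word F d i ∈ lexCode F d (k + 1) := hW ▸ (W.add_mem hvW hiW)
  obtain ⟨a, ha, hae⟩ := hsum
  have hcon' := hcon
  rw [hae] at hcon'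
  -- A vector below a word equals a smaller word or is close to one. The smaller words lie in the
  -- preceding code or among the smaller translates, and z is far from both.
  obtain ⟨b, hba, hcl⟩ := exists_word_close hcon'
  have hclose : hdist z (word F d b) < d := by
    rcases hcl with h | h
    · rw [h, hdist_self]; exact hd
    · exact h.2
  have hblt : BasisLT F (word F d b) (v + word F d i) := by
    rw [hae]; exact word_lt_word hd hba
  rcases hbelow _ (hmem b (hba.trans ha)) hblt with h | ⟨i', hi', h⟩
  · exact absurd (hz _ h) (not_le.2 hclose)
  · rw [h] at hclose
    exact absurd (hz' i' hi') (not_le.2 hclose)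

/-- Over the field with two elements all lexicographic codes are linear. -/
theorem isLinearCode_lexCode_two {F : OrdBasis 2} {d : ℕ} (k : ℕ) :
    IsLinearCode (lexCode F d k) := by
  induction k with
  | zero => exact isLinearCode_lexCode_zero
  | succ k ih =>
    obtain ⟨C, hC⟩ := id ih
    have hCmem : ∀ i < 2 ^ k, word F d i ∈ C := fun i hi => by
      rw [← SetLike.mem_coe, hC]; exact word_mem_lexCode hi
    set v := word F d (2 ^ k) with hv
    have hvfar : v ∈ farSet d (C : Set (Vec 2)) := hC ▸ word_pow_mem_farSet k
    have key : ∀ i < 2 ^ k, word F d (2 ^ k + i) = v + word F d i := by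
      intro i
      induction i using Nat.strong_induction_on with
      | _ i IH =>
        intro hi
        by_contra hne
        set z := word F d (2 ^ k + i) with hz
        have hfar : ∀ b < 2 ^ k + i, d ≤ hdist (v + word F d i) (word F d b) := by
          intro b hb
          rcases lt_or_ge b (2 ^ k) with h | h
          · exact add_mem_farSet hvfar (hCmem i hi) _ (hCmem b h)
          · obtain ⟨c, rfl⟩ := Nat.exists_eq_add_of_le h
            rw [IH c (by omega) (by omega), hdist_eq_of_sub_eq
              (show v + word F d i - (v + word F d c) = word F d i - word F d c by abel)]
            exact word_far (by omega)
        have hlt : BasisLT F z (v + word F d i) :=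
          (basisLT_or_of_ne F hne).resolve_right (word_min hfar)
        obtain ⟨N, hN, hN'⟩ := hlt
        have h1 : ¬ BasisLT F (z - v) (word F d i) := by
          refine word_min fun b hb => ?_
          rw [hdist_eq_of_sub_eq (show z - v - word F d b = z - (v + word F d b) by abel),
            ← IH b hb (by omega)]
          exact word_far (by omega)
        have h2 : ¬ BasisLT F (z - word F d i) v := by
          refine word_pow_min ?_
          rw [← hC]
          refine sub_mem_farSet ?_ (hCmem i hi)
          rw [hC]
          rintro _ ⟨b, hb, rfl⟩
          exact word_far (by omega)
        have h3 : ¬ (F.repr z N - F.repr v N).val < (F.repr (word F d i) N).val := by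
          refine fun h => h1 ⟨N, ?_, fun j hj => ?_⟩
          · rwa [map_sub, Finsupp.sub_apply]
          · rw [map_sub, Finsupp.sub_apply, hN' j hj, map_add, Finsupp.add_apply, add_sub_cancel_left]
        have h4 : ¬ (F.repr z N - F.repr (word F d i) N).val < (F.repr v N).val := by
          refine fun h => h2 ⟨N, ?_, fun j hj => ?_⟩
          · rwa [map_sub, Finsupp.sub_apply]
          · rw [map_sub, Finsupp.sub_apply, hN' j hj, map_add, Finsupp.add_apply, add_sub_cancel_right]
        rw [map_add, Finsupp.add_apply] at hN
        -- In 𝔽₂ the inequality c < a + b means c = 0 and {a, b} = {0, 1}. If a = 1, then c - b = 0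
        -- < a contradicts `h4`; if b = 1, then c - a = 0 < b contradicts `h3`.
        generalize F.repr z N = c at *
        generalize F.repr v N = a at *
        generalize F.repr (word F d i) N = b at *
        revert a b c
        decide
    refine isLinearCode_lexCode_succ ih fun s hs i hi => ?_
    interval_cases s
    · simp
    · simpa using key i hi

end LexCode

/-! ### Twisted coordinates, and minimal vectors outside a given support -/

namespace LexCode

variable {p : ℕ}

/-- The coordinates with respect to `F` are the standard ones, except that `κ x_ξ` is subtracted
at the index `η`. -/
structure IsTwisted (F : OrdBasis p) (ξ η : ℕ) (κ : ZMod p) : Prop where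
  repr_apply : ∀ x i, F.repr x i = x i - if i = η then κ * x ξ else 0
  order : η < ξ ∧ (κ = 0 ∨ κ = 1) ∨ ξ < η ∧ κ = 1

theorem exists_isTwisted {F : OrdBasis p} (hF : F ∈ basisFamily p) :
    ∃ ξ η κ, IsTwisted F ξ η κ := by
  rcases hF with rfl | ⟨ξ, η, h, rfl⟩
  -- With κ = 0 nothing is twisted, so any two indices with η < ξ serve for the standard basis.
  · refine ⟨3, 0, 0, fun x i => ?_, Or.inl ⟨by norm_num, Or.inl rfl⟩⟩
    simp [stdBasis]
  · refine ⟨ξ, η, 1, fun x i => ?_, ?_⟩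
    · have : (Finsupp.lapply i).comp
          ((twistBasis p ξ η h).repr : Vec p →ₗ[ZMod p] (ℕ →₀ ZMod p)) =
          Finsupp.lapply i - if i = η then Finsupp.lapply ξ else 0 := by
        refine (twistBasis p ξ η h).ext fun j => ?_
        rw [LinearMap.comp_apply, LinearEquiv.coe_coe, Module.Basis.repr_self, twistBasis_apply,
          stdBasis_apply, stdBasis_apply, stdBasis_apply]
        by_cases hj : j = ξ <;> by_cases hi : i = η
        · subst hj hi
          simp [h, h.symm]
        · subst hj
          simp [hi, Ne.symm hi, Finsupp.single_apply, eq_comm]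
        · subst hi
          simp [hj, Finsupp.single_apply]
        · simp [hj, hi, Finsupp.single_apply]
      have h2 := LinearMap.congr_fun this x
      by_cases hi : i = η
      · simpa [hi] using h2
      · simpa [hi] using h2
    · rcases lt_or_gt_of_ne h with h' | h'
      · exact Or.inr ⟨h', rfl⟩
      · exact Or.inl ⟨h', Or.inr rfl⟩

/-- The number of nonzero coordinates outside of `S`. -/
def outWeight (S : Finset ℕ) (x : Vec p) : ℕ := (x.support \ S).card

theorem outWeight_le_of_perm {S : Finset ℕ} {v z : Vec p} (σ : Equiv.Perm ℕ)
    (h : ∀ x, x ∉ S → v x ≠ 0 → σ x ∉ S ∧ z (σ x) ≠ 0) : outWeight S v ≤ outWeight S z := by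
  refine Finset.card_le_card_of_injOn σ (fun x hx => ?_) σ.injective.injOn
  simp only [Finset.coe_sdiff, Set.mem_sdiff, Finset.mem_coe, Finsupp.mem_support_iff] at hx ⊢
  exact (h x hx.2 hx.1).symm

theorem outWeight_le {S : Finset ℕ} {v z : Vec p}
    (h : ∀ x, x ∉ S → v x ≠ 0 → z x ≠ 0) : outWeight S v ≤ outWeight S z :=
  outWeight_le_of_perm (Equiv.refl ℕ) fun x hx hv => ⟨hx, h x hx hv⟩

theorem outWeight_update_zero {S : Finset ℕ} {v : Vec p} {A : ℕ} (hA : A ∉ S) (hv : v A ≠ 0) :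
    outWeight S (v.update A 0) + 1 = outWeight S v := by
  classical
  have : (v.update A 0).support \ S = (v.support \ S).erase A := by
    ext x
    by_cases hx : x = A
    · subst hx; simp
    · simp [hx, Function.update_apply]
  rw [outWeight, this, Finset.card_erase_add_one (by simp [hA, hv]), outWeight]

theorem exists_of_lt_outWeight {S : Finset ℕ} {v : Vec p} {B : Finset ℕ}
    (h : (B \ S).card < outWeight S v) : ∃ A, A ∉ S ∧ v A ≠ 0 ∧ A ∉ B := by
  obtain ⟨A, hA, hAB⟩ := Finset.exists_mem_notMem_of_card_lt_card h
  simp only [Finset.mem_sdiff, Finsupp.mem_support_iff, not_and, not_not] at hA hAB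
  exact ⟨A, hA.2, hA.1, fun hB => hA.2 (hAB hB)⟩

/-- The set `S` is closed downwards, up to gaps below `ξ` and `η` if `ξ < η`. -/
structure IsClosedDown (ξ η : ℕ) (S : Finset ℕ) : Prop where
  left : η < ξ → ∀ N ∈ S, ∀ x < N, x ∈ S
  mem_iff : ξ < η → (ξ ∈ S ↔ η ∈ S)
  right : ξ < η → ∀ N ∈ S, N ≠ ξ → N ≠ η → ∀ x < N, x ∈ S

theorem isClosedDown_empty (ξ η : ℕ) : IsClosedDown ξ η ∅ := by constructor <;> simp

/-- A minimal element `v` of a set `Z` of vectors that have weight at least `t` outside of `S`,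
where `Z` is stable under changes outside of `S`. -/
structure IsMinStep (F : OrdBasis p) (ξ η : ℕ) (S : Finset ℕ) (t : ℕ) (Z : Set (Vec p))
    (v : Vec p) : Prop where
  mem : v ∈ Z
  min : ∀ z ∈ Z, ¬ BasisLT F z v
  low : ∀ z ∈ Z, t ≤ outWeight S z
  inv : ∀ z ∈ Z, ∀ z', (∀ x ∈ S, z' x = z x) → outWeight S z ≤ outWeight S z' → z' ∈ Z
  cand : ∀ o : Vec p, t ≤ outWeight S o →
    ∃ z ∈ Z, (∀ x, x ∉ S → z x = o x) ∧ (ξ ∈ S → η ∈ S → z ξ = 0 ∧ z η = 0)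
  two : 2 ≤ t
  closed : IsClosedDown ξ η S

section

variable [Fact p.Prime] {F : OrdBasis p} {ξ η : ℕ} {κ : ZMod p}

theorem IsTwisted.ne (hF : IsTwisted F ξ η κ) : ξ ≠ η := by
  rcases hF.order with ⟨h, -⟩ | ⟨h, -⟩
  · exact h.ne'
  · exact h.ne

theorem IsTwisted.repr_of_ne (hF : IsTwisted F ξ η κ) {i : ℕ} (hi : i ≠ η) (x : Vec p) :
    F.repr x i = x i := by
  rw [hF.repr_apply, if_neg hi, sub_zero]

theorem IsTwisted.repr_eta (hF : IsTwisted F ξ η κ) (x : Vec p) :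
    F.repr x η = x η - κ * x ξ := by
  rw [hF.repr_apply, if_pos rfl]

theorem IsTwisted.kappa (hF : IsTwisted F ξ η κ) (h : ξ < η) : κ = 1 := by
  rcases hF.order with h' | h'
  · omega
  · exact h'.2

theorem IsTwisted.repr_eta_of_lt (hF : IsTwisted F ξ η κ) (h : ξ < η) (x : Vec p) :
    F.repr x η = x η - x ξ := by
  rw [hF.repr_eta, hF.kappa h, one_mul]

theorem IsTwisted.repr_congr (hF : IsTwisted F ξ η κ) {x y : Vec p} {i : ℕ} (h : x i = y i)
    (h' : i = η → x ξ = y ξ) : F.repr x i = F.repr y i := by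
  rw [hF.repr_apply, hF.repr_apply, h]
  split_ifs with hi
  · rw [h' hi]
  · rfl

theorem val_pos_of_ne_zero {a : ZMod p} (h : a ≠ 0) : 0 < a.val :=
  Nat.pos_of_ne_zero fun h' => h ((ZMod.val_eq_zero _).1 h')

theorem val_one_lt {a : ZMod p} (h : a ≠ 0) (h1 : a ≠ 1) : (1 : ZMod p).val < a.val := by
  have hp : 1 < p := (Fact.out : p.Prime).one_lt
  have : Fact (1 < p) := ⟨hp⟩
  have h2 := val_pos_of_ne_zero h
  have h3 : a.val ≠ 1 := fun h' => h1 ((ZMod.val_eq_one hp _).1 h')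
  rw [ZMod.val_one]
  omega

namespace IsMinStep

variable {S : Finset ℕ} {t : ℕ} {Z : Set (Vec p)} {v : Vec p}

/-- With more than t outside entries one can be deleted: `cand` refills S so that the result is
again in the set. The entry to delete is chosen such that the deletion lowers the vector even though
the coordinate at η mixes two entries. -/
theorem outWeight_eq (hF : IsTwisted F ξ η κ) (h : IsMinStep F ξ η S t Z v) :
    outWeight S v = t := by
  classical
  refine le_antisymm ?_ (h.low v h.mem)
  by_contra hlt
  rw [not_le] at hlt
  have hred : ∀ A, A ∉ S → v A ≠ 0 → t ≤ outWeight S (v.update A 0) := fun A hA hv => by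
    have := outWeight_update_zero hA hv
    omega
  rcases lt_or_gt_of_ne hF.ne with hB | hA
  · by_cases hξS : ξ ∈ S
    · have hηS := (h.closed.mem_iff hB).1 hξS
      obtain ⟨A, hAS, hA0, -⟩ := exists_of_lt_outWeight (S := S) (v := v) (B := ∅)
        (by simpa using (show 0 < outWeight S v by omega))
      have hAξ : A ≠ ξ := fun e => hAS (e ▸ hξS)
      have hAη : A ≠ η := fun e => hAS (e ▸ hηS)
      obtain ⟨z, hz, ho, hsp⟩ := h.cand _ (hred A hAS hA0)
      obtain ⟨hzξ, hzη⟩ := hsp hξS hηS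
      refine h.min z hz (basisLT_of_le_above A ?_ fun i hi => ?_)
      · rw [hF.repr_of_ne hAη, hF.repr_of_ne hAη, ho A hAS]
        simpa using val_pos_of_ne_zero hA0
      · by_cases hiη : i = η
        · rw [hiη, hF.repr_eta, hzξ, hzη]; simp
        by_cases hiξ : i = ξ
        · rw [hiξ, hF.repr_of_ne hF.ne, hzξ]; simp
        have hiS : i ∉ S := fun hiS => hAS (h.closed.right hB i hiS hiξ hiη A hi)
        rw [hF.repr_of_ne hiη, hF.repr_of_ne hiη, ho i hiS]
        simp [Function.update_apply, hi.ne']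
    · have hηS : η ∉ S := fun e => hξS ((h.closed.mem_iff hB).2 e)
      have hSlow : ∀ A, A ∉ S → ∀ i, A ≤ i → i ∉ S := fun A hAS i hi hiS => by
        rcases hi.eq_or_lt with e | hi
        · exact hAS (e ▸ hiS)
        · exact hAS (h.closed.right hB i hiS (fun e => hξS (e ▸ hiS)) (fun e => hηS (e ▸ hiS)) A hi)
      by_cases hsame : (v ξ = 0 ↔ v η = 0)
      -- If both special entries are nonzero, a third outside entry exists because the weight
      -- exceeds t ≥ 2. Leaving ξ and η alone keeps the coordinate at η.
      · obtain ⟨A, hAS, hA0, hAsp⟩ : ∃ A, A ∉ S ∧ v A ≠ 0 ∧ A ∉ ({ξ, η} : Finset ℕ) := by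
          by_cases hξ0 : v ξ = 0
          · obtain ⟨A, hAS, hA0, -⟩ := exists_of_lt_outWeight (S := S) (v := v) (B := ∅)
              (by simpa using (show 0 < outWeight S v by omega))
            refine ⟨A, hAS, hA0, ?_⟩
            simp only [Finset.mem_insert, Finset.mem_singleton, not_or]
            exact ⟨fun e => hA0 (e ▸ hξ0), fun e => hA0 (e ▸ hsame.1 hξ0)⟩
          · refine exists_of_lt_outWeight ?_
            have h1 := Finset.card_le_card (Finset.sdiff_subset (s := {ξ, η}) (t := S))
            have h2 := Finset.card_le_two (a := ξ) (b := η)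
            have := h.two
            omega
        simp only [Finset.mem_insert, Finset.mem_singleton, not_or] at hAsp
        obtain ⟨z, hz, ho, -⟩ := h.cand _ (hred A hAS hA0)
        refine h.min z hz ⟨A, ?_, fun i hi => ?_⟩
        · rw [hF.repr_of_ne hAsp.2, hF.repr_of_ne hAsp.2, ho A hAS]
          simpa using val_pos_of_ne_zero hA0
        · refine hF.repr_congr ?_ fun _ => ?_
          · rw [ho i (hSlow A hAS i hi.le)]
            simp [Function.update_apply, hi.ne']
          · rw [ho ξ hξS]
            simp [Function.update_apply, Ne.symm hAsp.1]
      -- Exactly one special entry is nonzero. Deleting it turns the nonzero coordinate at η into 0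
      -- and changes nothing above η.
      · obtain ⟨A, hA0, hoth, hAS, hAsp⟩ : ∃ A, v A ≠ 0 ∧ (v.update A 0) ξ = 0 ∧ A ∉ S ∧
            (v.update A 0) η = 0 ∧ A ≤ η := by
          by_cases hξ0 : v ξ = 0
          · have hη0 : v η ≠ 0 := fun e => hsame ⟨fun _ => e, fun _ => hξ0⟩
            exact ⟨η, hη0, by simp [Function.update_apply, hF.ne, hξ0], hηS, by simp, le_rfl⟩
          · have hη0 : v η = 0 := by
              by_contra e
              exact hsame ⟨fun h => absurd h hξ0, fun h => absurd h e⟩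
            exact ⟨ξ, hξ0, by simp, hξS, by simp [Function.update_apply, hF.ne.symm, hη0], hB.le⟩
        obtain ⟨z, hz, ho, -⟩ := h.cand _ (hred A hAS hA0)
        refine h.min z hz ⟨η, ?_, fun i hi => ?_⟩
        · rw [hF.repr_eta_of_lt hB, hF.repr_eta_of_lt hB, ho η hηS, ho ξ hξS, hoth, hAsp.1, sub_zero,
            ZMod.val_zero]
          refine val_pos_of_ne_zero fun e => hsame ?_
          rw [sub_eq_zero.1 e]
        · refine hF.repr_congr ?_ fun e => absurd e hi.ne'
          rw [ho i (hSlow η hηS i hi.le)]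
          have : i ≠ A := by omega
          simp [Function.update_apply, this]
  · have hT : (v.support \ S).Nonempty := by
      rw [← Finset.card_pos]
      exact (Nat.zero_le _).trans_lt hlt
    set A := (v.support \ S).max' hT with hAdef
    have hAmem := (v.support \ S).max'_mem hT
    rw [← hAdef, Finset.mem_sdiff, Finsupp.mem_support_iff] at hAmem
    have htop : ∀ i, A < i → i ∉ S ∧ v i = 0 := fun i hi => by
      have hiS : i ∉ S := fun e => hAmem.2 (h.closed.left hA i e A hi)
      refine ⟨hiS, ?_⟩
      by_contra hne
      exact absurd ((v.support \ S).le_max' i (by simp [hne, hiS])) (not_le.2 hi)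
    obtain ⟨z, hz, ho, -⟩ := h.cand _ (hred A hAmem.2 hAmem.1)
    have hz0 : ∀ i, A < i → z i = v i := fun i hi => by
      rw [ho i (htop i hi).1]
      simp [Function.update_apply, hi.ne']
    have hzA : z A = 0 := by rw [ho A hAmem.2]; simp
    refine h.min z hz ⟨A, ?_, fun i hi => hF.repr_congr (hz0 i hi) fun e => ?_⟩
    · by_cases hAη : A = η
      · have hξ : A < ξ := by omega
        rw [hF.repr_apply, hF.repr_apply, if_pos hAη, hz0 ξ hξ, (htop ξ hξ).2, hzA]
        simpa using val_pos_of_ne_zero hAmem.1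
      · rw [hF.repr_of_ne hAη, hF.repr_of_ne hAη, hzA, ZMod.val_zero]
        exact val_pos_of_ne_zero hAmem.1
    · exact hz0 ξ (by omega)

/-- If `ξ < η`, then the coordinates at `ξ` and `η` agree if these are new. -/
theorem eq_of_notMem (hF : IsTwisted F ξ η κ) (h : IsMinStep F ξ η S t Z v) (hB : ξ < η)
    (hξS : ξ ∉ S) : v ξ = v η := by
  classical
  have hηS : η ∉ S := fun e => hξS ((h.closed.mem_iff hB).2 e)
  by_contra hne
  have hlow := h.low v h.mem
  have h2 := h.two
  by_cases hboth : v ξ ≠ 0 ∧ v η ≠ 0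
  -- When both entries are nonzero, overwriting one by the other keeps the weight and makes the
  -- coordinate at η zero.
  · refine h.min (v.update η (v ξ)) (h.inv v h.mem _ (fun x hx => ?_) (outWeight_le fun x _ h0 => ?_))
      ⟨η, ?_, fun i hi => hF.repr_congr ?_ fun e => absurd e hi.ne'⟩
    · have : x ≠ η := fun e => hηS (e ▸ hx)
      simp [Function.update_apply, this]
    · by_cases hx : x = η
      · simpa [hx] using hboth.1
      · simpa [Function.update_apply, hx] using h0
    · rw [hF.repr_eta_of_lt hB, hF.repr_eta_of_lt hB]
      simp only [Finsupp.coe_update, Function.update_self, Function.update_of_ne hF.ne, sub_self,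
        ZMod.val_zero]
      exact val_pos_of_ne_zero fun e => hne (sub_eq_zero.1 e).symm
    · simp [Function.update_apply, hi.ne']
  · obtain ⟨a, b, hab, ha, hb, haS, hbS⟩ : ∃ a b, (a = ξ ∧ b = η ∨ a = η ∧ b = ξ) ∧ v a ≠ 0 ∧
        v b = 0 ∧ a ∉ S ∧ b ∉ S := by
      by_cases hξ0 : v ξ = 0
      · exact ⟨η, ξ, Or.inr ⟨rfl, rfl⟩, fun e => hne (hξ0.trans e.symm), hξ0, hηS, hξS⟩
      · exact ⟨ξ, η, Or.inl ⟨rfl, rfl⟩, hξ0, by_contra fun e => hboth ⟨hξ0, e⟩, hξS, hηS⟩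
    have hne_ab : a ≠ b := by have := hF.ne; rcases hab with ⟨rfl, rfl⟩ | ⟨rfl, rfl⟩ <;> tauto
    obtain ⟨A, hAS, hA0, hAa⟩ := exists_of_lt_outWeight (S := S) (v := v) (B := {a}) (by
      have := Finset.card_le_card (Finset.sdiff_subset (s := {a}) (t := S))
      rw [Finset.card_singleton] at this
      omega)
    rw [Finset.mem_singleton] at hAa
    have hAb : A ≠ b := fun e => hA0 (e ▸ hb)
    -- Another outside entry A is given up to pay for a copy at the vanishing special index b. The
    -- coordinate at η becomes 0, and above η at most the entry at A changes, to 0.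
    set z := (v.update A 0).update b (v a) with hz
    have hza : z a = v a := by simp [hz, Function.update_apply, hne_ab, Ne.symm hAa]
    have hzb : z b = v a := by simp [hz]
    have hzA : z A = 0 := by simp [hz, Function.update_apply, hAb]
    have hzo : ∀ i, i ≠ A → i ≠ b → z i = v i := fun i h1 h2 => by
      simp [hz, Function.update_apply, h1, h2]
    have hAη : A ≠ η := by rcases hab with ⟨rfl, rfl⟩ | ⟨rfl, rfl⟩ <;> assumption
    have hzη : z η = z ξ := by
      rcases hab with ⟨rfl, rfl⟩ | ⟨rfl, rfl⟩
      · rw [hza, hzb]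
      · rw [hza, hzb]
    refine h.min z (h.inv v h.mem _ (fun x hx => hzo x (fun e => hAS (e ▸ hx))
      (fun e => hbS (e ▸ hx))) (outWeight_le_of_perm (Equiv.swap A b) fun x hx h0 => ?_))
      (basisLT_of_le_above η ?_ fun i hi => ?_)
    · rcases eq_or_ne x A with rfl | hxA
      · rw [Equiv.swap_apply_left]
        exact ⟨hbS, hzb ▸ ha⟩
      · have hxb : x ≠ b := fun e => h0 (e ▸ hb)
        rw [Equiv.swap_apply_of_ne_of_ne hxA hxb]
        exact ⟨hx, hzo x hxA hxb ▸ h0⟩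
    · rw [hF.repr_eta_of_lt hB, hF.repr_eta_of_lt hB, hzη, sub_self, ZMod.val_zero]
      exact val_pos_of_ne_zero fun e => hne (sub_eq_zero.1 e).symm
    · rw [hF.repr_of_ne hi.ne', hF.repr_of_ne hi.ne']
      by_cases hiA : i = A
      · rw [hiA, hzA, ZMod.val_zero]; exact Nat.zero_le _
      · have hib : i ≠ b := by rcases hab with ⟨rfl, rfl⟩ | ⟨rfl, rfl⟩ <;> omega
        rw [hzo i hiA hib]

/-- The new coordinates are all one. -/
theorem eq_one (hF : IsTwisted F ξ η κ) (h : IsMinStep F ξ η S t Z v) {A : ℕ} (hAS : A ∉ S)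
    (hA0 : v A ≠ 0) : v A = 1 := by
  classical
  have hZ : ∀ z : Vec p, (∀ x ∈ S, z x = v x) → (∀ x, x ∉ S → v x ≠ 0 → z x ≠ 0) → z ∈ Z :=
    fun z h1 h2 => h.inv v h.mem z h1 (outWeight_le h2)
  have hup : ∀ A, A ∉ S → v.update A 1 ∈ Z := fun A hA => hZ _ (fun x hx => by
      have : x ≠ A := fun e => hA (e ▸ hx)
      simp [Function.update_apply, this]) (fun x _ h0 => by
      by_cases hx : x = A
      · simp [hx]
      · simpa [Function.update_apply, hx] using h0)
  have hgen : ∀ A, A ∉ S → v A ≠ 0 → A ≠ η → (η < ξ ∨ A ≠ ξ) → v A = 1 := by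
    intro A hAS hA0 hAη hAξ
    by_contra h1
    refine h.min _ (hup A hAS) ⟨A, ?_, fun i hi => hF.repr_congr ?_ fun e => ?_⟩
    · rw [hF.repr_of_ne hAη, hF.repr_of_ne hAη]
      simpa using val_one_lt hA0 h1
    · simp [Function.update_apply, hi.ne']
    · have : ξ ≠ A := by rcases hAξ with h | h <;> omega
      simp [Function.update_apply, this]
  rcases hF.order with ⟨hA, hκ⟩ | ⟨hB, hκ⟩
  · by_cases hAη : A = η
    · subst hAη
      by_contra h1
      have hξS : ξ ∉ S := fun e => hAS (h.closed.left hA ξ e A hA)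
      -- The entry at ξ is already known to be 0 or 1. So putting 1 at η makes the coordinate there
      -- 1 or 0, in both cases the best that a nonzero entry can achieve.
      have hc : κ * v ξ = 0 ∨ κ * v ξ = 1 := by
        rcases hκ with rfl | rfl
        · simp
        · by_cases hξ0 : v ξ = 0
          · simp [hξ0]
          · right; rw [hgen ξ hξS hξ0 hF.ne (Or.inl hA), one_mul]
      refine h.min _ (hup A hAS) ⟨A, ?_, fun i hi => hF.repr_congr ?_ fun e => absurd e hi.ne'⟩
      · rw [hF.repr_eta, hF.repr_eta]
        simp only [Finsupp.coe_update, Function.update_self, Function.update_of_ne hF.ne]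
        rcases hc with hc | hc <;> rw [hc]
        · simpa using val_one_lt hA0 h1
        · rw [sub_self, ZMod.val_zero]
          exact val_pos_of_ne_zero fun e => h1 (sub_eq_zero.1 e)
      · simp [Function.update_apply, hi.ne']
    · exact hgen A hAS hA0 hAη (Or.inl hA)
  · by_cases hsp : A = ξ ∨ A = η
    · have hξS : ξ ∉ S := by
        rcases hsp with rfl | rfl
        · exact hAS
        · exact fun e => hAS ((h.closed.mem_iff hB).1 e)
      have hηS : η ∉ S := fun e => hξS ((h.closed.mem_iff hB).2 e)
      have heq := h.eq_of_notMem hF hB hξS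
      have hAv : v A = v ξ := by rcases hsp with rfl | rfl <;> simp [heq]
      rw [hAv] at hA0 ⊢
      by_contra h1
      -- The two entries agree, so they are reset together: the coordinate at η remains 0 and the
      -- first change from above occurs at ξ.
      set z := (v.update ξ 1).update η 1 with hz
      have hzξ : z ξ = 1 := by simp [hz, Function.update_apply, hF.ne]
      have hzη : z η = 1 := by simp [hz]
      have hzo : ∀ i, i ≠ ξ → i ≠ η → z i = v i := fun i h1 h2 => by
        simp [hz, Function.update_apply, h1, h2]
      refine h.min z (hZ z (fun x hx => hzo x (fun e => hξS (e ▸ hx)) (fun e => hηS (e ▸ hx)))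
        fun x _ h0 => ?_) ⟨ξ, ?_, fun i hi => ?_⟩
      · by_cases h1 : x = ξ
        · simp [h1, hzξ]
        by_cases h2 : x = η
        · simp [h2, hzη]
        rwa [hzo x h1 h2]
      · rw [hF.repr_of_ne hF.ne, hF.repr_of_ne hF.ne, hzξ]
        exact val_one_lt hA0 h1
      · by_cases hiη : i = η
        · rw [hiη, hF.repr_eta_of_lt hB, hF.repr_eta_of_lt hB, hzξ, hzη, heq, sub_self, sub_self]
        · rw [hF.repr_of_ne hiη, hF.repr_of_ne hiη, hzo i hi.ne' hiη]
    · push Not at hsp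
      exact hgen A hAS hA0 hsp.2 (Or.inr hsp.1)

theorem move_mem (h : IsMinStep F ξ η S t Z v) {A x : ℕ} (hAS : A ∉ S) (hxS : x ∉ S)
    (hx0 : v x = 0) (hA0 : v A ≠ 0) : (v.update A 0).update x (v A) ∈ Z := by
  classical
  have hAx : A ≠ x := fun e => hA0 (e ▸ hx0)
  refine h.inv v h.mem _ (fun y hy => ?_) (outWeight_le_of_perm (Equiv.swap A x) fun y hy h0 => ?_)
  · have h1 : y ≠ A := fun e => hAS (e ▸ hy)
    have h2 : y ≠ x := fun e => hxS (e ▸ hy)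
    simp [Function.update_apply, h1, h2]
  · rcases eq_or_ne y A with rfl | hyA
    · rw [Equiv.swap_apply_left]
      exact ⟨hxS, by simpa using hA0⟩
    · have hyx : y ≠ x := fun e => h0 (e ▸ hx0)
      rw [Equiv.swap_apply_of_ne_of_ne hyA hyx]
      exact ⟨hy, by simpa [Function.update_apply, hyA, hyx] using h0⟩

theorem move_two_mem (h : IsMinStep F ξ η S t Z v) {A B x y : ℕ} (hAS : A ∉ S) (hBS : B ∉ S)
    (hxS : x ∉ S) (hyS : y ∉ S) (hx0 : v x = 0) (hy0 : v y = 0) (hA0 : v A ≠ 0) (hB0 : v B ≠ 0)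
    (hAB : A ≠ B) (hxy : x ≠ y) :
    ((((v.update A 0).update B 0).update x 1).update y 1) ∈ Z := by
  classical
  have hAx : A ≠ x := fun e => hA0 (e ▸ hx0)
  have hAy : A ≠ y := fun e => hA0 (e ▸ hy0)
  have hBx : B ≠ x := fun e => hB0 (e ▸ hx0)
  have hBy : B ≠ y := fun e => hB0 (e ▸ hy0)
  refine h.inv v h.mem _ (fun w hw => ?_)
    (outWeight_le_of_perm (Equiv.swap A x * Equiv.swap B y) fun w hw h0 => ?_)
  · have h1 : w ≠ A := fun e => hAS (e ▸ hw)
    have h2 : w ≠ x := fun e => hxS (e ▸ hw)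
    have h3 : w ≠ B := fun e => hBS (e ▸ hw)
    have h4 : w ≠ y := fun e => hyS (e ▸ hw)
    simp [Function.update_apply, h1, h2, h3, h4]
  · rw [Equiv.Perm.mul_apply]
    rcases eq_or_ne w A with rfl | hwA
    · rw [Equiv.swap_apply_of_ne_of_ne hAB hAy, Equiv.swap_apply_left]
      exact ⟨hxS, by simp [Function.update_apply, hxy]⟩
    rcases eq_or_ne w B with rfl | hwB
    · rw [Equiv.swap_apply_left, Equiv.swap_apply_of_ne_of_ne hAy.symm hxy.symm]
      exact ⟨hyS, by simp⟩
    · have hwx : w ≠ x := fun e => h0 (e ▸ hx0)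
      have hwy : w ≠ y := fun e => h0 (e ▸ hy0)
      rw [Equiv.swap_apply_of_ne_of_ne hwB hwy, Equiv.swap_apply_of_ne_of_ne hwA hwx]
      exact ⟨hw, by simpa [Function.update_apply, hwA, hwB, hwx, hwy] using h0⟩

/-- A gap below a new index could receive one of the entries above it, which lowers the vector. The
exceptions permitted by `IsClosedDown` come from the coordinate at η, which couples two entries. -/
theorem isClosedDown (hF : IsTwisted F ξ η κ) (h : IsMinStep F ξ η S t Z v) :
    IsClosedDown ξ η (S ∪ v.support) := by
  classical
  have hnot : ∀ {x}, x ∉ S ∪ v.support → x ∉ S ∧ v x = 0 := fun {x} hx => by simpa using hx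
  refine ⟨fun hA N hN x hx => ?_, fun hB => ?_, fun hB N hN hNξ hNη x hx => ?_⟩
  · by_contra hxn
    obtain ⟨hxS, hx0⟩ := hnot hxn
    have hNS : N ∉ S := fun e => hxS (h.closed.left hA N e x hx)
    have hN0 : v N ≠ 0 := by simpa [hNS] using hN
    -- The entry at N is moved, unless N = η and the entry at ξ is nonzero: then the coordinate at η
    -- may be 0 already, and the entry at ξ > η is moved instead.
    obtain ⟨A, hAS, hA0, hxA, hAη⟩ : ∃ A, A ∉ S ∧ v A ≠ 0 ∧ x < A ∧ (A = η → v ξ = 0) := by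
      by_cases hc : N = η ∧ v ξ ≠ 0
      · exact ⟨ξ, fun e => hxS (h.closed.left hA ξ e x (by omega)), hc.2, by omega,
          fun e => absurd e hF.ne⟩
      · exact ⟨N, hNS, hN0, hx, fun e => by_contra fun h' => hc ⟨e, h'⟩⟩
    refine h.min _ (h.move_mem hAS hxS hx0 hA0) ⟨A, ?_, fun i hi => hF.repr_congr ?_ fun e => ?_⟩
    · rw [hF.repr_apply, hF.repr_apply]
      have h1 : v A - (if A = η then κ * v ξ else 0) = v A := by
        split_ifs with e
        · rw [hAη e, mul_zero, sub_zero]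
        · rw [sub_zero]
      rw [h1]
      have h2 : ((v.update A 0).update x (v A)) A -
          (if A = η then κ * ((v.update A 0).update x (v A)) ξ else 0) = 0 := by
        have : ((v.update A 0).update x (v A)) A = 0 := by simp [Function.update_apply, hxA.ne']
        rw [this]
        split_ifs with e
        · have hxξ : ξ ≠ x := by omega
          have hAξ : ξ ≠ A := by omega
          simp [Function.update_apply, hxξ, hAξ, hAη e]
        · simp
      rw [h2, ZMod.val_zero]
      exact val_pos_of_ne_zero hA0
    · simp [Function.update_apply, hi.ne', (hxA.trans hi).ne']
    · have h1 : ξ ≠ x := by omega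
      have h2 : ξ ≠ A := by omega
      simp [Function.update_apply, h1, h2]
  · by_cases hξS : ξ ∈ S
    · simp [hξS, (h.closed.mem_iff hB).1 hξS]
    · have hηS : η ∉ S := fun e => hξS ((h.closed.mem_iff hB).2 e)
      simp [hξS, hηS, h.eq_of_notMem hF hB hξS]
  · by_contra hxn
    obtain ⟨hxS, hx0⟩ := hnot hxn
    have hNS : N ∉ S := fun e => hxS (h.closed.right hB N e hNξ hNη x hx)
    have hN0 : v N ≠ 0 := by simpa [hNS] using hN
    by_cases hsp : x = ξ ∨ x = η
    · have hξS : ξ ∉ S := by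
        rcases hsp with rfl | rfl
        · exact hxS
        · exact fun e => hxS ((h.closed.mem_iff hB).1 e)
      have hηS : η ∉ S := fun e => hξS ((h.closed.mem_iff hB).2 e)
      have heq := h.eq_of_notMem hF hB hξS
      have hξ0 : v ξ = 0 := by
        rcases hsp with rfl | rfl
        · exact hx0
        · rw [heq, hx0]
      have hη0 : v η = 0 := heq ▸ hξ0
      -- Filling only one of the gaps ξ and η could raise the coordinate at η. Since t ≥ 2, there is
      -- a second new entry, and both gaps are filled with 1 at once.
      obtain ⟨M, hMS, hM0, hMN⟩ := exists_of_lt_outWeight (S := S) (v := v) (B := {N}) (by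
        have h1 := Finset.card_le_card (Finset.sdiff_subset (s := {N}) (t := S))
        rw [Finset.card_singleton] at h1
        have := h.low v h.mem
        have := h.two
        omega)
      rw [Finset.mem_singleton] at hMN
      have hMξ : M ≠ ξ := fun e => hM0 (e ▸ hξ0)
      have hMη : M ≠ η := fun e => hM0 (e ▸ hη0)
      refine h.min _ (h.move_two_mem hNS hMS hξS hηS hξ0 hη0 hN0 hM0 (Ne.symm hMN) hF.ne)
        (basisLT_of_le_above N ?_ fun i hi => ?_)
      · rw [hF.repr_of_ne hNη, hF.repr_of_ne hNη]
        simpa [Function.update_apply, hNη, hNξ, Ne.symm hMN] using val_pos_of_ne_zero hN0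
      · by_cases hiη : i = η
        · rw [hiη, hF.repr_eta_of_lt hB]
          simp [Function.update_apply, hF.ne]
        · rw [hF.repr_of_ne hiη, hF.repr_of_ne hiη]
          have hiξ : i ≠ ξ := by rcases hsp with rfl | rfl <;> omega
          by_cases hiM : i = M
          · simp [hiM, Function.update_apply, hMη, hMξ]
          · simp [Function.update_apply, hiη, hiξ, hi.ne', hiM]
    · push Not at hsp
      refine h.min _ (h.move_mem hNS hxS hx0 hN0) ⟨N, ?_, fun i hi => hF.repr_congr ?_ fun e => ?_⟩
      · rw [hF.repr_of_ne hNη, hF.repr_of_ne hNη]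
        simpa [Function.update_apply, hx.ne'] using val_pos_of_ne_zero hN0
      · simp [Function.update_apply, hi.ne', (hx.trans hi).ne']
      · simp [Function.update_apply, Ne.symm hsp.1, Ne.symm hNξ]

/-- If `ξ < η` and `ξ` is new, there is at most one gap below `ξ`. -/
theorem gap_unique (hF : IsTwisted F ξ η κ) (h : IsMinStep F ξ η S t Z v) (hB : ξ < η)
    (hξS : ξ ∉ S) (hξ0 : v ξ ≠ 0) {x y : ℕ} (hx : x < ξ) (hy : y < ξ)
    (hxn : x ∉ S ∪ v.support) (hyn : y ∉ S ∪ v.support) : x = y := by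
  classical
  by_contra hxy
  have hηS : η ∉ S := fun e => hξS ((h.closed.mem_iff hB).2 e)
  have heq := h.eq_of_notMem hF hB hξS
  simp only [Finset.mem_union, Finsupp.mem_support_iff, not_or, not_not] at hxn hyn
  -- Two gaps could absorb the entries at ξ and η simultaneously, leaving the coordinate at η equal
  -- to 0 and lowering the one at ξ.
  refine h.min _ (h.move_two_mem hξS hηS hxn.1 hyn.1 hxn.2 hyn.2 hξ0 (heq ▸ hξ0) hF.ne hxy)
    ⟨ξ, ?_, fun i hi => ?_⟩
  · rw [hF.repr_of_ne hF.ne, hF.repr_of_ne hF.ne]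
    simpa [Function.update_apply, hx.ne', hy.ne', hF.ne] using val_pos_of_ne_zero hξ0
  · by_cases hiη : i = η
    · rw [hiη, hF.repr_eta_of_lt hB, hF.repr_eta_of_lt hB, heq, sub_self]
      have h1 : η ≠ x := by omega
      have h2 : η ≠ y := by omega
      simp [Function.update_apply, h1, h2, hx.ne', hy.ne', hF.ne]
    · rw [hF.repr_of_ne hiη, hF.repr_of_ne hiη]
      simp [Function.update_apply, hiη, hi.ne', (hx.trans hi).ne', (hy.trans hi).ne']

end IsMinStep

end

end LexCode

/-! ### Replicated ternary simplex codes and their distances -/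

namespace LexCode

open Finset

section Simplex

variable {v : ℕ → Vec 3} {t : ℕ → ℕ} {j : ℕ}

/-- The union of the supports of the first `j` vectors. -/
def suppUnion (v : ℕ → Vec 3) (j : ℕ) : Finset ℕ := (range j).biUnion fun l => (v l).support

/-- The indices with the same column as `N` in the first `j` vectors. -/
def colClass (v : ℕ → Vec 3) (j N : ℕ) : Finset ℕ :=
  (suppUnion v j).filter fun x => ∀ l < j, v l x = v l N

theorem mem_suppUnion {x : ℕ} : x ∈ suppUnion v j ↔ ∃ l < j, v l x ≠ 0 := by
  simp [suppUnion]

theorem eq_zero_of_notMem_suppUnion {x : ℕ} (h : x ∉ suppUnion v j) {l : ℕ} (hl : l < j) :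
    v l x = 0 := by
  by_contra hne
  exact h (mem_suppUnion.2 ⟨l, hl, hne⟩)

theorem suppUnion_mono {i j : ℕ} (h : i ≤ j) : suppUnion v i ⊆ suppUnion v j := fun _ hx => by
  obtain ⟨l, hl, hx⟩ := mem_suppUnion.1 hx
  exact mem_suppUnion.2 ⟨l, hl.trans_le h, hx⟩

theorem suppUnion_succ : suppUnion v (j + 1) = suppUnion v j ∪ (v j).support := by
  ext x
  simp only [mem_suppUnion, mem_union, Finsupp.mem_support_iff]
  constructor
  · rintro ⟨l, hl, h⟩
    rcases (Nat.lt_succ_iff.1 hl).eq_or_lt with rfl | hl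
    · exact Or.inr h
    · exact Or.inl ⟨l, hl, h⟩
  · rintro (⟨l, hl, h⟩ | h)
    · exact ⟨l, by omega, h⟩
    · exact ⟨j, by omega, h⟩

@[simp] theorem suppUnion_zero : suppUnion v 0 = ∅ := by simp [suppUnion]

theorem mem_colClass {N x : ℕ} :
    x ∈ colClass v j N ↔ x ∈ suppUnion v j ∧ ∀ l < j, v l x = v l N := by
  simp [colClass]

theorem self_mem_colClass {N : ℕ} (h : N ∈ suppUnion v j) : N ∈ colClass v j N :=
  mem_colClass.2 ⟨h, fun _ _ => rfl⟩

theorem mem_colClass' {N x : ℕ} (hN : N ∈ suppUnion v j) :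
    x ∈ colClass v j N ↔ ∀ l < j, v l x = v l N := by
  refine mem_colClass.trans ⟨fun h => h.2, fun h => ⟨?_, h⟩⟩
  obtain ⟨l, hl, h0⟩ := mem_suppUnion.1 hN
  exact mem_suppUnion.2 ⟨l, hl, h l hl ▸ h0⟩

theorem colClass_eq {N x : ℕ} (h : x ∈ colClass v j N) : colClass v j x = colClass v j N := by
  ext y
  simp only [mem_colClass]
  refine and_congr_right fun _ => forall₂_congr fun l hl => ?_
  rw [(mem_colClass.1 h).2 l hl]

theorem mem_colClass_comm {N x : ℕ} (hN : N ∈ suppUnion v j) (h : x ∈ colClass v j N) :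
    N ∈ colClass v j x := colClass_eq h ▸ self_mem_colClass hN

/-- The first `j` vectors form the generator matrix of a replicated simplex code. -/
structure IsSimplex (v : ℕ → Vec 3) (t : ℕ → ℕ) (j : ℕ) : Prop where
  one : ∀ l < j, ∀ x, x ∉ suppUnion v l → v l x ≠ 0 → v l x = 1
  new : ∀ l < j, outWeight (suppUnion v l) (v l) = t l
  unif : ∀ l < j, ∀ N ∈ suppUnion v l, ∀ a, #{x ∈ colClass v l N | v l x = a} = t l
  step : ∀ l, l + 1 < j → t l = 3 * t (l + 1)

theorem IsSimplex.mono {i j : ℕ} (h : IsSimplex v t j) (hij : i ≤ j) : IsSimplex v t i :=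
  ⟨fun l hl => h.one l (hl.trans_le hij), fun l hl => h.new l (hl.trans_le hij),
    fun l hl => h.unif l (hl.trans_le hij), fun l hl => h.step l (hl.trans_le hij)⟩

/-- A class for j + 1 rows is either a fibre of the last row on an older class or the set of new
indices of the last row. Both have t j elements, by `unif` and by `new`. -/
theorem IsSimplex.card_colClass (h : IsSimplex v t (j + 1)) {N : ℕ}
    (hN : N ∈ suppUnion v (j + 1)) : #(colClass v (j + 1) N) = t j := by
  by_cases hNj : N ∈ suppUnion v j
  · rw [← h.unif j (by omega) N hNj (v j N)]
    congr 1
    ext x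
    rw [mem_colClass' hN, mem_filter, mem_colClass' hNj]
    constructor
    · exact fun hx => ⟨fun l hl => hx l (by omega), hx j (by omega)⟩
    · rintro ⟨h1, h2⟩ l hl
      rcases (Nat.lt_succ_iff.1 hl).eq_or_lt with rfl | hl
      · exact h2
      · exact h1 l hl
  · rw [← h.new j (by omega), outWeight]
    have hN0 : v j N ≠ 0 := by
      rw [suppUnion_succ, mem_union, Finsupp.mem_support_iff] at hN
      exact hN.resolve_left hNj
    congr 1
    ext x
    rw [mem_colClass' hN, mem_sdiff, Finsupp.mem_support_iff]
    constructor
    · refine fun hx => ⟨hx j (by omega) ▸ hN0, fun hxj => ?_⟩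
      obtain ⟨l, hl, h0⟩ := mem_suppUnion.1 hxj
      exact h0 (by rw [hx l (by omega), eq_zero_of_notMem_suppUnion hNj hl])
    · rintro ⟨h1, h2⟩ l hl
      rcases (Nat.lt_succ_iff.1 hl).eq_or_lt with rfl | hl
      · rw [h.one _ hl x h2 h1, h.one _ hl N hNj hN0]
      · rw [eq_zero_of_notMem_suppUnion h2 hl, eq_zero_of_notMem_suppUnion hNj hl]

theorem card_suppUnion_succ : #(suppUnion v (j + 1)) =
    #(suppUnion v j) + outWeight (suppUnion v j) (v j) := by
  rw [suppUnion_succ, outWeight, ← union_sdiff_self_eq_union, card_union_of_disjoint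
    disjoint_sdiff]

/-- The support has t 0 + … + t j elements, a geometric sum with ratio 1/3. -/
theorem IsSimplex.two_mul_card (h : IsSimplex v t (j + 1)) :
    2 * #(suppUnion v (j + 1)) + t j = 3 * t 0 := by
  induction j with
  | zero =>
    rw [card_suppUnion_succ, h.new 0 (by omega)]
    simp
    omega
  | succ j ih =>
    have h1 := ih (h.mono (by omega))
    have h2 := h.step j (by omega)
    rw [card_suppUnion_succ, h.new (j + 1) (by omega)]
    omega

/-- The code spanned by the first `j` vectors. -/
noncomputable def simplexCode (v : ℕ → Vec 3) (j : ℕ) : Submodule (ZMod 3) (Vec 3) :=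
  Submodule.span (ZMod 3) (v '' {l | l < j})

theorem mem_simplexCode_of_lt {l : ℕ} (h : l < j) : v l ∈ simplexCode v j :=
  Submodule.subset_span ⟨l, h, rfl⟩

theorem mem_simplexCode_succ {c : Vec 3} :
    c ∈ simplexCode v (j + 1) ↔ ∃ a : ZMod 3, ∃ c' ∈ simplexCode v j, c = a • v j + c' := by
  have : v '' {l | l < j + 1} = insert (v j) (v '' {l | l < j}) := by
    ext x
    simp only [Set.mem_image, Set.mem_ofPred_eq, Set.mem_insert_iff, Nat.lt_succ_iff_lt_or_eq]
    constructor
    · rintro ⟨l, hl | rfl, rfl⟩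
      · exact Or.inr ⟨l, hl, rfl⟩
      · exact Or.inl rfl
    · rintro (rfl | ⟨l, hl, rfl⟩)
      · exact ⟨j, Or.inr rfl, rfl⟩
      · exact ⟨l, Or.inl hl, rfl⟩
  rw [simplexCode, this, Submodule.mem_span_insert]
  rfl

theorem simplexCode_zero : simplexCode v 0 = ⊥ := by simp [simplexCode]

theorem simplexCode_eq_zero {c : Vec 3} (hc : c ∈ simplexCode v j) {x : ℕ}
    (hx : x ∉ suppUnion v j) : c x = 0 := by
  refine Submodule.span_induction (p := fun c _ => c x = 0) ?_ rfl ?_ ?_ hc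
  · rintro _ ⟨l, hl, rfl⟩
    exact eq_zero_of_notMem_suppUnion hx hl
  · intro a b _ _ ha hb
    rw [Finsupp.add_apply, ha, hb, add_zero]
  · intro a b _ hb
    rw [Finsupp.smul_apply, hb, smul_zero]

theorem simplexCode_congr {c : Vec 3} (hc : c ∈ simplexCode v j) {x y : ℕ}
    (h : ∀ l < j, v l x = v l y) : c x = c y := by
  refine Submodule.span_induction (p := fun c _ => c x = c y) ?_ rfl ?_ ?_ hc
  · rintro _ ⟨l, hl, rfl⟩
    exact h l hl
  · intro a b _ _ ha hb
    rw [Finsupp.add_apply, Finsupp.add_apply, ha, hb]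
  · intro a b _ hb
    rw [Finsupp.smul_apply, Finsupp.smul_apply, hb]

theorem simplexCode_congr_colClass {c : Vec 3} (hc : c ∈ simplexCode v j) {x N : ℕ}
    (h : x ∈ colClass v j N) : c x = c N := simplexCode_congr hc (mem_colClass.1 h).2

/-- The linear combination of the first `j` vectors with given coefficients. -/
noncomputable def comb (v : ℕ → Vec 3) (j : ℕ) (a : Fin j → ZMod 3) : Vec 3 := ∑ l, a l • v l

theorem comb_mem (a : Fin j → ZMod 3) : comb v j a ∈ simplexCode v j :=
  Submodule.sum_mem _ fun l _ => Submodule.smul_mem _ _ (mem_simplexCode_of_lt l.2)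

theorem comb_add (a b : Fin j → ZMod 3) : comb v j (a + b) = comb v j a + comb v j b := by
  simp [comb, add_smul, sum_add_distrib]

theorem comb_smul (r : ZMod 3) (a : Fin j → ZMod 3) : comb v j (r • a) = r • comb v j a := by
  simp [comb, smul_sum, mul_smul]

theorem comb_single (l : Fin j) (r : ZMod 3) : comb v j (Pi.single l r) = r • v l := by
  rw [comb, sum_eq_single l]
  · simp
  · intro b _ hb
    simp [hb]
  · simp

/-- The first row that is nonzero in a column is the one for which the index is new, and new entries
are 1. So columns are normalised representatives of projective points. -/
theorem IsSimplex.exists_lead (h : IsSimplex v t j) {N : ℕ} (hN : N ∈ suppUnion v j) :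
    ∃ l < j, v l N = 1 ∧ ∀ i < l, v i N = 0 := by
  classical
  have hex := mem_suppUnion.1 hN
  obtain ⟨h1, h2⟩ := Nat.find_spec hex
  have h3 : ∀ i < Nat.find hex, v i N = 0 := fun i hi => by
    have := Nat.find_min hex hi
    push Not at this
    exact this (hi.trans h1)
  refine ⟨_, h1, h.one _ h1 N (fun hmem => ?_) h2, h3⟩
  obtain ⟨i, hi, h0⟩ := mem_suppUnion.1 hmem
  exact h0 (h3 i hi)

/-- Different columns with leading entry 1 are not proportional, so some 2 × 2 minor is nonzero and
yields a combination with prescribed values at the two indices. -/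
theorem IsSimplex.exists_separating (h : IsSimplex v t j) {N x : ℕ} (hN : N ∈ suppUnion v j)
    (hx : x ∈ suppUnion v j) (hxN : x ∉ colClass v j N) :
    ∃ a, comb v j a N = 0 ∧ comb v j a x = 1 := by
  classical
  by_cases hminor : ∃ l m : Fin j, v l N * v m x - v m N * v l x ≠ 0
  · obtain ⟨l, m, hlm⟩ := hminor
    refine ⟨(v l N * v m x - v m N * v l x)⁻¹ • (Pi.single m (v l N) - Pi.single l (v m N)), ?_, ?_⟩
    · rw [comb_smul, sub_eq_add_neg (Pi.single m _), comb_add, ← Pi.single_neg, comb_single, comb_single]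
      simp only [Finsupp.smul_apply, Finsupp.add_apply, smul_eq_mul]
      ring
    · rw [comb_smul, sub_eq_add_neg (Pi.single m _), comb_add, ← Pi.single_neg, comb_single, comb_single]
      simp only [Finsupp.smul_apply, Finsupp.add_apply, smul_eq_mul]
      rw [show v l N * v m x + -v m N * v l x = v l N * v m x - v m N * v l x by ring,
        inv_mul_cancel₀ hlm]
  · exfalso
    push Not at hminor
    obtain ⟨l, hl, hl1, hl0⟩ := h.exists_lead hN
    obtain ⟨m, hm, hm1, hm0⟩ := h.exists_lead hx
    have hprop : ∀ i < j, v i x = v i N * v l x := fun i hi => by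
      have := hminor ⟨l, hl⟩ ⟨i, hi⟩
      simp only [hl1, one_mul] at this
      exact sub_eq_zero.1 this
    have hml : m = l := by
      rcases lt_trichotomy m l with hlt | heq | hgt
      · rw [hprop m hm, hl0 m hlt, zero_mul] at hm1
        exact absurd hm1 (by decide)
      · exact heq
      · have := hprop m hm
        rw [hm0 l hgt, mul_zero, hm1] at this
        exact absurd this (by decide)
    subst hml
    refine hxN ((mem_colClass' hN).2 fun i hi => ?_)
    rw [hprop i hi, hm1, mul_one]

/-- The distance to an element of the code, inside and outside of its support. -/
theorem hdist_eq_add {z c : Vec 3} (hc : c ∈ simplexCode v j) :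
    hdist z c = #{x ∈ suppUnion v j | z x ≠ c x} + outWeight (suppUnion v j) z := by
  rw [hdist, outWeight, ← card_union_of_disjoint]
  · congr 1
    ext x
    simp only [Finsupp.mem_neLocus, mem_union, mem_filter, mem_sdiff, Finsupp.mem_support_iff]
    by_cases hx : x ∈ suppUnion v j
    · simp [hx]
    · simp [hx, simplexCode_eq_zero hc hx]
  · rw [disjoint_left]
    intro x hx hx'
    exact (mem_sdiff.1 hx').2 (mem_filter.1 hx).1

theorem card_agree_add_hdist {z c : Vec 3} (hc : c ∈ simplexCode v j) :
    #{x ∈ suppUnion v j | z x = c x} + hdist z c =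
      #(suppUnion v j) + outWeight (suppUnion v j) z := by
  rw [hdist_eq_add hc, ← add_assoc, card_filter_add_card_filter_not]

/-- Vectors far from the code are balanced on each class of columns. -/
theorem IsSimplex.card_le_outWeight (h : IsSimplex v t j) {z : Vec 3}
    (hz : z ∈ farSet (t 0) (simplexCode v j : Set (Vec 3))) {N : ℕ} (hN : N ∈ suppUnion v j)
    (a : ZMod 3) : #{x ∈ colClass v j N | z x = a} ≤ outWeight (suppUnion v j) z := by
  classical
  obtain ⟨j, rfl⟩ : ∃ i, j = i + 1 := by
    cases j with
    | zero => simp at hN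
    | succ i => exact ⟨i, rfl⟩
  set S := suppUnion v (j + 1) with hS
  set B := colClass v (j + 1) N with hB
  -- The distances from z are summed over the codewords with value a at N. On the class of N these
  -- codewords all equal a, while at any other column they are equidistributed.
  set H : Finset (Fin (j + 1) → ZMod 3) := univ.filter fun b => comb v (j + 1) b N = a with hH
  have hBS : B ⊆ S := filter_subset _ _
  have hHpos : 0 < #H := by
    obtain ⟨l, hl, hl1, -⟩ := h.exists_lead hN
    refine card_pos.2 ⟨Pi.single ⟨l, hl⟩ a, ?_⟩
    simp [hH, comb_single, hl1]
  have hsum : #H * t 0 ≤ ∑ b ∈ H, hdist z (comb v (j + 1) b) := by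
    rw [← smul_eq_mul]
    exact card_nsmul_le_sum _ _ _ fun b _ => hz _ (comb_mem b)
  have hswap : ∑ b ∈ H, #{x ∈ S | z x ≠ comb v (j + 1) b x} =
      ∑ x ∈ S, #{b ∈ H | z x ≠ comb v (j + 1) b x} :=
    sum_card_bipartiteAbove_eq_sum_card_bipartiteBelow
      fun (b : Fin (j + 1) → ZMod 3) (x : ℕ) => z x ≠ comb v (j + 1) b x
  have hin : ∀ x ∈ B, #{b ∈ H | z x ≠ comb v (j + 1) b x} = if z x = a then 0 else #H := by
    intro x hx
    have : ∀ b ∈ H, comb v (j + 1) b x = a := fun b hb => by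
      rw [simplexCode_congr_colClass (comb_mem b) hx]
      exact (mem_filter.1 hb).2
    split_ifs with hza
    · rw [card_eq_zero, filter_eq_empty_iff]
      exact fun b hb => by rw [this b hb]; simpa using hza
    · rw [filter_true_of_mem fun b hb => by rw [this b hb]; exact hza]
  -- A codeword that vanishes at N and is 1 at x shifts H into itself, so each value at x is taken
  -- by a third of H and two thirds of H disagree with z there.
  have hout : ∀ x ∈ S \ B, 3 * #{b ∈ H | z x ≠ comb v (j + 1) b x} = 2 * #H := by
    intro x hx
    obtain ⟨hxS, hxB⟩ := mem_sdiff.1 hx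
    obtain ⟨e, he0, he1⟩ := h.exists_separating hN hxS hxB
    have hshift : ∀ r : ZMod 3, #{b ∈ H | comb v (j + 1) b x = r} =
        #{b ∈ H | comb v (j + 1) b x = r + 1} := by
      intro r
      refine card_nbij' (fun b => b + e) (fun b => b - e) ?_ ?_ ?_ ?_
      · intro b hb
        simp only [hH, coe_filter, mem_filter, mem_univ, true_and, Set.mem_ofPred_eq] at hb ⊢
        rw [comb_add, Finsupp.add_apply, Finsupp.add_apply, he0, he1, hb.1, hb.2]
        simp
      · intro b hb
        simp only [hH, coe_filter, mem_filter, mem_univ, true_and, Set.mem_ofPred_eq] at hb ⊢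
        have h1 : comb v (j + 1) b = comb v (j + 1) (b - e) + comb v (j + 1) e := by
          rw [← comb_add, sub_add_cancel]
        rw [h1, Finsupp.add_apply, Finsupp.add_apply, he0, he1, add_zero] at hb
        exact ⟨hb.1, by simpa using hb.2⟩
      · intro b _; simp
      · intro b _; simp
    have htot : #H = ∑ r : ZMod 3, #{b ∈ H | comb v (j + 1) b x = r} :=
      card_eq_sum_card_fiberwise fun _ _ => mem_univ _
    have h012 : ∑ r : ZMod 3, #{b ∈ H | comb v (j + 1) b x = r} =
        #{b ∈ H | comb v (j + 1) b x = 0} + #{b ∈ H | comb v (j + 1) b x = 1} +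
          #{b ∈ H | comb v (j + 1) b x = 2} := Fin.sum_univ_three _
    have h1 := hshift 0
    have h2 := hshift 1
    have h3 : ∀ r : ZMod 3, 3 * #{b ∈ H | comb v (j + 1) b x = r} = #H := by
      rw [zero_add] at h1
      rw [show (1 : ZMod 3) + 1 = 2 from rfl] at h2
      intro r
      have : r = 0 ∨ r = 1 ∨ r = 2 := by revert r; decide
      rcases this with rfl | rfl | rfl <;> omega
    have h4 := card_filter_add_card_filter_not (s := H) (fun b => comb v (j + 1) b x = z x)
    have h5 := h3 (z x)
    have h6 : #{b ∈ H | z x ≠ comb v (j + 1) b x} = #{b ∈ H | ¬ comb v (j + 1) b x = z x} := by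
      congr 1
      ext b
      simp [eq_comm]
    omega
  set n := #{x ∈ B | z x = a} with hn
  have hBsum : ∑ x ∈ B, #{b ∈ H | z x ≠ comb v (j + 1) b x} = (#B - n) * #H := by
    rw [sum_congr rfl hin, sum_ite, sum_const_zero, zero_add, sum_const, smul_eq_mul]
    congr 1
    have := card_filter_add_card_filter_not (s := B) (fun x => z x = a)
    omega
  have hSsum : 3 * ∑ x ∈ S \ B, #{b ∈ H | z x ≠ comb v (j + 1) b x} = (#S - #B) * (2 * #H) := by
    rw [mul_sum, sum_congr rfl hout, sum_const, smul_eq_mul, card_sdiff_of_subset hBS]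
  have hcardB : #B = t j := h.card_colClass hN
  have hcardS : 2 * #S + t j = 3 * t 0 := h.two_mul_card
  have hnB : n ≤ #B := card_filter_le _ _
  have hBSc : #B ≤ #S := card_le_card hBS
  have hdsum : ∑ b ∈ H, hdist z (comb v (j + 1) b) =
      (∑ x ∈ S \ B, #{b ∈ H | z x ≠ comb v (j + 1) b x}) + (#B - n) * #H +
        #H * outWeight S z := by
    rw [sum_congr rfl fun b _ => hdist_eq_add (z := z) (comb_mem b), sum_add_distrib, hswap,
      ← sum_sdiff hBS, hBsum, sum_const, smul_eq_mul]
  rw [hdsum] at hsum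
  -- After division by #H, the sizes 2 #S = 3 t 0 - t j and #B = t j cancel everything except n ≤
  -- `outWeight S z`.
  have key : #H * (3 * t 0) ≤ #H * ((#S - #B) * 2 + 3 * (#B - n) + 3 * outWeight S z) := by
    calc #H * (3 * t 0) = 3 * (#H * t 0) := by ring
      _ ≤ _ := Nat.mul_le_mul_left 3 hsum
      _ = (3 * ∑ x ∈ S \ B, #{b ∈ H | z x ≠ comb v (j + 1) b x}) + 3 * ((#B - n) * #H) +
          3 * (#H * outWeight S z) := by ring
      _ = _ := by rw [hSsum]; ring
  have := Nat.le_of_mul_le_mul_left key hHpos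
  omega

/-- Rearrangements within the classes do not change the distances to the code. -/
theorem hdist_le_of_card_eq {z z' c : Vec 3} (hc : c ∈ simplexCode v j)
    (hcard : ∀ N ∈ suppUnion v j, ∀ a,
      #{x ∈ colClass v j N | z' x = a} = #{x ∈ colClass v j N | z x = a})
    (hout : outWeight (suppUnion v j) z ≤ outWeight (suppUnion v j) z') :
    hdist z c ≤ hdist z' c := by
  classical
  have hfib : ∀ y : Vec 3, #{x ∈ suppUnion v j | y x = c x} =
      ∑ B ∈ (suppUnion v j).image (colClass v j),
        #{x ∈ {x ∈ suppUnion v j | y x = c x} | colClass v j x = B} := fun y =>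
    card_eq_sum_card_fiberwise fun x hx =>
      mem_image_of_mem _ (mem_filter.1 hx).1
  have heq : #{x ∈ suppUnion v j | z x = c x} = #{x ∈ suppUnion v j | z' x = c x} := by
    rw [hfib, hfib]
    refine sum_congr rfl fun B hB => ?_
    obtain ⟨N, hN, rfl⟩ := mem_image.1 hB
    have h2 : ∀ y : Vec 3, {x ∈ {x ∈ suppUnion v j | y x = c x} | colClass v j x = colClass v j N} =
        {x ∈ colClass v j N | y x = c N} := by
      intro y
      ext x
      simp only [mem_filter]
      constructor
      · rintro ⟨⟨h1, h2⟩, h3⟩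
        have h4 : x ∈ colClass v j N := h3 ▸ self_mem_colClass h1
        exact ⟨h4, by rw [h2, simplexCode_congr_colClass hc h4]⟩
      · rintro ⟨h1, h2⟩
        exact ⟨⟨(mem_colClass.1 h1).1, by rw [h2, simplexCode_congr_colClass hc h1]⟩,
          colClass_eq h1⟩
    rw [h2, h2, hcard N hN]
  have h1 := card_agree_add_hdist (z := z) hc
  have h2 := card_agree_add_hdist (z := z') hc
  omega

theorem farSet_of_card_eq {d : ℕ} {z z' : Vec 3}
    (hz : z ∈ farSet d (simplexCode v j : Set (Vec 3)))
    (hcard : ∀ N ∈ suppUnion v j, ∀ a,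
      #{x ∈ colClass v j N | z' x = a} = #{x ∈ colClass v j N | z x = a})
    (hout : outWeight (suppUnion v j) z ≤ outWeight (suppUnion v j) z') :
    z' ∈ farSet d (simplexCode v j : Set (Vec 3)) := fun c hc =>
  (hz c hc).trans (hdist_le_of_card_eq hc hcard hout)

/-- Counting agreements with a codeword class by class. -/
theorem IsSimplex.mul_card_agree (h : IsSimplex v t (j + 1)) {z c : Vec 3}
    (hc : c ∈ simplexCode v (j + 1)) :
    t j * #{x ∈ suppUnion v (j + 1) | z x = c x} =
      ∑ N ∈ suppUnion v (j + 1), #{x ∈ colClass v (j + 1) N | z x = c N} := by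
  classical
  set S := suppUnion v (j + 1) with hS
  have h1 : ∑ N ∈ S, #{x ∈ colClass v (j + 1) N | z x = c N} =
      ∑ N ∈ S, #{x ∈ {x ∈ S | z x = c x} | x ∈ colClass v (j + 1) N} := by
    refine sum_congr rfl fun N hN => ?_
    congr 1
    ext x
    simp only [mem_filter]
    constructor
    · rintro ⟨h1, h2⟩
      exact ⟨⟨(mem_colClass.1 h1).1, by rw [h2, simplexCode_congr_colClass hc h1]⟩, h1⟩
    · rintro ⟨⟨-, h2⟩, h3⟩
      exact ⟨h3, by rw [h2, simplexCode_congr_colClass hc h3]⟩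
  have h2 : ∑ N ∈ S, #{x ∈ {x ∈ S | z x = c x} | x ∈ colClass v (j + 1) N} =
      ∑ x ∈ {x ∈ S | z x = c x}, #{N ∈ S | x ∈ colClass v (j + 1) N} :=
    sum_card_bipartiteAbove_eq_sum_card_bipartiteBelow
      fun (N : ℕ) (x : ℕ) => x ∈ colClass v (j + 1) N
  rw [h1, h2, sum_congr rfl (g := fun _ => t j), sum_const, smul_eq_mul, mul_comm]
  intro x hx
  have hxS : x ∈ S := (mem_filter.1 hx).1
  rw [← h.card_colClass hxS]
  congr 1
  ext N
  simp only [mem_filter]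
  exact ⟨fun hN => mem_colClass_comm hN.1 hN.2,
    fun hN => ⟨(mem_colClass.1 hN).1, mem_colClass_comm hxS hN⟩⟩

/-- Balanced vectors have constant distance from the code. -/
theorem IsSimplex.three_mul_hdist (h : IsSimplex v t (j + 1)) {z c : Vec 3} {τ : ℕ}
    (hpos : 0 < τ) (hτ : t j = 3 * τ) (hc : c ∈ simplexCode v (j + 1))
    (hcard : ∀ N ∈ suppUnion v (j + 1), ∀ a, #{x ∈ colClass v (j + 1) N | z x = a} = τ) :
    hdist z c + τ = t 0 + outWeight (suppUnion v (j + 1)) z := by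
  have h1 := h.mul_card_agree (z := z) hc
  rw [sum_congr rfl fun N hN => hcard N hN (c N), sum_const, smul_eq_mul, hτ] at h1
  have h2 : 3 * #{x ∈ suppUnion v (j + 1) | z x = c x} = #(suppUnion v (j + 1)) := by
    have : τ * (3 * #{x ∈ suppUnion v (j + 1) | z x = c x}) = τ * #(suppUnion v (j + 1)) := by
      rw [mul_comm τ #(suppUnion v (j + 1)), ← h1]
      ring
    exact Nat.eq_of_mul_eq_mul_left hpos this
  have h3 := card_agree_add_hdist (z := z) hc
  have h4 := h.two_mul_card
  omega

/-- The code has constant weight. -/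
theorem IsSimplex.card_support (h : IsSimplex v t j) (hpos : ∀ l < j, 0 < t l) {c : Vec 3}
    (hc : c ∈ simplexCode v j) (hc0 : c ≠ 0) : #c.support = t 0 := by
  induction j generalizing c with
  | zero =>
    rw [simplexCode_zero, Submodule.mem_bot] at hc
    exact absurd hc hc0
  | succ j ih =>
    obtain ⟨a, c', hc', rfl⟩ := mem_simplexCode_succ.1 hc
    by_cases ha : a = 0
    · rw [ha, zero_smul, zero_add] at hc0 ⊢
      exact ih (h.mono (by omega)) (fun l hl => hpos l (by omega)) hc' hc0
    · have h1 : #(a • v j + c').support = hdist (a • v j) (-c') := by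
        rw [hdist_eq_card_support, sub_neg_eq_add]
      have hsupp : outWeight (suppUnion v j) (a • v j) = t j := by
        rw [outWeight, Finsupp.support_smul_eq ha]
        exact h.new j (by omega)
      rw [h1]
      cases j with
      | zero =>
        rw [hdist_eq_add ((simplexCode v 0).neg_mem hc'), hsupp]
        simp
      | succ i =>
        -- The multiple a v_j is balanced on the earlier classes, so its distance to every earlier
        -- codeword is t 0 minus a third of the previous t plus its t j new entries, and these two
        -- terms cancel.
        have h2 := (h.mono (by omega : i + 1 ≤ i + 1 + 1)).three_mul_hdist (z := a • v (i + 1))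
          (hpos (i + 1) (by omega)) (h.step i (by omega)) ((simplexCode v (i + 1)).neg_mem hc')
          (fun N hN b => by
            rw [← h.unif (i + 1) (by omega) N hN (a⁻¹ * b)]
            congr 1
            ext x
            rw [mem_filter, mem_filter, Finsupp.smul_apply, smul_eq_mul, eq_inv_mul_iff_mul_eq₀ ha])
        rw [hsupp] at h2
        omega

/-- Vectors that are balanced up to a deficiency along a codeword are far from the code. -/
theorem IsSimplex.mem_farSet (h : IsSimplex v t (j + 1)) (hpos : ∀ l < j + 1, 0 < t l)
    {z c₀ : Vec 3} {τ s : ℕ} (hτ : t j + s = 3 * τ) (hc₀ : c₀ ∈ simplexCode v (j + 1))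
    (hcard : ∀ N ∈ suppUnion v (j + 1), ∀ a,
      #{x ∈ colClass v (j + 1) N | z x = a} + (if a = c₀ N then s else 0) = τ)
    (hout : τ ≤ outWeight (suppUnion v (j + 1)) z) :
    z ∈ farSet (t 0) (simplexCode v (j + 1) : Set (Vec 3)) := by
  classical
  intro c hc
  set S := suppUnion v (j + 1) with hS
  have h1 := h.mul_card_agree (z := z) hc
  have h2 : t j * #{x ∈ S | z x = c x} + s * #{x ∈ S | c x = c₀ x} = τ * #S := by
    have : ∑ N ∈ S, (#{x ∈ colClass v (j + 1) N | z x = c N} + (if c N = c₀ N then s else 0)) =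
        ∑ N ∈ S, τ := sum_congr rfl fun N hN => hcard N hN (c N)
    rw [sum_add_distrib, ← h1, sum_const, smul_eq_mul, ← sum_filter, sum_const, smul_eq_mul] at this
    rw [mul_comm s, this, mul_comm]
  -- Constant weight: different codewords disagree in exactly t 0 places.
  have h3 : #S ≤ #{x ∈ S | c x = c₀ x} + t 0 := by
    by_cases hcc : c = c₀
    · rw [hcc]; simp
    · have hsub : c - c₀ ∈ simplexCode v (j + 1) := Submodule.sub_mem _ hc hc₀
      have h4 := h.card_support hpos hsub (sub_ne_zero.2 hcc)
      have h5 : #{x ∈ S | ¬ c x = c₀ x} ≤ #(c - c₀).support := by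
        refine card_le_card fun x hx => ?_
        rw [Finsupp.mem_support_iff, Finsupp.sub_apply, sub_ne_zero]
        exact (mem_filter.1 hx).2
      have h6 := card_filter_add_card_filter_not (s := S) (fun x => c x = c₀ x)
      omega
  have h4 := card_agree_add_hdist (z := z) hc
  have h5 := h.two_mul_card
  rw [← hS] at h4 h5
  have hr := hpos j (by omega)
  generalize #{x ∈ S | z x = c x} = A at *
  generalize #{x ∈ S | c x = c₀ x} = E at *
  generalize outWeight S z = o at *
  generalize #S = M at *
  generalize t 0 = d at *
  generalize t j = r at *
  by_contra hlt
  rw [not_le] at hlt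
  -- A distance below d means A + d ≥ M + τ + 1. With r A + s E = τ M, E ≥ M - d, 2 M + r = 3 d and
  -- r + s = 3 τ one gets r A ≤ r (M + τ - d), with no room to spare.
  have h6 : r * (M + τ + 1) ≤ r * (A + d) := Nat.mul_le_mul_left r (by omega)
  zify at *
  nlinarith [h6, h2, mul_le_mul_of_nonneg_left h3 (Int.natCast_nonneg s)]

end Simplex

end LexCode

/-! ### Vectors with prescribed fibres on the column classes -/

namespace LexCode

open Finset

/-- Functions on a finite set with prescribed fibre sizes, vanishing on a given small subset. -/
theorem exists_of_card_eq {B A : Finset ℕ} {n : ZMod 3 → ℕ} (hn : n 0 + n 1 + n 2 = #B)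
    (hA : A ⊆ B) (hA0 : #A ≤ n 0) :
    ∃ f : ℕ → ZMod 3, (∀ a, #{x ∈ B | f x = a} = n a) ∧ ∀ x ∈ A, f x = 0 := by
  classical
  obtain ⟨U, hAU, hUB, hU⟩ := exists_subsuperset_card_eq hA hA0 (by omega)
  obtain ⟨W, hWB, hW⟩ := exists_subset_card_eq (s := B \ U) (n := n 1)
    (by rw [card_sdiff_of_subset hUB]; omega)
  have hWU : ∀ x ∈ W, x ∈ B ∧ x ∉ U := fun x hx => mem_sdiff.1 (hWB hx)
  have h0 : #{x ∈ B | (if x ∈ U then (0 : ZMod 3) else if x ∈ W then 1 else 2) = 0} = n 0 := by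
    rw [← hU]
    congr 1
    ext x
    rw [mem_filter]
    constructor
    · rintro ⟨-, hx⟩
      by_contra hxU
      rw [if_neg hxU] at hx
      split_ifs at hx <;> exact absurd hx (by decide)
    · exact fun hx => ⟨hUB hx, if_pos hx⟩
  have h1 : #{x ∈ B | (if x ∈ U then (0 : ZMod 3) else if x ∈ W then 1 else 2) = 1} = n 1 := by
    rw [← hW]
    congr 1
    ext x
    rw [mem_filter]
    constructor
    · rintro ⟨-, hx⟩
      by_contra hxW
      rw [if_neg hxW] at hx
      split_ifs at hx <;> exact absurd hx (by decide)
    · exact fun hx => ⟨(hWU x hx).1, by rw [if_neg (hWU x hx).2, if_pos hx]⟩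
  refine ⟨fun x => if x ∈ U then 0 else if x ∈ W then 1 else 2, fun a => ?_,
    fun x hx => if_pos (hAU hx)⟩
  have htot : #B = ∑ r : ZMod 3,
      #{x ∈ B | (if x ∈ U then (0 : ZMod 3) else if x ∈ W then 1 else 2) = r} :=
    card_eq_sum_card_fiberwise fun _ _ => mem_univ _
  have h012 : ∑ r : ZMod 3, #{x ∈ B | (if x ∈ U then (0 : ZMod 3) else if x ∈ W then 1 else 2) = r} =
      #{x ∈ B | (if x ∈ U then (0 : ZMod 3) else if x ∈ W then 1 else 2) = 0} +
      #{x ∈ B | (if x ∈ U then (0 : ZMod 3) else if x ∈ W then 1 else 2) = 1} +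
      #{x ∈ B | (if x ∈ U then (0 : ZMod 3) else if x ∈ W then 1 else 2) = 2} := Fin.sum_univ_three _
  have : a = 0 ∨ a = 1 ∨ a = 2 := by revert a; decide
  rcases this with rfl | rfl | rfl
  · exact h0
  · exact h1
  · show #{x ∈ B | (if x ∈ U then (0 : ZMod 3) else if x ∈ W then 1 else 2) = 2} = _
    omega

theorem card_eq_sum_three (B : Finset ℕ) (f : ℕ → ZMod 3) :
    #B = #{x ∈ B | f x = 0} + #{x ∈ B | f x = 1} + #{x ∈ B | f x = 2} := by
  have htot : #B = ∑ r : ZMod 3, #{x ∈ B | f x = r} :=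
    card_eq_sum_card_fiberwise fun _ _ => mem_univ _
  exact htot.trans (Fin.sum_univ_three _)

section

variable {v : ℕ → Vec 3} {t : ℕ → ℕ} {j : ℕ}

/-- Vectors with prescribed values outside of the support of the code, and prescribed fibre sizes
on each class of columns. -/
theorem exists_vec_of_card_eq (o : Vec 3) (A : Finset ℕ) {n : ℕ → ZMod 3 → ℕ}
    (hn : ∀ N ∈ suppUnion v j, n N 0 + n N 1 + n N 2 = #(colClass v j N))
    (hcongr : ∀ N ∈ suppUnion v j, ∀ x ∈ colClass v j N, n x = n N)
    (hA : ∀ N ∈ suppUnion v j, #A ≤ n N 0) :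
    ∃ z : Vec 3, (∀ x, x ∉ suppUnion v j → z x = o x) ∧
      (∀ N ∈ suppUnion v j, ∀ a, #{x ∈ colClass v j N | z x = a} = n N a) ∧
      ∀ x ∈ A, x ∈ suppUnion v j → z x = 0 := by
  classical
  have hB : ∀ B : Finset ℕ, ∃ f : ℕ → ZMod 3, ∀ N ∈ suppUnion v j, colClass v j N = B →
      (∀ a, #{x ∈ B | f x = a} = n N a) ∧ ∀ x ∈ A, x ∈ B → f x = 0 := by
    intro B
    by_cases hex : ∃ N ∈ suppUnion v j, colClass v j N = B
    · obtain ⟨N, hN, rfl⟩ := hex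
      obtain ⟨f, hf, hf0⟩ := exists_of_card_eq (hn N hN)
        (inter_subset_right : A ∩ colClass v j N ⊆ colClass v j N)
        ((card_le_card inter_subset_left).trans (hA N hN))
      refine ⟨f, fun N' hN' he => ⟨fun a => ?_, fun x hx hxB => hf0 x (mem_inter.2 ⟨hx, hxB⟩)⟩⟩
      rw [hf, hcongr N hN N' (he ▸ self_mem_colClass hN')]
    · exact ⟨0, fun N hN he => absurd ⟨N, hN, he⟩ hex⟩
  choose f hf using hB
  set z : Vec 3 := Finsupp.onFinset (suppUnion v j ∪ o.support)
    (fun x => if x ∈ suppUnion v j then f (colClass v j x) x else o x) (fun x hx => by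
      by_cases hxS : x ∈ suppUnion v j
      · exact mem_union_left _ hxS
      · simp only [hxS, if_false] at hx
        exact mem_union_right _ (Finsupp.mem_support_iff.2 hx)) with hz
  have hzin : ∀ x ∈ suppUnion v j, z x = f (colClass v j x) x := fun x hx => by
    simp [hz, hx]
  refine ⟨z, fun x hx => by simp [hz, hx], fun N hN a => ?_, fun x hx hxS => ?_⟩
  · rw [← (hf _ N hN rfl).1 a]
    congr 1
    ext x
    simp only [mem_filter]
    refine and_congr_right fun hx => ?_
    rw [hzin x (mem_colClass.1 hx).1, colClass_eq hx]
  · rw [hzin x hxS]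
    exact (hf _ x hxS rfl).2 x hx (self_mem_colClass hxS)

theorem outWeight_congr {p : ℕ} {S : Finset ℕ} {y z : Vec p} (h : ∀ x, x ∉ S → y x = z x) :
    outWeight S y = outWeight S z :=
  le_antisymm (outWeight_le fun x hx h0 => h x hx ▸ h0) (outWeight_le fun x hx h0 => h x hx ▸ h0)

theorem outWeight_smul {p : ℕ} [Fact p.Prime] {S : Finset ℕ} {a : ZMod p} (ha : a ≠ 0) (z : Vec p) :
    outWeight S (a • z) = outWeight S z := by
  rw [outWeight, Finsupp.support_smul_eq ha, outWeight]

/-- The common size of the fibres of a vector that is far from the code. -/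
theorem IsSimplex.card_eq (h : IsSimplex v t (j + 1)) {z : Vec 3} {τ : ℕ} (hτ : t j = 3 * τ)
    (hz : z ∈ farSet (t 0) (simplexCode v (j + 1) : Set (Vec 3)))
    (hout : outWeight (suppUnion v (j + 1)) z ≤ τ) {N : ℕ} (hN : N ∈ suppUnion v (j + 1))
    (a : ZMod 3) : #{x ∈ colClass v (j + 1) N | z x = a} = τ := by
  have h1 := h.card_le_outWeight hz hN
  have h2 := card_eq_sum_three (colClass v (j + 1) N) z
  rw [h.card_colClass hN] at h2
  have h3 := h1 0
  have h4 := h1 1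
  have h5 := h1 2
  have : a = 0 ∨ a = 1 ∨ a = 2 := by revert a; decide
  rcases this with rfl | rfl | rfl <;> omega

theorem IsSimplex.suppUnion_nonempty (h : IsSimplex v t (j + 1)) (h0 : 0 < t 0) :
    (suppUnion v (j + 1)).Nonempty := by
  have h1 := h.new 0 (by omega)
  rw [outWeight, suppUnion_zero, sdiff_empty] at h1
  obtain ⟨x, hx⟩ := card_pos.1 (h1 ▸ h0)
  exact ⟨x, mem_suppUnion.2 ⟨0, by omega, Finsupp.mem_support_iff.1 hx⟩⟩

/-- Here τ is t j / 3 rounded up, with rounding s. On a class of t j columns some value occurs at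
least τ times, so far vectors have outside weight at least τ. Conversely any outside pattern of that
weight extends to a far vector with τ entries of each value except τ - s zeros; s + 2 ≤ τ leaves two
zeros for ξ and η. -/
theorem IsSimplex.isMinStep {F : OrdBasis 3} {ξ η : ℕ} (h : IsSimplex v t j)
    (hpos : ∀ l < j, 0 < t l) {τ s : ℕ} (hs : s ≤ 2) (h0 : j = 0 → τ = t 0)
    (hstep : ∀ l, l + 1 = j → t l + s = 3 * τ) (h2 : s + 2 ≤ τ)
    (hcl : IsClosedDown ξ η (suppUnion v j)) {y : Vec 3}
    (hy : y ∈ farSet (t 0) (simplexCode v j : Set (Vec 3)))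
    (hmin : ∀ z ∈ farSet (t 0) (simplexCode v j : Set (Vec 3)), ¬ BasisLT F z y) :
    IsMinStep F ξ η (suppUnion v j) τ (farSet (t 0) (simplexCode v j : Set (Vec 3))) y := by
  classical
  refine ⟨hy, hmin, fun z hz => ?_, fun z hz z' h1 h2 => ?_, fun o ho => ?_, by omega, hcl⟩
  · cases j with
    | zero =>
      have := hz 0 (Submodule.zero_mem _)
      rw [hdist_eq_card_support, sub_zero] at this
      rw [h0 rfl]
      simpa [outWeight] using this
    | succ j =>
      obtain ⟨N, hN⟩ := h.suppUnion_nonempty (hpos 0 (by omega))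
      have h1 := h.card_le_outWeight hz hN
      have h3 := card_eq_sum_three (colClass v (j + 1) N) z
      rw [h.card_colClass hN] at h3
      have h4 := h1 0
      have h5 := h1 1
      have h6 := h1 2
      have h7 := hstep j rfl
      omega
  · refine farSet_of_card_eq hz (fun N hN a => ?_) h2
    congr 1
    ext x
    simp only [mem_filter]
    exact and_congr_right fun hx => by rw [h1 x (mem_colClass.1 hx).1]
  · cases j with
    | zero =>
      refine ⟨o, fun c hc => ?_, fun _ _ => rfl, fun h => by simp at h⟩
      rw [SetLike.mem_coe, simplexCode_zero, Submodule.mem_bot] at hc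
      rw [hc, hdist_eq_card_support, sub_zero, ← h0 rfl]
      simpa [outWeight] using ho
    | succ j =>
      have h7 := hstep j rfl
      obtain ⟨z, hz1, hz2, hz3⟩ := exists_vec_of_card_eq (v := v) (j := j + 1) o {ξ, η}
        (n := fun _ a => τ - if a = 0 then s else 0) (fun N hN => by
          rw [h.card_colClass hN, if_pos rfl, if_neg (by decide), if_neg (by decide)]; omega)
        (fun _ _ _ _ => rfl) (fun _ _ => card_le_two.trans (by rw [if_pos rfl]; omega))
      refine ⟨z, h.mem_farSet hpos (c₀ := 0) (s := s) (τ := τ) h7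
        (Submodule.zero_mem _) (fun N hN a => ?_) ?_, hz1, fun h1 h2 => ⟨hz3 ξ (by simp) h1,
        hz3 η (by simp) h2⟩⟩
      · rw [hz2 N hN a, Finsupp.zero_apply]
        split_ifs <;> omega
      · rwa [outWeight_congr hz1]

/-- Balanced vectors are far from the code. -/
theorem IsSimplex.mem_farSet_of_card_eq (h : IsSimplex v t j) (hpos : ∀ l < j, 0 < t l) {z : Vec 3}
    {τ : ℕ} (h0 : j = 0 → τ = t 0) (hstep : ∀ l, l + 1 = j → t l = 3 * τ)
    (hcard : ∀ N ∈ suppUnion v j, ∀ a, #{x ∈ colClass v j N | z x = a} = τ)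
    (hout : τ ≤ outWeight (suppUnion v j) z) :
    z ∈ farSet (t 0) (simplexCode v j : Set (Vec 3)) := by
  cases j with
  | zero =>
    intro c hc
    rw [SetLike.mem_coe, simplexCode_zero, Submodule.mem_bot] at hc
    rw [hc, hdist_eq_card_support, sub_zero, ← h0 rfl]
    simpa [outWeight] using hout
  | succ j =>
    exact h.mem_farSet hpos (c₀ := 0) (s := 0) (hstep j rfl) (Submodule.zero_mem _)
      (fun N hN a => by rw [hcard N hN a]; simp) hout

/-- The rearrangement of the coordinates of a vector. -/
theorem farSet_equivMapDomain {d : ℕ} {z : Vec 3}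
    (hz : z ∈ farSet d (simplexCode v j : Set (Vec 3))) {σ : Equiv.Perm ℕ}
    (hσ : ∀ x, x ∉ suppUnion v j → σ x = x) (hσ' : ∀ x, ∀ l < j, v l (σ x) = v l x) :
    Finsupp.equivMapDomain σ.symm z ∈ farSet d (simplexCode v j : Set (Vec 3)) := by
  refine farSet_of_card_eq hz (fun N hN a => ?_) (le_of_eq (outWeight_congr fun x hx => ?_))
  · refine card_nbij' σ σ.symm (fun x hx => ?_) (fun x hx => ?_) (fun x _ => by simp)
      (fun x _ => by simp)
    · rw [mem_coe, mem_filter, mem_colClass' hN, Finsupp.equivMapDomain_apply,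
        Equiv.symm_symm] at hx
      rw [mem_coe, mem_filter, mem_colClass' hN]
      exact ⟨fun l hl => (hσ' x l hl).trans (hx.1 l hl), hx.2⟩
    · rw [mem_coe, mem_filter, mem_colClass' hN] at hx
      rw [mem_coe, mem_filter, mem_colClass' hN, Finsupp.equivMapDomain_apply,
        Equiv.symm_symm, Equiv.apply_symm_apply]
      refine ⟨fun l hl => ?_, hx.2⟩
      have := hσ' (σ.symm x) l hl
      rw [Equiv.apply_symm_apply] at this
      exact this.symm.trans (hx.1 l hl)
  · rw [Finsupp.equivMapDomain_apply, Equiv.symm_symm, hσ x hx]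

theorem column_swap {x y : ℕ} (h : ∀ l < j, v l x = v l y) (w : ℕ) {l : ℕ} (hl : l < j) :
    v l (Equiv.swap x y w) = v l w := by
  rcases eq_or_ne w x with rfl | hx
  · rw [Equiv.swap_apply_left, h l hl]
  · rcases eq_or_ne w y with rfl | hy
    · rw [Equiv.swap_apply_right, h l hl]
    · rw [Equiv.swap_apply_of_ne_of_ne hx hy]

theorem swap_apply_of_notMem {S : Finset ℕ} {x y w : ℕ} (hx : x ∈ S) (hy : y ∈ S) (hw : w ∉ S) :
    Equiv.swap x y w = w :=
  Equiv.swap_apply_of_ne_of_ne (fun e => hw (e ▸ hx)) fun e => hw (e ▸ hy)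

theorem farSet_swap {d : ℕ} {z : Vec 3} (hz : z ∈ farSet d (simplexCode v j : Set (Vec 3)))
    {x y : ℕ} (hx : x ∈ suppUnion v j) (hy : y ∈ colClass v j x) :
    Finsupp.equivMapDomain (Equiv.swap x y).symm z ∈ farSet d (simplexCode v j : Set (Vec 3)) :=
  farSet_equivMapDomain hz (fun _ hw => swap_apply_of_notMem hx (mem_colClass.1 hy).1 hw)
    fun w l hl => column_swap (fun l hl => ((mem_colClass.1 hy).2 l hl).symm) w hl

theorem farSet_swap_swap {d : ℕ} {z : Vec 3} (hz : z ∈ farSet d (simplexCode v j : Set (Vec 3)))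
    {x y x' y' : ℕ} (hx : x ∈ suppUnion v j) (hy : y ∈ colClass v j x) (hx' : x' ∈ suppUnion v j)
    (hy' : y' ∈ colClass v j x') :
    Finsupp.equivMapDomain (Equiv.swap x y * Equiv.swap x' y').symm z ∈
      farSet d (simplexCode v j : Set (Vec 3)) := by
  refine farSet_equivMapDomain hz (fun w hw => ?_) fun w l hl => ?_
  · rw [Equiv.Perm.mul_apply, swap_apply_of_notMem hx' (mem_colClass.1 hy').1 hw,
      swap_apply_of_notMem hx (mem_colClass.1 hy).1 hw]
  · rw [Equiv.Perm.mul_apply, column_swap (fun l hl => ((mem_colClass.1 hy).2 l hl).symm) _ hl,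
      column_swap (fun l hl => ((mem_colClass.1 hy').2 l hl).symm) _ hl]

end

end LexCode

/-! ### Ternary generator matrices with minimal rows -/

namespace LexCode

open Finset

/-- The correction between the coordinate at `N` with respect to the standard basis and with
respect to the twisted basis. -/
def twist (ξ η : ℕ) (κ : ZMod 3) (N : ℕ) (x : Vec 3) : ZMod 3 := if N = η then κ * x ξ else 0

/-- The data of a generator matrix of a lexicographic code: each row is the minimal vector that is
far from the span of the preceding rows. -/
structure LexSimplex (F : OrdBasis 3) (ξ η : ℕ) (v : ℕ → Vec 3) (t : ℕ → ℕ) (j : ℕ) : Prop where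
  simplex : IsSimplex v t j
  closed : ∀ l ≤ j, IsClosedDown ξ η (suppUnion v l)
  special : ξ < η → ∀ l < j, v l ξ = v l η
  mem : ∀ l < j, v l ∈ farSet (t 0) (simplexCode v l : Set (Vec 3))
  min : ∀ l < j, ∀ z ∈ farSet (t 0) (simplexCode v l : Set (Vec 3)), ¬ BasisLT F z (v l)
  two : ∀ l < j, 2 ≤ t l

section

variable {F : OrdBasis 3} {ξ η : ℕ} {κ : ZMod 3} {v : ℕ → Vec 3} {t : ℕ → ℕ} {j l : ℕ}

theorem IsTwisted.repr_eq (hF : IsTwisted F ξ η κ) (x : Vec 3) (N : ℕ) :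
    F.repr x N = x N - twist ξ η κ N x := hF.repr_apply x N

theorem twist_of_ne {N : ℕ} (h : N ≠ η) (x : Vec 3) : twist ξ η κ N x = 0 := if_neg h

theorem twist_add (N : ℕ) (x y : Vec 3) :
    twist ξ η κ N (x + y) = twist ξ η κ N x + twist ξ η κ N y := by
  simp only [twist, Finsupp.add_apply]
  split_ifs <;> ring

theorem twist_smul (N : ℕ) (a : ZMod 3) (x : Vec 3) :
    twist ξ η κ N (a • x) = a * twist ξ η κ N x := by
  simp only [twist, Finsupp.smul_apply, smul_eq_mul]
  split_ifs <;> ring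

namespace LexSimplex

theorem mono (h : LexSimplex F ξ η v t j) {i : ℕ} (hi : i ≤ j) : LexSimplex F ξ η v t i :=
  ⟨h.simplex.mono hi, fun l hl => h.closed l (hl.trans hi),
    fun hB l hl => h.special hB l (hl.trans_le hi), fun l hl => h.mem l (hl.trans_le hi),
    fun l hl => h.min l (hl.trans_le hi), fun l hl => h.two l (hl.trans_le hi)⟩

theorem mem_colClass_eta (h : LexSimplex F ξ η v t j) (hB : ξ < η) (hl : l ≤ j)
    {N : ℕ} (hξ : ξ ∈ colClass v l N) : η ∈ colClass v l N := by
  obtain ⟨h1, h2⟩ := mem_colClass.1 hξ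
  exact mem_colClass.2 ⟨((h.closed l hl).mem_iff hB).1 h1,
    fun i hi => (h.special hB i (hi.trans_le hl)).symm.trans (h2 i hi)⟩

theorem mem_colClass_xi (h : LexSimplex F ξ η v t j) (hB : ξ < η) (hl : l ≤ j)
    {N : ℕ} (hη : η ∈ colClass v l N) : ξ ∈ colClass v l N := by
  obtain ⟨h1, h2⟩ := mem_colClass.1 hη
  exact mem_colClass.2 ⟨((h.closed l hl).mem_iff hB).2 h1,
    fun i hi => (h.special hB i (hi.trans_le hl)).trans (h2 i hi)⟩

theorem code_special (h : LexSimplex F ξ η v t j) (hB : ξ < η) {c : Vec 3}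
    (hc : c ∈ simplexCode v j) : c ξ = c η :=
  simplexCode_congr hc fun l hl => h.special hB l hl

theorem swap_not_lt (h : LexSimplex F ξ η v t j) (hl : l < j) {x y : ℕ}
    (hx : x ∈ suppUnion v l) (hy : y ∈ colClass v l x) :
    ¬ BasisLT F (Finsupp.equivMapDomain (Equiv.swap x y).symm (v l)) (v l) :=
  h.min l hl _ (farSet_swap (h.mem l hl) hx hy)

theorem swap_swap_not_lt (h : LexSimplex F ξ η v t j) (hl : l < j) {x y x' y' : ℕ}
    (hx : x ∈ suppUnion v l) (hy : y ∈ colClass v l x) (hx' : x' ∈ suppUnion v l)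
    (hy' : y' ∈ colClass v l x') :
    ¬ BasisLT F (Finsupp.equivMapDomain (Equiv.swap x y * Equiv.swap x' y').symm (v l)) (v l) :=
  h.min l hl _ (farSet_swap_swap (h.mem l hl) hx hy hx' hy')

/-- Exchanging two entries within a class does not affect distances to the code, so in a minimal row
the larger index carries the smaller coordinate. The correction at N is untouched: if N = η, both
exchanged indices lie below ξ. -/
theorem sorted_left (hF : IsTwisted F ξ η κ) (h : LexSimplex F ξ η v t j) (hl : l < j)
    (hA : η < ξ) {N x : ℕ} (hN : N ∈ suppUnion v l) (hx : x ∈ colClass v l N) (hxN : x < N) :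
    (v l N - twist ξ η κ N (v l)).val ≤ (v l x - twist ξ η κ N (v l)).val := by
  by_contra hlt
  rw [not_le] at hlt
  refine h.swap_not_lt hl hN hx ⟨N, ?_, fun i hi => hF.repr_congr ?_ fun e => ?_⟩
  · have h1 : Finsupp.equivMapDomain (Equiv.swap N x).symm (v l) N = v l x := by simp
    have h2 : twist ξ η κ N (Finsupp.equivMapDomain (Equiv.swap N x).symm (v l)) =
        twist ξ η κ N (v l) := by
      by_cases hNη : N = η
      · simp only [twist, if_pos hNη, Finsupp.equivMapDomain_apply, Equiv.symm_symm]
        rw [Equiv.swap_apply_of_ne_of_ne (by omega) (by omega)]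
      · rw [twist_of_ne hNη, twist_of_ne hNη]
    rw [hF.repr_eq, hF.repr_eq, h1, h2]
    exact hlt
  · rw [Finsupp.equivMapDomain_apply, Equiv.symm_symm,
      Equiv.swap_apply_of_ne_of_ne (by omega) (by omega)]
  · rw [Finsupp.equivMapDomain_apply, Equiv.symm_symm,
      Equiv.swap_apply_of_ne_of_ne (by omega) (by omega)]

theorem exists_other (h : LexSimplex F ξ η v t j) (hl : l < j) {N M : ℕ}
    (hN : N ∈ suppUnion v l) (a : ZMod 3) : ∃ x ∈ colClass v l N, v l x = a ∧ x ≠ M := by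
  have h1 := h.simplex.unif l hl N hN a
  have h2 := h.two l hl
  obtain ⟨x, hx, hxM⟩ := exists_mem_ne (by omega : 1 < #{x ∈ colClass v l N | v l x = a}) M
  exact ⟨x, (mem_filter.1 hx).1, (mem_filter.1 hx).2, hxM⟩

/-- Again by exchanging entries in a class. Only an exchange involving x = ξ with N < η would
disturb a coordinate above N, namely the one at η, and it is repaired by a second exchange. -/
theorem sorted_right (hF : IsTwisted F ξ η κ) (h : LexSimplex F ξ η v t j) (hl : l < j)
    (hB : ξ < η) {N x : ℕ} (hN : N ∈ suppUnion v l) (hNξ : N ≠ ξ) (hNη : N ≠ η)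
    (hx : x ∈ colClass v l N) (hxN : x < N) : (v l N).val ≤ (v l x).val := by
  by_contra hlt
  rw [not_le] at hlt
  by_cases hc : x = ξ ∧ N < η
  · obtain ⟨rfl, hNη'⟩ := hc
    have hη := h.mem_colClass_eta hB hl.le hx
    -- A second index M with the same entry as N is exchanged with η, so that ξ and η receive equal
    -- entries. The entry arriving at M is smaller, which is harmless even if M lies above N.
    obtain ⟨M, hM, hMN, hne⟩ := h.exists_other hl hN (v l N) (M := N)
    have hMx : M ≠ x := fun e => absurd (e ▸ hMN) fun e' => by rw [e'] at hlt; omega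
    have hMη : M ≠ η := fun e => absurd (e ▸ hMN) fun e' => by
      rw [h.special hB l hl, e'] at hlt; omega
    have hs := h.special hB l hl
    refine h.swap_swap_not_lt hl hN hx (mem_colClass.1 hη).1
      (colClass_eq hη ▸ hM) (basisLT_of_le_above N ?_ fun i hi => ?_)
    · rw [hF.repr_of_ne hNη, hF.repr_of_ne hNη, Finsupp.equivMapDomain_apply, Equiv.symm_symm,
        Equiv.Perm.mul_apply, Equiv.swap_apply_of_ne_of_ne hNη hne.symm, Equiv.swap_apply_left]
      exact hlt
    · by_cases hiη : i = η
      · subst hiη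
        rw [hF.repr_eta_of_lt hB, hF.repr_eta_of_lt hB]
        simp only [Finsupp.equivMapDomain_apply, Equiv.symm_symm, Equiv.Perm.mul_apply,
          Equiv.swap_apply_left]
        rw [Equiv.swap_apply_of_ne_of_ne hne hMx, Equiv.swap_apply_of_ne_of_ne (by omega) hMx.symm,
          Equiv.swap_apply_right, hMN, sub_self]
        simp
      · rw [hF.repr_of_ne hiη, hF.repr_of_ne hiη, Finsupp.equivMapDomain_apply, Equiv.symm_symm,
          Equiv.Perm.mul_apply]
        by_cases hiM : i = M
        · rw [hiM, Equiv.swap_apply_right, Equiv.swap_apply_of_ne_of_ne (by omega) (by omega), ← hs,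
            hMN]
          exact hlt.le
        · rw [Equiv.swap_apply_of_ne_of_ne hiη hiM,
            Equiv.swap_apply_of_ne_of_ne (by omega) (by omega)]
  · refine h.swap_not_lt hl hN hx ⟨N, ?_, fun i hi => hF.repr_congr ?_ fun e => ?_⟩
    · rw [hF.repr_of_ne hNη, hF.repr_of_ne hNη]
      simpa using hlt
    · rw [Finsupp.equivMapDomain_apply, Equiv.symm_symm,
        Equiv.swap_apply_of_ne_of_ne (by omega) (by omega)]
    · rw [Finsupp.equivMapDomain_apply, Equiv.symm_symm,
        Equiv.swap_apply_of_ne_of_ne (by omega) (by omega)]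

/-- Two different indices of this kind could be exchanged with ξ and η at the same time. The
coordinate at η would stay 0 and that at ξ would decrease. -/
theorem eq_of_lt_xi (hF : IsTwisted F ξ η κ) (h : LexSimplex F ξ η v t j) (hl : l < j)
    (hB : ξ < η) (hξ : ξ ∈ suppUnion v l) {x y : ℕ} (hx : x ∈ colClass v l ξ)
    (hy : y ∈ colClass v l ξ) (hxξ : x < ξ) (hyξ : y < ξ) (hxy : v l x = v l y)
    (hlt : (v l x).val < (v l ξ).val) : x = y := by
  by_contra hne
  have hη := h.mem_colClass_eta hB hl.le (self_mem_colClass hξ)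
  refine h.swap_swap_not_lt hl hξ hx (mem_colClass.1 hη).1 (colClass_eq hη ▸ hy)
    ⟨ξ, ?_, fun i hi => ?_⟩
  · rw [hF.repr_of_ne hF.ne, hF.repr_of_ne hF.ne, Finsupp.equivMapDomain_apply, Equiv.symm_symm,
      Equiv.Perm.mul_apply, Equiv.swap_apply_of_ne_of_ne hF.ne hyξ.ne', Equiv.swap_apply_left]
    exact hlt
  · by_cases hiη : i = η
    · rw [hiη, hF.repr_eta_of_lt hB, hF.repr_eta_of_lt hB]
      simp only [Finsupp.equivMapDomain_apply, Equiv.symm_symm, Equiv.Perm.mul_apply,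
        Equiv.swap_apply_left]
      rw [Equiv.swap_apply_of_ne_of_ne hyξ.ne (Ne.symm hne),
        Equiv.swap_apply_of_ne_of_ne hF.ne hyξ.ne',
        Equiv.swap_apply_left, hxy, h.special hB l hl, sub_self, sub_self]
    · rw [hF.repr_of_ne hiη, hF.repr_of_ne hiη, Finsupp.equivMapDomain_apply, Equiv.symm_symm,
        Equiv.Perm.mul_apply, Equiv.swap_apply_of_ne_of_ne hiη (by omega),
        Equiv.swap_apply_of_ne_of_ne (by omega) (by omega)]

end LexSimplex

/-- In the minimal vector the entries at `ξ` and `η` coincide. -/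
theorem special_eq_of_mem (hF : IsTwisted F ξ η κ) (hB : ξ < η) {y : Vec 3} {d : ℕ}
    (hy : y ∈ farSet d (simplexCode v j : Set (Vec 3)))
    (hmin : ∀ z ∈ farSet d (simplexCode v j : Set (Vec 3)), ¬ BasisLT F z y)
    (hξ : ξ ∈ suppUnion v j) (hη : η ∈ colClass v j ξ)
    (hcard : ∀ a, 2 ≤ #{x ∈ colClass v j ξ | y x = a}) : y ξ = y η := by
  by_contra hne
  have hηS := (mem_colClass.1 hη).1
  have hmem : ∀ {x}, x ∈ colClass v j ξ → x ∈ colClass v j η := fun hx => by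
    rwa [colClass_eq hη]
  have hpos : 0 < (y η - y ξ).val := val_pos_of_ne_zero (sub_ne_zero.2 (Ne.symm hne))
  have h1 : ∀ x ∈ colClass v j ξ, x ≠ ξ → x ≠ η → y x = y ξ → η < x := by
    intro x hx hxξ hxη hyx
    by_contra hlt
    refine hmin _ (farSet_swap hy hηS (hmem hx)) ⟨η, ?_, fun i hi => ?_⟩
    · rw [hF.repr_eta_of_lt hB, hF.repr_eta_of_lt hB, Finsupp.equivMapDomain_apply,
        Finsupp.equivMapDomain_apply, Equiv.symm_symm, Equiv.swap_apply_left,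
        Equiv.swap_apply_of_ne_of_ne hF.ne hxξ.symm, hyx, sub_self]
      simpa using hpos
    · rw [hF.repr_of_ne hi.ne', hF.repr_of_ne hi.ne', Finsupp.equivMapDomain_apply,
        Equiv.symm_symm, Equiv.swap_apply_of_ne_of_ne (by omega) (by omega)]
  have h2 : ∀ x ∈ colClass v j ξ, x ≠ ξ → x ≠ η → y x = y η → η < x := by
    intro x hx hxξ hxη hyx
    by_contra hlt
    refine hmin _ (farSet_swap hy hξ hx) ⟨η, ?_, fun i hi => ?_⟩
    · rw [hF.repr_eta_of_lt hB, hF.repr_eta_of_lt hB, Finsupp.equivMapDomain_apply,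
        Finsupp.equivMapDomain_apply, Equiv.symm_symm, Equiv.swap_apply_left,
        Equiv.swap_apply_of_ne_of_ne hF.ne.symm hxη.symm, hyx, sub_self]
      simpa using hpos
    · rw [hF.repr_of_ne hi.ne', hF.repr_of_ne hi.ne', Finsupp.equivMapDomain_apply,
        Equiv.symm_symm, Equiv.swap_apply_of_ne_of_ne (by omega) (by omega)]
  have hsort : ∀ x ∈ colClass v j ξ, ∀ s ∈ colClass v j ξ, η < x → s = ξ ∨ s = η →
      (y x).val ≤ (y s).val := by
    intro x hx s hs hηx hsp
    by_contra hlt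
    rw [not_le] at hlt
    refine hmin _ (farSet_swap hy (mem_colClass.1 hx).1 ((colClass_eq hx).symm ▸ hs))
      ⟨x, ?_, fun i hi => ?_⟩
    · rw [hF.repr_of_ne hηx.ne', hF.repr_of_ne hηx.ne']
      simpa using hlt
    · rw [hF.repr_of_ne (by omega), hF.repr_of_ne (by omega), Finsupp.equivMapDomain_apply,
        Equiv.symm_symm, Equiv.swap_apply_of_ne_of_ne (by omega) (by omega)]
  -- Each of the two values occurs a second time, and by `h1` and `h2` only above η, since otherwise
  -- an exchange would equalise the entries at ξ and η. Above η entries are at most those at ξ and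
  -- η, so each value bounds the other.
  obtain ⟨x, hx, hxξ⟩ := exists_mem_ne (hcard (y ξ)) ξ
  obtain ⟨x', hx', hxη⟩ := exists_mem_ne (hcard (y η)) η
  obtain ⟨hx, hyx⟩ := mem_filter.1 hx
  obtain ⟨hx', hyx'⟩ := mem_filter.1 hx'
  have h3 := h1 x hx hxξ (fun e => hne (by rw [← hyx, e])) hyx
  have h4 := h2 x' hx' (fun e => hne (by rw [← hyx', e])) hxη hyx'
  have h5 := hsort x hx η hη h3 (Or.inr rfl)
  have h6 := hsort x' hx' ξ (self_mem_colClass hξ) h4 (Or.inl rfl)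
  rw [hyx] at h5
  rw [hyx'] at h6
  exact hne (ZMod.val_injective 3 (le_antisymm h5 h6))

theorem LexSimplex.zero : LexSimplex F ξ η v t 0 :=
  ⟨⟨by simp, by simp, by simp, by simp⟩, fun l hl => by
    rw [Nat.le_zero.1 hl, suppUnion_zero]; exact isClosedDown_empty ξ η,
    by simp, by simp, by simp, by simp⟩

theorem LexSimplex.isMinStep (h : LexSimplex F ξ η v t j) (h2 : 2 ≤ t j)
    (hstep : ∀ l, l + 1 = j → t l = 3 * t j)
    (hy : v j ∈ farSet (t 0) (simplexCode v j : Set (Vec 3)))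
    (hmin : ∀ z ∈ farSet (t 0) (simplexCode v j : Set (Vec 3)), ¬ BasisLT F z (v j)) :
    IsMinStep F ξ η (suppUnion v j) (t j) (farSet (t 0) (simplexCode v j : Set (Vec 3))) (v j) :=
  h.simplex.isMinStep (fun l hl => (by norm_num : 0 < 2).trans_le (h.two l hl)) (Nat.zero_le 2)
    (fun e => by rw [e]) hstep (by omega) (h.closed j le_rfl) hy hmin

/-- The minimal vector has the least possible outside weight t j. The bound then allows each value
at most t j times on a class of 3 t j columns, so all fibres have exactly this size and the simplex
structure continues. -/
theorem LexSimplex.succ (hF : IsTwisted F ξ η κ) (h : LexSimplex F ξ η v t j) (h2 : 2 ≤ t j)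
    (hstep : ∀ l, l + 1 = j → t l = 3 * t j)
    (hy : v j ∈ farSet (t 0) (simplexCode v j : Set (Vec 3)))
    (hmin : ∀ z ∈ farSet (t 0) (simplexCode v j : Set (Vec 3)), ¬ BasisLT F z (v j)) :
    LexSimplex F ξ η v t (j + 1) := by
  have hM := h.isMinStep h2 hstep hy hmin
  have hcases : ∀ {P : ℕ → Prop}, (∀ l < j, P l) → P j → ∀ l < j + 1, P l := fun h1 h2 l hl =>
    (Nat.lt_succ_iff_lt_or_eq.1 hl).elim (h1 l) fun e => e ▸ h2
  have hunif : ∀ N ∈ suppUnion v j, ∀ a, #{x ∈ colClass v j N | v j x = a} = t j := by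
    intro N hN a
    cases j with
    | zero => simp at hN
    | succ i => exact h.simplex.card_eq (hstep i rfl) hy (hM.outWeight_eq hF).le hN a
  refine ⟨⟨hcases h.simplex.one fun x hx hx0 => hM.eq_one hF hx hx0,
    hcases h.simplex.new (hM.outWeight_eq hF), hcases h.simplex.unif hunif, fun l hl => ?_⟩,
    fun l hl => ?_, fun hB => hcases (h.special hB) ?_, hcases h.mem hy, hcases h.min hmin,
    hcases h.two h2⟩
  · rcases (Nat.lt_succ_iff.1 hl).eq_or_lt with e | hl
    · rw [hstep l e, e]
    · exact h.simplex.step l hl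
  · rcases hl.eq_or_lt with rfl | hl
    · rw [suppUnion_succ]
      exact hM.isClosedDown hF
    · exact h.closed l (by omega)
  · by_cases hξ : ξ ∈ suppUnion v j
    · exact special_eq_of_mem hF hB hy hmin hξ
        (h.mem_colClass_eta hB le_rfl (self_mem_colClass hξ)) fun a => (hunif ξ hξ a).symm ▸ h2
    · exact hM.eq_of_notMem hF hB hξ

end

end LexCode

/-! ### Base-three digits, and entries determined by the coordinates above an index -/

namespace LexCode

open Finset

/-- The coordinate at `x` is determined by the coordinates above `N` with respect to the twisted
basis. -/
def Beyond (ξ η N x : ℕ) : Prop := N < x ∧ (x = η → N < ξ)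

/-- The sequence `w` follows the digits in base three. -/
structure IsDigitSum (w v : ℕ → Vec 3) (j : ℕ) : Prop where
  zero : w 0 = 0
  add : ∀ l < j, ∀ s < 3, ∀ i < 3 ^ l, w (s * 3 ^ l + i) = (s : ZMod 3) • v l + w i

section

variable {F : OrdBasis 3} {ξ η : ℕ} {κ : ZMod 3} {v w : ℕ → Vec 3} {t : ℕ → ℕ} {j l : ℕ}

/-- The entry at η is its coordinate plus κ times the entry at ξ, and ξ lies above N as well. -/
theorem Beyond.eq (hF : IsTwisted F ξ η κ) {N x : ℕ} (hx : Beyond ξ η N x) {y z : Vec 3}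
    (h : ∀ i, N < i → F.repr y i = F.repr z i) : y x = z x := by
  by_cases hxη : x = η
  · have h1 := h ξ (hx.2 hxη)
    have h2 := h x hx.1
    rw [hF.repr_of_ne hF.ne, hF.repr_of_ne hF.ne] at h1
    rw [hxη] at h2 ⊢
    rw [hF.repr_eta, hF.repr_eta, h1] at h2
    exact sub_left_injective h2
  · have h2 := h x hx.1
    rwa [hF.repr_of_ne hxη, hF.repr_of_ne hxη] at h2

theorem exists_digit {i : ℕ} (hi : i < 3 ^ (l + 1)) : ∃ s < 3, ∃ i' < 3 ^ l, i = s * 3 ^ l + i' := by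
  have hpos : 0 < 3 ^ l := by positivity
  refine ⟨i / 3 ^ l, ?_, i % 3 ^ l, Nat.mod_lt _ hpos, ?_⟩
  · rw [Nat.div_lt_iff_lt_mul hpos]
    rw [pow_succ] at hi
    omega
  · rw [mul_comm, Nat.div_add_mod]

theorem IsDigitSum.mem (h : IsDigitSum w v j) (hl : l ≤ j) {i : ℕ} (hi : i < 3 ^ l) :
    w i ∈ simplexCode v l := by
  induction l generalizing i with
  | zero =>
    obtain rfl : i = 0 := by simpa using hi
    rw [h.zero]
    exact Submodule.zero_mem _
  | succ l ih =>
    obtain ⟨s, hs, i', hi', rfl⟩ := exists_digit hi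
    rw [h.add l (by omega) s hs i' hi']
    exact mem_simplexCode_succ.2 ⟨_, _, ih (by omega) hi', rfl⟩

theorem IsDigitSum.exists_eq (h : IsDigitSum w v j) (hl : l ≤ j) {c : Vec 3}
    (hc : c ∈ simplexCode v l) : ∃ i < 3 ^ l, c = w i := by
  induction l generalizing c with
  | zero =>
    rw [simplexCode_zero, Submodule.mem_bot] at hc
    exact ⟨0, by simp, by rw [hc, h.zero]⟩
  | succ l ih =>
    obtain ⟨a, c', hc', rfl⟩ := mem_simplexCode_succ.1 hc
    obtain ⟨i', hi', rfl⟩ := ih (by omega) hc'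
    refine ⟨a.val * 3 ^ l + i', ?_, ?_⟩
    · have := ZMod.val_lt a
      rw [pow_succ]
      nlinarith [show 0 < 3 ^ l by positivity]
    · rw [h.add l (by omega) _ (ZMod.val_lt a) i' hi', ZMod.natCast_zmod_val]

namespace LexSimplex

/-- By sortedness, smaller entries of a class sit at larger indices. If x = η with ξ < η, then ξ
lies in the same class with the same entry and is above A for the same reason. -/
theorem beyond_of_lt (hF : IsTwisted F ξ η κ) (h : LexSimplex F ξ η v t j) (hl : l < j) {A x : ℕ}
    (hA : A ∈ suppUnion v l) (hgood : η < ξ ∨ A ≠ ξ ∧ A ≠ η) (hx : x ∈ colClass v l A)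
    (hlt : (v l x - twist ξ η κ A (v l)).val < (v l A - twist ξ η κ A (v l)).val) :
    Beyond ξ η A x := by
  have hxA : x ≠ A := fun e => by rw [e] at hlt; omega
  rcases lt_or_gt_of_ne hF.ne with hB | hB
  · obtain ⟨hAξ, hAη⟩ := hgood.resolve_left (by omega)
    have key : ∀ x ∈ colClass v l A, (v l x).val < (v l A).val → A < x := by
      intro x hx hlt
      have hxA : x ≠ A := fun e => by rw [e] at hlt; omega
      by_contra hle
      have := h.sorted_right hF hl hB hA hAξ hAη hx (by omega)
      omega
    rw [twist_of_ne hAη, sub_zero, sub_zero] at hlt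
    refine ⟨key x hx hlt, fun e => key ξ ?_ ?_⟩
    · exact h.mem_colClass_xi hB hl.le (e ▸ hx)
    · rwa [h.special hB l hl, ← e]
  · have hAx : A < x := by
      by_contra hle
      have := h.sorted_left hF hl hB hA hx (by omega)
      omega
    exact ⟨hAx, fun e => by omega⟩

/-- The support is closed downwards below ordinary indices, so whatever is missing lies above A; if
η is missing, then so is ξ when ξ < η. -/
theorem beyond_of_notMem (hF : IsTwisted F ξ η κ) (h : LexSimplex F ξ η v t j) (hl : l ≤ j)
    {A x : ℕ} (hA : A ∈ suppUnion v l) (hgood : η < ξ ∨ A ≠ ξ ∧ A ≠ η) (hx : x ∉ suppUnion v l) :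
    Beyond ξ η A x := by
  have hne : ∀ {y}, y ∉ suppUnion v l → y ≠ A := fun hy e => hy (e ▸ hA)
  rcases lt_or_gt_of_ne hF.ne with hB | hB
  · obtain ⟨hAξ, hAη⟩ := hgood.resolve_left (by omega)
    have key : ∀ y, y ∉ suppUnion v l → A < y := fun y hy => by
      have := hne hy
      by_contra hle
      exact hy ((h.closed l hl).right hB A hA hAξ hAη y (by omega))
    exact ⟨key x hx, fun e => key ξ fun hξ => hx (e ▸ ((h.closed l hl).mem_iff hB).1 hξ)⟩
  · have := hne hx
    have hAx : A < x := by
      by_contra hle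
      exact hx ((h.closed l hl).left hB A hA x (by omega))
    exact ⟨hAx, fun e => by omega⟩

theorem twist_eq_zero (hF : IsTwisted F ξ η κ) (h : LexSimplex F ξ η v t j) (hl : l ≤ j) {N : ℕ}
    (hN : N ∉ suppUnion v l) {c : Vec 3} (hc : c ∈ simplexCode v l) : twist ξ η κ N c = 0 := by
  by_cases hNη : N = η
  · have hξ : ξ ∉ suppUnion v l := fun hξ => hN <| by
      rcases lt_or_gt_of_ne hF.ne with hB | hB
      · exact hNη ▸ ((h.closed l hl).mem_iff hB).1 hξ
      · exact (h.closed l hl).left hB ξ hξ N (hNη ▸ hB)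
    rw [twist, if_pos hNη, simplexCode_eq_zero hc hξ, mul_zero]
  · exact twist_of_ne hNη c

theorem repr_eq_zero (hF : IsTwisted F ξ η κ) (h : LexSimplex F ξ η v t j) (hl : l ≤ j) {N : ℕ}
    (hN : N ∉ suppUnion v l) {c : Vec 3} (hc : c ∈ simplexCode v l) : F.repr c N = 0 := by
  rw [hF.repr_eq, h.twist_eq_zero hF hl hN hc, simplexCode_eq_zero hc hN, sub_zero]

/-- The coordinates that are determined above an index `N` at which the last row does not
vanish. -/
theorem anchor (hF : IsTwisted F ξ η κ) (h : LexSimplex F ξ η v t (j + 1)) {N : ℕ}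
    (hN : N ∈ suppUnion v j) (h0 : F.repr (v j) N ≠ 0) :
    (∀ l ≤ j, N ∈ suppUnion v l → ∀ x, x ∉ suppUnion v l → Beyond ξ η N x) ∧
    (∀ l < j, N ∈ suppUnion v l → ∀ x ∈ colClass v l N,
      (v l x - twist ξ η κ N (v l)).val < (v l N - twist ξ η κ N (v l)).val → Beyond ξ η N x) ∧
    ∀ e, (e - twist ξ η κ N (v j)).val < (v j N - twist ξ η κ N (v j)).val →
      ∃ U ⊆ colClass v j N, ∃ W ⊆ colClass v j N, t j + 1 ≤ #U + #W ∧
        (∀ x ∈ U, v j x = e ∧ Beyond ξ η N x) ∧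
        ∀ x ∈ W, v j x = v j N ∧ (x = N ∨ ξ < η ∧ N = ξ ∧ x = η) := by
  by_cases hgood : η < ξ ∨ N ≠ ξ ∧ N ≠ η
  · refine ⟨fun l hl hNl x hx => h.beyond_of_notMem hF (by omega) hNl hgood hx,
      fun l hl hNl x hx hlt => h.beyond_of_lt hF (by omega) hNl hgood hx hlt, fun e he => ?_⟩
    refine ⟨{x ∈ colClass v j N | v j x = e}, filter_subset _ _, {N},
      singleton_subset_iff.2 (self_mem_colClass hN), ?_, fun x hx => ?_, fun x hx => ?_⟩
    · rw [h.simplex.unif j (by omega) N hN, card_singleton]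
    · obtain ⟨hx, hxe⟩ := mem_filter.1 hx
      exact ⟨hxe, h.beyond_of_lt hF (by omega) hN hgood hx (hxe ▸ he)⟩
    · rw [mem_singleton] at hx
      exact ⟨by rw [hx], Or.inl hx⟩
  · push Not at hgood
    have hB : ξ < η := lt_of_le_of_ne hgood.1 hF.ne
    have hs := h.special hB j (by omega)
    have hNξ : N = ξ := by
      by_contra hne
      have hNη := hgood.2 hne
      rw [hNη, hF.repr_eta_of_lt hB, hs, sub_self] at h0
      exact h0 rfl
    subst hNξ
    have htw : ∀ y, twist N η κ N y = 0 := twist_of_ne hF.ne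
    have hη := h.mem_colClass_eta hB (by omega) (self_mem_colClass hN)
    -- Now N = ξ < η. At most one index with a given smaller entry can lie below ξ; this loss is
    -- made up by η, which carries the same entry as ξ and joins W.
    have hU : ∀ e : ZMod 3, e.val < (v j N).val →
        t j - 1 ≤ #{x ∈ {x ∈ colClass v j N | v j x = e} | N < x} := by
      intro e he
      have h1 := card_filter_add_card_filter_not (s := {x ∈ colClass v j N | v j x = e})
        (fun x => N < x)
      rw [h.simplex.unif j (by omega) N hN] at h1
      have h2 : #{x ∈ {x ∈ colClass v j N | v j x = e} | ¬ N < x} ≤ 1 := by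
        refine card_le_one.2 fun x hx y hy => ?_
        simp only [mem_filter] at hx hy
        have hxN : x ≠ N := fun e' => by rw [← hx.1.2, e'] at he; omega
        have hyN : y ≠ N := fun e' => by rw [← hy.1.2, e'] at he; omega
        exact h.eq_of_lt_xi hF (by omega) hB hN hx.1.1 hy.1.1 (by omega) (by omega)
          (hx.1.2.trans hy.1.2.symm) (hx.1.2 ▸ he)
      omega
    have h2 := h.two j (by omega)
    have h0' : v j N ≠ 0 := by rwa [hF.repr_of_ne hF.ne] at h0
    -- An ordinary index above ξ with the same columns in the earlier rows. It stands in for ξ, to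
    -- which the sortedness and closedness lemmas do not apply directly.
    obtain ⟨A, hA⟩ := card_pos.1 ((by omega : 0 < t j - 1).trans_le
      (hU 0 (by rw [ZMod.val_zero]; exact val_pos_of_ne_zero h0')))
    simp only [mem_filter] at hA
    obtain ⟨⟨hA, hA0⟩, hNA⟩ := hA
    have hAη : A ≠ η := fun e => h0' (by rw [hs, ← e, hA0])
    have hAl : ∀ l ≤ j, N ∈ suppUnion v l → A ∈ colClass v l N := fun l hl hNl =>
      (mem_colClass' hNl).2 fun i hi => (mem_colClass.1 hA).2 i (by omega)
    refine ⟨fun l hl hNl x hx => ?_, fun l hl hNl x hx hlt => ?_, fun e he => ?_⟩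
    · have h3 := h.beyond_of_notMem hF (by omega) (mem_colClass.1 (hAl l hl hNl)).1
        (Or.inr ⟨hNA.ne', hAη⟩) hx
      exact ⟨hNA.trans h3.1, fun e => hNA.trans (h3.2 e)⟩
    · have h3 := h.beyond_of_lt hF (by omega : l < j + 1) (mem_colClass.1 (hAl l hl.le hNl)).1
        (Or.inr ⟨hNA.ne', hAη⟩) (colClass_eq (hAl l hl.le hNl) ▸ hx) (by
          rw [htw, sub_zero, sub_zero] at hlt
          rwa [twist_of_ne hAη, sub_zero, sub_zero, (mem_colClass.1 hA).2 l hl])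
      exact ⟨hNA.trans h3.1, fun e => hNA.trans (h3.2 e)⟩
    · rw [htw, sub_zero, sub_zero] at he
      refine ⟨{x ∈ {x ∈ colClass v j N | v j x = e} | N < x},
        (filter_subset _ _).trans (filter_subset _ _), {N, η}, ?_, ?_, fun x hx => ?_,
        fun x hx => ?_⟩
      · exact insert_subset (self_mem_colClass hN) (singleton_subset_iff.2 hη)
      · have := hU e he
        rw [card_pair hF.ne]
        exact (by omega : t j + 1 ≤ t j - 1 + 2).trans (Nat.add_le_add_right this 2)
      · simp only [mem_filter] at hx
        exact ⟨hx.1.2, hx.2, fun e' => absurd (hx.1.2 ▸ he) (by rw [e', hs]; exact lt_irrefl _)⟩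
      · rcases mem_insert.1 hx with rfl | hx
        · exact ⟨rfl, Or.inl rfl⟩
        · rw [mem_singleton] at hx
          exact ⟨by rw [hx, hs], Or.inr ⟨hB, rfl, hx⟩⟩

end LexSimplex

end

end LexCode

/-! ### Deviations from codewords, and the position of the top difference -/

namespace LexCode

open Finset

section

variable {F : OrdBasis 3} {ξ η : ℕ} {κ : ZMod 3} {v w : ℕ → Vec 3} {t : ℕ → ℕ} {j l : ℕ}

theorem val_sub_one_lt : ∀ e : ZMod 3, e ≠ 0 → (e - 1).val < e.val := by decide

theorem ne_sub_one : ∀ e : ZMod 3, e ≠ e - 1 := by decide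

namespace LexSimplex

theorem pos (h : LexSimplex F ξ η v t j) (hl : l < j) : 0 < t l := by
  have := h.two l hl
  omega

theorem mem_farSet_of_digit (hw : IsDigitSum w v j) (hl : l < j) {s : ℕ} (hs : s < 3) (hs0 : s ≠ 0)
    {i : ℕ} {d : ℕ} {y : Vec 3} (hfar : ∀ i' < s * 3 ^ l + i, d ≤ hdist y (w i')) :
    y ∈ farSet d (simplexCode v l : Set (Vec 3)) := fun c hc => by
  obtain ⟨i', hi', rfl⟩ := hw.exists_eq hl.le hc
  refine hfar i' ?_
  have : 3 ^ l ≤ s * 3 ^ l := Nat.le_mul_of_pos_left _ (by omega)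
  omega

theorem isMinStep_of_lt (h : LexSimplex F ξ η v t j) (hl : l < j) :
    IsMinStep F ξ η (suppUnion v l) (t l) (farSet (t 0) (simplexCode v l : Set (Vec 3))) (v l) :=
  (h.mono hl.le).isMinStep (h.two l hl) (fun i hi => by
    subst hi; exact h.simplex.step i hl) (h.mem l hl) (h.min l hl)

theorem card_eq (h : LexSimplex F ξ η v t j) (hl : l < j) {z : Vec 3}
    (hz : z ∈ farSet (t 0) (simplexCode v l : Set (Vec 3)))
    (hout : outWeight (suppUnion v l) z ≤ t l) {N : ℕ} (hN : N ∈ suppUnion v l) (a : ZMod 3) :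
    #{x ∈ colClass v l N | z x = a} = t l := by
  cases l with
  | zero => simp at hN
  | succ l => exact (h.simplex.mono hl.le).card_eq (h.simplex.step l hl) hz hout hN a

theorem outWeight_smul_eq (h : LexSimplex F ξ η v t j) (hl : l < j) {a : ZMod 3} (ha : a ≠ 0)
    {z : Vec 3} (hz : ∀ x, x ∉ suppUnion v l → z x = a * v l x) :
    outWeight (suppUnion v l) z = t l := by
  rw [← h.simplex.new l hl, ← outWeight_smul ha (v l)]
  exact outWeight_congr hz

/-- A vector that deviates from a codeword at two indices with the same column, in opposite
directions, is close to a smaller codeword. -/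
theorem not_forall_far (hF : IsTwisted F ξ η κ) (h : LexSimplex F ξ η v t j)
    (hw : IsDigitSum w v j) {N M : ℕ} (hl : l ≤ j) (hNM : ∀ l' < l, v l' M = v l' N) {i : ℕ}
    (hi : i < 3 ^ l) {y : Vec 3} (hsupp : ∀ x, x ∉ suppUnion v l → y x = 0)
    (hfar : ∀ i' < i, t 0 ≤ hdist y (w i')) (hone : F.repr (w i) N = 1)
    (hyN : y N = w i N + 1) (hyM : y M = w i N - 1)
    (hlt : ∀ l' < l, N ∈ suppUnion v l' → ∀ x ∈ colClass v l' N,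
      (v l' x - twist ξ η κ N (v l')).val < (v l' N - twist ξ η κ N (v l')).val → y x = w i x)
    (hout : ∀ l' < l, N ∈ suppUnion v l' → ∀ x, x ∉ suppUnion v l' → y x = w i x) : False := by
  classical
  induction l generalizing i y with
  | zero =>
    obtain rfl : i = 0 := by simpa using hi
    rw [hw.zero, map_zero] at hone
    exact absurd hone (by simp)
  | succ l ih =>
    obtain ⟨s, hs, i', hi', rfl⟩ := exists_digit hi
    have hwi := hw.add l hl s hs i' hi'
    have hmem : w i' ∈ simplexCode v l := hw.mem (by omega) hi'
    have hs3 : s = 0 ∨ s = 1 ∨ s = 2 := by omega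
    by_cases hN : N ∈ suppUnion v l
    · have hM : M ∈ colClass v l N := (mem_colClass' hN).2 fun l' hl' => hNM l' (by omega)
      have hyout : ∀ x, x ∉ suppUnion v l → y x = s * v l x := fun x hx => by
        rw [hout l (by omega) hN x hx, hwi, Finsupp.add_apply, Finsupp.smul_apply, smul_eq_mul,
          simplexCode_eq_zero hmem hx, add_zero]
      rcases eq_or_ne s 0 with rfl | hs0
      · have hwi' : w (0 * 3 ^ l + i') = w i' := by rw [zero_mul, zero_add]
        rw [hwi'] at hone hyN hyM
        exact ih (by omega) (fun l' hl' => hNM l' (by omega)) hi'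
          (fun x hx => by simpa using hyout x hx) (fun b hb => hfar b (by omega)) hone hyN hyM
          (fun l' hl' h1 x hx h2 => hwi' ▸ hlt l' (by omega) h1 x hx h2)
          (fun l' hl' h1 x hx => hwi' ▸ hout l' (by omega) h1 x hx)
      · have hsne : (s : ZMod 3) ≠ 0 := by
          rcases hs3 with rfl | rfl | rfl
          · exact absurd rfl hs0
          · decide
          · decide
        have hrepr : F.repr (w (s * 3 ^ l + i')) N = s * F.repr (v l) N + F.repr (w i') N := by
          rw [hwi]; simp
        -- If the row does not contribute to the coordinate at N, its multiple is subtracted and the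
        -- induction hypothesis applies to the remaining digits.
        by_cases he : F.repr (v l) N = 0
        · have hsub : ∀ x, y x = w (s * 3 ^ l + i') x → (y - (s : ZMod 3) • v l) x = w i' x :=
            fun x hx => by
              rw [Finsupp.sub_apply, hx, hwi, Finsupp.add_apply, add_sub_cancel_left]
          refine ih (y := y - (s : ZMod 3) • v l) (by omega) (fun l' hl' => hNM l' (by omega)) hi'
            (fun x hx => ?_) (fun b hb => ?_) ?_ ?_ ?_
            (fun l' hl' h1 x hx h2 => hsub x (hlt l' (by omega) h1 x hx h2))
            (fun l' hl' h1 x hx => hsub x (hout l' (by omega) h1 x hx))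
          · rw [Finsupp.sub_apply, Finsupp.smul_apply, hyout x hx, smul_eq_mul, sub_self]
          · rw [hdist_eq_of_sub_eq (show y - (s : ZMod 3) • v l - w b =
              y - w (s * 3 ^ l + b) by rw [hw.add l hl s hs b (by omega)]; abel)]
            exact hfar _ (by omega)
          · rw [hrepr, he, mul_zero, zero_add] at hone
            exact hone
          · rw [Finsupp.sub_apply, hyN, hwi, Finsupp.add_apply]
            ring
          · rw [Finsupp.sub_apply, hyM, hwi, Finsupp.add_apply, Finsupp.smul_apply,
              Finsupp.smul_apply, hNM l (by omega)]
            ring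
        · have hyf := mem_farSet_of_digit hw hl hs hs0 hfar
          have hcard := h.card_eq hl hyf (h.outWeight_smul_eq hl hsne hyout).le hN
          set e := F.repr (v l) N with hedef
          set τ := twist ξ η κ N (v l) with hτ
          have heN : v l N = e + τ := by rw [hedef, hF.repr_eq]; ring
          have heq : ∀ x ∈ colClass v l N, v l x = e - 1 + τ →
              y x = s * (e - 1 + τ) + w i' N := by
            intro x hx hvx
            rw [hlt l (by omega) hN x hx, hwi, Finsupp.add_apply, Finsupp.smul_apply, smul_eq_mul,
              hvx, simplexCode_congr_colClass hmem hx]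
            rw [hvx, heN, add_sub_cancel_right, add_sub_cancel_right]
            exact val_sub_one_lt e he
          -- All fibres of y on the class have t l elements. The t l indices where the row has
          -- coordinate e - 1 already fill one fibre, and a further index with that value is
          -- impossible. The deviation supplies it: M if the leading digit is 1, N if it is 2.
          have hsubs : ∀ x₀ ∈ colClass v l N, v l x₀ = v l N → y x₀ = s * (e - 1 + τ) + w i' N →
              False := by
            intro x₀ hx₀ hv₀ hy₀
            have h1 : insert x₀ {x ∈ colClass v l N | v l x = e - 1 + τ} ⊆
                {x ∈ colClass v l N | y x = s * (e - 1 + τ) + w i' N} := by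
              refine insert_subset (mem_filter.2 ⟨hx₀, hy₀⟩) fun x hx => ?_
              obtain ⟨hx, hvx⟩ := mem_filter.1 hx
              exact mem_filter.2 ⟨hx, heq x hx hvx⟩
            have h2 := card_le_card h1
            rw [card_insert_of_notMem, hcard, h.simplex.unif l hl N hN] at h2
            · omega
            · intro hx
              have := (mem_filter.1 hx).2
              rw [hv₀, heN, add_left_inj] at this
              exact ne_sub_one e this
          have hwN : w (s * 3 ^ l + i') N = s * (e + τ) + w i' N := by
            rw [hwi, Finsupp.add_apply, Finsupp.smul_apply, smul_eq_mul, heN]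
          rcases hs3 with rfl | rfl | rfl
          · exact hs0 rfl
          · refine hsubs M hM (hNM l (by omega)) ?_
            rw [hyM, hwN]
            push_cast
            ring
          · refine hsubs N (self_mem_colClass hN) rfl ?_
            rw [hyN, hwN]
            push_cast
            linear_combination (1 : ZMod 3) * (by decide : (3 : ZMod 3) = 0)
    · have hr0 := (h.mono (by omega : l ≤ j)).repr_eq_zero hF le_rfl hN hmem
      have hrepr : F.repr (w (s * 3 ^ l + i')) N = s * F.repr (v l) N := by
        rw [hwi, map_add, Finsupp.add_apply, hr0, add_zero, map_smul, Finsupp.smul_apply,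
          smul_eq_mul]
      have hs0 : s ≠ 0 := by
        rintro rfl
        rw [hrepr, Nat.cast_zero, zero_mul] at hone
        exact absurd hone (by decide)
      have hNS : N ∈ suppUnion v (l + 1) := by
        by_contra hN'
        rw [hrepr, h.repr_eq_zero hF hl hN' (mem_simplexCode_of_lt (by omega)), mul_zero] at hone
        exact absurd hone (by decide)
      have hMS : M ∈ suppUnion v (l + 1) :=
        (mem_colClass.1 ((mem_colClass' hNS).2 fun l' hl' => hNM l' (by omega))).1
      have hMl : M ∉ suppUnion v l := fun hM => by
        obtain ⟨l', hl', h0⟩ := mem_suppUnion.1 hM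
        exact h0 (by rw [hNM l' (by omega), eq_zero_of_notMem_suppUnion hN hl'])
      have hyf := mem_farSet_of_digit hw hl hs hs0 hfar
      have hlow := (h.isMinStep_of_lt hl).low y hyf
      -- Being far from the earlier rows requires t l outside entries, and y is supported on exactly
      -- t l such places. But at N and M it equals s + 1 and s - 1, one of which is 0.
      have hall : ∀ x ∈ suppUnion v (l + 1), x ∉ suppUnion v l → y x ≠ 0 := by
        intro x hx hxl
        have h1 : y.support \ suppUnion v l ⊆ (v l).support \ suppUnion v l := by
          intro x hx
          obtain ⟨hx0, hxl⟩ := mem_sdiff.1 hx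
          refine mem_sdiff.2 ⟨?_, hxl⟩
          by_contra hxv
          refine Finsupp.mem_support_iff.1 hx0 (hsupp x ?_)
          rw [suppUnion_succ, mem_union, not_or]
          exact ⟨hxl, hxv⟩
        have h2 := eq_of_subset_of_card_le h1 (by
          have := h.simplex.new l hl
          rw [outWeight] at this hlow
          omega)
        rw [suppUnion_succ, mem_union] at hx
        have h3 : x ∈ y.support \ suppUnion v l := h2 ▸ mem_sdiff.2 ⟨hx.resolve_left hxl, hxl⟩
        exact Finsupp.mem_support_iff.1 (mem_sdiff.1 h3).1
      have hv1 : v l N = 1 := h.simplex.one l hl N hN <| by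
        rw [suppUnion_succ, mem_union] at hNS
        exact Finsupp.mem_support_iff.1 (hNS.resolve_left hN)
      have hwN : w (s * 3 ^ l + i') N = s := by
        rw [hwi, Finsupp.add_apply, Finsupp.smul_apply, smul_eq_mul, hv1,
          simplexCode_eq_zero hmem hN, mul_one, add_zero]
      have hN0 := hall N hNS hN
      have hM0 := hall M hMS hMl
      rw [hyN, hwN] at hN0
      rw [hyM, hwN] at hM0
      rcases hs3 with rfl | rfl | rfl
      · exact hs0 rfl
      · exact hM0 (by decide)
      · exact hN0 (by decide)

/-- The top difference to a smaller vector lies in the support of the preceding rows. -/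
theorem mem_suppUnion_of_top (hF : IsTwisted F ξ η κ) (h : LexSimplex F ξ η v t (j + 1)) {z c : Vec 3}
    (hz : z ∈ farSet (t 0) (simplexCode v j : Set (Vec 3))) (hc : c ∈ simplexCode v j)
    {s : ZMod 3} {N : ℕ} (htop : ∀ i, N < i → F.repr z i = F.repr (s • v j + c) i)
    (hz0 : F.repr z N = 0) (ha0 : F.repr (v j) N ≠ 0)
    (hab : F.repr c N ≠ 0 ∨ F.repr (v j) N = 1) : N ∈ suppUnion v j := by
  classical
  by_contra hN
  have hNS : N ∈ suppUnion v (j + 1) := by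
    by_contra hN'
    exact ha0 (h.repr_eq_zero hF le_rfl hN' (mem_simplexCode_of_lt (by omega)))
  have ha : F.repr (v j) N = 1 :=
    hab.resolve_left fun h' => h' (h.repr_eq_zero hF (by omega) hN hc)
  have hM := h.isMinStep_of_lt (show j < j + 1 by omega)
  have hlow := hM.low z hz
  have hc0 : ∀ {x}, x ∉ suppUnion v j → c x = 0 := fun hx => simplexCode_eq_zero hc hx
  have hNv : v j N ≠ 0 := by
    rw [suppUnion_succ, mem_union] at hNS
    exact Finsupp.mem_support_iff.1 (hNS.resolve_left hN)
  have hN1 : v j N = 1 := h.simplex.one j (by omega) N hN hNv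
  have htw0 : twist ξ η κ N (v j) = 0 := by
    rw [hF.repr_eq, hN1] at ha
    simpa using ha
  have hS : ∀ {x}, x ∈ suppUnion v (j + 1) → x ∉ suppUnion v j → v j x ≠ 0 := fun hx hxj => by
    rw [suppUnion_succ, mem_union] at hx
    exact Finsupp.mem_support_iff.1 (hx.resolve_left hxj)
  have hbey : ∀ {x}, Beyond ξ η N x → x ∉ suppUnion v j → z x ≠ 0 → v j x ≠ 0 := by
    intro x hx hxj hzx hvx
    refine hzx ?_
    rw [hx.eq hF htop, Finsupp.add_apply, Finsupp.smul_apply, hvx, hc0 hxj, smul_zero, add_zero]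
  have hnew := h.simplex.new j (by omega)
  have hNT : N ∈ (v j).support \ suppUnion v j :=
    mem_sdiff.2 ⟨Finsupp.mem_support_iff.2 hNv, hN⟩
  -- Under this condition z uses at most the new indices of the row other than N, one less than the
  -- required t j.
  have hfin : (∀ x, x ∉ suppUnion v j → z x ≠ 0 → x ≠ N ∧ v j x ≠ 0) → False := by
    intro hall
    have h1 : z.support \ suppUnion v j ⊆ ((v j).support \ suppUnion v j).erase N := by
      intro x hx
      obtain ⟨hx0, hxj⟩ := mem_sdiff.1 hx
      obtain ⟨h2, h3⟩ := hall x hxj (Finsupp.mem_support_iff.1 hx0)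
      exact mem_erase.2 ⟨h2, mem_sdiff.2 ⟨Finsupp.mem_support_iff.2 h3, hxj⟩⟩
    have h2 := card_lt_card (h1.trans_ssubset (erase_ssubset hNT))
    rw [outWeight] at hlow hnew
    omega
  rcases lt_or_gt_of_ne hF.ne with hB | hA
  · have hNη : N ≠ η := fun e => by
      rw [e, hF.repr_eta_of_lt hB, h.special hB j (by omega), sub_self] at ha
      exact absurd ha (by decide)
    by_cases hNξ : N = ξ
    · subst hNξ
      have hηj : η ∉ suppUnion v j := fun e => hN (((h.closed j (by omega)).mem_iff hB).2 e)
      have hzN : z N = 0 := by rwa [hF.repr_of_ne hNη] at hz0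
      have hs := h.special hB j (by omega)
      have hzη : z η = 0 := by
        have := htop η hB
        rw [hF.repr_eta_of_lt hB, hF.repr_eta_of_lt hB, hzN, Finsupp.add_apply, Finsupp.add_apply,
          Finsupp.smul_apply, Finsupp.smul_apply, hs, hc0 hN, hc0 hηj, sub_self, sub_zero] at this
        exact this
      -- If N = ξ < η, indices below ξ outside of the support may also be used, but there is at most
      -- one. Since z vanishes at both ξ and η, its weight still drops below t j.
      set G := {x ∈ range N | x ∉ suppUnion v (j + 1)} with hG
      have hGcard : #G ≤ 1 := card_le_one.2 fun x hx y hy => by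
        simp only [hG, mem_filter, mem_range, suppUnion_succ] at hx hy
        exact hM.gap_unique hF hB hN hNv hx.1 hy.1 hx.2 hy.2
      have hηT : η ∈ ((v j).support \ suppUnion v j).erase N :=
        mem_erase.2 ⟨hNη.symm, mem_sdiff.2 ⟨Finsupp.mem_support_iff.2 (hs ▸ hNv), hηj⟩⟩
      have h1 : z.support \ suppUnion v j ⊆
          (((v j).support \ suppUnion v j).erase N).erase η ∪ G := by
        intro x hx
        obtain ⟨hx0, hxj⟩ := mem_sdiff.1 hx
        have hzx := Finsupp.mem_support_iff.1 hx0
        have hxN : x ≠ N := fun e => hzx (e ▸ hzN)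
        have hxη : x ≠ η := fun e => hzx (e ▸ hzη)
        by_cases hvx : v j x = 0
        · refine mem_union_right _ (mem_filter.2 ⟨mem_range.2 ?_, fun hxS => hS hxS hxj hvx⟩)
          by_contra hle
          exact hbey ⟨by omega, fun e => absurd e hxη⟩ hxj hzx hvx
        · exact mem_union_left _ (mem_erase.2 ⟨hxη, mem_erase.2 ⟨hxN,
            mem_sdiff.2 ⟨Finsupp.mem_support_iff.2 hvx, hxj⟩⟩⟩)
      have h2 := card_le_card h1
      have h3 := card_union_le ((((v j).support \ suppUnion v j).erase N).erase η) G
      have h4 := card_erase_add_one hηT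
      have h5 := card_erase_add_one hNT
      rw [outWeight] at hlow hnew
      omega
    · refine hfin fun x hxj hzx => ⟨fun e => hzx ?_, ?_⟩
      · rw [e]
        rwa [hF.repr_of_ne hNη] at hz0
      · rcases lt_trichotomy x N with hx | hx | hx
        · exact hS ((h.closed (j + 1) le_rfl).right hB N hNS hNξ hNη x hx) hxj
        · exact hx ▸ hNv
        · by_cases hxη : x = η ∧ ξ < N
          · have hξS := (h.closed (j + 1) le_rfl).right hB N hNS hNξ hNη ξ hxη.2
            exact hS (hxη.1 ▸ ((h.closed (j + 1) le_rfl).mem_iff hB).1 hξS) hxj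
          · exact hbey ⟨hx, fun e => by
              have : ¬ ξ < N := fun h' => hxη ⟨e, h'⟩
              omega⟩ hxj hzx
  · refine hfin fun x hxj hzx => ⟨fun e => hzx ?_, ?_⟩
    · rw [e]
      rw [hF.repr_eq, sub_eq_zero] at hz0
      rw [hz0]
      by_cases hNη : N = η
      · have hξj : ξ ∉ suppUnion v j := fun hξ =>
          hN ((h.closed j (by omega)).left hA ξ hξ N (hNη ▸ hA))
        have h1 := htop ξ (hNη ▸ hA)
        rw [hF.repr_of_ne hF.ne, hF.repr_of_ne hF.ne, Finsupp.add_apply, hc0 hξj, add_zero,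
          Finsupp.smul_apply, smul_eq_mul] at h1
        rw [twist, if_pos hNη] at htw0 ⊢
        rw [h1, mul_left_comm, htw0, mul_zero]
      · exact twist_of_ne hNη z
    · rcases lt_trichotomy x N with hx | hx | hx
      · exact hS ((h.closed (j + 1) le_rfl).left hA N hNS x hx) hxj
      · exact hx ▸ hNv
      · exact hbey ⟨hx, fun e => by omega⟩ hxj hzx

end LexSimplex

end

end LexCode

/-! ### Ternary words follow the addition of digits -/

namespace LexCode

open Finset

section

variable {F : OrdBasis 3} {ξ η : ℕ} {κ : ZMod 3} {v w : ℕ → Vec 3} {t : ℕ → ℕ} {j l : ℕ}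

namespace LexSimplex

/-- The values on the sets of indices provided by `anchor`. -/
theorem anchor_apply (hF : IsTwisted F ξ η κ) (h : LexSimplex F ξ η v t (j + 1)) {z c : Vec 3}
    (hc : c ∈ simplexCode v j) {s : ZMod 3} {N : ℕ} (hN : N ∈ suppUnion v j)
    (htop : ∀ i, N < i → F.repr z i = F.repr (s • v j + c) i)
    (hz0 : F.repr z N = 0) (ha0 : F.repr (v j) N ≠ 0) {x : ℕ}
    (hx : x = N ∨ ξ < η ∧ N = ξ ∧ x = η) :
    z x = s * twist ξ η κ N (v j) + twist ξ η κ N c := by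
  have htw : twist ξ η κ N z = s * twist ξ η κ N (v j) + twist ξ η κ N c := by
    rw [← twist_smul, ← twist_add]
    by_cases hNη : N = η
    · have hA : η < ξ := by
        rcases lt_or_gt_of_ne hF.ne with hB | hA
        · rw [hNη, hF.repr_eta_of_lt hB, h.special hB j (by omega), sub_self] at ha0
          exact absurd rfl ha0
        · exact hA
      have h1 := htop ξ (hNη ▸ hA)
      rw [hF.repr_of_ne hF.ne, hF.repr_of_ne hF.ne] at h1
      rw [twist, twist, if_pos hNη, if_pos hNη, h1]
    · rw [twist_of_ne hNη, twist_of_ne hNη]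
  rw [← htw]
  have hzN : z N = twist ξ η κ N z := by
    rwa [hF.repr_eq, sub_eq_zero] at hz0
  rcases hx with rfl | ⟨hB, rfl, rfl⟩
  · exact hzN
  · have h1 := htop x hB
    rw [hF.repr_eta_of_lt hB, hF.repr_eta_of_lt hB, Finsupp.add_apply, Finsupp.add_apply,
      Finsupp.smul_apply, Finsupp.smul_apply, h.special hB j (by omega),
      (h.mono (Nat.le_succ j)).code_special hB hc, sub_self, sub_eq_zero] at h1
    rw [h1, hzN]

theorem apply_of_notMem (hF : IsTwisted F ξ η κ) (h : LexSimplex F ξ η v t (j + 1)) {z c : Vec 3}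
    (hc : c ∈ simplexCode v j) {s : ZMod 3} {N : ℕ} (hN : N ∈ suppUnion v j)
    (htop : ∀ i, N < i → F.repr z i = F.repr (s • v j + c) i) (ha0 : F.repr (v j) N ≠ 0)
    {x : ℕ} (hx : x ∉ suppUnion v j) : z x = s * v j x := by
  rw [((h.anchor hF hN ha0).1 j le_rfl hN x hx).eq hF htop, Finsupp.add_apply, Finsupp.smul_apply,
    smul_eq_mul, simplexCode_eq_zero hc hx, add_zero]

/-- A vector cannot vanish at the top difference to `s v_j + c` if some value below that of `v_j`
also leads to zero. -/
theorem not_rel (hF : IsTwisted F ξ η κ) (h : LexSimplex F ξ η v t (j + 1)) {z c : Vec 3}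
    (hz : z ∈ farSet (t 0) (simplexCode v j : Set (Vec 3))) (hc : c ∈ simplexCode v j)
    {s r : ZMod 3} (hs : s ≠ 0) {N : ℕ} (hN : N ∈ suppUnion v j)
    (htop : ∀ i, N < i → F.repr z i = F.repr (s • v j + c) i)
    (hz0 : F.repr z N = 0) (hr : r.val < (F.repr (v j) N).val) (hrel : s * r + F.repr c N = 0) :
    False := by
  classical
  have ha0 : F.repr (v j) N ≠ 0 := fun e => by rw [e, ZMod.val_zero] at hr; omega
  have hcard := h.card_eq (Nat.lt_succ_self j) hz (h.outWeight_smul_eq (Nat.lt_succ_self j) hs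
    fun x hx => h.apply_of_notMem hF hc hN htop ha0 hx).le hN
  obtain ⟨U, hU, W, hW, hUW, hU', hW'⟩ := (h.anchor hF hN ha0).2.2 (r + twist ξ η κ N (v j)) (by
    rwa [add_sub_cancel_right, ← hF.repr_eq])
  have hdisj : Disjoint U W := disjoint_left.2 fun x hx hx' => by
    have h1 := (hU' x hx).1
    rw [(hW' x hx').1, ← sub_eq_iff_eq_add, ← hF.repr_eq] at h1
    rw [h1] at hr
    omega
  -- At the indices of U the row has coordinate r, which leads to the same value of z as the
  -- vanishing coordinate at N does on W. So one fibre of z has more than t j elements.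
  have hsub : U ∪ W ⊆ {x ∈ colClass v j N | z x = s * twist ξ η κ N (v j) + twist ξ η κ N c} := by
    intro x hx
    rcases mem_union.1 hx with hx | hx
    · refine mem_filter.2 ⟨hU hx, ?_⟩
      obtain ⟨h1, h2⟩ := hU' x hx
      rw [h2.eq hF htop, Finsupp.add_apply, Finsupp.smul_apply, smul_eq_mul, h1,
        simplexCode_congr_colClass hc (hU hx)]
      rw [hF.repr_eq] at hrel
      linear_combination hrel
    · exact mem_filter.2 ⟨hW hx, h.anchor_apply hF hc hN htop hz0 ha0 (hW' x hx).2⟩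
  have h1 := card_le_card hsub
  rw [card_union_of_disjoint hdisj, hcard] at h1
  omega

/-- No smaller value of the row leads to 0 here, so one fibre alone is not overfull. Counting two
fibres together instead produces an index M at which the difference of z and the row deviates from w
i, opposite to the deviation at N; `not_forall_far` excludes this. -/
theorem not_one_one (hF : IsTwisted F ξ η κ) (h : LexSimplex F ξ η v t (j + 1))
    (hw : IsDigitSum w v j) {z : Vec 3} (hz : z ∈ farSet (t 0) (simplexCode v j : Set (Vec 3)))
    {i : ℕ} (hi : i < 3 ^ j) (hfar : ∀ i' < i, t 0 ≤ hdist z (v j + w i')) {N : ℕ}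
    (hN : N ∈ suppUnion v j) (htop : ∀ x, N < x → F.repr z x = F.repr (v j + w i) x)
    (hz0 : F.repr z N = 0) (ha : F.repr (v j) N = 1) (hb : F.repr (w i) N = 1) : False := by
  classical
  have hc : w i ∈ simplexCode v j := hw.mem le_rfl hi
  have ha0 : F.repr (v j) N ≠ 0 := by rw [ha]; decide
  have htop' : ∀ x, N < x → F.repr z x = F.repr ((1 : ZMod 3) • v j + w i) x := by rwa [one_smul]
  have hcard := h.card_eq (Nat.lt_succ_self j) hz (h.outWeight_smul_eq (Nat.lt_succ_self j)
    one_ne_zero fun x hx => h.apply_of_notMem hF hc hN htop' ha0 hx).le hN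
  obtain ⟨hout, hlt, hUW⟩ := h.anchor hF hN ha0
  obtain ⟨U, hU, W, hW, hUW, hU', hW'⟩ := hUW (twist ξ η κ N (v j)) (by
    rw [sub_self, ← hF.repr_eq, ha]; decide)
  set τ := twist ξ η κ N (v j) with hτ
  set σ := twist ξ η κ N (w i) with hσ
  have hvN : v j N = 1 + τ := by rw [hF.repr_eq] at ha; linear_combination ha
  have hwN : w i N = 1 + σ := by rw [hF.repr_eq] at hb; linear_combination hb
  have hzU : ∀ x ∈ U, z x = 1 + τ + σ := fun x hx => by
    obtain ⟨h1, h2⟩ := hU' x hx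
    rw [h2.eq hF htop, Finsupp.add_apply, h1, simplexCode_congr_colClass hc (hU hx), hwN]
    ring
  have hzW : ∀ x ∈ W, z x = τ + σ := fun x hx => by
    rw [h.anchor_apply hF hc hN htop' hz0 ha0 (hW' x hx).2, one_mul]
  -- Otherwise the t j indices where the row is 2 + τ would lie in the other two fibres of z. These
  -- have 2 t j elements, of which at least t j + 1 are occupied by U and W.
  obtain ⟨M, hM, hvM, hzM⟩ : ∃ M ∈ colClass v j N, v j M = 2 + τ ∧ z M = 2 + τ + σ := by
    by_contra hno
    push Not at hno
    have hsub : {x ∈ colClass v j N | v j x = 2 + τ} ⊆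
        ({x ∈ colClass v j N | z x = 1 + τ + σ} \ U) ∪ ({x ∈ colClass v j N | z x = τ + σ} \ W) := by
      intro x hx
      obtain ⟨hx, hvx⟩ := mem_filter.1 hx
      have hxU : x ∉ U := fun hxU => by
        have := (hU' x hxU).1
        rw [hvx] at this
        exact absurd (add_right_cancel (this.trans (zero_add τ).symm)) (by decide)
      have hxW : x ∉ W := fun hxW => by
        have := (hW' x hxW).1
        rw [hvx, hvN] at this
        exact absurd (add_right_cancel this) (by decide)
      have h2 := hno x hx hvx
      have h3 : ∀ a b : ZMod 3, a ≠ 2 + b → a = 1 + b ∨ a = b := by decide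
      rw [add_assoc] at h2
      rcases h3 _ _ h2 with h4 | h4
      · exact mem_union_left _ (mem_sdiff.2 ⟨mem_filter.2 ⟨hx, by rw [h4, add_assoc]⟩, hxU⟩)
      · exact mem_union_right _ (mem_sdiff.2 ⟨mem_filter.2 ⟨hx, h4⟩, hxW⟩)
    have h1 := card_le_card hsub
    have h2 := card_union_le ({x ∈ colClass v j N | z x = 1 + τ + σ} \ U)
      ({x ∈ colClass v j N | z x = τ + σ} \ W)
    have h3 : U ⊆ {x ∈ colClass v j N | z x = 1 + τ + σ} := fun x hx =>
      mem_filter.2 ⟨hU hx, hzU x hx⟩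
    have h4 : W ⊆ {x ∈ colClass v j N | z x = τ + σ} := fun x hx =>
      mem_filter.2 ⟨hW hx, hzW x hx⟩
    have h5 := card_le_card h3
    have h6 := card_le_card h4
    rw [card_sdiff_of_subset h3, card_sdiff_of_subset h4] at h2
    rw [h.simplex.unif j (Nat.lt_succ_self j) N hN] at h1
    rw [hcard] at h2 h5
    rw [hcard] at h2 h6
    have := h.two j (Nat.lt_succ_self j)
    omega
  have hyeq : ∀ {x}, Beyond ξ η N x → (z - v j) x = w i x := fun hx => by
    rw [Finsupp.sub_apply, hx.eq hF htop, Finsupp.add_apply, add_sub_cancel_left]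
  have hzN : z N = τ + σ := by
    rw [h.anchor_apply hF hc hN htop' hz0 ha0 (Or.inl rfl), one_mul]
  -- Modulo 3, the difference of z and the row is σ - 1 = w i N + 1 at N and σ = w i M - 1 at M.
  refine (h.mono (Nat.le_succ j)).not_forall_far hF hw le_rfl (mem_colClass.1 hM).2 hi (y := z - v j)
    (fun x hx => ?_) (fun b hb => ?_) hb ?_ ?_ (fun l hl hNl x hx hvx => hyeq (hlt l hl hNl x hx hvx))
    fun l hl hNl x hx => hyeq (hout l hl.le hNl x hx)
  · rw [hyeq (hout j le_rfl hN x hx), simplexCode_eq_zero hc hx]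
  · rw [hdist_eq_of_sub_eq (show z - v j - w b = z - (v j + w b) by abel)]
    exact hfar b hb
  · rw [Finsupp.sub_apply, hzN, hvN, hwN]
    linear_combination (-1 : ZMod 3) * (by decide : (3 : ZMod 3) = 0)
  · rw [Finsupp.sub_apply, hzM, hvM, hwN]
    ring

end LexSimplex

end

section Words

theorem val_le_of_not_lt {p : ℕ} {F : OrdBasis p} {x y : Vec p} {N : ℕ}
    (h : ∀ i, N < i → F.repr x i = F.repr y i) (hlt : ¬ BasisLT F x y) :
    (F.repr y N).val ≤ (F.repr x N).val := by
  by_contra hle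
  exact hlt ⟨N, not_le.1 hle, h⟩

/-- A word is determined by being far from the preceding ones and minimal with this property. -/
theorem word_eq {p : ℕ} [Fact p.Prime] {F : OrdBasis p} {d a : ℕ} {u : Vec p}
    (hfar : ∀ b < a, d ≤ hdist u (word F d b))
    (hmin : ∀ z, (∀ b < a, d ≤ hdist z (word F d b)) → ¬ BasisLT F z u) : word F d a = u := by
  by_contra hne
  rcases basisLT_or_of_ne F hne with h | h
  · exact hmin _ (fun b hb => word_far hb) h
  · exact word_min hfar h

variable {F : OrdBasis 3} {ξ η : ℕ} {κ : ZMod 3} {t : ℕ → ℕ} {d j : ℕ}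

/-- In this and the next two lemmas a, b, c are the coordinates of the row, of w i and of a smaller
competitor z at the top difference. The hypotheses say that removing one summand from z cannot beat
the other one. -/
theorem top_config_one : ∀ a b c : ZMod 3, c.val < (a + b).val → b.val ≤ (c - a).val →
    a.val ≤ (c - b).val → a = 1 ∧ b = 1 ∧ c = 0 := by decide

theorem top_config_two : ∀ a c : ZMod 3, c.val < (2 * a).val → a.val ≤ (c - a).val →
    a = 1 ∧ c = 0 := by decide

theorem top_config_three (a : ZMod 3) : ∀ b c : ZMod 3, c.val < (2 * a + b).val →
    (a + b).val ≤ (c - a).val → (2 * a).val ≤ (c - b).val → a = 2 ∧ b = 1 ∧ c = 0 := by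
  have : a = 0 ∨ a = 1 ∨ a = 2 := by revert a; decide
  rcases this with rfl | rfl | rfl <;> decide

theorem exists_lt_digit {j a s i : ℕ} (hi : i < 3 ^ j) (ha : a < s * 3 ^ j + i) :
    ∃ s' i', i' < 3 ^ j ∧ a = s' * 3 ^ j + i' ∧ (s' < s ∨ s' = s ∧ i' < i) := by
  have hpos : 0 < 3 ^ j := by positivity
  have h1 : a / 3 ^ j * 3 ^ j + a % 3 ^ j = a := by rw [mul_comm]; exact Nat.div_add_mod _ _
  have h2 := Nat.mod_lt a hpos
  refine ⟨a / 3 ^ j, a % 3 ^ j, h2, h1.symm, ?_⟩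
  rcases lt_trichotomy (a / 3 ^ j) s with h | h | h
  · exact Or.inl h
  · rw [h] at h1
    exact Or.inr ⟨h, by omega⟩
  · exfalso
    have : (s + 1) * 3 ^ j ≤ a / 3 ^ j * 3 ^ j := Nat.mul_le_mul_right _ h
    rw [add_mul, one_mul] at this
    omega

set_option maxHeartbeats 1000000 in
-- The candidate s v_j + w_i is far from all preceding words, so only minimality is at stake. A
-- smaller competitor is reduced to one configuration at the top difference, located in the old
-- support by `mem_suppUnion_of_top`; digit 1 is excluded by `not_one_one` and digit 2 by `not_rel`.
theorem LexSimplex.word_add (hF : IsTwisted F ξ η κ)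
    (h : LexSimplex F ξ η (fun l => word F d (3 ^ l)) t (j + 1)) (hd : t 0 = d)
    (hw : IsDigitSum (word F d) (fun l => word F d (3 ^ l)) j) {s : ℕ} (hs : s < 3) {i : ℕ}
    (hi : i < 3 ^ j) :
    word F d (s * 3 ^ j + i) = (s : ZMod 3) • word F d (3 ^ j) + word F d i := by
  classical
  set v : ℕ → Vec 3 := fun l => word F d (3 ^ l) with hv
  have hvj : word F d (3 ^ j) = v j := rfl
  have hj := Nat.lt_succ_self j
  have hmem : ∀ {i}, i < 3 ^ j → word F d i ∈ simplexCode v j := fun hi => hw.mem le_rfl hi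
  have hcode : ∀ {z : Vec 3}, (∀ b < 3 ^ j, d ≤ hdist z (word F d b)) →
      z ∈ farSet (t 0) (simplexCode v j : Set (Vec 3)) := by
    intro z hz c hc
    obtain ⟨b, hb, rfl⟩ := hw.exists_eq le_rfl hc
    exact hd ▸ hz b hb
  have hvfar := h.mem j hj
  -- distances between translates of the code
  have hfar : ∀ (s s' : ℕ), s' < s → s < 3 → ∀ c ∈ simplexCode v j, ∀ c' ∈ simplexCode v j,
      d ≤ hdist ((s : ZMod 3) • v j + c) ((s' : ZMod 3) • v j + c') := by
    intro s s' hss' hs c hc c' hc'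
    have hne : (s : ZMod 3) - s' ≠ 0 := by
      have h3 : s < 3 := hs
      interval_cases s <;> interval_cases s' <;> decide
    rw [hdist_eq_of_sub_eq (show (s : ZMod 3) • v j + c - ((s' : ZMod 3) • v j + c') =
      ((s : ZMod 3) - s') • v j - (c' - c) by rw [sub_smul]; abel), ← hd]
    exact smul_mem_farSet hne hvfar _ (Submodule.sub_mem _ hc' hc)
  have hzero : ∀ i, i < 3 ^ j → word F d (0 * 3 ^ j + i) = ((0 : ℕ) : ZMod 3) • v j + word F d i := by
    intro i _
    simp
  -- the candidate is far from the preceding words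
  have hcand : ∀ s i, s < 3 → i < 3 ^ j →
      (∀ s' i' : ℕ, i' < 3 ^ j → (s' < s ∨ s' = s ∧ i' < i) →
        word F d (s' * 3 ^ j + i') = (s' : ZMod 3) • v j + word F d i') →
      ∀ a < s * 3 ^ j + i, d ≤ hdist ((s : ZMod 3) • v j + word F d i) (word F d a) := by
    intro s i hs hi hprev a ha
    obtain ⟨s', i', hi', rfl, hlt⟩ := exists_lt_digit hi ha
    rw [hprev s' i' hi' hlt]
    rcases hlt with hlt | ⟨rfl, hlt⟩
    · exact hfar s s' hlt hs _ (hmem hi) _ (hmem hi')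
    · rw [hdist_eq_of_sub_eq (show (s' : ZMod 3) • v j + word F d i -
        ((s' : ZMod 3) • v j + word F d i') = word F d i - word F d i' by abel)]
      exact word_far hlt
  have hpre : ∀ {s a : ℕ}, 0 < s → a < 3 ^ j → ∀ i, a < s * 3 ^ j + i := fun hs ha i => by
    have := Nat.le_mul_of_pos_left (3 ^ j) hs
    omega
  have hone : ∀ i, i < 3 ^ j → word F d (1 * 3 ^ j + i) = ((1 : ℕ) : ZMod 3) • v j + word F d i := by
    intro i
    induction i using Nat.strong_induction_on with
    | _ i ih =>
      intro hi
      have hprev : ∀ s' i' : ℕ, i' < 3 ^ j → (s' < 1 ∨ s' = 1 ∧ i' < i) →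
          word F d (s' * 3 ^ j + i') = (s' : ZMod 3) • v j + word F d i' := by
        rintro s' i' hi' (hs' | ⟨rfl, hlt⟩)
        · obtain rfl : s' = 0 := by omega
          exact hzero i' hi'
        · exact ih i' hlt hi'
      refine word_eq (hcand 1 i (by norm_num) hi hprev) fun z hz hlt => ?_
      rw [Nat.cast_one, one_smul] at hlt
      have hzC := hcode fun b hb => hz b (hpre one_pos hb i)
      have hz1 : ∀ i' < i, d ≤ hdist z (v j + word F d i') := fun i' hi' => by
        have := hz (1 * 3 ^ j + i') (by omega)
        rwa [ih i' hi' (by omega), Nat.cast_one, one_smul] at this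
      obtain ⟨N, hN, htop⟩ := hlt
      have h1 : ¬ BasisLT F (z - v j) (word F d i) := word_min fun b hb => by
        rw [hdist_eq_of_sub_eq (show z - v j - word F d b = z - (v j + word F d b) by abel)]
        exact hz1 b hb
      have h2 : ¬ BasisLT F (z - word F d i) (v j) := h.min j hj _ (sub_mem_farSet hzC (hmem hi))
      have h3 := val_le_of_not_lt (N := N) (fun x hx => by simp [htop x hx]) h1
      have h4 := val_le_of_not_lt (N := N) (fun x hx => by simp [htop x hx]) h2
      simp only [map_add, map_sub, Finsupp.add_apply, Finsupp.sub_apply] at hN h3 h4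
      obtain ⟨ha, hb, hc⟩ := top_config_one _ _ _ hN h3 h4
      have hNj : N ∈ suppUnion v j := h.mem_suppUnion_of_top hF hzC (hmem hi) (s := 1)
        (fun x hx => by rw [htop x hx, one_smul]) hc (by rw [ha]; decide) (Or.inr ha)
      exact h.not_one_one hF hw hzC hi (fun i' hi' => hd ▸ hz1 i' hi') hNj htop hc ha hb
  -- Subtracting the row lowers the leading digit by one, so the difference is admissible at the
  -- stage of v_j + w_i, which is already known.
  have htwo_sub : ∀ {i} {z : Vec 3}, i < 3 ^ j → (∀ s' i' : ℕ, i' < 3 ^ j → (s' < 2 ∨ s' = 2 ∧ i' < i) →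
      d ≤ hdist z ((s' : ZMod 3) • v j + word F d i')) →
      ¬ BasisLT F (z - v j) (v j + word F d i) := by
    intro i z hi hz
    have := hone i hi
    rw [Nat.cast_one, one_smul] at this
    rw [← this]
    refine word_min fun a ha => ?_
    obtain ⟨s', i', hi', rfl, hlt⟩ := exists_lt_digit hi ha
    have h01 : s' = 0 ∨ s' = 1 := by omega
    have hw' : word F d (s' * 3 ^ j + i') = (s' : ZMod 3) • v j + word F d i' := by
      rcases h01 with rfl | rfl
      · exact hzero i' hi'
      · exact hone i' hi'
    rw [hw', hdist_eq_of_sub_eq (show z - v j - ((s' : ZMod 3) • v j + word F d i') =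
      z - (((s' + 1 : ℕ) : ZMod 3) • v j + word F d i') by push_cast; rw [add_smul, one_smul]; abel)]
    exact hz (s' + 1) i' hi' (by omega)
  have hprev2 : ∀ i, (∀ i' < i, i' < 3 ^ j →
      word F d (2 * 3 ^ j + i') = ((2 : ℕ) : ZMod 3) • v j + word F d i') →
      ∀ s' i' : ℕ, i' < 3 ^ j → (s' < 2 ∨ s' = 2 ∧ i' < i) →
        word F d (s' * 3 ^ j + i') = (s' : ZMod 3) • v j + word F d i' := by
    rintro i ih s' i' hi' (hs' | ⟨rfl, hlt⟩)
    · have h01 : s' = 0 ∨ s' = 1 := by omega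
      rcases h01 with rfl | rfl
      · exact hzero i' hi'
      · exact hone i' hi'
    · exact ih i' hlt hi'
  have hz2 : ∀ {i} {z : Vec 3}, (∀ s' i' : ℕ, i' < 3 ^ j → (s' < 2 ∨ s' = 2 ∧ i' < i) →
        word F d (s' * 3 ^ j + i') = (s' : ZMod 3) • v j + word F d i') →
      (∀ b < 2 * 3 ^ j + i, d ≤ hdist z (word F d b)) →
      ∀ s' i' : ℕ, i' < 3 ^ j → (s' < 2 ∨ s' = 2 ∧ i' < i) →
      d ≤ hdist z ((s' : ZMod 3) • v j + word F d i') := by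
    intro i z hprev hz s' i' hi' hlt
    rw [← hprev s' i' hi' hlt]
    refine hz _ ?_
    rcases hlt with hlt | ⟨rfl, hlt⟩
    · have : s' * 3 ^ j ≤ 1 * 3 ^ j := Nat.mul_le_mul_right _ (by omega)
      omega
    · omega
  have htwo0 : word F d (2 * 3 ^ j) = (2 : ZMod 3) • v j := by
    have hpos : 0 < 3 ^ j := by positivity
    have hw0 : word F d 0 = 0 := hw.zero
    have hprev := hprev2 0 (fun i' hi' => absurd hi' (by omega))
    refine word_eq (fun b hb => ?_) fun z hz hlt => ?_
    · have := hcand 2 0 (by norm_num) hpos hprev b hb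
      rwa [hw0, add_zero] at this
    · have hz' := hz2 hprev hz
      have hzC := hcode fun b hb => hz b (hpre two_pos hb 0)
      obtain ⟨N, hN, htop⟩ := hlt
      have h1 := htwo_sub hpos hz'
      rw [hw0, add_zero] at h1
      have h3 := val_le_of_not_lt (N := N) (fun x hx => by
        rw [map_sub, Finsupp.sub_apply, htop x hx, map_smul, Finsupp.smul_apply, smul_eq_mul]
        ring) h1
      simp only [map_smul, map_sub, Finsupp.smul_apply, Finsupp.sub_apply, smul_eq_mul] at hN h3
      obtain ⟨ha, hc⟩ := top_config_two _ _ hN h3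
      have htop' : ∀ x, N < x → F.repr z x = F.repr ((2 : ZMod 3) • v j + 0) x := fun x hx => by
        rw [htop x hx, add_zero]
      have hNj : N ∈ suppUnion v j := h.mem_suppUnion_of_top hF hzC (Submodule.zero_mem _)
        htop' hc (by rw [ha]; decide) (Or.inr ha)
      exact h.not_rel hF hzC (Submodule.zero_mem _) (by decide) hNj htop' hc (r := 0)
        (by rw [ha]; decide) (by simp)
  have htwo : ∀ i, i < 3 ^ j → word F d (2 * 3 ^ j + i) = ((2 : ℕ) : ZMod 3) • v j + word F d i := by
    intro i
    induction i using Nat.strong_induction_on with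
    | _ i ih =>
      intro hi
      rcases Nat.eq_zero_or_pos i with rfl | hipos
      · rw [add_zero, htwo0, hw.zero, add_zero]
        rfl
      have hprev := hprev2 i ih
      refine word_eq (hcand 2 i (by norm_num) hi hprev) fun z hz hlt => ?_
      have hz' := hz2 hprev hz
      have hzC := hcode fun b hb => hz b (hpre two_pos hb i)
      obtain ⟨N, hN, htop⟩ := hlt
      have h1 := htwo_sub hi hz'
      have h2 : ¬ BasisLT F (z - word F d i) ((2 : ZMod 3) • v j) := by
        rw [← htwo0]
        refine word_min fun a ha => ?_
        obtain ⟨s', i', hi', rfl, hlt⟩ := exists_lt_digit (i := 0) (by positivity) ha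
        rw [hprev2 0 (fun _ h' => absurd h' (by omega)) s' i' hi' hlt]
        obtain ⟨i₁, hi₁, he⟩ := hw.exists_eq le_rfl (Submodule.add_mem _ (hmem hi') (hmem hi))
        rw [hdist_eq_of_sub_eq (show z - word F d i - ((s' : ZMod 3) • v j + word F d i') =
          z - ((s' : ZMod 3) • v j + (word F d i' + word F d i)) by abel), he]
        exact hz' s' i₁ hi₁ (Or.inl (by omega))
      have h3 := val_le_of_not_lt (N := N) (fun x hx => by
        simp only [map_sub, Finsupp.sub_apply, htop x hx, map_add, map_smul, Finsupp.add_apply,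
          Finsupp.smul_apply, smul_eq_mul]
        push_cast
        ring) h1
      have h4 := val_le_of_not_lt (N := N) (fun x hx => by
        simp only [map_sub, Finsupp.sub_apply, htop x hx, map_add, map_smul, Finsupp.add_apply,
          Finsupp.smul_apply, smul_eq_mul]
        push_cast
        ring) h2
      simp only [map_add, map_smul, map_sub, Finsupp.add_apply, Finsupp.smul_apply,
        Finsupp.sub_apply, smul_eq_mul] at hN h3 h4
      obtain ⟨ha, hb, hc⟩ := top_config_three _ _ _ hN h3 h4
      have hNj : N ∈ suppUnion v j := h.mem_suppUnion_of_top hF hzC (hmem hi) (s := 2)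
        htop hc (by rw [ha]; decide) (Or.inl (by rw [hb]; decide))
      exact h.not_rel hF hzC (hmem hi) (by decide) hNj htop hc (r := 1)
        (by rw [ha]; decide) (by rw [hb]; decide)
  have hs3 : s = 0 ∨ s = 1 ∨ s = 2 := by omega
  rcases hs3 with rfl | rfl | rfl
  · exact hzero i hi
  · exact hone i hi
  · exact htwo i hi

theorem IsDigitSum.simplexCode_eq (hw : IsDigitSum (word F d) (fun l => word F d (3 ^ l)) j) :
    (simplexCode (fun l => word F d (3 ^ l)) j : Set (Vec 3)) = lexCode F d j := by
  ext x
  constructor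
  · intro hx
    obtain ⟨i, hi, rfl⟩ := hw.exists_eq le_rfl hx
    exact word_mem_lexCode hi
  · rintro ⟨i, hi, rfl⟩
    exact hw.mem le_rfl hi

/-- The words at the powers of three form the generator matrix of a replicated simplex code. -/
theorem lexSimplex_word (hF : IsTwisted F ξ η κ) (hd : t 0 = d) {k : ℕ}
    (hstep : ∀ l, l + 1 < k → t l = 3 * t (l + 1)) (htwo : ∀ l < k, 2 ≤ t l) :
    LexSimplex F ξ η (fun l => word F d (3 ^ l)) t k ∧
      IsDigitSum (word F d) (fun l => word F d (3 ^ l)) k := by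
  suffices ∀ j ≤ k, LexSimplex F ξ η (fun l => word F d (3 ^ l)) t j ∧
      IsDigitSum (word F d) (fun l => word F d (3 ^ l)) j from this k le_rfl
  intro j
  induction j with
  | zero => exact fun _ => ⟨LexSimplex.zero, word_zero, by simp⟩
  | succ j ih =>
    intro hj
    obtain ⟨h, hw⟩ := ih (by omega)
    have hcode := hw.simplexCode_eq
    have h' : LexSimplex F ξ η (fun l => word F d (3 ^ l)) t (j + 1) := by
      refine h.succ hF (htwo j hj) (fun l hl => ?_) ?_ fun z hz => ?_
      · subst hl; exact hstep l hj
      · rw [hcode, hd]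
        exact word_pow_mem_farSet j
      · rw [hcode, hd] at hz
        exact word_pow_min hz
    refine ⟨h', hw.zero, fun l hl s hs i hi => ?_⟩
    rcases (Nat.lt_succ_iff.1 hl).eq_or_lt with rfl | hl
    · exact h'.word_add hF hd hw hs hi
    · exact hw.add l hl s hs i hi

theorem isLinearCode_lexCode_three (hF : F ∈ basisFamily 3) {k d' : ℕ} (hd' : 2 ≤ d') :
    IsLinearCode (lexCode F (3 ^ (k - 1) * d') k) := by
  obtain ⟨ξ, η, κ, hF⟩ := exists_isTwisted hF
  -- Row l is to have 3^(k-1-l) d' new entries. The last of these numbers is d', so d' ≥ 2 keeps all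
  -- of them at least 2, as the exchange arguments require.
  obtain ⟨-, hw⟩ := lexSimplex_word hF (t := fun l => 3 ^ (k - 1 - l) * d') rfl (k := k)
    (fun l hl => by
      have : k - 1 - l = k - 1 - (l + 1) + 1 := by omega
      simp only [this, pow_succ]
      ring) (fun l _ => hd'.trans (Nat.le_mul_of_pos_left _ (by positivity)))
  exact ⟨_, hw.simplexCode_eq⟩

end Words

end LexCode

/-! ### The next ternary word when the number of new entries is not divisible by three -/

namespace LexCode

open Finset

/-- Subsets with prescribed fibre sizes that contain a given small set. -/
theorem exists_subset_of_card_fiber {B A : Finset ℕ} (f : ℕ → ZMod 3) {m : ZMod 3 → ℕ}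
    (hm : ∀ a, m a ≤ #{x ∈ B | f x = a}) (hA : A ⊆ B) (hA' : ∀ a, #A ≤ m a) :
    ∃ X ⊆ B, A ⊆ X ∧ ∀ a, #{x ∈ X | f x = a} = m a := by
  classical
  have hex : ∀ a, ∃ Y, {x ∈ A | f x = a} ⊆ Y ∧ Y ⊆ {x ∈ B | f x = a} ∧ #Y = m a := fun a =>
    exists_subsuperset_card_eq (filter_subset_filter _ hA) ((card_filter_le _ _).trans (hA' a))
      (hm a)
  choose Y hY1 hY2 hY3 using hex
  have hfib : ∀ a, {x ∈ univ.biUnion Y | f x = a} = Y a := by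
    intro a
    ext x
    simp only [mem_filter, mem_biUnion, mem_univ, true_and]
    constructor
    · rintro ⟨⟨b, hb⟩, rfl⟩
      rwa [← (mem_filter.1 (hY2 b hb)).2] at hb
    · exact fun hx => ⟨⟨a, hx⟩, (mem_filter.1 (hY2 a hx)).2⟩
  refine ⟨univ.biUnion Y, ?_, fun x hx => ?_, fun a => by rw [hfib, hY3]⟩
  · exact biUnion_subset.2 fun a _ => (hY2 a).trans (filter_subset _ _)
  · exact mem_biUnion.2 ⟨f x, mem_univ _, hY1 _ (mem_filter.2 ⟨hx, rfl⟩)⟩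

/-- Fibre sizes after moving by `e` on `X` and by `-e` on the complement. -/
theorem card_filter_shift {B X : Finset ℕ} (hX : X ⊆ B) (f : ℕ → ZMod 3) (e a : ZMod 3) :
    #{x ∈ B | (if x ∈ X then f x + e else f x - e) = a} + #{x ∈ X | f x = a + e} =
      #{x ∈ X | f x = a - e} + #{x ∈ B | f x = a + e} := by
  classical
  have h1 : {x ∈ B | (if x ∈ X then f x + e else f x - e) = a} =
      {x ∈ X | f x = a - e} ∪ {x ∈ B \ X | f x = a + e} := by
    ext x
    simp only [mem_filter, mem_union, mem_sdiff]
    by_cases hx : x ∈ X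
    · simp [hx, hX hx, eq_sub_iff_add_eq]
    · simp [hx, sub_eq_iff_eq_add]
  have h2 : {x ∈ B | f x = a + e} = {x ∈ B \ X | f x = a + e} ∪ {x ∈ X | f x = a + e} := by
    rw [← filter_union, sdiff_union_of_subset hX]
  rw [h1, h2, card_union_of_disjoint, card_union_of_disjoint]
  · ring
  · exact disjoint_filter_filter sdiff_disjoint
  · exact disjoint_filter_filter disjoint_sdiff

section

variable {F : OrdBasis 3} {ξ η : ℕ} {κ : ZMod 3} {v : ℕ → Vec 3} {t : ℕ → ℕ} {j τ s : ℕ} {y : Vec 3}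

theorem IsSimplex.colClass_of_notMem (h : IsSimplex v t (j + 1)) {N : ℕ}
    (hN : N ∈ suppUnion v (j + 1)) (hNj : N ∉ suppUnion v j) :
    colClass v (j + 1) N = suppUnion v (j + 1) \ suppUnion v j := by
  have hS : ∀ {x}, x ∈ suppUnion v (j + 1) → x ∉ suppUnion v j → v j x = 1 := fun {x} hx hxj => by
    refine h.one j (by omega) x hxj ?_
    rw [suppUnion_succ, mem_union] at hx
    exact Finsupp.mem_support_iff.1 (hx.resolve_left hxj)
  ext x
  rw [mem_colClass' hN, mem_sdiff]
  constructor
  · intro hx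
    have hxj : x ∉ suppUnion v j := fun hxj => by
      obtain ⟨l, hl, h0⟩ := mem_suppUnion.1 hxj
      exact h0 (by rw [hx l (by omega), eq_zero_of_notMem_suppUnion hNj hl])
    exact ⟨mem_suppUnion.2 ⟨j, by omega, by rw [hx j (by omega), hS hN hNj]; decide⟩, hxj⟩
  · rintro ⟨hx, hxj⟩ l hl
    rcases (Nat.lt_succ_iff.1 hl).eq_or_lt with rfl | hl
    · rw [hS hx hxj, hS hN hNj]
    · rw [eq_zero_of_notMem_suppUnion hNj hl, eq_zero_of_notMem_suppUnion hxj hl]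

/-- Gaps of a closed set occur only below ξ and η, and only if ξ < η. -/
theorem IsClosedDown.special {S : Finset ℕ} (h : IsClosedDown ξ η S) (hne : ξ ≠ η) {N x : ℕ}
    (hN : N ∉ S) (hx : x ∈ S) (hNx : N < x) : ξ < η ∧ (x = ξ ∨ x = η) := by
  rcases lt_or_gt_of_ne hne with hB | hA
  · refine ⟨hB, ?_⟩
    by_contra hsp
    rw [not_or] at hsp
    exact hN (h.right hB x hx hsp.1 hsp.2 N hNx)
  · exact absurd (h.left hA x hx N hNx) hN

theorem card_sdiff_suppUnion : #(suppUnion v (j + 1) \ suppUnion v j) =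
    outWeight (suppUnion v j) (v j) := by
  rw [suppUnion_succ, union_sdiff_left, outWeight]

namespace LexSimplex

theorem isMinStep_of_mod (h : LexSimplex F ξ η v t (j + 1)) (hs : s ≤ 2) (hτ : t j + s = 3 * τ)
    (h2 : s + 2 ≤ τ) (hy : y ∈ farSet (t 0) (simplexCode v (j + 1) : Set (Vec 3)))
    (hmin : ∀ z ∈ farSet (t 0) (simplexCode v (j + 1) : Set (Vec 3)), ¬ BasisLT F z y) :
    IsMinStep F ξ η (suppUnion v (j + 1)) τ
      (farSet (t 0) (simplexCode v (j + 1) : Set (Vec 3))) y :=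
  h.simplex.isMinStep (fun _ hl => h.pos hl) hs (fun e => absurd e (by omega))
    (fun l hl => by obtain rfl : l = j := by omega
                    exact hτ) h2 (h.closed _ le_rfl) hy hmin

/-- The distribution of the values of the next word on the support of the last row. -/
theorem card_two_of_mod (hF : IsTwisted F ξ η κ) (h : LexSimplex F ξ η v t (j + 1)) (hs : s ≤ 2)
    (hτ : t j + s = 3 * τ) (h2 : s + 2 ≤ τ)
    (hy : y ∈ farSet (t 0) (simplexCode v (j + 1) : Set (Vec 3)))
    (hmin : ∀ z ∈ farSet (t 0) (simplexCode v (j + 1) : Set (Vec 3)), ¬ BasisLT F z y) :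
    #{x ∈ suppUnion v (j + 1) \ suppUnion v j | y x = 0} = τ ∧
    #{x ∈ suppUnion v (j + 1) \ suppUnion v j | y x = 1} = τ ∧
    #{x ∈ suppUnion v (j + 1) \ suppUnion v j | y x = 2} = τ - s := by
  classical
  have hM := h.isMinStep_of_mod hs hτ h2 hy hmin
  have hout := hM.outWeight_eq hF
  have hcl := h.closed j (by omega)
  have hlt := Nat.lt_succ_self j
  set S := suppUnion v (j + 1) with hS
  set T := S \ suppUnion v j with hT
  have hTcard : #T = t j := card_sdiff_suppUnion.trans (h.simplex.new j hlt)
  have hTclass : ∀ N ∈ T, colClass v (j + 1) N = T := fun N hN =>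
    h.simplex.colClass_of_notMem (mem_sdiff.1 hN).1 (mem_sdiff.1 hN).2
  have hpos := h.pos hlt
  obtain ⟨N₀, hN₀⟩ : T.Nonempty := card_pos.1 (by omega)
  have hle : ∀ a, #{x ∈ T | y x = a} ≤ τ := fun a => by
    have := h.simplex.card_le_outWeight hy (mem_sdiff.1 hN₀).1 a
    rwa [hTclass N₀ hN₀, hout] at this
  have hsum := card_eq_sum_three T y
  have h0 := hle 0
  have h1 := hle 1
  suffices hmain : ¬ τ - s < #{x ∈ T | y x = 2} by omega
  intro hgt
  -- change some entries `2` to `0` or `1`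
  set A : Finset ℕ := {x ∈ T | y x = 2 ∧ x ≠ ξ ∧ x ≠ η} with hA
  have hAcard : #{x ∈ T | y x = 2} ≤ #A + 2 := by
    have : {x ∈ T | y x = 2} ⊆ A ∪ {ξ, η} := by
      intro x hx
      obtain ⟨hx, hx2⟩ := mem_filter.1 hx
      by_cases hsp : x = ξ ∨ x = η
      · exact mem_union_right _ (by simpa using hsp)
      · rw [not_or] at hsp
        exact mem_union_left _ (mem_filter.2 ⟨hx, hx2, hsp⟩)
    have h3 := card_le_card this
    have h4 := card_union_le A {ξ, η}
    have h5 : #({ξ, η} : Finset ℕ) ≤ 2 := card_le_two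
    omega
  -- The values 0 and 1 together lack as many entries as the value 2 has in excess of τ - s. The
  -- ordinary indices suffice for the change because τ - s ≥ 2.
  obtain ⟨Q, hQA, hQ⟩ := exists_subset_card_eq
    (show (τ - #{x ∈ T | y x = 0}) + (τ - #{x ∈ T | y x = 1}) ≤ #A by omega)
  obtain ⟨Q₀, hQ₀, hQ₀c⟩ := exists_subset_card_eq
    (show τ - #{x ∈ T | y x = 0} ≤ #Q by omega)
  have hQT : ∀ x ∈ Q, x ∈ T ∧ y x = 2 ∧ x ≠ ξ ∧ x ≠ η := fun x hx => mem_filter.1 (hQA hx)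
  have hQne : Q.Nonempty := card_pos.1 (by omega)
  -- The missing entries must follow a codeword. As v_j is 1 on T, twice the last row makes 2 the
  -- deficient value there.
  have hc₀ : (2 : ZMod 3) • v j ∈ simplexCode v (j + 1) :=
    Submodule.smul_mem _ _ (mem_simplexCode_of_lt hlt)
  have hvT : ∀ x ∈ T, v j x = 1 := fun x hx => by
    obtain ⟨h3, h4⟩ := mem_sdiff.1 hx
    refine h.simplex.one j hlt x h4 ?_
    rw [hS, suppUnion_succ, mem_union] at h3
    exact Finsupp.mem_support_iff.1 (h3.resolve_left h4)
  obtain ⟨z₀, hz₀, hz₀c, hz₀s⟩ := exists_vec_of_card_eq (v := v) (j := j + 1) y {ξ, η}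
    (n := fun N a => τ - if a = ((2 : ZMod 3) • v j) N then s else 0) (fun N hN => by
      rw [h.simplex.card_colClass hN]
      generalize ((2 : ZMod 3) • v j) N = e
      have h3 : e = 0 ∨ e = 1 ∨ e = 2 := by revert e; decide
      rcases h3 with rfl | rfl | rfl
      · rw [if_pos rfl, if_neg (by decide), if_neg (by decide)]; omega
      · rw [if_neg (by decide), if_pos rfl, if_neg (by decide)]; omega
      · rw [if_neg (by decide), if_neg (by decide), if_pos rfl]; omega)
    (fun N hN x hx => by rw [simplexCode_congr_colClass hc₀ hx])
    (fun N _ => card_le_two.trans (by split_ifs <;> omega))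
  set z : Vec 3 := Finsupp.onFinset (S ∪ y.support)
    (fun x => if x ∈ T then (if x ∈ Q₀ then 0 else if x ∈ Q then 1 else y x) else z₀ x)
    (fun x hx => by
      by_contra hxS
      rw [mem_union, not_or, Finsupp.notMem_support_iff] at hxS
      rw [if_neg fun hxT => hxS.1 (mem_sdiff.1 hxT).1, hz₀ x hxS.1] at hx
      exact hx hxS.2) with hz
  have hzT : ∀ x ∈ T, z x = if x ∈ Q₀ then 0 else if x ∈ Q then 1 else y x := fun x hx => by
    rw [hz, Finsupp.onFinset_apply, if_pos hx]
  have hzn : ∀ x, x ∉ T → z x = z₀ x := fun x hx => by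
    rw [hz, Finsupp.onFinset_apply, if_neg hx]
  have hzout : ∀ x, x ∉ S → z x = y x := fun x hx => by
    rw [hzn x fun hxT => hx (mem_sdiff.1 hxT).1, hz₀ x hx]
  have hcount0 : #{x ∈ T | z x = 0} = τ := by
    have : {x ∈ T | z x = 0} = {x ∈ T | y x = 0} ∪ Q₀ := by
      ext x
      rw [mem_union, mem_filter, mem_filter]
      constructor
      · rintro ⟨hx, hzx⟩
        rw [hzT x hx] at hzx
        split_ifs at hzx with h3 h4
        · exact Or.inr h3
        · exact absurd hzx (by decide)
        · exact Or.inl ⟨hx, hzx⟩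
      · rintro (⟨hx, hyx⟩ | hx)
        · have hxQ : x ∉ Q := fun hxQ => absurd (hyx.symm.trans (hQT x hxQ).2.1) (by decide)
          rw [hzT x hx, if_neg fun e => hxQ (hQ₀ e), if_neg hxQ]
          exact ⟨hx, hyx⟩
        · have := (hQT x (hQ₀ hx)).1
          rw [hzT x this, if_pos hx]
          exact ⟨this, rfl⟩
    rw [this, card_union_of_disjoint, hQ₀c]
    · omega
    · refine disjoint_left.2 fun x hx hx' => ?_
      exact absurd ((mem_filter.1 hx).2.symm.trans (hQT x (hQ₀ hx')).2.1) (by decide)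
  have hcount1 : #{x ∈ T | z x = 1} = τ := by
    have : {x ∈ T | z x = 1} = {x ∈ T | y x = 1} ∪ (Q \ Q₀) := by
      ext x
      rw [mem_union, mem_filter, mem_filter, mem_sdiff (s := Q)]
      constructor
      · rintro ⟨hx, hzx⟩
        rw [hzT x hx] at hzx
        split_ifs at hzx with h3 h4
        · exact absurd hzx (by decide)
        · exact Or.inr ⟨h4, h3⟩
        · exact Or.inl ⟨hx, hzx⟩
      · rintro (⟨hx, hyx⟩ | ⟨hx, hx'⟩)
        · have hxQ : x ∉ Q := fun hxQ => absurd (hyx.symm.trans (hQT x hxQ).2.1) (by decide)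
          rw [hzT x hx, if_neg fun e => hxQ (hQ₀ e), if_neg hxQ]
          exact ⟨hx, hyx⟩
        · have := (hQT x hx).1
          rw [hzT x this, if_neg hx', if_pos hx]
          exact ⟨this, rfl⟩
    rw [this, card_union_of_disjoint, card_sdiff_of_subset hQ₀, hQ, hQ₀c]
    · omega
    · refine disjoint_left.2 fun x hx hx' => ?_
      exact absurd ((mem_filter.1 hx).2.symm.trans (hQT x (mem_sdiff.1 hx').1).2.1) (by decide)
  have hcount2 : #{x ∈ T | z x = 2} = τ - s := by
    have := card_eq_sum_three T z
    omega
  have hzfar : z ∈ farSet (t 0) (simplexCode v (j + 1) : Set (Vec 3)) := by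
    refine h.simplex.mem_farSet (fun _ hl => h.pos hl) (s := s) (τ := τ) hτ hc₀ (fun N hN a => ?_) ?_
    · by_cases hNT : N ∈ T
      · rw [hTclass N hNT, Finsupp.smul_apply, hvT N hNT, smul_eq_mul, mul_one]
        have h3 : a = 0 ∨ a = 1 ∨ a = 2 := by revert a; decide
        rcases h3 with rfl | rfl | rfl
        · rw [if_neg (by decide), hcount0, add_zero]
        · rw [if_neg (by decide), hcount1, add_zero]
        · rw [if_pos rfl, hcount2]; omega
      · have hNj : N ∈ suppUnion v j := by
          by_contra hNj
          exact hNT (mem_sdiff.2 ⟨hN, hNj⟩)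
        have h3 : #{x ∈ colClass v (j + 1) N | z x = a} =
            #{x ∈ colClass v (j + 1) N | z₀ x = a} := by
          congr 1
          ext x
          rw [mem_filter, mem_filter]
          refine and_congr_right fun hx => ?_
          rw [hzn x fun hxT => hNT (hTclass x hxT ▸ mem_colClass_comm hN hx)]
        rw [h3, hz₀c N hN a]
        split_ifs <;> omega
    · rw [outWeight_congr hzout, hout]
  set N := Q.max' hQne with hN
  have hNQ : N ∈ Q := Q.max'_mem hQne
  obtain ⟨hNT, hyN, hNξ, hNη⟩ := hQT N hNQ
  have hNj := (mem_sdiff.1 hNT).2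
  have habove : ∀ i, N < i → i ∉ suppUnion v j → z i = y i := by
    intro i hi hij
    have hiQ : i ∉ Q := fun hiQ => absurd (Q.le_max' i hiQ) (not_le.2 hi)
    by_cases hiS : i ∈ S
    · rw [hzT i (mem_sdiff.2 ⟨hiS, hij⟩), if_neg fun e => hiQ (hQ₀ e), if_neg hiQ]
    · exact hzout i hiS
  have hsp : ∀ i ∈ suppUnion v j, i = ξ ∨ i = η → z i = 0 := by
    intro i hi hie
    rw [hzn i fun hiT => (mem_sdiff.1 hiT).2 hi]
    exact hz₀s i (by simpa using hie) (suppUnion_mono (Nat.le_succ j) hi)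
  -- At the topmost changed index of T an entry 2 has dropped. Old indices above it can only be ξ
  -- and η, where the refilled vector was chosen to vanish.
  refine hmin z hzfar (basisLT_of_le_above N ?_ fun i hi => ?_)
  · rw [hF.repr_of_ne hNη, hF.repr_of_ne hNη, hyN, hzT N hNT, if_pos hNQ]
    split_ifs <;> decide
  · by_cases hij : i ∈ suppUnion v j
    · obtain ⟨hB, hie⟩ := hcl.special hF.ne hNj hij hi
      have h3 : F.repr z i = 0 := by
        rcases hie with rfl | rfl
        · rw [hF.repr_of_ne hF.ne, hsp i hij (Or.inl rfl)]
        · rw [hF.repr_eta_of_lt hB, hsp i hij (Or.inr rfl),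
            hsp ξ ((hcl.mem_iff hB).2 hij) (Or.inl rfl), sub_zero]
      rw [h3, ZMod.val_zero]
      exact Nat.zero_le _
    · refine le_of_eq (congrArg _ (hF.repr_congr (habove i hi hij) fun hiη => ?_))
      subst hiη
      have hξj : ξ ∉ suppUnion v j := fun hξ => by
        rcases lt_or_gt_of_ne hF.ne with hB | hA
        · exact hij ((hcl.mem_iff hB).1 hξ)
        · exact hij (hcl.left hA ξ hξ i hA)
      by_cases hξS : ξ ∈ S
      · have hξQ : ξ ∉ Q := fun e => (hQT ξ e).2.2.1 rfl
        rw [hzT ξ (mem_sdiff.2 ⟨hξS, hξj⟩), if_neg fun e => hξQ (hQ₀ e), if_neg hξQ]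
      · exact hzout ξ hξS

end LexSimplex

end

end LexCode

/-! ### Failure of linearity over 𝔽₃ -/

namespace LexCode

open Finset

section

variable {F : OrdBasis 3} {ξ η : ℕ} {κ : ZMod 3} {v : ℕ → Vec 3} {t : ℕ → ℕ} {j τ s : ℕ} {y : Vec 3}

theorem IsSimplex.filter_colClass (h : IsSimplex v t j) {M x : ℕ} {l : ℕ} (hl : l < j)
    (hM : M ∈ suppUnion v l) (hx : x ∈ colClass v l M) :
    {i ∈ colClass v l M | v l i = v l x} = colClass v (l + 1) x := by
  ext i
  have hxS : x ∈ suppUnion v (l + 1) := suppUnion_mono (Nat.le_succ l) (mem_colClass.1 hx).1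
  rw [mem_filter, mem_colClass' hM, mem_colClass' hxS]
  constructor
  · rintro ⟨h1, h2⟩ i hi
    rcases (Nat.lt_succ_iff.1 hi).eq_or_lt with rfl | hi
    · exact h2
    · rw [h1 i hi, (mem_colClass.1 hx).2 i hi]
  · exact fun h1 => ⟨fun i hi => by rw [h1 i (by omega), (mem_colClass.1 hx).2 i hi], h1 l (by omega)⟩

namespace LexSimplex

/-- If the number of new coordinates is not divisible by three, then some translate of the next word
is not minimal. -/
theorem exists_lt_add (hF : IsTwisted F ξ η κ) (h : LexSimplex F ξ η v t (j + 1)) (hs0 : 1 ≤ s)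
    (hs : s ≤ 2) (hτ : t j + s = 3 * τ) (h2 : s + 2 ≤ τ)
    (hy : y ∈ farSet (t 0) (simplexCode v (j + 1) : Set (Vec 3)))
    (hmin : ∀ z ∈ farSet (t 0) (simplexCode v (j + 1) : Set (Vec 3)), ¬ BasisLT F z y) :
    ∃ z ∈ farSet (t 0) (simplexCode v (j + 1) : Set (Vec 3)),
      z - y ∈ farSet (t 0) (simplexCode v j : Set (Vec 3)) ∧ BasisLT F z (y + v j) := by
  classical
  have hM := h.isMinStep_of_mod hs hτ h2 hy hmin
  have hout := hM.outWeight_eq hF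
  have hcl := h.closed j (by omega)
  have hlt := Nat.lt_succ_self j
  obtain ⟨hn0, hn1, hn2⟩ := h.card_two_of_mod hF hs hτ h2 hy hmin
  set S := suppUnion v (j + 1) with hS
  set T := S \ suppUnion v j with hT
  have hTclass : ∀ N ∈ T, colClass v (j + 1) N = T := fun N hN =>
    h.simplex.colClass_of_notMem (mem_sdiff.1 hN).1 (mem_sdiff.1 hN).2
  have hvT : ∀ x ∈ T, v j x = 1 := fun x hx => by
    obtain ⟨h3, h4⟩ := mem_sdiff.1 hx
    refine h.simplex.one j hlt x h4 ?_
    rw [hS, suppUnion_succ, mem_union] at h3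
    exact Finsupp.mem_support_iff.1 (h3.resolve_left h4)
  -- the top difference
  set A : Finset ℕ := {x ∈ T | y x = 1 ∧ x ≠ ξ ∧ x ≠ η} with hA
  have hAne : A.Nonempty := by
    have : {x ∈ T | y x = 1} ⊆ A ∪ {ξ, η} := by
      intro x hx
      obtain ⟨hx, hx2⟩ := mem_filter.1 hx
      by_cases hsp : x = ξ ∨ x = η
      · exact mem_union_right _ (by simpa using hsp)
      · rw [not_or] at hsp
        exact mem_union_left _ (mem_filter.2 ⟨hx, hx2, hsp⟩)
    have h3 := card_le_card this
    have h4 := card_union_le A {ξ, η}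
    have h5 : #({ξ, η} : Finset ℕ) ≤ 2 := card_le_two
    exact card_pos.1 (by omega)
  set N := A.max' hAne with hN
  obtain ⟨hNT, hyN, hNξ, hNη⟩ : N ∈ T ∧ y N = 1 ∧ N ≠ ξ ∧ N ≠ η :=
    mem_filter.1 (A.max'_mem hAne)
  obtain ⟨hNS, hNj⟩ := mem_sdiff.1 hNT
  -- the sets of indices at which the last row is added
  have hX : ∀ B : Finset ℕ, ∃ X : Finset ℕ, ∀ M ∈ S, colClass v (j + 1) M = B → v j M ≠ 0 →
      X ⊆ B ∧ (∀ x ∈ B, x = ξ ∨ x = η → x ∈ X) ∧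
      (∀ a, #{x ∈ X | y x = a - v j M} + #{x ∈ B | y x = a + v j M} =
        #{x ∈ B | y x = a} + #{x ∈ X | y x = a + v j M}) ∧
      (M ∈ suppUnion v j → #X = s + 6) ∧ (M ∉ suppUnion v j → N ∉ X ∧ ∀ x ∈ B, N < x → x ∈ X) := by
    intro B
    by_cases hex : ∃ M ∈ S, colClass v (j + 1) M = B ∧ v j M ≠ 0
    · obtain ⟨M, hM, rfl, hM0⟩ := hex
      by_cases hMj : M ∈ suppUnion v j
      · have hle : ∀ a, #{x ∈ colClass v (j + 1) M | y x = a} ≤ τ := fun a =>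
          hout ▸ h.simplex.card_le_outWeight hy hM a
        have hsum := card_eq_sum_three (colClass v (j + 1) M) y
        rw [h.simplex.card_colClass hM] at hsum
        set n : ZMod 3 → ℕ := fun a => #{x ∈ colClass v (j + 1) M | y x = a} with hn
        have hsum' : ∀ a e : ZMod 3, e ≠ 0 → n a + n (a - e) + n (a + e) = t j := by
          have h4 : ∀ a e : ZMod 3, e ≠ 0 → ∀ P : ZMod 3 → ℕ,
              P a + P (a - e) + P (a + e) = P 0 + P 1 + P 2 := by
            intro a e he P
            have h3 : ∀ b : ZMod 3, b = 0 ∨ b = 1 ∨ b = 2 := by decide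
            rcases h3 a with rfl | rfl | rfl <;> rcases h3 e with rfl | rfl | rfl <;>
              first
              | exact absurd rfl he
              | (show P _ + P _ + P _ = _; simp only [show (0 : ZMod 3) - 1 = 2 by decide,
                  show (0 : ZMod 3) + 1 = 1 by decide, show (0 : ZMod 3) - 2 = 1 by decide,
                  show (0 : ZMod 3) + 2 = 2 by decide, show (1 : ZMod 3) - 1 = 0 by decide,
                  show (1 : ZMod 3) + 1 = 2 by decide, show (1 : ZMod 3) - 2 = 2 by decide,
                  show (1 : ZMod 3) + 2 = 0 by decide, show (2 : ZMod 3) - 1 = 1 by decide,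
                  show (2 : ZMod 3) + 1 = 0 by decide, show (2 : ZMod 3) - 2 = 0 by decide,
                  show (2 : ZMod 3) + 2 = 1 by decide] <;> omega)
          intro a e he
          rw [h4 a e he n]
          exact hsum.symm
        -- These sizes make the shift by ± v_j preserve all fibres of y, since both sides of the
        -- balance equal τ + 2. They add up to s + 6, independently of the class, and are at least
        -- 2, so that ξ and η can be included. That fibres are large enough uses s + 2 ≤ τ.
        obtain ⟨X, hXB, hAX, hXc⟩ := exists_subset_of_card_fiber (B := colClass v (j + 1) M)
          (A := {ξ, η} ∩ colClass v (j + 1) M) y (m := fun a => τ + 2 - n (a - v j M))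
          (fun a => by
            have h3 := hsum' a (v j M) hM0
            have h4 := hle (a + v j M)
            show τ + 2 - n (a - v j M) ≤ n a
            change n (a + v j M) ≤ τ at h4
            omega)
          inter_subset_right
          (fun a => ((card_le_card inter_subset_left).trans card_le_two).trans (by
            have h4 := hle (a - v j M)
            show 2 ≤ τ + 2 - n (a - v j M)
            change n (a - v j M) ≤ τ at h4
            omega))
        refine ⟨X, fun M' hM' he hM'0 => ⟨hXB, fun x hx hsp => hAX (mem_inter.2
          ⟨by simpa using hsp, hx⟩), fun a => ?_, fun _ => ?_, fun hM'j => ?_⟩⟩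
        · have hMM' : v j M' = v j M :=
            (mem_colClass.1 (he ▸ self_mem_colClass hM')).2 j hlt
          rw [hMM', hXc, hXc]
          have h3 : a - v j M - v j M = a + v j M := by
            linear_combination (-v j M) * (by decide : (3 : ZMod 3) = 0)
          have h4 := hle (a + v j M)
          have h5 := hle a
          rw [h3, add_sub_cancel_right]
          simp only [hn]
          omega
        · have h3 := card_eq_sum_three X y
          rw [hXc, hXc, hXc] at h3
          have h4 := hsum' 0 (v j M) hM0
          have h5 := hle (0 - v j M)
          have h6 := hle (1 - v j M)
          have h7 := hle (2 - v j M)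
          have h8 : n (0 - v j M) + n (1 - v j M) + n (2 - v j M) = t j := by
            have h9 : ∀ e : ZMod 3, e ≠ 0 → (1 - e = 0 ∧ 2 - e = 0 + e) ∨
              (1 - e = 0 + e ∧ 2 - e = 0) := by decide
            rcases h9 _ hM0 with ⟨h9, h10⟩ | ⟨h9, h10⟩ <;> rw [h9, h10] <;> omega
          change n (0 - v j M) ≤ τ at h5
          change n (1 - v j M) ≤ τ at h6
          change n (2 - v j M) ≤ τ at h7
          omega
        · exact absurd (mem_suppUnion.2 (by
            obtain ⟨l, hl, h0⟩ := mem_suppUnion.1 hMj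
            exact ⟨l, hl, by
              rwa [(mem_colClass.1 (he ▸ self_mem_colClass hM')).2 l (by omega)]⟩)) hM'j
      · have hMT : M ∈ T := mem_sdiff.2 ⟨hM, hMj⟩
        rw [hTclass M hMT]
        have herase : ∀ a, #{x ∈ T.erase N | y x = a} + (if a = 1 then 1 else 0) =
            #{x ∈ T | y x = a} := by
          intro a
          rw [filter_erase]
          split_ifs with ha
          · exact card_erase_add_one (mem_filter.2 ⟨hNT, by rw [hyN, ha]⟩)
          · rw [add_zero, erase_eq_of_notMem]
            exact fun hN' => ha ((mem_filter.1 hN').2.symm.trans hyN)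
        -- On T all entries 0 and 2 are moved upwards, and all but s of the entries 1. The omitted
        -- ones include N, which is possible because s ≥ 1; the fibre sizes τ, τ, τ - s are
        -- preserved.
        obtain ⟨X, hXB, hAX, hXc⟩ := exists_subset_of_card_fiber (B := T.erase N)
          (A := {ξ, η} ∩ T) y (m := fun a => if a = 0 then τ else τ - s)
          (fun a => by
            have h3 := herase a
            have h4 : ∀ a : ZMod 3, a = 0 ∨ a = 1 ∨ a = 2 := by decide
            rcases h4 a with rfl | rfl | rfl
            · rw [if_pos rfl]; rw [if_neg (by decide)] at h3; omega
            · rw [if_neg (by decide)]; rw [if_pos rfl] at h3; omega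
            · rw [if_neg (by decide)]; rw [if_neg (by decide)] at h3; omega)
          (fun x hx => by
            obtain ⟨h3, h4⟩ := mem_inter.1 hx
            refine mem_erase.2 ⟨fun e => ?_, h4⟩
            rw [e, mem_insert, mem_singleton] at h3
            exact h3.elim hNξ hNη)
          (fun a => ((card_le_card inter_subset_left).trans card_le_two).trans (by
            split_ifs <;> omega))
        refine ⟨X, fun M' hM' he hM'0 => ⟨hXB.trans (erase_subset _ _), fun x hx hsp =>
          hAX (mem_inter.2 ⟨by simpa using hsp, hx⟩), fun a => ?_, fun hM'j => ?_, fun _ =>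
          ⟨fun hNX => (mem_erase.1 (hXB hNX)).1 rfl, fun x hx hNx => ?_⟩⟩⟩
        · rw [hvT M' (he ▸ self_mem_colClass hM'), hXc, hXc]
          have h4 : a = 0 ∨ a = 1 ∨ a = 2 := by revert a; decide
          rcases h4 with rfl | rfl | rfl
          · rw [if_neg (by decide), if_neg (by decide), show (0 : ZMod 3) + 1 = 1 from rfl]
            omega
          · rw [if_pos (by decide), if_neg (by decide), show (1 : ZMod 3) + 1 = 2 from rfl]
            omega
          · rw [if_neg (by decide), if_pos (by decide), show (2 : ZMod 3) + 1 = 0 from rfl]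
            omega
        · exact absurd hM'j (mem_sdiff.1 (he ▸ self_mem_colClass hM' : M' ∈ T)).2
        · by_cases hsp : x = ξ ∨ x = η
          · exact hAX (mem_inter.2 ⟨by simpa using hsp, hx⟩)
          · have hyx : y x ≠ 1 := fun hyx => by
              rw [not_or] at hsp
              exact absurd (A.le_max' x (mem_filter.2 ⟨hx, hyx, hsp⟩)) (not_le.2 hNx)
            have hfull : ∀ a : ZMod 3, a ≠ 1 → {x ∈ X | y x = a} = {x ∈ T | y x = a} := by
              intro a ha
              refine eq_of_subset_of_card_le
                (filter_subset_filter _ (hXB.trans (erase_subset _ _))) ?_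
              rw [hXc]
              have h4 : a = 0 ∨ a = 2 := by revert a; decide
              rcases h4 with rfl | rfl
              · rw [if_pos rfl, hn0]
              · rw [if_neg (by decide), hn2]
            have := hfull (y x) hyx ▸ (mem_filter.2 ⟨hx, rfl⟩ : x ∈ {i ∈ T | y i = y x})
            exact (mem_filter.1 this).1
    · exact ⟨∅, fun M hM he hM0 => absurd ⟨M, hM, he, hM0⟩ hex⟩
  choose X hX using hX
  -- The last row is added on the chosen sets and subtracted elsewhere. At N this gives 0 instead of
  -- 2, and above N, as well as at ξ and η, it agrees with y + v_j.
  set z : Vec 3 := Finsupp.onFinset (S ∪ y.support)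
    (fun x => if x ∈ X (colClass v (j + 1) x) then y x + v j x else y x - v j x)
    (fun x hx => by
      by_contra hxS
      rw [mem_union, not_or, Finsupp.notMem_support_iff] at hxS
      rw [hxS.2, eq_zero_of_notMem_suppUnion hxS.1 hlt, add_zero, sub_zero, ite_self] at hx
      exact hx rfl) with hz
  have hzx : ∀ x, z x = if x ∈ X (colClass v (j + 1) x) then y x + v j x else y x - v j x :=
    fun x => rfl
  have hz0 : ∀ x, v j x = 0 → z x = y x := fun x hx => by
    rw [hzx, hx, add_zero, sub_zero, ite_self]
  have hzB : ∀ M ∈ S, ∀ x ∈ colClass v (j + 1) M,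
      z x = if x ∈ X (colClass v (j + 1) M) then y x + v j M else y x - v j M := fun M _ x hx => by
    rw [hzx, colClass_eq hx, (mem_colClass.1 hx).2 j hlt]
  have hzadd : ∀ x ∈ S, x ∈ X (colClass v (j + 1) x) → z x = (y + v j) x := fun x _ hxX => by
    rw [hzx, if_pos hxX, Finsupp.add_apply]
  have hzout : ∀ x, x ∉ S → z x = y x := fun x hx => hz0 x (eq_zero_of_notMem_suppUnion hx hlt)
  refine ⟨z, farSet_of_card_eq hy (fun M hM a => ?_) (le_of_eq (outWeight_congr fun x hx =>
    (hzout x hx).symm)), ?_, N, ?_, fun i hi => ?_⟩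
  · by_cases hM0 : v j M = 0
    · congr 1
      ext x
      rw [mem_filter, mem_filter]
      refine and_congr_right fun hx => ?_
      rw [hz0 x (by rw [(mem_colClass.1 hx).2 j hlt, hM0])]
    · obtain ⟨hXB, -, hXc, -⟩ := hX _ M hM rfl hM0
      have h3 := card_filter_shift hXB y (v j M) a
      have h4 := hXc a
      have h5 : #{x ∈ colClass v (j + 1) M | z x = a} =
          #{x ∈ colClass v (j + 1) M | (if x ∈ X (colClass v (j + 1) M) then y x + v j M
            else y x - v j M) = a} := by
        congr 1
        ext x
        rw [mem_filter, mem_filter]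
        exact and_congr_right fun hx => by rw [hzB M hM x hx]
      omega
  · have hsub : ∀ x, (z - y) x = if x ∈ X (colClass v (j + 1) x) then v j x else - v j x :=
      fun x => by
        rw [Finsupp.sub_apply, hzx]
        split_ifs <;> ring
    have hne : ∀ x, (z - y) x = 0 ↔ v j x = 0 := fun x => by
      rw [hsub]
      split_ifs
      · exact Iff.rfl
      · exact neg_eq_zero
    refine (h.simplex.mono (Nat.le_succ j)).mem_farSet_of_card_eq (fun l hl => h.pos (by omega))
      (τ := t j) (fun e => by rw [e]) (fun l hl => ?_) (fun M hM => ?_) ?_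
    · subst hl; exact h.simplex.step l hlt
    · have hunif := h.simplex.unif j hlt M hM
      have hrep : ∀ e, ∃ x ∈ colClass v j M, v j x = e := fun e => by
        obtain ⟨x, hx, hxe, -⟩ := h.exists_other hlt hM e (M := 0)
        exact ⟨x, hx, hxe⟩
      obtain ⟨x₁, hx₁, hv₁⟩ := hrep 1
      obtain ⟨x₂, hx₂, hv₂⟩ := hrep 2
      have hB₁ := h.simplex.filter_colClass hlt hM hx₁
      have hB₂ := h.simplex.filter_colClass hlt hM hx₂
      rw [hv₁] at hB₁
      rw [hv₂] at hB₂
      have hS' : ∀ {x}, x ∈ colClass v j M → x ∈ S ∧ x ∈ suppUnion v j := fun hx =>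
        ⟨suppUnion_mono (Nat.le_succ j) (mem_colClass.1 hx).1, (mem_colClass.1 hx).1⟩
      obtain ⟨hX₁, -, -, hc₁, -⟩ := hX _ x₁ (hS' hx₁).1 rfl (by rw [hv₁]; decide)
      obtain ⟨hX₂, -, -, hc₂, -⟩ := hX _ x₂ (hS' hx₂).1 rfl (by rw [hv₂]; decide)
      replace hc₁ := hc₁ (hS' hx₁).2
      replace hc₂ := hc₂ (hS' hx₂).2
      have h0 : #{x ∈ colClass v j M | (z - y) x = 0} = t j := by
        rw [← hunif 0]
        congr 1
        ext x
        rw [mem_filter, mem_filter, hne]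
      -- Value 1 arises by adding where the row is 1 and by subtracting where it is 2. As X has the
      -- same size in both classes, the total is the size of one class.
      have h1 : #{x ∈ colClass v j M | (z - y) x = 1} = t j := by
        have : {x ∈ colClass v j M | (z - y) x = 1} = X (colClass v (j + 1) x₁) ∪
            (colClass v (j + 1) x₂ \ X (colClass v (j + 1) x₂)) := by
          ext x
          rw [mem_filter, mem_union, mem_sdiff, hsub]
          constructor
          · rintro ⟨hx, hxe⟩
            split_ifs at hxe with hxX
            · have h3 : x ∈ colClass v (j + 1) x₁ := hB₁ ▸ mem_filter.2 ⟨hx, hxe⟩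
              exact Or.inl (colClass_eq h3 ▸ hxX)
            · have h3 : x ∈ colClass v (j + 1) x₂ :=
                hB₂ ▸ mem_filter.2 ⟨hx, by rw [← neg_neg (v j x), hxe]; rfl⟩
              exact Or.inr ⟨h3, colClass_eq h3 ▸ hxX⟩
          · rintro (hx | ⟨hx, hx'⟩)
            · have h3 := hX₁ hx
              have h4 := hB₁ ▸ h3
              obtain ⟨h5, h6⟩ := mem_filter.1 h4
              exact ⟨h5, by rw [colClass_eq h3, if_pos hx, h6]⟩
            · have h4 := hB₂ ▸ hx
              obtain ⟨h5, h6⟩ := mem_filter.1 h4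
              exact ⟨h5, by rw [colClass_eq hx, if_neg hx', h6]; rfl⟩
        have h6 := card_le_card hX₂
        rw [h.simplex.card_colClass (hS' hx₂).1] at h6
        rw [this, card_union_of_disjoint, card_sdiff_of_subset hX₂,
          h.simplex.card_colClass (hS' hx₂).1, hc₁, hc₂]
        · omega
        · refine disjoint_left.2 fun x hx hx' => ?_
          have h3 := (mem_colClass.1 (hX₁ hx)).2 j hlt
          rw [(mem_colClass.1 (mem_sdiff.1 hx').1).2 j hlt, hv₁, hv₂] at h3
          exact absurd h3 (by decide)
      have htot := card_eq_sum_three (colClass v j M) fun x => (z - y) x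
      have htot' := card_eq_sum_three (colClass v j M) (v j)
      rw [hunif, hunif, hunif] at htot'
      intro a
      have h4 : a = 0 ∨ a = 1 ∨ a = 2 := by revert a; decide
      rcases h4 with rfl | rfl | rfl <;> omega
    · rw [← h.simplex.new j hlt]
      exact outWeight_le fun x _ h0 => fun e => h0 ((hne x).1 e)
  · have hNX := (hX _ N hNS rfl (by rw [hvT N hNT]; decide)).2.2.2.2 hNj
    rw [hF.repr_of_ne hNη, hF.repr_of_ne hNη, hzx, if_neg hNX.1, Finsupp.add_apply, hyN,
      hvT N hNT]
    decide
  · have hspec : ∀ x, x = ξ ∨ x = η → z x = (y + v j) x := by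
      intro x hsp
      by_cases hx0 : v j x = 0
      · rw [hz0 x hx0, Finsupp.add_apply, hx0, add_zero]
      · have hxS : x ∈ S := mem_suppUnion.2 ⟨j, hlt, hx0⟩
        exact hzadd x hxS ((hX _ x hxS rfl hx0).2.1 x (self_mem_colClass hxS) hsp)
    refine hF.repr_congr ?_ fun _ => hspec ξ (Or.inl rfl)
    by_cases hsp : i = ξ ∨ i = η
    · exact hspec i hsp
    by_cases hiS : i ∈ S
    · have hij : i ∉ suppUnion v j := fun hij => hsp (hcl.special hF.ne hNj hij hi).2
      have hiT : i ∈ T := mem_sdiff.2 ⟨hiS, hij⟩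
      refine hzadd i hiS ?_
      have := ((hX _ N hNS rfl (by rw [hvT N hNT]; decide)).2.2.2.2 hNj).2 i
        (hTclass N hNT ▸ hiT) hi
      rwa [hTclass i hiT, ← hTclass N hNT]
    · rw [hzout i hiS, Finsupp.add_apply, eq_zero_of_notMem_suppUnion hiS hlt, add_zero]

end LexSimplex

/-- The vector from `exists_lt_add` is far from the code and from the first 3^j translates of the
next word, but lies below the translate by w(3^j), contradicting `not_lt_add_word`. -/
theorem not_isLinearCode_lexCode_three (hF : F ∈ basisFamily 3) {k d' : ℕ} (hk : 1 ≤ k)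
    (hd' : 8 ≤ d') (h3 : ¬ 3 ∣ d') : ¬ IsLinearCode (lexCode F (3 ^ (k - 1) * d') (k + 1)) := by
  obtain ⟨ξ, η, κ, hF⟩ := exists_isTwisted hF
  obtain ⟨j, rfl⟩ : ∃ j, k = j + 1 := ⟨k - 1, by omega⟩
  set d := 3 ^ (j + 1 - 1) * d' with hd
  obtain ⟨h, hw⟩ := lexSimplex_word hF (t := fun l => 3 ^ (j + 1 - 1 - l) * d') (d := d) rfl
    (k := j + 1) (fun l hl => by
      have : j + 1 - 1 - l = j + 1 - 1 - (l + 1) + 1 := by omega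
      simp only [this, pow_succ]
      ring) (fun l _ => (by omega : 2 ≤ d').trans (Nat.le_mul_of_pos_left _ (by positivity)))
  have hcode := hw.simplexCode_eq
  have hdpos : 0 < d := by positivity
  intro hlin
  -- The rounding s is 1 or 2 as 3 does not divide d'. The condition s + 2 ≤ τ holds from d' = 8 on;
  -- for d' = 7 one has s = 2 and τ = 3.
  obtain ⟨s, τ, hs0, hs, hτ, h2⟩ : ∃ s τ, 1 ≤ s ∧ s ≤ 2 ∧ d' + s = 3 * τ ∧ s + 2 ≤ τ :=
    ⟨3 - d' % 3, (d' + (3 - d' % 3)) / 3, by omega, by omega, by omega, by omega⟩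
  obtain ⟨z, hz, hzy, hlt⟩ := h.exists_lt_add hF hs0 hs (y := word F d (3 ^ (j + 1)))
    (τ := τ) (by simpa using hτ) h2 (hcode ▸ word_pow_mem_farSet (j + 1))
    (fun z hz => word_pow_min (hcode ▸ hz))
  refine not_lt_add_word hdpos hlin (k := j + 1) (i := 3 ^ j)
    (Nat.pow_lt_pow_right (by norm_num) (by omega)) (hcode ▸ hz) (fun i' hi' => ?_) hlt
  rw [hdist_eq_of_sub_eq (show z - (word F d (3 ^ (j + 1)) + word F d i') =
    z - word F d (3 ^ (j + 1)) - word F d i' by abel)]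
  exact hzy _ (hw.mem (Nat.le_succ j) hi')

end

end LexCode

/-! ### General p: the first two basis words of a linear code -/

namespace LexCode

open Finset

variable {p : ℕ} [Fact p.Prime] {F : OrdBasis p} {ξ η : ℕ} {κ : ZMod p} {d : ℕ}

theorem mem_lexCode_succ_iff (hd : 0 < d) {k : ℕ} (hlin : IsLinearCode (lexCode F d (k + 1)))
    {x : Vec p} : x ∈ lexCode F d (k + 1) ↔
      ∃ a : ZMod p, ∃ c ∈ lexCode F d k, x = a • word F d (p ^ k) + c := by
  have hp := (Fact.out : p.Prime)
  obtain ⟨W, hW⟩ := hlin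
  obtain ⟨Q, -, hQ⟩ := exists_pivot hd hW
  have hword : word F d (p ^ k) ∈ W := by
    rw [← SetLike.mem_coe, hW]
    exact word_mem_lexCode (Nat.pow_lt_pow_right hp.one_lt (Nat.lt_succ_self k))
  have hne : F.repr (word F d (p ^ k)) Q ≠ 0 := fun e => by
    obtain ⟨a, ha, he⟩ := (hQ _).2 ⟨hword, e⟩
    exact absurd (word_injective hd he) ha.ne'
  rw [← hW, SetLike.mem_coe]
  constructor
  · intro hx
    refine ⟨F.repr x Q / F.repr (word F d (p ^ k)) Q,
      x - (F.repr x Q / F.repr (word F d (p ^ k)) Q) • word F d (p ^ k),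
      (hQ _).2 ⟨W.sub_mem hx (W.smul_mem _ hword), ?_⟩, by abel⟩
    rw [map_sub, map_smul, Finsupp.sub_apply, Finsupp.smul_apply, smul_eq_mul,
      div_mul_cancel₀ _ hne, sub_self]
  · rintro ⟨a, c, hc, rfl⟩
    exact W.add_mem (W.smul_mem _ hword) ((hQ _).1 hc).1

theorem mem_lexCode_zero {x : Vec p} : x ∈ lexCode F d 0 ↔ x = 0 := by
  rw [mem_lexCode]
  constructor
  · rintro ⟨a, ha, rfl⟩
    obtain rfl : a = 0 := by simpa using ha
    exact word_zero
  · rintro rfl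
    exact ⟨0, by simp, word_zero.symm⟩

theorem mem_lexCode_one_iff (hd : 0 < d) (hlin : IsLinearCode (lexCode F d 1)) {x : Vec p} :
    x ∈ lexCode F d 1 ↔ ∃ a : ZMod p, x = a • word F d 1 := by
  rw [mem_lexCode_succ_iff hd hlin]
  simp only [mem_lexCode_zero, pow_zero, exists_eq_left, add_zero]

theorem eq_of_strictMonoOn {f : ℕ → ℕ} {n : ℕ} (hlt : ∀ i < n, f i < n)
    (hmono : ∀ i, i + 1 < n → f i < f (i + 1)) {i : ℕ} (hi : i < n) : f i = i := by
  have h1 : ∀ i < n, i ≤ f i := by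
    intro i
    induction i with
    | zero => exact fun _ => Nat.zero_le _
    | succ i ih =>
      intro hi
      have := ih (by omega)
      have := hmono i hi
      omega
  have h2 : ∀ m, ∀ i, i + m + 1 = n → f i + m + 1 ≤ n := by
    intro m
    induction m with
    | zero => exact fun i hi => hlt i (by omega)
    | succ m ih =>
      intro i hi
      have := ih (i + 1) (by omega)
      have := hmono i (by omega)
      omega
  have h3 := h2 (n - 1 - i) i (by omega)
  have h4 := h1 i hi
  omega

/-- The first p words are the multiples of w(1), ordered by their coordinate at its leading index.
These coordinates increase strictly and exhaust 𝔽_p, so the i-th one is i and that of w(1) is 1. -/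
theorem word_eq_smul (hd : 0 < d) (hlin : IsLinearCode (lexCode F d 1)) {i : ℕ} (hi : i < p) :
    word F d i = (i : ZMod p) • word F d 1 := by
  have hp := (Fact.out : p.Prime)
  obtain ⟨W, hW⟩ := id hlin
  have hmem : ∀ i < p, ∃ a : ZMod p, word F d i = a • word F d 1 := fun i hi =>
    (mem_lexCode_one_iff hd hlin).1 (word_mem_lexCode (by simpa using hi))
  have hne : word F d 1 ≠ 0 := fun e => by
    rw [← word_zero (F := F) (d := d)] at e
    exact absurd (word_injective hd e) one_ne_zero
  obtain ⟨P, hP, hP'⟩ := exists_top_index (F.repr.map_ne_zero_iff.2 hne)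
  set c := F.repr (word F d 1) P with hc
  have habove : ∀ i < p, ∀ x, P < x → F.repr (word F d i) x = 0 := fun i hi x hx => by
    obtain ⟨a, ha⟩ := hmem i hi
    rw [ha, map_smul, Finsupp.smul_apply, hP' x hx, smul_zero]
  have hval : ∀ i < p, (F.repr (word F d i) P).val = i := fun i hi => by
    refine eq_of_strictMonoOn (f := fun i => (F.repr (word F d i) P).val) (n := p)
      (fun i _ => ZMod.val_lt _) (fun i hi => ?_) hi
    obtain ⟨a, ha⟩ := hmem i (by omega)
    obtain ⟨b, hb⟩ := hmem (i + 1) hi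
    have hle := val_le_of_not_lt (F := F) (N := P)
      (fun x hx => (habove (i + 1) hi x hx).trans (habove i (by omega) x hx).symm)
      (basisLT_asymm (word_lt_word hd (Nat.lt_succ_self i)))
    refine lt_of_le_of_ne hle fun e => ?_
    have h1 := ZMod.val_injective p e
    rw [ha, hb, map_smul, map_smul, Finsupp.smul_apply, Finsupp.smul_apply, smul_eq_mul,
      smul_eq_mul] at h1
    have h2 := mul_right_cancel₀ hP h1
    exact absurd (word_injective hd (show word F d i = word F d (i + 1) by rw [ha, hb, h2]))
      (by omega)
  have hc1 : c = 1 := by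
    have := hval 1 hp.one_lt
    exact (ZMod.val_eq_one hp.one_lt _).1 this
  obtain ⟨a, ha⟩ := hmem i hi
  have h1 := hval i hi
  rw [ha, map_smul, Finsupp.smul_apply, ← hc, hc1, smul_eq_mul, mul_one] at h1
  rw [ha, ← h1, ZMod.natCast_zmod_val]

theorem isMinStep_word_one (hd : 2 ≤ d) :
    IsMinStep F ξ η ∅ d (farSet d (lexCode F d 0)) (word F d 1) := by
  have hfar : ∀ {z : Vec p}, z ∈ farSet d (lexCode F d 0) ↔ d ≤ outWeight ∅ z := by
    intro z
    constructor
    · intro hz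
      have := hz 0 (mem_lexCode_zero.2 rfl)
      rw [hdist_eq_card_support, sub_zero] at this
      simpa [outWeight] using this
    · intro hz c hc
      rw [mem_lexCode_zero.1 hc, hdist_eq_card_support, sub_zero]
      simpa [outWeight] using hz
  refine ⟨?_, fun z hz => ?_, fun z hz => hfar.1 hz,
    fun z hz z' _ h => hfar.2 ((hfar.1 hz).trans h), fun o ho => ⟨o, hfar.2 ho, fun _ _ => rfl,
    fun h => absurd h (by simp)⟩, hd, isClosedDown_empty ξ η⟩
  · have := word_pow_mem_farSet (F := F) (d := d) 0
    rwa [pow_zero] at this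
  · have := word_pow_min hz
    rwa [pow_zero] at this

/-- The first nonzero word is the indicator of a set. -/
theorem word_one (hF : IsTwisted F ξ η κ) (hd : 2 ≤ d) :
    ∃ S : Finset ℕ, #S = d ∧ IsClosedDown ξ η S ∧
      ∀ x, word F d 1 x = if x ∈ S then 1 else 0 := by
  have h := isMinStep_word_one (F := F) (ξ := ξ) (η := η) hd
  refine ⟨(word F d 1).support, ?_, ?_, fun x => ?_⟩
  · have := h.outWeight_eq hF
    rwa [outWeight, sdiff_empty] at this
  · simpa using h.isClosedDown hF
  · split_ifs with hx
    · exact h.eq_one hF (by simp) (Finsupp.mem_support_iff.1 hx)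
    · exact Finsupp.notMem_support_iff.1 hx

theorem card_agree_add_hdist_of_notMem {S : Finset ℕ} {c : Vec p} (hc : ∀ x, x ∉ S → c x = 0)
    (z : Vec p) : #{x ∈ S | z x = c x} + hdist z c = #S + outWeight S z := by
  have h1 : hdist z c = #{x ∈ S | ¬ z x = c x} + outWeight S z := by
    rw [hdist, outWeight, ← card_union_of_disjoint]
    · congr 1
      ext x
      rw [Finsupp.mem_neLocus, mem_union, mem_filter, mem_sdiff, Finsupp.mem_support_iff]
      by_cases hx : x ∈ S
      · simp [hx]
      · simp [hx, hc x hx]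
    · exact disjoint_left.2 fun x hx hx' => (mem_sdiff.1 hx').2 (mem_filter.1 hx).1
  rw [h1, ← add_assoc, card_filter_add_card_filter_not]

/-- The distance to a multiple of an indicator. -/
theorem card_agree_add_hdist_smul {S : Finset ℕ} {u : Vec p}
    (hu : ∀ x, u x = if x ∈ S then 1 else 0) (z : Vec p) (a : ZMod p) :
    #{x ∈ S | z x = a} + hdist z (a • u) = #S + outWeight S z := by
  rw [← card_agree_add_hdist_of_notMem (c := a • u) fun x hx => by simp [hu, hx]]
  congr 2
  refine filter_congr fun x hx => ?_
  rw [Finsupp.smul_apply, hu, if_pos hx, smul_eq_mul, mul_one]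

/-- The vector `v` with the values on `S` replaced by those of `f`. -/
noncomputable def setOn (S : Finset ℕ) (f : ℕ → ZMod p) (v : Vec p) : Vec p := by
  classical
  exact Finsupp.onFinset (S ∪ v.support) (fun x => if x ∈ S then f x else v x) fun x hx => by
    by_contra hxS
    rw [mem_union, not_or, Finsupp.notMem_support_iff] at hxS
    rw [if_neg hxS.1] at hx
    exact hx hxS.2

theorem setOn_of_mem {S : Finset ℕ} {f : ℕ → ZMod p} {v : Vec p} {x : ℕ} (hx : x ∈ S) :
    setOn S f v x = f x := by
  rw [setOn, Finsupp.onFinset_apply, if_pos hx]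

theorem setOn_of_notMem {S : Finset ℕ} {f : ℕ → ZMod p} {v : Vec p} {x : ℕ} (hx : x ∉ S) :
    setOn S f v x = v x := by
  rw [setOn, Finsupp.onFinset_apply, if_neg hx]

theorem outWeight_setOn {S : Finset ℕ} {f : ℕ → ZMod p} {v : Vec p} :
    outWeight S (setOn S f v) = outWeight S v :=
  outWeight_congr fun _ hx => setOn_of_notMem hx

theorem card_setOn {S : Finset ℕ} {f : ℕ → ZMod p} {v : Vec p} (a : ZMod p) :
    #{x ∈ S | setOn S f v x = a} = #{x ∈ S | f x = a} := by
  congr 1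
  ext x
  rw [mem_filter, mem_filter]
  exact and_congr_right fun hx => by rw [setOn_of_mem hx]

/-- The properties of the second basis word `v` of a code whose first basis word is the indicator
of `S` and whose second code is linear. -/
structure IsSecondStep (F : OrdBasis p) (ξ η : ℕ) (S : Finset ℕ) (v : Vec p) : Prop where
  closed : IsClosedDown ξ η S
  three : 3 ≤ #S
  count : ∀ a, #{x ∈ S | v x = a} ≤ outWeight S v
  min : ∀ z, (∀ a, #{x ∈ S | z x = a} ≤ outWeight S z) → ¬ BasisLT F z v
  add : ∀ f : ℕ → ZMod p, (∀ a, #{x ∈ S | f x = a} ≤ outWeight S v) → ∀ i < p,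
    (∀ x ∈ S, ∀ i' < i, f x ≠ v x + (i' : ZMod p)) →
    ¬ BasisLT F (setOn S f v) (setOn S (fun x => v x + (i : ZMod p)) v)

/-- As #S = d, the distance to a w(1) is at least d exactly when the value a occurs on S at most as
often as there are entries outside. The field `add` is `not_lt_add_word` for i w(1), restricted to
competitors that differ from all v + i' w(1) at every index of S. -/
theorem exists_isSecondStep (hF : IsTwisted F ξ η κ) (hd : 3 ≤ d)
    (hlin : IsLinearCode (lexCode F d 2)) :
    ∃ S : Finset ℕ, #S = d ∧ (∀ x, word F d 1 x = if x ∈ S then 1 else 0) ∧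
      IsSecondStep F ξ η S (word F d p) := by
  have hd0 : 0 < d := by omega
  have hlin1 := isLinearCode_of_succ hd0 hlin
  obtain ⟨S, hS, hcl, hu⟩ := word_one hF (by omega : 2 ≤ d)
  have hfar : ∀ {z : Vec p}, z ∈ farSet d (lexCode F d 1) ↔
      ∀ a, #{x ∈ S | z x = a} ≤ outWeight S z := by
    intro z
    constructor
    · intro hz a
      have h1 := hz _ ((mem_lexCode_one_iff hd0 hlin1).2 ⟨a, rfl⟩)
      have h2 := card_agree_add_hdist_smul hu z a
      omega
    · intro hz c hc
      obtain ⟨a, rfl⟩ := (mem_lexCode_one_iff hd0 hlin1).1 hc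
      have h1 := hz a
      have h2 := card_agree_add_hdist_smul hu z a
      omega
  refine ⟨S, hS, hu, hcl, hS ▸ hd, ?_, fun z hz => ?_, fun f hf i hi hav => ?_⟩
  · have := word_pow_mem_farSet (F := F) (d := d) 1
    rw [pow_one] at this
    exact hfar.1 this
  · have := word_pow_min (hfar.2 hz)
    rwa [pow_one] at this
  · have hz : setOn S f (word F d p) ∈ farSet d (lexCode F d 1) := hfar.2 fun a => by
      rw [card_setOn, outWeight_setOn]
      exact hf a
    have h1 := not_lt_add_word hd0 hlin (i := i) (by rwa [pow_one]) hz (fun i' hi' => ?_)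
    · have h2 : word F d (p ^ 1) + word F d i =
          setOn S (fun x => word F d p x + (i : ZMod p)) (word F d p) := by
        rw [pow_one, word_eq_smul hd0 hlin1 hi]
        ext x
        rw [Finsupp.add_apply, Finsupp.smul_apply, hu]
        split_ifs with hx
        · rw [setOn_of_mem hx, smul_eq_mul, mul_one]
        · rw [setOn_of_notMem hx, smul_zero, add_zero]
      rwa [h2] at h1
    · rw [pow_one, word_eq_smul hd0 hlin1 (hi'.trans hi), hdist_eq_card_support]
      refine hS.symm.le.trans (card_le_card fun x hx => ?_)
      rw [Finsupp.mem_support_iff, Finsupp.sub_apply, setOn_of_mem hx, Finsupp.add_apply,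
        Finsupp.smul_apply, hu, if_pos hx, smul_eq_mul, mul_one, sub_ne_zero]
      exact hav x hx i' hi'

end LexCode

/-! ### p ≥ 5: permuting the values of the second basis word -/

namespace LexCode

open Finset

variable {p : ℕ} [Fact p.Prime] {F : OrdBasis p} {ξ η : ℕ} {κ : ZMod p}

theorem natCast_ne_zero_of_lt {m : ℕ} (h0 : m ≠ 0) (hm : m < p) : (m : ZMod p) ≠ 0 := fun e =>
  h0 (Nat.eq_zero_of_dvd_of_lt ((ZMod.natCast_eq_zero_iff _ _).1 e) hm)

theorem two_ne_zero_of_le (hp : 5 ≤ p) : (2 : ZMod p) ≠ 0 := by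
  exact_mod_cast natCast_ne_zero_of_lt (p := p) (m := 2) (by norm_num) (by omega)

theorem three_ne_zero_of_le (hp : 5 ≤ p) : (3 : ZMod p) ≠ 0 := by
  exact_mod_cast natCast_ne_zero_of_lt (p := p) (m := 3) (by norm_num) (by omega)

theorem four_ne_zero_of_le (hp : 5 ≤ p) : (4 : ZMod p) ≠ 0 := by
  exact_mod_cast natCast_ne_zero_of_lt (p := p) (m := 4) (by norm_num) (by omega)

theorem val_two_lt (hp : 5 ≤ p) {a : ZMod p} (h0 : a ≠ 0) (h1 : a ≠ 1) (h2 : a ≠ 2) :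
    (2 : ZMod p).val < a.val := by
  have hv : (2 : ZMod p).val = 2 := by
    have := ZMod.val_natCast_of_lt (n := p) (a := 2) (by omega)
    exact_mod_cast this
  have h3 : a.val ≠ 0 := fun e => h0 ((ZMod.val_eq_zero a).1 e)
  have h4 : a.val ≠ 1 := fun e => h1 ((ZMod.val_eq_one (by omega) a).1 e)
  have h5 : a.val ≠ 2 := fun e => h2 (ZMod.val_injective p (e.trans hv.symm))
  omega

theorem update_apply_self (v : Vec p) (A : ℕ) (a : ZMod p) : v.update A a A = a := by
  simp

theorem update_apply_of_ne (v : Vec p) {A x : ℕ} (a : ZMod p) (h : x ≠ A) :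
    v.update A a x = v x := by
  simp [h]

/-- Functions with balanced fibres. -/
theorem exists_balanced (S : Finset ℕ) {m : ℕ} (h : #S ≤ p * m) :
    ∃ f : ℕ → ZMod p, ∀ a, #{x ∈ S | f x = a} ≤ m := by
  classical
  induction S using Finset.induction_on with
  | empty => exact ⟨0, by simp⟩
  | insert x S hx ih =>
    rw [card_insert_of_notMem hx] at h
    obtain ⟨f, hf⟩ := ih (by omega)
    obtain ⟨b, hb⟩ : ∃ b, #{y ∈ S | f y = b} < m := by
      by_contra hno
      push Not at hno
      have h1 : #S = ∑ b : ZMod p, #{y ∈ S | f y = b} :=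
        card_eq_sum_card_fiberwise fun _ _ => mem_univ _
      have h2 : Fintype.card (ZMod p) * m ≤ ∑ b : ZMod p, #{y ∈ S | f y = b} := by
        rw [← smul_eq_mul]
        exact card_nsmul_le_sum _ _ _ fun b _ => hno b
      rw [ZMod.card] at h2
      omega
    have hne : ∀ y ∈ S, y ≠ x := fun y hy e => hx (e ▸ hy)
    refine ⟨Function.update f x b, fun a => ?_⟩
    have hS : {y ∈ S | Function.update f x b y = a} = {y ∈ S | f y = a} := by
      ext y
      rw [mem_filter, mem_filter]
      exact and_congr_right fun hy => by rw [Function.update_of_ne (hne y hy)]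
    rw [filter_insert, hS, Function.update_self]
    split_ifs with hba
    · subst hba
      exact (card_insert_le _ _).trans hb
    · exact hf a

section Repr

variable {S : Finset ℕ} {v : Vec p} {f g : ℕ → ZMod p}

theorem repr_setOn_eta (hF : IsTwisted F ξ η κ) (h1 : η ∈ S → f η = g η) (h2 : ξ ∈ S → f ξ = g ξ) :
    F.repr (setOn S f v) η = F.repr (setOn S g v) η := by
  have key : ∀ {x}, (x ∈ S → f x = g x) → setOn S f v x = setOn S g v x := fun {x} hx => by
    by_cases hxS : x ∈ S
    · rw [setOn_of_mem hxS, setOn_of_mem hxS, hx hxS]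
    · rw [setOn_of_notMem hxS, setOn_of_notMem hxS]
  exact hF.repr_congr (key h1) fun _ => key h2

theorem repr_setOn_eta_of_sub (hF : IsTwisted F ξ η κ) (hB : ξ < η) (hξ : ξ ∈ S) (hη : η ∈ S)
    (h : f η - f ξ = g η - g ξ) : F.repr (setOn S f v) η = F.repr (setOn S g v) η := by
  rw [hF.repr_eta_of_lt hB, hF.repr_eta_of_lt hB, setOn_of_mem hξ, setOn_of_mem hη,
    setOn_of_mem hξ, setOn_of_mem hη, h]

end Repr

/-- A permutation of the values merely permutes the fibres, so it never violates the count
condition. -/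
theorem card_filter_perm {S : Finset ℕ} {v : ℕ → ZMod p} {o : ℕ}
    (h : ∀ a, #{x ∈ S | v x = a} ≤ o) (π : Equiv.Perm (ZMod p)) (a : ZMod p) :
    #{x ∈ S | π (v x) = a} ≤ o := by
  refine le_trans (le_of_eq ?_) (h (π.symm a))
  congr 1
  ext x
  rw [mem_filter, mem_filter, Equiv.eq_symm_apply]

/-- The shift by one, corrected so that `0` and `1` are exchanged. -/
noncomputable def shiftOne (p : ℕ) [Fact p.Prime] : Equiv.Perm (ZMod p) :=
  Equiv.swap 0 2 * Equiv.addRight 1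

theorem shiftOne_apply (a : ZMod p) : shiftOne p a = Equiv.swap 0 2 (a + 1) := rfl

theorem shiftOne_zero : shiftOne p 0 = 1 := by
  have h1 : (1 : ZMod p) ≠ 2 := fun e => by
    have : (1 : ZMod p) = 0 := by linear_combination -e
    exact one_ne_zero this
  rw [shiftOne_apply, zero_add, Equiv.swap_apply_of_ne_of_ne one_ne_zero h1]

theorem shiftOne_one : shiftOne p 1 = 0 := by
  rw [shiftOne_apply, one_add_one_eq_two, Equiv.swap_apply_right]

theorem shiftOne_of_ne {a : ZMod p} (h0 : a + 1 ≠ 0) (h1 : a ≠ 1) : shiftOne p a = a + 1 := by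
  rw [shiftOne_apply, Equiv.swap_apply_of_ne_of_ne h0]
  exact fun e => h1 (by linear_combination e)

theorem shiftOne_ne (hp : 5 ≤ p) (a : ZMod p) : shiftOne p a ≠ a := by
  rw [shiftOne_apply]
  intro e
  by_cases h0 : a + 1 = 0
  · rw [h0, Equiv.swap_apply_left] at e
    exact three_ne_zero_of_le hp (by linear_combination e + h0)
  · by_cases h2 : a + 1 = 2
    · rw [h2, Equiv.swap_apply_right] at e
      exact one_ne_zero (α := ZMod p) (by linear_combination -h2 - e)
    · rw [Equiv.swap_apply_of_ne_of_ne h0 h2] at e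
      exact one_ne_zero (α := ZMod p) (by linear_combination e)

/-- The shift by one, corrected so that `0`, `1` and `2` are permuted cyclically. -/
noncomputable def shiftTwo (p : ℕ) [Fact p.Prime] : Equiv.Perm (ZMod p) :=
  Equiv.swap 0 3 * Equiv.addRight 1

theorem shiftTwo_apply (a : ZMod p) : shiftTwo p a = Equiv.swap 0 3 (a + 1) := rfl

theorem shiftTwo_zero (hp : 5 ≤ p) : shiftTwo p 0 = 1 := by
  have h1 : (1 : ZMod p) ≠ 3 := fun e => two_ne_zero_of_le hp (by linear_combination -e)
  rw [shiftTwo_apply, zero_add, Equiv.swap_apply_of_ne_of_ne one_ne_zero h1]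

theorem shiftTwo_one (hp : 5 ≤ p) : shiftTwo p 1 = 2 := by
  have h1 : (2 : ZMod p) ≠ 3 := fun e => one_ne_zero (α := ZMod p) (by linear_combination -e)
  rw [shiftTwo_apply, one_add_one_eq_two, Equiv.swap_apply_of_ne_of_ne (two_ne_zero_of_le hp) h1]

theorem shiftTwo_two : shiftTwo p 2 = 0 := by
  rw [shiftTwo_apply, show (2 : ZMod p) + 1 = 3 by norm_num, Equiv.swap_apply_right]

theorem shiftTwo_ne (hp : 5 ≤ p) (a : ZMod p) : shiftTwo p a ≠ a := by
  rw [shiftTwo_apply]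
  intro e
  by_cases h0 : a + 1 = 0
  · rw [h0, Equiv.swap_apply_left] at e
    exact four_ne_zero_of_le hp (by linear_combination e + h0)
  · by_cases h2 : a + 1 = 3
    · rw [h2, Equiv.swap_apply_right] at e
      exact two_ne_zero_of_le hp (by linear_combination -h2 - e)
    · rw [Equiv.swap_apply_of_ne_of_ne h0 h2] at e
      exact one_ne_zero (α := ZMod p) (by linear_combination e)

theorem IsClosedDown.lt_of_mem {S : Finset ℕ} (h : IsClosedDown ξ η S) (hne : ξ ≠ η) {A x : ℕ}
    (hA : A ∉ S) (hx : x ∈ S) (hsp : η < ξ ∨ x ≠ ξ ∧ x ≠ η) : x < A := by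
  by_contra hle
  have hAx : A < x := by
    have : A ≠ x := fun e => hA (e ▸ hx)
    omega
  have := h.special hne hA hx hAx
  omega

namespace IsSecondStep

variable {S : Finset ℕ} {v : Vec p}

theorem plain (hF : IsTwisted F ξ η κ) (h : IsSecondStep F ξ η S v) {f : ℕ → ZMod p}
    (hf : ∀ a, #{x ∈ S | f x = a} ≤ outWeight S v) {i : ℕ} (hi : i < p)
    (hav : ∀ x ∈ S, ∀ i' < i, f x ≠ v x + (i' : ZMod p)) {N : ℕ} (hN : N ∈ S) (hNη : N ≠ η)
    (hlt : (f N).val < (v N + (i : ZMod p)).val)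
    (hab : ∀ x ∈ S, N < x → x ≠ η → f x = v x + (i : ZMod p))
    (hη : N < η → F.repr (setOn S f v) η =
      F.repr (setOn S (fun x => v x + (i : ZMod p)) v) η) : False := by
  refine h.add f hf i hi hav ⟨N, ?_, fun x hx => ?_⟩
  · rwa [hF.repr_of_ne hNη, hF.repr_of_ne hNη, setOn_of_mem hN, setOn_of_mem hN]
  · by_cases hxη : x = η
    · subst hxη
      exact hη hx
    · rw [hF.repr_of_ne hxη, hF.repr_of_ne hxη]
      by_cases hxS : x ∈ S
      · rw [setOn_of_mem hxS, setOn_of_mem hxS, hab x hxS hx hxη]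
      · rw [setOn_of_notMem hxS, setOn_of_notMem hxS]

/-- Permutations of the values cannot lead to a smaller vector. -/
theorem perm_plain (hF : IsTwisted F ξ η κ) (h : IsSecondStep F ξ η S v) (π : Equiv.Perm (ZMod p))
    {N : ℕ} (hN : N ∈ S) (hNη : N ≠ η) (hlt : (π (v N)).val < (v N).val)
    (hab : ∀ x ∈ S, N < x → x ≠ η → π (v x) = v x)
    (hη : N < η → F.repr (setOn S (fun x => π (v x)) v) η = F.repr (setOn S v v) η) : False := by
  refine h.plain hF (f := fun x => π (v x)) (i := 0) (card_filter_perm h.count π)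
    (Fact.out : p.Prime).pos (fun _ _ i' hi' => absurd hi' (by omega)) hN hNη ?_ ?_ ?_
  · simpa using hlt
  · simpa using hab
  · simpa using hη

/-- A permutation of the values without fixed points yields a vector differing from v on all of S,
which may therefore be compared with v + w(1) rather than v. -/
theorem perm_plain_one (hF : IsTwisted F ξ η κ) (h : IsSecondStep F ξ η S v)
    (π : Equiv.Perm (ZMod p)) (hπ : ∀ a, π a ≠ a) {N : ℕ} (hN : N ∈ S) (hNη : N ≠ η)
    (hlt : (π (v N)).val < (v N + 1).val)
    (hab : ∀ x ∈ S, N < x → x ≠ η → π (v x) = v x + 1)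
    (hη : N < η → F.repr (setOn S (fun x => π (v x)) v) η =
      F.repr (setOn S (fun x => v x + 1) v) η) : False := by
  refine h.plain hF (f := fun x => π (v x)) (i := 1) (card_filter_perm h.count π)
    (Fact.out : p.Prime).one_lt (fun x _ i' hi' => ?_) hN hNη ?_ ?_ ?_
  · obtain rfl : i' = 0 := by omega
    simpa using hπ (v x)
  · simpa using hlt
  · simpa using hab
  · simpa using hη

/-- The topmost nonzero entry on `S` cannot have a coordinate that is independent of the twist. -/
theorem false_of_top (hp : 5 ≤ p) (hF : IsTwisted F ξ η κ) (h : IsSecondStep F ξ η S v) {N : ℕ}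
    (hN : N ∈ S) (hNη : N ≠ η) (hN0 : v N ≠ 0) (hab : ∀ x ∈ S, N < x → x ≠ η → v x = 0)
    (hη : N < η → ∀ (π : Equiv.Perm (ZMod p)) (b : ZMod p), π 0 = b →
      F.repr (setOn S (fun x => π (v x)) v) η = F.repr (setOn S (fun x => v x + b) v) η) :
    False := by
  -- If the top entry is 1, the cyclic shift with 0 and 1 interchanged agrees with v + w(1) on the
  -- zeros above N and has 0 instead of 2 at N. Otherwise exchanging the value with 1 improves v
  -- itself.
  by_cases hN1 : v N = 1
  · refine h.perm_plain_one hF (shiftOne p) (shiftOne_ne hp) hN hNη ?_ (fun x hx hNx hxη => ?_)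
      fun hlt => hη hlt _ _ shiftOne_zero
    · rw [hN1, shiftOne_one, one_add_one_eq_two, ZMod.val_zero]
      exact val_pos_of_ne_zero (two_ne_zero_of_le hp)
    · rw [hab x hx hNx hxη, shiftOne_zero, zero_add]
  · have h0 : Equiv.swap 1 (v N) 0 = 0 :=
      Equiv.swap_apply_of_ne_of_ne zero_ne_one hN0.symm
    refine h.perm_plain hF (Equiv.swap 1 (v N)) hN hNη ?_ (fun x hx hNx hxη => ?_)
      fun hlt => ?_
    · rw [Equiv.swap_apply_right]
      exact val_one_lt hN0 hN1
    · rw [hab x hx hNx hxη, h0]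
    · have := hη hlt _ _ h0
      simpa using this

theorem one_le_outWeight (h : IsSecondStep F ξ η S v) : 1 ≤ outWeight S v := by
  obtain ⟨x, hx⟩ : S.Nonempty := card_pos.1 (by have := h.three; omega)
  have hx' : x ∈ {y ∈ S | v y = v x} := mem_filter.2 ⟨hx, rfl⟩
  exact (card_pos.2 ⟨x, hx'⟩).trans_le (h.count (v x))

/-- If v vanished on S, it would have at least #S ≥ 3 outside entries. One of them, at an ordinary
index, could be traded for a 1 inside S, which is below it. -/
theorem exists_ne_zero (hF : IsTwisted F ξ η κ) (h : IsSecondStep F ξ η S v) : ∃ x ∈ S, v x ≠ 0 := by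
  classical
  by_contra hno
  push Not at hno
  have h3 := h.three
  have hout : #S ≤ outWeight S v := by
    have := h.count 0
    rwa [filter_true_of_mem hno] at this
  have h2 : #({ξ, η} : Finset ℕ) ≤ 2 := card_le_two
  obtain ⟨y, hy, hysp⟩ := exists_mem_notMem_of_card_lt_card
    (show #({ξ, η} : Finset ℕ) < #S by omega)
  obtain ⟨A, hAS, hA0, hAsp⟩ := exists_of_lt_outWeight (S := S) (v := v) (B := {ξ, η})
    ((card_le_card sdiff_subset).trans_lt (by omega))
  rw [mem_insert, mem_singleton, not_or] at hysp hAsp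
  have hyA := h.closed.lt_of_mem hF.ne hAS hy (Or.inr hysp)
  set w := setOn S (fun x => if x = y then 1 else 0) v with hw
  have hwA : w A ≠ 0 := by rwa [hw, setOn_of_notMem hAS]
  have hout' : outWeight S (w.update A 0) + 1 = outWeight S v := by
    rw [outWeight_update_zero hAS hwA, outWeight_setOn]
  have hz : ∀ x ∈ S, w.update A 0 x = if x = y then 1 else 0 := fun x hx => by
    rw [update_apply_of_ne _ _ (fun e : x = A => hAS (e ▸ hx)), hw, setOn_of_mem hx]
  refine h.min (w.update A 0) (fun a => ?_) ⟨A, ?_, fun x hx => ?_⟩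
  · by_cases ha : a = 0
    · have h4 : {x ∈ S | w.update A 0 x = a} ⊆ S.erase y := fun x hx => by
        obtain ⟨hx, hxa⟩ := mem_filter.1 hx
        refine mem_erase.2 ⟨fun e => ?_, hx⟩
        rw [hz x hx, if_pos e, ha] at hxa
        exact one_ne_zero hxa
      have h5 := card_le_card h4
      rw [card_erase_of_mem hy] at h5
      omega
    · have h4 : {x ∈ S | w.update A 0 x = a} ⊆ {y} := fun x hx => by
        obtain ⟨hx, hxa⟩ := mem_filter.1 hx
        rw [mem_singleton]
        by_contra e
        rw [hz x hx, if_neg e] at hxa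
        exact ha hxa.symm
      have h5 := card_le_card h4
      rw [card_singleton] at h5
      omega
  · rw [hF.repr_of_ne hAsp.2, hF.repr_of_ne hAsp.2, update_apply_self, ZMod.val_zero]
    exact val_pos_of_ne_zero hA0
  · have hsame : ∀ x, x ≠ y → x ≠ A → w.update A 0 x = v x := fun x hxy hxA => by
      rw [update_apply_of_ne _ _ hxA, hw]
      by_cases hxS : x ∈ S
      · rw [setOn_of_mem hxS, if_neg hxy, hno x hxS]
      · rw [setOn_of_notMem hxS]
    exact hF.repr_congr (hsame x (by omega) (by omega)) fun _ =>
      hsame ξ (Ne.symm hysp.1) (Ne.symm hAsp.1)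

/-- If the entries at `ξ` and `η` are `0` and `1`, the topmost other entry leads to a
contradiction. -/
theorem false_of_zero_one (hp : 5 ≤ p) (hF : IsTwisted F ξ η κ) (h : IsSecondStep F ξ η S v)
    (hη1 : v η = 1) (hξ0 : ξ ∈ S → v ξ = 0) (hy : ∃ y ∈ S, v y ≠ 0 ∧ v y ≠ 1) : False := by
  classical
  obtain ⟨y, hy, hy0, hy1⟩ := hy
  set R : Finset ℕ := {x ∈ S | v x ≠ 0 ∧ v x ≠ 1} with hR
  have hRne : R.Nonempty := ⟨y, mem_filter.2 ⟨hy, hy0, hy1⟩⟩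
  set M := R.max' hRne with hMdef
  obtain ⟨hM, hM0, hM1⟩ : M ∈ S ∧ v M ≠ 0 ∧ v M ≠ 1 := mem_filter.1 (R.max'_mem hRne)
  have hMab : ∀ x ∈ S, M < x → v x = 0 ∨ v x = 1 := fun x hx hMx => by
    by_contra h0
    rw [not_or] at h0
    exact absurd (R.le_max' x (mem_filter.2 ⟨hx, h0⟩)) (not_le.2 hMx)
  have hMη : M ≠ η := fun e' => hM1 (by rw [e', hη1])
  -- As for the topmost nonzero entry, but with both 0 and 1 reserved: exchange the value with 2,
  -- or, if it is 2, compare the corrected shift 0 → 1 → 2 → 0 with v + w(1).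
  by_cases hM2 : v M = 2
  · refine h.perm_plain_one hF (shiftTwo p) (shiftTwo_ne hp) hM hMη ?_ (fun x hx hMx _ => ?_)
      fun _ => repr_setOn_eta hF (fun _ => ?_) fun hξ => ?_
    · rw [hM2, shiftTwo_two, ZMod.val_zero]
      refine val_pos_of_ne_zero ?_
      rw [show (2 : ZMod p) + 1 = 3 by norm_num]
      exact three_ne_zero_of_le hp
    · rcases hMab x hx hMx with h0 | h1
      · rw [h0, shiftTwo_zero hp, zero_add]
      · rw [h1, shiftTwo_one hp, one_add_one_eq_two]
    · rw [hη1, shiftTwo_one hp, one_add_one_eq_two]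
    · rw [hξ0 hξ, shiftTwo_zero hp, zero_add]
  · have h0 : Equiv.swap 2 (v M) 0 = 0 :=
      Equiv.swap_apply_of_ne_of_ne (two_ne_zero_of_le hp).symm hM0.symm
    have h1 : Equiv.swap 2 (v M) 1 = 1 :=
      Equiv.swap_apply_of_ne_of_ne (fun e => one_ne_zero (α := ZMod p) (by linear_combination -e))
        hM1.symm
    refine h.perm_plain hF (Equiv.swap 2 (v M)) hM hMη ?_ (fun x hx hMx _ => ?_)
      fun _ => repr_setOn_eta hF (fun _ => ?_) fun hξ => ?_
    · rw [Equiv.swap_apply_right]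
      exact val_two_lt hp hM0 hM1 hM2
    · rcases hMab x hx hMx with h' | h'
      · rw [h', h0]
      · rw [h', h1]
    · rw [hη1, h1]
    · rw [hξ0 hξ, h0]

section Left

theorem eq_zero_or_one (hF : IsTwisted F ξ η κ) (h : IsSecondStep F ξ η S v) (hA : η < ξ)
    (hξ : ξ ∉ S) : v ξ = 0 ∨ v ξ = 1 := by
  classical
  by_contra hno
  rw [not_or] at hno
  have hz : ∀ x, x ≠ ξ → v.update ξ 1 x = v x := fun x hx => by
    rw [update_apply_of_ne _ _ hx]
  have hout : outWeight S (v.update ξ 1) = outWeight S v := by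
    refine le_antisymm (outWeight_le fun x _ h0 => ?_) (outWeight_le fun x _ h0 => ?_)
    · by_cases hx : x = ξ
      · rw [hx]; exact hno.1
      · rwa [hz x hx] at h0
    · by_cases hx : x = ξ
      · rw [hx, update_apply_self]; exact one_ne_zero
      · rwa [hz x hx]
  refine h.min (v.update ξ 1) (fun a => ?_) ⟨ξ, ?_, fun x hx => ?_⟩
  · rw [hout]
    refine le_trans (le_of_eq ?_) (h.count a)
    congr 1
    ext x
    rw [mem_filter, mem_filter]
    exact and_congr_right fun hx => by rw [hz x fun e => hξ (e ▸ hx)]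
  · rw [hF.repr_of_ne hF.ne, hF.repr_of_ne hF.ne, update_apply_self]
    exact val_one_lt hno.1 hno.2
  · rw [hF.repr_of_ne (by omega), hF.repr_of_ne (by omega), hz x (by omega)]

/-- If only two values occurred, then #S would be at most twice the outside weight. With five values
available, S can be filled in a more balanced way, and an outside entry can be saved. -/
theorem exists_third (hp : 5 ≤ p) (hF : IsTwisted F ξ η κ) (h : IsSecondStep F ξ η S v)
    (hA : η < ξ) (a b : ZMod p) : ∃ x ∈ S, v x ≠ a ∧ v x ≠ b := by
  classical
  by_contra hno
  push Not at hno
  have h3 := h.three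
  have hsum : #S ≤ #{x ∈ S | v x = a} + #{x ∈ S | v x = b} := by
    refine (card_le_card fun x hx => ?_).trans (card_union_le _ _)
    by_cases hxa : v x = a
    · exact mem_union_left _ (mem_filter.2 ⟨hx, hxa⟩)
    · exact mem_union_right _ (mem_filter.2 ⟨hx, hno x hx hxa⟩)
  have ha := h.count a
  have hb := h.count b
  obtain ⟨o, ho⟩ : ∃ o, outWeight S v = o + 1 := ⟨outWeight S v - 1, by omega⟩
  obtain ⟨f, hf⟩ := exists_balanced (p := p) S (m := o) (by
    have : 5 * o ≤ p * o := Nat.mul_le_mul_right o hp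
    omega)
  obtain ⟨A, hAS, hA0, hAη⟩ : ∃ A, A ∉ S ∧ v A ≠ 0 ∧ (A = η → v ξ = 0) := by
    obtain ⟨A, hAS, hA0, -⟩ := exists_of_lt_outWeight (S := S) (v := v) (B := ∅)
      (by rw [empty_sdiff, card_empty]; omega)
    by_cases hc : A = η ∧ v ξ ≠ 0
    · exact ⟨ξ, fun hξ => hAS (h.closed.left hA ξ hξ A (by omega)), hc.2,
        fun e => absurd e hF.ne⟩
    · exact ⟨A, hAS, hA0, fun e => by by_contra h0; exact hc ⟨e, h0⟩⟩
  have hlt : ∀ x ∈ S, x < A := fun x hx => h.closed.lt_of_mem hF.ne hAS hx (Or.inl hA)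
  set w := setOn S f v with hw
  have hwA : w A ≠ 0 := by rwa [hw, setOn_of_notMem hAS]
  have hout' : outWeight S (w.update A 0) = o := by
    have := outWeight_update_zero hAS hwA
    rw [hw, outWeight_setOn, ← hw] at this
    omega
  have hz : ∀ x, x ∉ S → x ≠ A → w.update A 0 x = v x := fun x hx hxA => by
    rw [update_apply_of_ne _ _ hxA, hw, setOn_of_notMem hx]
  have hnot : ∀ x, A < x → x ∉ S := fun x hx hxS => by
    have := hlt x hxS
    omega
  refine h.min (w.update A 0) (fun a => ?_) ⟨A, ?_, fun x hx => ?_⟩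
  · rw [hout']
    refine le_trans (le_of_eq ?_) (hf a)
    congr 1
    ext x
    rw [mem_filter, mem_filter]
    exact and_congr_right fun hx => by
      rw [update_apply_of_ne _ _ (hlt x hx).ne, hw, setOn_of_mem hx]
  · have hzA : w.update A 0 A = 0 := by rw [update_apply_self]
    rw [hF.repr_apply, hF.repr_apply, hzA]
    by_cases he : A = η
    · rw [if_pos he, if_pos he, hAη he, hz ξ (hnot ξ (by omega)) (by omega), hAη he, mul_zero,
        sub_zero, sub_zero, ZMod.val_zero]
      exact val_pos_of_ne_zero hA0
    · rw [if_neg he, if_neg he, sub_zero, sub_zero, ZMod.val_zero]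
      exact val_pos_of_ne_zero hA0
  · exact hF.repr_congr (hz x (hnot x hx) hx.ne') fun e =>
      hz ξ (hnot ξ (by omega)) (by omega)

/-- The topmost nonzero entry other than η is excluded by `false_of_top`, unless η ∈ S lies above it
with a nonzero entry. Then the correction at η is 0 or 1, so exchanging values would improve unless
the entry at η is 1, and `false_of_zero_one` applies. -/
theorem false_of_left (hp : 5 ≤ p) (hF : IsTwisted F ξ η κ) (h : IsSecondStep F ξ η S v)
    (hA : η < ξ) : False := by
  classical
  obtain ⟨y, hy, hy0, hyη⟩ := h.exists_third hp hF hA 0 (v η)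
  set R : Finset ℕ := {x ∈ S | v x ≠ 0 ∧ x ≠ η} with hR
  have hRne : R.Nonempty := ⟨y, mem_filter.2 ⟨hy, hy0, fun e => hyη (by rw [e])⟩⟩
  set N := R.max' hRne with hNdef
  obtain ⟨hN, hN0, hNη⟩ : N ∈ S ∧ v N ≠ 0 ∧ N ≠ η := mem_filter.1 (R.max'_mem hRne)
  have hab : ∀ x ∈ S, N < x → x ≠ η → v x = 0 := fun x hx hNx hxη => by
    by_contra h0
    exact absurd (R.le_max' x (mem_filter.2 ⟨hx, h0, hxη⟩)) (not_le.2 hNx)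
  by_cases hc : N < η → v η = 0
  · refine h.false_of_top hp hF hN hNη hN0 hab fun hlt π b hb => ?_
    refine repr_setOn_eta hF (fun _ => ?_) fun hξ => ?_
    · rw [hc hlt, hb, zero_add]
    · rw [hab ξ hξ (by omega) hF.ne, hb, zero_add]
  · push Not at hc
    obtain ⟨hlt, hη0⟩ := hc
    have hηS : η ∈ S := by
      by_contra hηS
      -- then `v η` is not on `S`, and the coordinate at `η` is unaffected
      refine h.false_of_top hp hF hN hNη hN0 hab fun _ π b hb => ?_
      exact repr_setOn_eta hF (fun h' => absurd h' hηS) fun hξ =>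
        absurd (h.closed.left hA ξ hξ η hA) hηS
    have habη : ∀ x ∈ S, η < x → v x = 0 := fun x hx hηx => hab x hx (by omega) (by omega)
    -- the coordinate at `η` after a change of values which fixes `0`
    set e : ZMod p := if ξ ∈ S then 0 else κ * v ξ with he
    have he01 : e = 0 ∨ e = 1 := by
      rw [he]
      split_ifs with hξ
      · exact Or.inl rfl
      · rcases h.eq_zero_or_one hF hA hξ with h0 | h1
        · rw [h0, mul_zero]; exact Or.inl rfl
        · rw [h1, mul_one]
          rcases hF.order with ⟨-, hκ⟩ | ⟨hB, -⟩
          · exact hκ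
          · omega
    have hrepr : ∀ f : ℕ → ZMod p, (ξ ∈ S → f ξ = 0) → F.repr (setOn S f v) η = f η - e := by
      intro f hf
      rw [hF.repr_eta, setOn_of_mem hηS, he]
      split_ifs with hξ
      · rw [setOn_of_mem hξ, hf hξ, mul_zero]
      · rw [setOn_of_notMem hξ]
    have hvv : setOn S v v = v := by
      ext x
      by_cases hx : x ∈ S
      · rw [setOn_of_mem hx]
      · rw [setOn_of_notMem hx]
    have hvη : F.repr v η = v η - e := by
      have := hrepr v fun hξ => habη ξ hξ hA
      rwa [hvv] at this
    have hη1 : v η = 1 := by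
      by_contra hη1
      have h0 : Equiv.swap 1 (v η) 0 = 0 :=
        Equiv.swap_apply_of_ne_of_ne zero_ne_one hη0.symm
      refine h.min (setOn S (fun x => Equiv.swap 1 (v η) (v x)) v) (fun a => ?_)
        ⟨η, ?_, fun x hx => ?_⟩
      · rw [card_setOn, outWeight_setOn]
        exact card_filter_perm h.count _ a
      · rw [hrepr _ fun hξ => by rw [habη ξ hξ hA, h0], Equiv.swap_apply_right, hvη]
        rcases he01 with h' | h'
        · rw [h', sub_zero, sub_zero]
          exact val_one_lt hη0 hη1
        · rw [h', sub_self, ZMod.val_zero]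
          exact val_pos_of_ne_zero (sub_ne_zero.2 hη1)
      · rw [hF.repr_of_ne (by omega), hF.repr_of_ne (by omega)]
        by_cases hxS : x ∈ S
        · rw [setOn_of_mem hxS, habη x hxS hx, h0]
        · rw [setOn_of_notMem hxS]
    exact h.false_of_zero_one hp hF hη1 (fun hξ => habη ξ hξ hA) (h.exists_third hp hF hA 0 1)

end Left

/-- If the special indices are not in `S`, or the entries there coincide, then the topmost nonzero
entry leads to a contradiction. -/
theorem false_of_right (hp : 5 ≤ p) (hF : IsTwisted F ξ η κ) (h : IsSecondStep F ξ η S v)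
    (hB : ξ < η) (hs : ξ ∈ S → v ξ = v η) : False := by
  classical
  obtain ⟨y, hy, hy0, hyη⟩ : ∃ x ∈ S, v x ≠ 0 ∧ x ≠ η := by
    obtain ⟨y, hy, hy0⟩ := h.exists_ne_zero hF
    by_cases hyη : y = η
    · have hξ := (h.closed.mem_iff hB).2 (hyη ▸ hy)
      exact ⟨ξ, hξ, by rw [hs hξ, ← hyη]; exact hy0, hF.ne⟩
    · exact ⟨y, hy, hy0, hyη⟩
  set R : Finset ℕ := {x ∈ S | v x ≠ 0 ∧ x ≠ η} with hR
  have hRne : R.Nonempty := ⟨y, mem_filter.2 ⟨hy, hy0, hyη⟩⟩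
  set N := R.max' hRne with hNdef
  obtain ⟨hN, hN0, hNη⟩ : N ∈ S ∧ v N ≠ 0 ∧ N ≠ η := mem_filter.1 (R.max'_mem hRne)
  refine h.false_of_top hp hF hN hNη hN0 (fun x hx hNx hxη => ?_) fun _ π b _ => ?_
  · by_contra h0
    exact absurd (R.le_max' x (mem_filter.2 ⟨hx, h0, hxη⟩)) (not_le.2 hNx)
  · by_cases hξ : ξ ∈ S
    · refine repr_setOn_eta_of_sub hF hB hξ ((h.closed.mem_iff hB).1 hξ) ?_
      rw [hs hξ]
      ring
    · exact repr_setOn_eta hF (fun hη => absurd ((h.closed.mem_iff hB).2 hη) hξ)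
        fun h' => absurd h' hξ

end IsSecondStep

end LexCode

/-! ### p ≥ 5: different entries at ξ and η, and the reduction to p = d = 5 -/

namespace LexCode

open Finset

variable {p : ℕ} [Fact p.Prime] {F : OrdBasis p} {ξ η : ℕ} {κ : ZMod p} {S : Finset ℕ} {v : Vec p}

theorem exists_perm_of_injective {α : Type*} {n : ℕ} {x y : Fin n → α}
    (hx : Function.Injective x) (hy : Function.Injective y) :
    ∃ π : Equiv.Perm α, ∀ i, π (x i) = y i := by
  obtain ⟨π, hπ⟩ := MulAction.isMultiplyPretransitive_iff.1
    (Equiv.Perm.isMultiplyPretransitive α n) ⟨x, hx⟩ ⟨y, hy⟩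
  exact ⟨π, fun i => DFunLike.congr_fun hπ i⟩

theorem exists_perm_three {α : Type*} {a b c a' b' c' : α} (hab : a ≠ b) (hac : a ≠ c)
    (hbc : b ≠ c) (hab' : a' ≠ b') (hac' : a' ≠ c') (hbc' : b' ≠ c') :
    ∃ π : Equiv.Perm α, π a = a' ∧ π b = b' ∧ π c = c' := by
  obtain ⟨π, hπ⟩ := exists_perm_of_injective (x := ![a, b, c]) (y := ![a', b', c'])
    (fun i j => by fin_cases i <;> fin_cases j <;> simp [*, Ne.symm])
    (fun i j => by fin_cases i <;> fin_cases j <;> simp [*, Ne.symm])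
  exact ⟨π, hπ 0, hπ 1, hπ 2⟩

theorem exists_perm_four {α : Type*} {a b c d a' b' c' d' : α} (hab : a ≠ b) (hac : a ≠ c)
    (had : a ≠ d) (hbc : b ≠ c) (hbd : b ≠ d) (hcd : c ≠ d) (hab' : a' ≠ b') (hac' : a' ≠ c')
    (had' : a' ≠ d') (hbc' : b' ≠ c') (hbd' : b' ≠ d') (hcd' : c' ≠ d') :
    ∃ π : Equiv.Perm α, π a = a' ∧ π b = b' ∧ π c = c' ∧ π d = d' := by
  obtain ⟨π, hπ⟩ := exists_perm_of_injective (x := ![a, b, c, d]) (y := ![a', b', c', d'])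
    (fun i j => by fin_cases i <;> fin_cases j <;> simp [*, Ne.symm])
    (fun i j => by fin_cases i <;> fin_cases j <;> simp [*, Ne.symm])
  exact ⟨π, hπ 0, hπ 1, hπ 2, hπ 3⟩

theorem card_filter_swap {f : ℕ → ZMod p} {x y : ℕ} (hx : x ∈ S) (hy : y ∈ S) (a : ZMod p) :
    #{w ∈ S | f (Equiv.swap x y w) = a} = #{w ∈ S | f w = a} := by
  have hmem : ∀ w ∈ S, Equiv.swap x y w ∈ S := fun w hw => by
    by_cases h1 : w = x
    · rwa [h1, Equiv.swap_apply_left]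
    · by_cases h2 : w = y
      · rwa [h2, Equiv.swap_apply_right]
      · rwa [Equiv.swap_apply_of_ne_of_ne h1 h2]
  refine card_nbij' (Equiv.swap x y) (Equiv.swap x y) (fun w hw => ?_) (fun w hw => ?_)
    (fun w _ => Equiv.swap_apply_self _ _ _) (fun w _ => Equiv.swap_apply_self _ _ _)
  · obtain ⟨h1, h2⟩ := mem_filter.1 hw
    exact mem_filter.2 ⟨hmem w h1, h2⟩
  · obtain ⟨h1, h2⟩ := mem_filter.1 hw
    exact mem_filter.2 ⟨hmem w h1, by rwa [Equiv.swap_apply_self]⟩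

namespace IsSecondStep

/-- Changing the entries on `S` so that those at `ξ` and `η` coincide is an improvement, if no
entry above `η` increases. -/
theorem false_of_eq (hF : IsTwisted F ξ η κ) (h : IsSecondStep F ξ η S v) (hB : ξ < η)
    (hξ : ξ ∈ S) (hη : η ∈ S) (hne : v ξ ≠ v η) {f : ℕ → ZMod p}
    (hf : ∀ a, #{x ∈ S | f x = a} ≤ outWeight S v) (heq : f η = f ξ)
    (hle : ∀ x ∈ S, η < x → (f x).val ≤ (v x).val) : False := by
  refine h.min (setOn S f v) (fun a => ?_) (basisLT_of_le_above η ?_ fun x hx => ?_)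
  · rw [card_setOn, outWeight_setOn]
    exact hf a
  · rw [hF.repr_eta_of_lt hB, hF.repr_eta_of_lt hB, setOn_of_mem hξ, setOn_of_mem hη, heq, sub_self,
      ZMod.val_zero]
    exact val_pos_of_ne_zero (sub_ne_zero.2 hne.symm)
  · rw [hF.repr_of_ne hx.ne', hF.repr_of_ne hx.ne']
    by_cases hxS : x ∈ S
    · rw [setOn_of_mem hxS]
      exact hle x hxS hx
    · rw [setOn_of_notMem hxS]

theorem card_filter_update_le (h : IsSecondStep F ξ η S v) {y : ℕ} {b : ZMod p}
    (hb : #{x ∈ S | v x = b} < outWeight S v) (a : ZMod p) :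
    #{x ∈ S | Function.update v y b x = a} ≤ outWeight S v := by
  classical
  by_cases hab : a = b
  · subst hab
    have h1 : {x ∈ S | Function.update v y a x = a} ⊆ insert y {x ∈ S | v x = a} := fun x hx => by
      obtain ⟨hx, hxa⟩ := mem_filter.1 hx
      by_cases hxy : x = y
      · rw [hxy]; exact mem_insert_self _ _
      · rw [Function.update_of_ne hxy] at hxa
        exact mem_insert_of_mem (mem_filter.2 ⟨hx, hxa⟩)
    exact ((card_le_card h1).trans (card_insert_le _ _)).trans hb
  · refine (card_le_card fun x hx => ?_).trans (h.count a)
    obtain ⟨hx, hxa⟩ := mem_filter.1 hx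
    by_cases hxy : x = y
    · rw [hxy, Function.update_self] at hxa
      exact absurd hxa.symm hab
    · rw [Function.update_of_ne hxy] at hxa
      exact mem_filter.2 ⟨hx, hxa⟩

/-- With outside weight at least 2 the entries at ξ and η can be made equal, which improves the
coordinate at η. -/
theorem outWeight_eq_one (hF : IsTwisted F ξ η κ) (h : IsSecondStep F ξ η S v) (hB : ξ < η)
    (hξ : ξ ∈ S) (hη : η ∈ S) (hne : v ξ ≠ v η) : outWeight S v = 1 := by
  classical
  by_contra ho
  have h1 := h.one_le_outWeight
  -- A value occurring only once may be copied to the other special index. So both values are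
  -- repeated, and then the smaller special entry is exchanged with a second copy of the larger
  -- value; nothing above η increases.
  have hpair : ∀ y ∈ S, ∀ z, (Function.update v z (v y) η = Function.update v z (v y) ξ) → z ≤ η →
      ∃ x ∈ S, v x = v y ∧ x ≠ y := fun y hy z hz hzη => by
    by_contra hno
    push Not at hno
    have hle : #{x ∈ S | v x = v y} ≤ 1 := card_le_one.2 fun a ha b hb => by
      obtain ⟨ha, ha'⟩ := mem_filter.1 ha
      obtain ⟨hb, hb'⟩ := mem_filter.1 hb
      rw [hno a ha ha', hno b hb hb']
    refine h.false_of_eq hF hB hξ hη hne (h.card_filter_update_le (y := z) (b := v y) (by omega))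
      hz fun x _ hx => ?_
    rw [Function.update_of_ne (by omega)]
  rcases lt_or_gt_of_ne (fun e => hne (ZMod.val_injective p e)) with hlt | hlt
  · obtain ⟨x, hx, hxη, hne'⟩ := hpair η hη ξ
      (by rw [Function.update_self, Function.update_of_ne hF.ne.symm]) hB.le
    have hxξ : x ≠ ξ := fun e => hne (by rw [← hxη, e])
    refine h.false_of_eq hF hB hξ hη hne (f := fun w => v (Equiv.swap ξ x w))
      (fun a => (card_filter_swap hξ hx a).trans_le (h.count a)) ?_ fun w _ hw => ?_
    · rw [Equiv.swap_apply_left, Equiv.swap_apply_of_ne_of_ne hF.ne.symm hne'.symm, hxη]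
    · by_cases hwx : w = x
      · rw [hwx, Equiv.swap_apply_right, hxη]
        exact hlt.le
      · rw [Equiv.swap_apply_of_ne_of_ne (by omega) hwx]
  · obtain ⟨x, hx, hxξ, hne'⟩ := hpair ξ hξ η
      (by rw [Function.update_self, Function.update_of_ne hF.ne]) le_rfl
    have hxη : x ≠ η := fun e => hne (by rw [← hxξ, e])
    refine h.false_of_eq hF hB hξ hη hne (f := fun w => v (Equiv.swap η x w))
      (fun a => (card_filter_swap hη hx a).trans_le (h.count a)) ?_ fun w _ hw => ?_
    · rw [Equiv.swap_apply_left, Equiv.swap_apply_of_ne_of_ne hF.ne hne'.symm, hxξ]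
    · by_cases hwx : w = x
      · rw [hwx, Equiv.swap_apply_right, hxξ]
        exact hlt.le
      · rw [Equiv.swap_apply_of_ne_of_ne (by omega) hwx]

/-- The entries above `η` are zero. -/
theorem eq_zero_of_lt (hp : 5 ≤ p) (hF : IsTwisted F ξ η κ) (h : IsSecondStep F ξ η S v) {x : ℕ}
    (hx : x ∈ S) (hηx : η < x) : v x = 0 := by
  classical
  by_contra h0
  set R : Finset ℕ := {x ∈ S | v x ≠ 0 ∧ η < x} with hR
  have hRne : R.Nonempty := ⟨x, mem_filter.2 ⟨hx, h0, hηx⟩⟩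
  set N := R.max' hRne with hNdef
  obtain ⟨hN, hN0, hNη⟩ : N ∈ S ∧ v N ≠ 0 ∧ η < N := mem_filter.1 (R.max'_mem hRne)
  refine h.false_of_top hp hF hN hNη.ne' hN0 (fun x hx hNx _ => ?_) fun hlt => absurd hlt (by omega)
  by_contra h0
  exact absurd (R.le_max' x (mem_filter.2 ⟨hx, h0, by omega⟩)) (not_le.2 hNx)

end IsSecondStep

/-- The second step for `ξ < η` in the case in which the entries at `ξ` and `η` differ. -/
structure IsTwistedStep (F : OrdBasis p) (ξ η : ℕ) (S : Finset ℕ) (v : Vec p) : Prop extends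
    IsSecondStep F ξ η S v where
  lt : ξ < η
  left_mem : ξ ∈ S
  right_mem : η ∈ S
  out : outWeight S v = 1
  inj : ∀ x ∈ S, ∀ y ∈ S, v x = v y → x = y
  diff : v η = v ξ + 1

/-- All other cases are excluded. The coordinate at η is nonzero, and multiplying all values by its
inverse makes it 1; the entries above η are zero and do not change. -/
theorem IsSecondStep.isTwistedStep (hp : 5 ≤ p) (hF : IsTwisted F ξ η κ)
    (h : IsSecondStep F ξ η S v) : IsTwistedStep F ξ η S v := by
  have hB : ξ < η := by
    rcases lt_or_gt_of_ne hF.ne with hB | hA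
    · exact hB
    · exact (h.false_of_left hp hF hA).elim
  have hs : ¬ (ξ ∈ S → v ξ = v η) := fun hs => h.false_of_right hp hF hB hs
  push Not at hs
  obtain ⟨hξ, hne⟩ := hs
  have hη := (h.closed.mem_iff hB).1 hξ
  have hout := h.outWeight_eq_one hF hB hξ hη hne
  refine ⟨h, hB, hξ, hη, hout, fun x hx y hy e => ?_, ?_⟩
  · have h1 := h.count (v y)
    rw [hout] at h1
    exact card_le_one.1 h1 x (mem_filter.2 ⟨hx, e⟩) y (mem_filter.2 ⟨hy, rfl⟩)
  · by_contra hno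
    have hδ0 : v η - v ξ ≠ 0 := sub_ne_zero.2 hne.symm
    have hδ1 : v η - v ξ ≠ 1 := fun e => hno (by linear_combination e)
    refine h.min (setOn S (fun x => Equiv.mulLeft₀ _ (inv_ne_zero hδ0) (v x)) v) (fun a => ?_)
      ⟨η, ?_, fun x hx => ?_⟩
    · rw [card_setOn, outWeight_setOn]
      exact card_filter_perm h.count _ a
    · rw [hF.repr_eta_of_lt hB, hF.repr_eta_of_lt hB, setOn_of_mem hξ, setOn_of_mem hη]
      change ((v η - v ξ)⁻¹ * v η - (v η - v ξ)⁻¹ * v ξ).val < _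
      rw [← mul_sub, inv_mul_cancel₀ hδ0]
      exact val_one_lt hδ0 hδ1
    · rw [hF.repr_of_ne hx.ne', hF.repr_of_ne hx.ne']
      by_cases hxS : x ∈ S
      · rw [setOn_of_mem hxS, h.eq_zero_of_lt hp hF hxS hx]
        exact mul_zero _
      · rw [setOn_of_notMem hxS]

instance fact_prime_five : Fact (Nat.Prime 5) := ⟨by norm_num⟩

namespace IsTwistedStep

theorem card_le_one (hinj : ∀ x ∈ S, ∀ y ∈ S, v x = v y → x = y) (f : ZMod p → ZMod p)
    (hf : ∀ x ∈ S, ∀ y ∈ S, f (v x) = f (v y) → v x = v y) (a : ZMod p) :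
    #{x ∈ S | f (v x) = a} ≤ 1 := by
  refine Finset.card_le_one.2 fun x hx y hy => ?_
  obtain ⟨hx, hxa⟩ := mem_filter.1 hx
  obtain ⟨hy, hya⟩ := mem_filter.1 hy
  exact hinj x hx y hy (hf x hx y hy (hxa.trans hya.symm))

/-- Since the entries on S are distinct, any relabelling injective on them is allowed. It keeps the
coordinate at η as soon as the values at ξ and η still differ by 1. -/
theorem false_of_add (hF : IsTwisted F ξ η κ) (h : IsTwistedStep F ξ η S v) {f : ZMod p → ZMod p}
    (hf : ∀ x ∈ S, ∀ y ∈ S, f (v x) = f (v y) → v x = v y) {i : ℕ} (hi : i < p)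
    (hav : ∀ x ∈ S, ∀ i' < i, f (v x) ≠ v x + (i' : ZMod p)) {N : ℕ} (hN : N ∈ S) (hNη : N ≠ η)
    (hlt : (f (v N)).val < (v N + (i : ZMod p)).val)
    (hab : ∀ x ∈ S, N < x → x ≠ η → f (v x) = v x + (i : ZMod p))
    (hd : f (v η) = f (v ξ) + 1) : False := by
  refine h.plain hF (fun a => ?_) hi hav hN hNη hlt hab fun _ => ?_
  · rw [h.out]
    exact card_le_one h.inj f hf a
  · refine repr_setOn_eta_of_sub hF h.lt h.left_mem h.right_mem ?_
    rw [hd, h.diff]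
    ring

theorem false_of_perm (hF : IsTwisted F ξ η κ) (h : IsTwistedStep F ξ η S v)
    (π : Equiv.Perm (ZMod p)) {N : ℕ} (hN : N ∈ S) (hNη : N ≠ η)
    (hlt : (π (v N)).val < (v N).val) (hab : ∀ x ∈ S, N < x → x ≠ η → π (v x) = v x)
    (hd : π (v η) = π (v ξ) + 1) : False := by
  refine h.perm_plain hF π hN hNη hlt hab fun _ => ?_
  refine repr_setOn_eta_of_sub hF h.lt h.left_mem h.right_mem ?_
  rw [hd, h.diff]
  ring

/-- A translation of all values preserves their differences, in particular the coordinate at η, and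
can bring the entry at N to 0. -/
theorem false_of_sub (hF : IsTwisted F ξ η κ) (h : IsTwistedStep F ξ η S v) {N : ℕ} (hN : N ∈ S)
    (hNη : N ≠ η) (hN0 : v N ≠ 0) (hab : ∀ x ∈ S, N < x → x = η) : False := by
  refine h.false_of_perm hF (Equiv.subRight (v N)) hN hNη ?_
    (fun x hx hNx hxη => absurd (hab x hx hNx) hxη) ?_
  · rw [Equiv.subRight_apply, sub_self, ZMod.val_zero]
    exact val_pos_of_ne_zero hN0
  · rw [Equiv.subRight_apply, Equiv.subRight_apply, h.diff]
    ring

/-- There is an ordinary index in `S` above `ξ`. -/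
theorem exists_above (hp : 5 ≤ p) (hF : IsTwisted F ξ η κ) (h : IsTwistedStep F ξ η S v) :
    ∃ x ∈ S, ξ < x ∧ x ≠ η := by
  by_contra hno
  push Not at hno
  have hξ0 : v ξ = 0 := by
    by_contra h0
    exact h.false_of_sub hF h.left_mem hF.ne h0 fun x hx hlt => hno x hx hlt
  have h1 : #({ξ, η} : Finset ℕ) < #S := card_le_two.trans_lt h.three
  obtain ⟨y, hy, hysp⟩ := exists_mem_notMem_of_card_lt_card h1
  rw [mem_insert, mem_singleton, not_or] at hysp
  have hη1 : v η = 1 := by rw [h.diff, hξ0, zero_add]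
  exact h.false_of_zero_one hp hF hη1 (fun _ => hξ0) ⟨y, hy,
    fun e => hysp.1 (h.inj y hy ξ h.left_mem (e.trans hξ0.symm)),
    fun e => hysp.2 (h.inj y hy η h.right_mem (e.trans hη1.symm))⟩

/-- The topmost ordinary index in `S` is the only one above `ξ`. -/
theorem exists_unique_above (hp : 5 ≤ p) (hF : IsTwisted F ξ η κ) (h : IsTwistedStep F ξ η S v) :
    ∃ y ∈ S, ξ < y ∧ y ≠ η ∧ v y = 0 ∧ v ξ = 1 ∧ v η = 2 ∧ ∀ x ∈ S, ξ < x → x = η ∨ x = y := by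
  classical
  obtain ⟨x, hx, hξx, hxη⟩ := h.exists_above hp hF
  set R : Finset ℕ := {x ∈ S | ξ < x ∧ x ≠ η} with hR
  have hRne : R.Nonempty := ⟨x, mem_filter.2 ⟨hx, hξx, hxη⟩⟩
  set y := R.max' hRne with hydef
  obtain ⟨hy, hξy, hyη⟩ : y ∈ S ∧ ξ < y ∧ y ≠ η := mem_filter.1 (R.max'_mem hRne)
  have hab : ∀ x ∈ S, y < x → x = η := fun x hx hyx => by
    by_contra hxη
    exact absurd (R.le_max' x (mem_filter.2 ⟨hx, by omega, hxη⟩)) (not_le.2 hyx)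
  have hy0 : v y = 0 := by
    by_contra h0
    exact h.false_of_sub hF hy hyη h0 hab
  have hξ0 : v ξ ≠ 0 := fun e => hξy.ne (h.inj ξ h.left_mem y hy (e.trans hy0.symm))
  have hη0 : v ξ + 1 ≠ 0 := fun e =>
    hyη (h.inj η h.right_mem y hy (by rw [h.diff, e, hy0])).symm
  have h1 : v ξ ≠ v ξ + 1 := fun e => one_ne_zero (α := ZMod p) (by linear_combination -e)
  have h12 : (1 : ZMod p) ≠ 2 := fun e => one_ne_zero (α := ZMod p) (by linear_combination -e)
  have h13 : (1 : ZMod p) ≠ 3 := fun e => two_ne_zero_of_le hp (by linear_combination -e)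
  have h23 : (2 : ZMod p) ≠ 3 := fun e => one_ne_zero (α := ZMod p) (by linear_combination -e)
  have h2 := two_ne_zero_of_le hp
  have h3 := three_ne_zero_of_le hp
  have huniq : ∀ x ∈ S, ξ < x → x = η ∨ x = y := by
    by_contra hno
    push Not at hno
    obtain ⟨x, hx, hξx, hxη, hxy⟩ := hno
    have hxR : x ∈ R := mem_filter.2 ⟨hx, hξx, hxη⟩
    set Q := R.erase y with hQ
    have hQne : Q.Nonempty := ⟨x, mem_erase.2 ⟨hxy, hxR⟩⟩
    set N := Q.max' hQne with hNdef
    obtain ⟨hNy, hNR⟩ := mem_erase.1 (Q.max'_mem hQne)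
    obtain ⟨hN, hξN, hNη⟩ : N ∈ S ∧ ξ < N ∧ N ≠ η := mem_filter.1 hNR
    have habN : ∀ x ∈ S, N < x → x ≠ η → x = y := fun x hx hNx hxη => by
      by_contra hxy
      exact absurd (Q.le_max' x (mem_erase.2 ⟨hxy, mem_filter.2 ⟨hx, by omega, hxη⟩⟩))
        (not_le.2 hNx)
    have hN0 : v N ≠ 0 := fun e => hNy (h.inj N hN y hy (e.trans hy0.symm))
    have hNξ : v N ≠ v ξ := fun e => hξN.ne' (h.inj N hN ξ h.left_mem e)
    have hNη' : v N ≠ v ξ + 1 := fun e => hNη (h.inj N hN η h.right_mem (e.trans h.diff.symm))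
    -- N is the second highest ordinary index above ξ. There are enough values to send the entries
    -- at y, N, ξ, η to 0, 1, 2, 3, which improves v at N.
    have hN1 : v N = 1 := by
      by_contra hN1
      obtain ⟨π, hπ0, hπN, hπξ, hπη⟩ := exists_perm_four (a' := (0 : ZMod p)) (b' := 1) (c' := 2)
        (d' := 3) hN0.symm hξ0.symm hη0.symm hNξ hNη' h1 zero_ne_one h2.symm h3.symm h12 h13 h23
      refine h.false_of_perm hF π hN hNη ?_ (fun x hx hNx hxη => ?_) ?_
      · rw [hπN]
        exact val_one_lt hN0 hN1
      · rw [habN x hx hNx hxη, hy0, hπ0]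
      · rw [h.diff, hπξ, hπη]
        norm_num
    have hpos : 0 < (v N + ((1 : ℕ) : ZMod p)).val := by
      refine val_pos_of_ne_zero ?_
      rw [hN1, Nat.cast_one, one_add_one_eq_two]
      exact h2
    have hone : ∀ π : Equiv.Perm (ZMod p), (∀ a, π a ≠ a) → π 0 = 1 → π 1 = 0 →
        π (v ξ + 1) = π (v ξ) + 1 → False := fun π hπ hπ0 hπ1 hπd => by
      refine h.false_of_add hF (f := π) (fun _ _ _ _ e => π.injective e)
        (Fact.out : p.Prime).one_lt (fun x _ i' hi' => ?_) hN hNη ?_ (fun x hx hNx hxη => ?_) ?_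
      · obtain rfl : i' = 0 := by omega
        simpa using hπ (v x)
      · rwa [hN1, hπ1, ZMod.val_zero, ← hN1]
      · rw [habN x hx hNx hxη, hy0, hπ0, Nat.cast_one, zero_add]
      · rw [h.diff, hπd]
    rw [hN1] at hNξ
    -- The competitor for v + w(1) must interchange 0 and 1, have no fixed points and keep the
    -- difference of the entries at ξ and η. The corrected shift does so if the entry at ξ is 2, and
    -- its inverse does in the other cases.
    by_cases hξ2 : v ξ = 2
    · refine hone (shiftOne p) (shiftOne_ne hp) shiftOne_zero shiftOne_one ?_
      have e3 : (2 : ZMod p) + 1 = 3 := by norm_num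
      have e4 : (3 : ZMod p) + 1 = 4 := by norm_num
      rw [hξ2, shiftOne_of_ne (a := 2) (by rw [e3]; exact h3) h12.symm, e3,
        shiftOne_of_ne (by rw [e4]; exact four_ne_zero_of_le hp) h13.symm]
    · have e1 : shiftOne p (v ξ) = v ξ + 1 := shiftOne_of_ne hη0 hNξ.symm
      have e2 : shiftOne p (v ξ - 1) = v ξ := by
        rw [shiftOne_of_ne (by rwa [sub_add_cancel])
          (fun e => hξ2 (by linear_combination e)), sub_add_cancel]
      refine hone (shiftOne p).symm (fun a e => ?_) ?_ ?_ ?_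
      · exact shiftOne_ne hp a ((Equiv.symm_apply_eq _).1 e).symm
      · rw [Equiv.symm_apply_eq, shiftOne_one]
      · rw [Equiv.symm_apply_eq, shiftOne_zero]
      · rw [(Equiv.symm_apply_eq _).2 e1.symm, (Equiv.symm_apply_eq _).2 e2.symm, sub_add_cancel]
  have hξ1 : v ξ = 1 := by
    by_contra hξ1
    obtain ⟨π, hπ0, hπξ, hπη⟩ := exists_perm_three (a' := (0 : ZMod p)) (b' := 1) (c' := 2)
      hξ0.symm hη0.symm h1 zero_ne_one h2.symm h12
    refine h.false_of_perm hF π h.left_mem hF.ne ?_ (fun x hx hξx hxη => ?_) ?_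
    · rw [hπξ]
      exact val_one_lt hξ0 hξ1
    · rw [(huniq x hx hξx).resolve_left hxη, hy0, hπ0]
    · rw [h.diff, hπξ, hπη]
      norm_num
  refine ⟨y, hy, hξy, hyη, hy0, hξ1, ?_, huniq⟩
  rw [h.diff, hξ1, one_add_one_eq_two]

theorem card_le (h : IsTwistedStep F ξ η S v) : #S ≤ p := by
  classical
  rw [← ZMod.card p, ← card_image_of_injOn fun x hx y hy => h.inj x hx y hy]
  exact card_le_univ _

/-- For larger p there is a relabelling 0 → 2, 1 → 0, 2 → 1 that sends no a to a or a + 1. It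
competes with v + w(2) and wins at ξ, where it has 0 instead of 3. -/
theorem eq_five (hp : 5 ≤ p) (hF : IsTwisted F ξ η κ) (h : IsTwistedStep F ξ η S v) : p = 5 := by
  by_contra hp5
  obtain ⟨y, hy, hξy, hyη, hy0, hξ1, hη2, huniq⟩ := h.exists_unique_above hp hF
  have hp7 : 7 ≤ p := by
    by_contra hlt
    obtain rfl : p = 6 := by omega
    exact absurd (Fact.out : Nat.Prime 6) (by norm_num)
  have hne : ∀ m : ℕ, m ≠ 0 → m < 7 → (m : ZMod p) ≠ 0 := fun m h0 hm =>
    natCast_ne_zero_of_lt h0 (by omega)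
  have n1 : (1 : ZMod p) ≠ 0 := one_ne_zero
  have n2 : (2 : ZMod p) ≠ 0 := by exact_mod_cast hne 2 (by norm_num) (by norm_num)
  have n3 : (3 : ZMod p) ≠ 0 := by exact_mod_cast hne 3 (by norm_num) (by norm_num)
  have n4 : (4 : ZMod p) ≠ 0 := by exact_mod_cast hne 4 (by norm_num) (by norm_num)
  have n5 : (5 : ZMod p) ≠ 0 := by exact_mod_cast hne 5 (by norm_num) (by norm_num)
  -- A shift by 2, corrected at four values. The corrections -2 → 3 and -1 → 4 move by 5, which must
  -- be nonzero; this is where p = 5 escapes.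
  set π : Equiv.Perm (ZMod p) := Equiv.swap 0 3 * Equiv.swap 1 4 * Equiv.addRight 2 with hπ
  have happ : ∀ a, π a = Equiv.swap 0 3 (Equiv.swap 1 4 (a + 2)) := fun a => rfl
  have hcase : ∀ a, π a = a + 2 ∨ (a = -2 ∧ π a = 3) ∨ (a = -1 ∧ π a = 4) ∨
      (a = 1 ∧ π a = 0) ∨ (a = 2 ∧ π a = 1) := fun a => by
    rw [happ]
    by_cases h1 : a + 2 = 1
    · rw [h1, Equiv.swap_apply_left, Equiv.swap_apply_of_ne_of_ne n4
        (fun e => n1 (by linear_combination e))]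
      exact Or.inr (Or.inr (Or.inl ⟨by linear_combination h1, rfl⟩))
    by_cases h4 : a + 2 = 4
    · rw [h4, Equiv.swap_apply_right, Equiv.swap_apply_of_ne_of_ne n1
        (fun e => n2 (by linear_combination -e))]
      exact Or.inr (Or.inr (Or.inr (Or.inr ⟨by linear_combination h4, rfl⟩)))
    rw [Equiv.swap_apply_of_ne_of_ne h1 h4]
    by_cases h0 : a + 2 = 0
    · rw [h0, Equiv.swap_apply_left]
      exact Or.inr (Or.inl ⟨by linear_combination h0, rfl⟩)
    by_cases h3 : a + 2 = 3
    · rw [h3, Equiv.swap_apply_right]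
      exact Or.inr (Or.inr (Or.inr (Or.inl ⟨by linear_combination h3, rfl⟩)))
    exact Or.inl (Equiv.swap_apply_of_ne_of_ne h0 h3)
  have hπ0 : π 0 = 2 := by
    rcases hcase 0 with e | ⟨e, -⟩ | ⟨e, -⟩ | ⟨e, -⟩ | ⟨e, -⟩
    · rw [e, zero_add]
    · exact (n2 (by linear_combination e)).elim
    · exact (n1 (by linear_combination e)).elim
    · exact (n1 (by linear_combination -e)).elim
    · exact (n2 (by linear_combination -e)).elim
  have hπ1 : π 1 = 0 := by
    have h3 : Equiv.swap (1 : ZMod p) 4 3 = 3 := Equiv.swap_apply_of_ne_of_ne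
      (fun e => n2 (by linear_combination e)) (fun e => n1 (by linear_combination -e))
    rw [happ, show (1 : ZMod p) + 2 = 3 by norm_num, h3, Equiv.swap_apply_right]
  have hπ2 : π 2 = 1 := by
    rw [happ, show (2 : ZMod p) + 2 = 4 by norm_num, Equiv.swap_apply_right,
      Equiv.swap_apply_of_ne_of_ne n1 (fun e => n2 (by linear_combination -e))]
  refine h.false_of_add hF (f := π) (fun _ _ _ _ e => π.injective e) (i := 2) (by omega)
    (fun x _ i' hi' => ?_) h.left_mem hF.ne ?_ (fun x hx hξx hxη => ?_) ?_
  · generalize v x = a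
    have h2 : i' = 0 ∨ i' = 1 := by omega
    intro e
    rcases h2 with rfl | rfl
    · rw [Nat.cast_zero, add_zero] at e
      rcases hcase a with e' | ⟨e', e''⟩ | ⟨e', e''⟩ | ⟨e', e''⟩ | ⟨e', e''⟩
      · exact n2 (by linear_combination e - e')
      · exact n5 (by linear_combination e - e'' + e')
      · exact n5 (by linear_combination e - e'' + e')
      · exact n1 (by linear_combination -e + e'' - e')
      · exact n1 (by linear_combination -e + e'' - e')
    · rw [Nat.cast_one] at e
      rcases hcase a with e' | ⟨e', e''⟩ | ⟨e', e''⟩ | ⟨e', e''⟩ | ⟨e', e''⟩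
      · exact n1 (by linear_combination e - e')
      · exact n4 (by linear_combination e - e'' + e')
      · exact n4 (by linear_combination e - e'' + e')
      · exact n2 (by linear_combination -e + e'' - e')
      · exact n2 (by linear_combination -e + e'' - e')
  · rw [hξ1, hπ1, ZMod.val_zero]
    refine val_pos_of_ne_zero fun e => n3 ?_
    rw [Nat.cast_ofNat] at e
    linear_combination e
  · rw [(huniq x hx hξx).resolve_left hxη, hy0, hπ0, Nat.cast_ofNat, zero_add]
  · rw [hη2, hξ1, hπ2, hπ1, zero_add]

theorem card_eq_five {F : OrdBasis 5} {S : Finset ℕ} {v : Vec 5} {κ : ZMod 5}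
    (hF : IsTwisted F ξ η κ) (h : IsTwistedStep F ξ η S v) : #S = 5 := by
  by_contra hS5
  obtain ⟨y, hy, hξy, hyη, hy0, hξ1, hη2, huniq⟩ := h.exists_unique_above le_rfl hF
  -- No a is sent to a, a + 1 or a + 2, so this competes with v + w(3) and wins at ξ with 0 against
  -- 4. Only 3 and 4 collide, and if S had fewer than five elements, one of them would be missing.
  set f : ZMod 5 → ZMod 5 := ![3, 0, 1, 2, 2] with hf
  have ha : ∀ a : ZMod 5, a = 0 ∨ a = 1 ∨ a = 2 ∨ a = 3 ∨ a = 4 := by decide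
  have hmiss : ∀ x ∈ S, ∀ w ∈ S, v x = 3 → v w = 4 → False := fun x hx w hw hx3 hw4 => by
    refine hS5 (le_antisymm h.card_le ?_)
    have huniv : (univ : Finset (ZMod 5)) ⊆ S.image v := fun a _ => by
      rcases ha a with rfl | rfl | rfl | rfl | rfl
      · exact mem_image.2 ⟨y, hy, hy0⟩
      · exact mem_image.2 ⟨ξ, h.left_mem, hξ1⟩
      · exact mem_image.2 ⟨η, h.right_mem, hη2⟩
      · exact mem_image.2 ⟨x, hx, hx3⟩
      · exact mem_image.2 ⟨w, hw, hw4⟩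
    exact (card_le_card huniv).trans card_image_le
  have hinj : ∀ a b, f a = f b → a = b ∨ a = 3 ∧ b = 4 ∨ a = 4 ∧ b = 3 := by
    have : ∀ a b : Fin 5, (![3, 0, 1, 2, 2] : Fin 5 → Fin 5) a = (![3, 0, 1, 2, 2] : Fin 5 → Fin 5) b →
        a = b ∨ a = 3 ∧ b = 4 ∨ a = 4 ∧ b = 3 := by decide
    exact this
  have hav : ∀ a, ∀ i' < 3, f a ≠ a + ((i' : ℕ) : ZMod 5) := by
    rw [hf]; decide
  refine h.false_of_add hF (f := f) (fun x hx w hw e => ?_) (i := 3) (by norm_num)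
    (fun x _ => hav (v x)) h.left_mem hF.ne ?_ (fun x hx hξx hxη => ?_) ?_
  · rcases hinj _ _ e with e | ⟨e1, e2⟩ | ⟨e1, e2⟩
    · exact e
    · exact (hmiss x hx w hw e1 e2).elim
    · exact (hmiss w hw x hx e2 e1).elim
  · rw [hξ1, hf]; decide
  · rw [(huniq x hx hξx).resolve_left hxη, hy0, hf]; decide
  · rw [hη2, hξ1, hf]; decide

end IsTwistedStep

end LexCode

/-! ### Agreement of functions on 𝔽₅ with lines -/

namespace LexCode

open Finset

/-- The number of agreements of `φ : 𝔽₅ → 𝔽₅` with the line `m + n a`, where `t` is compared with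
the slope in addition. -/
def lineAgree (φ : ZMod 5 → ZMod 5) (t m n : ZMod 5) : ℕ :=
  (∑ a, if φ a = m + n * a then 1 else 0) + if t = n then 1 else 0

theorem lineAgree_eq (φ : ZMod 5 → ZMod 5) (t m n : ZMod 5) : lineAgree φ t m n =
    (if φ 0 = m then 1 else 0) + (if φ 1 = m + n then 1 else 0) +
    (if φ 2 = m + n * 2 then 1 else 0) + (if φ 3 = m + n * 3 then 1 else 0) +
    (if φ 4 = m + n * 4 then 1 else 0) + if t = n then 1 else 0 := by
  have h : ∀ g : ZMod 5 → ℕ, ∑ a, g a = g 0 + g 1 + g 2 + g 3 + g 4 := Fin.sum_univ_five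
  rw [lineAgree, h, mul_zero, add_zero, mul_one]

theorem exists_fun_five (a b c d e : ZMod 5) : ∃ φ : ZMod 5 → ZMod 5,
    φ 0 = a ∧ φ 1 = b ∧ φ 2 = c ∧ φ 3 = d ∧ φ 4 = e :=
  ⟨![a, b, c, d, e], rfl, rfl, rfl, rfl, rfl⟩

/-- A conic has no nucleus. -/
theorem exists_three_le_lineAgree (φ : ZMod 5 → ZMod 5) (t : ZMod 5) :
    ∃ m n, 3 ≤ lineAgree φ t m n := by
  have key : ∀ a b c d : ZMod 5, ∃ m n : ZMod 5, 3 ≤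
      (if 0 = m then 1 else 0) + (if a = m + n then 1 else 0) +
      (if b = m + n * 2 then 1 else 0) + (if c = m + n * 3 then 1 else 0) +
      (if d = m + n * 4 then 1 else 0) + if 0 = n then 1 else 0 := by
    decide +kernel
  -- Subtracting the line φ 0 + t a reduces to a function vanishing at 0 and to slope 0, so that
  -- only four values remain to be checked.
  obtain ⟨m, n, h⟩ := key (φ 1 - φ 0 - t) (φ 2 - φ 0 - t * 2) (φ 3 - φ 0 - t * 3)
    (φ 4 - φ 0 - t * 4)
  refine ⟨φ 0 + m, t + n, h.trans (le_of_eq ?_)⟩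
  rw [lineAgree_eq]
  have e : ∀ {a b c d : ZMod 5}, (d - c = b - a) → ((a = b) = (c = d)) := fun {a b c d} hs =>
    propext ⟨fun h' => by rw [h', sub_self] at hs; exact (sub_eq_zero.1 hs).symm,
      fun h' => by rw [h', sub_self] at hs; exact (sub_eq_zero.1 hs.symm).symm⟩
  have e' : ∀ {a b c d : ZMod 5}, (d - c = b - a) →
      (if a = b then 1 else 0) = if c = d then 1 else 0 := fun {a b c d} hs => by
    congr 1
    exact e hs
  refine congrArg₂ _ (congrArg₂ _ (congrArg₂ _ (congrArg₂ _ (congrArg₂ _ ?_ ?_) ?_) ?_) ?_) ?_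
  all_goals exact e' (by ring)

/-- Supplies the competitor that bounds the third basis word from above: its leading values are the
smallest for which no line agrees four times. -/
theorem exists_lineAgree_le : ∃ φ : ZMod 5 → ZMod 5, φ 0 = 0 ∧ φ 1 = 1 ∧ φ 2 = 1 ∧
    ∀ m n, lineAgree φ 0 m n ≤ 3 := by
  obtain ⟨φ, h0, h1, h2, h3, h4⟩ := exists_fun_five 0 1 1 0 2
  refine ⟨φ, h0, h1, h2, fun m n => ?_⟩
  rw [lineAgree_eq, h0, h1, h2, h3, h4]
  revert m n
  have : ∀ m n : ZMod 5,
      (if 0 = m then 1 else 0) + (if 1 = m + n then 1 else 0) +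
      (if 1 = m + n * 2 then 1 else 0) + (if 0 = m + n * 3 then 1 else 0) +
      (if 2 = m + n * 4 then 1 else 0) + (if 0 = n then 1 else 0) ≤ 3 := by
    decide +kernel
  exact this

/-- Supplies the competitor that beats the sum of the third basis word and w(1). The values at 3 and
4 are kept away from given ones to ensure the distance from the third basis word itself. -/
theorem exists_lineAgree_le_of_ne (a b : ZMod 5) : ∃ φ : ZMod 5 → ZMod 5,
    φ 0 = 1 ∧ φ 1 = 0 ∧ φ 2 = 0 ∧ φ 3 ≠ a ∧ φ 4 ≠ b ∧ ∀ m n, lineAgree φ 0 m n ≤ 3 := by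
  have key : ∀ a b : ZMod 5, ∃ c d : ZMod 5, c ≠ a ∧ d ≠ b ∧ ∀ m n : ZMod 5,
      (if 1 = m then 1 else 0) + (if 0 = m + n then 1 else 0) +
      (if 0 = m + n * 2 then 1 else 0) + (if c = m + n * 3 then 1 else 0) +
      (if d = m + n * 4 then 1 else 0) + (if 0 = n then 1 else 0) ≤ 3 := by
    decide +kernel
  obtain ⟨c, d, hc, hd, h⟩ := key a b
  obtain ⟨φ, h0, h1, h2, h3, h4⟩ := exists_fun_five 1 0 0 c d
  refine ⟨φ, h0, h1, h2, h3 ▸ hc, h4 ▸ hd, fun m n => ?_⟩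
  rw [lineAgree_eq, h0, h1, h2, h3, h4]
  exact h m n

end LexCode

/-! ### The exceptional case p = d = 5 -/

namespace LexCode

open Finset

variable {F : OrdBasis 5} {ξ η : ℕ} {κ : ZMod 5}

/-- The first two basis words of a code over `𝔽₅` with minimal distance `5` are lines on the six
indices `e a` and `τ`. -/
structure IsFiveStep (F : OrdBasis 5) (ξ η : ℕ) (e : ZMod 5 → ℕ) (τ : ℕ) : Prop where
  inj : Function.Injective e
  left : e 1 = ξ
  right : e 2 = η
  lt : ξ < η
  top : ξ < e 0
  third : e 3 < ξ
  fourth : e 4 < ξ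
  out : ∀ a, e a ≠ τ
  top_lt : e 0 < τ
  gap : ∀ A, (∀ a, e a ≠ A) → A ≠ τ → τ < A
  one : ∀ a, word F 5 1 (e a) = 1
  one_of_ne : ∀ x, (∀ a, e a ≠ x) → word F 5 1 x = 0
  five : ∀ a, word F 5 5 (e a) = a
  five_out : word F 5 5 τ = 1
  five_of_ne : ∀ x, (∀ a, e a ≠ x) → x ≠ τ → word F 5 5 x = 0

/-- The second basis word is a bijection from S to 𝔽₅, and e is its inverse. Its single outside
entry is 1 and sits at the lowest free index τ, by minimality. -/
theorem exists_isFiveStep (hF : IsTwisted F ξ η κ) (hlin : IsLinearCode (lexCode F 5 2)) :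
    ∃ e τ, IsFiveStep F ξ η e τ := by
  obtain ⟨S, hS, hu, hstep⟩ := exists_isSecondStep hF (by norm_num) hlin
  have h := hstep.isTwistedStep le_rfl hF
  obtain ⟨y, hy, hξy, hyη, hy0, hξ1, hη2, huniq⟩ := h.exists_unique_above le_rfl hF
  set v := word F 5 5 with hv
  have hsurj : ∀ a, ∃ x ∈ S, v x = a := fun a => by
    have : S.image v = univ := by
      rw [← card_eq_iff_eq_univ, card_image_of_injOn fun x hx y hy => h.inj x hx y hy, hS, ZMod.card]
    simpa using this.ge (mem_univ a)
  choose e heS hev using hsurj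
  have heq : ∀ {x a}, x ∈ S → v x = a → e a = x := fun {x a} hx hxa =>
    h.inj _ (heS a) x hx ((hev a).trans hxa.symm)
  have hnot : ∀ {x}, (∀ a, e a ≠ x) → x ∉ S := fun {x} hx hxS => hx _ (heq hxS rfl)
  obtain ⟨τ, hτ⟩ := card_eq_one.1 h.out
  have hτ' : τ ∈ v.support \ S := hτ ▸ mem_singleton_self τ
  rw [mem_sdiff, Finsupp.mem_support_iff] at hτ'
  obtain ⟨hτ0, hτS⟩ := hτ'
  have hother : ∀ x, x ∉ S → x ≠ τ → v x = 0 := fun x hx hxτ => by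
    by_contra h0
    have : x ∈ v.support \ S := mem_sdiff.2 ⟨Finsupp.mem_support_iff.2 h0, hx⟩
    rw [hτ, mem_singleton] at this
    exact hxτ this
  have hτξ : τ ≠ ξ := fun e' => hτS (e' ▸ h.left_mem)
  have hτη : τ ≠ η := fun e' => hτS (e' ▸ h.right_mem)
  have h1 : e 1 = ξ := heq h.left_mem hξ1
  have h2 : e 2 = η := heq h.right_mem hη2
  have h0 : e 0 = y := heq hy hy0
  have hinj : Function.Injective e := fun a b hab => by rw [← hev a, hab, hev b]
  have hbelow : ∀ a, a ≠ 0 → a ≠ 1 → a ≠ 2 → e a < ξ := fun a ha0 ha1 ha2 => by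
    by_contra hle
    have hne : e a ≠ ξ := fun e' => ha1 (hinj (e'.trans h1.symm))
    rcases huniq (e a) (heS a) (by omega) with e' | e'
    · exact ha2 (hinj (e'.trans h2.symm))
    · exact ha0 (hinj (e'.trans h0.symm))
  -- a vector that is smaller at an index outside of `S`
  have hmin : ∀ z : Vec 5, (∀ x ∈ S, z x = v x) → 1 ≤ outWeight S z → (z τ).val < (v τ).val →
      (∀ x, τ < x → z x = v x) → False := fun z hzS hzo hlt hab => by
    refine h.min z (fun a => ?_) ⟨τ, ?_, fun x hx => ?_⟩
    · refine le_trans (le_of_eq ?_) ((h.count a).trans (h.out.le.trans hzo))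
      congr 1
      exact filter_congr fun x hx => by rw [hzS x hx]
    · rwa [hF.repr_of_ne hτη, hF.repr_of_ne hτη]
    · exact hF.repr_congr (hab x hx) fun _ => hzS ξ h.left_mem
  refine ⟨e, τ, hinj, h1, h2, h.lt, h0 ▸ hξy, hbelow 3 (by decide) (by decide) (by decide),
    hbelow 4 (by decide) (by decide) (by decide), fun a e' => hτS (e' ▸ heS a), ?_,
    fun A hA hAτ => ?_, fun a => ?_, fun x hx => ?_, hev, ?_, fun x hx => hother x (hnot hx)⟩
  · exact h.closed.lt_of_mem hF.ne hτS (heS 0) (Or.inr ⟨by rw [h0]; exact hξy.ne', by rwa [h0]⟩)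
  · by_contra hlt
    have hAS := hnot hA
    have hz : ∀ x, x ≠ A → x ≠ τ → ((v.update τ 0).update A 1) x = v x := fun x hxA hxτ => by
      rw [update_apply_of_ne _ _ hxA, update_apply_of_ne _ _ hxτ]
    refine hmin ((v.update τ 0).update A 1) (fun x hx => ?_) (card_pos.2 ⟨A, ?_⟩) ?_ fun x hx => ?_
    · exact hz x (fun e' => hAS (e' ▸ hx)) fun e' => hτS (e' ▸ hx)
    · rw [mem_sdiff, Finsupp.mem_support_iff, update_apply_self]
      exact ⟨one_ne_zero, hAS⟩
    · rw [update_apply_of_ne _ _ hAτ.symm, update_apply_self, ZMod.val_zero]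
      exact val_pos_of_ne_zero hτ0
    · exact hz x (by omega) (by omega)
  · rw [hu, if_pos (heS a)]
  · rw [hu, if_neg (hnot hx)]
  · by_contra hτ1
    refine hmin (v.update τ 1) (fun x hx => ?_) (card_pos.2 ⟨τ, ?_⟩) ?_ fun x hx => ?_
    · rw [update_apply_of_ne _ _ fun e' : x = τ => hτS (e' ▸ hx)]
    · rw [mem_sdiff, Finsupp.mem_support_iff, update_apply_self]
      exact ⟨one_ne_zero, hτS⟩
    · rw [update_apply_self]
      exact val_one_lt hτ0 hτ1
    · rw [update_apply_of_ne _ _ hx.ne']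

/-- The six indices of the supports of the first words. -/
def cols (e : ZMod 5 → ℕ) (τ : ℕ) : Finset ℕ := insert τ (univ.image e)

theorem mem_cols {e : ZMod 5 → ℕ} {τ x : ℕ} : x ∈ cols e τ ↔ x = τ ∨ ∃ a, e a = x := by
  simp [cols]

/-- The vector `w` with the values on the six indices replaced. -/
noncomputable def fill (e : ZMod 5 → ℕ) (τ : ℕ) (φ : ZMod 5 → ZMod 5) (t : ZMod 5) (w : Vec 5) :
    Vec 5 :=
  setOn (cols e τ) (fun x => if x = τ then t else Function.extend e φ 0 x) w

namespace IsFiveStep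

variable {e : ZMod 5 → ℕ} {τ : ℕ} {φ : ZMod 5 → ZMod 5} {t : ZMod 5} {w : Vec 5}

theorem fill_apply (h : IsFiveStep F ξ η e τ) (a : ZMod 5) : fill e τ φ t w (e a) = φ a := by
  rw [fill, setOn_of_mem (mem_cols.2 (Or.inr ⟨a, rfl⟩)), if_neg (h.out a), h.inj.extend_apply]

theorem fill_out : fill e τ φ t w τ = t := by
  rw [fill, setOn_of_mem (mem_cols.2 (Or.inl rfl)), if_pos rfl]

theorem fill_of_notMem {x : ℕ} (hx : x ∉ cols e τ) : fill e τ φ t w x = w x := setOn_of_notMem hx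

theorem outWeight_fill : outWeight (cols e τ) (fill e τ φ t w) = outWeight (cols e τ) w :=
  outWeight_setOn

/-- Codewords have entries m + n a at e a and n at τ, and vanish elsewhere. So the distance is 6
plus the outside weight minus the number of agreements with a line. -/
theorem mem_farSet_iff (h : IsFiveStep F ξ η e τ) (hlin : IsLinearCode (lexCode F 5 2)) {z : Vec 5} :
    z ∈ farSet 5 (lexCode F 5 2) ↔
      ∀ m n, lineAgree (fun a => z (e a)) (z τ) m n ≤ outWeight (cols e τ) z + 1 := by
  have hτ : τ ∉ univ.image e := by simpa using h.out
  have hcard : #(cols e τ) = 6 := by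
    rw [cols, card_insert_of_notMem hτ, card_image_of_injective _ h.inj, card_univ, ZMod.card]
  have key : ∀ m n : ZMod 5, lineAgree (fun a => z (e a)) (z τ) m n +
      hdist z (n • word F 5 5 + m • word F 5 1) = 6 + outWeight (cols e τ) z := fun m n => by
    rw [← hcard, ← card_agree_add_hdist_of_notMem (c := n • word F 5 5 + m • word F 5 1)]
    · congr 1
      rw [card_filter, cols, sum_insert hτ, sum_image h.inj.injOn, add_comm, lineAgree]
      congr 1
      · refine sum_congr rfl fun a _ => ?_
        rw [Finsupp.add_apply, Finsupp.smul_apply, Finsupp.smul_apply, h.one, h.five, smul_eq_mul,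
          smul_eq_mul, mul_one, add_comm]
      · rw [Finsupp.add_apply, Finsupp.smul_apply, Finsupp.smul_apply, h.one_of_ne τ h.out,
          h.five_out, smul_zero, add_zero, smul_eq_mul, mul_one]
    · intro x hx
      rw [mem_cols, not_or, not_exists] at hx
      rw [Finsupp.add_apply, Finsupp.smul_apply, Finsupp.smul_apply, h.one_of_ne x hx.2,
        h.five_of_ne x hx.2 hx.1, smul_zero, smul_zero, add_zero]
  constructor
  · intro hz m n
    have h1 := hz (n • word F 5 5 + m • word F 5 1) ((mem_lexCode_succ_iff (by norm_num) hlin).2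
      ⟨n, _, (mem_lexCode_one_iff (by norm_num) (isLinearCode_of_succ (by norm_num) hlin)).2
        ⟨m, rfl⟩, by rw [pow_one]⟩)
    have h2 := key m n
    omega
  · intro hz c hc
    obtain ⟨n, c', hc', rfl⟩ := (mem_lexCode_succ_iff (by norm_num) hlin).1 hc
    obtain ⟨m, rfl⟩ := (mem_lexCode_one_iff (by norm_num)
      (isLinearCode_of_succ (by norm_num) hlin)).1 hc'
    rw [pow_one]
    have h1 := hz m n
    have h2 := key m n
    omega

theorem fill_mem_farSet (h : IsFiveStep F ξ η e τ) (hlin : IsLinearCode (lexCode F 5 2))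
    (hφ : ∀ m n, lineAgree φ t m n ≤ 3) (ho : 2 ≤ outWeight (cols e τ) w) :
    fill e τ φ t w ∈ farSet 5 (lexCode F 5 2) := by
  refine (h.mem_farSet_iff hlin).2 fun m n => ?_
  rw [outWeight_fill, fill_out, show (fun a => fill e τ φ t w (e a)) = φ from
    funext fun a => h.fill_apply a]
  exact (hφ m n).trans (by omega)

theorem eq_of_mem_cols (h : IsFiveStep F ξ η e τ) {x : ℕ} (hx : x ∈ cols e τ) (hξ : ξ < x) :
    x = τ ∨ x = e 0 ∨ x = η := by
  rcases mem_cols.1 hx with hx | ⟨a, rfl⟩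
  · exact Or.inl hx
  · have ha : ∀ a : ZMod 5, a = 0 ∨ a = 1 ∨ a = 2 ∨ a = 3 ∨ a = 4 := by decide
    have h1 := h.left
    have h3 := h.third
    have h4 := h.fourth
    rcases ha a with rfl | rfl | rfl | rfl | rfl
    · exact Or.inr (Or.inl rfl)
    · omega
    · exact Or.inr (Or.inr h.right)
    · omega
    · omega

theorem repr_fill_eta (hF : IsTwisted F ξ η κ) (h : IsFiveStep F ξ η e τ) :
    F.repr (fill e τ φ t w) η = φ 2 - φ 1 := by
  rw [hF.repr_eta_of_lt h.lt, ← h.right, ← h.left, h.fill_apply, h.fill_apply]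

/-- Above `ξ`, a suitable refilling does not increase the coordinates. -/
theorem repr_fill_le (hF : IsTwisted F ξ η κ) (h : IsFiveStep F ξ η e τ) (h0 : φ 0 = 0)
    (h12 : φ 1 = φ 2) {i : ℕ} (hi : ξ < i) :
    (F.repr (fill e τ φ 0 w) i).val ≤ (F.repr w i).val := by
  by_cases hiη : i = η
  · rw [hiη, h.repr_fill_eta hF, h12, sub_self, ZMod.val_zero]
    exact Nat.zero_le _
  · rw [hF.repr_of_ne hiη, hF.repr_of_ne hiη]
    by_cases hic : i ∈ cols e τ
    · rcases h.eq_of_mem_cols hic hi with rfl | rfl | rfl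
      · rw [fill_out, ZMod.val_zero]
        exact Nat.zero_le _
      · rw [h.fill_apply, h0, ZMod.val_zero]
        exact Nat.zero_le _
      · exact absurd rfl hiη
    · rw [fill_of_notMem hic]

theorem two_le_outWeight (h : IsFiveStep F ξ η e τ) (hlin : IsLinearCode (lexCode F 5 2))
    (hw : w ∈ farSet 5 (lexCode F 5 2)) : 2 ≤ outWeight (cols e τ) w := by
  obtain ⟨m, n, hmn⟩ := exists_three_le_lineAgree (fun a => w (e a)) (w τ)
  have := (h.mem_farSet_iff hlin).1 hw m n
  omega

theorem lt_of_notMem (h : IsFiveStep F ξ η e τ) {A : ℕ} (hA : A ∉ cols e τ) : τ < A := by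
  rw [mem_cols, not_or, not_exists] at hA
  exact h.gap A hA.2 hA.1

theorem ne_of_notMem (h : IsFiveStep F ξ η e τ) {A : ℕ} (hA : A ∉ cols e τ) : A ≠ η := fun e' =>
  hA (e' ▸ mem_cols.2 (Or.inr ⟨2, h.right⟩))

/-- Every function with a slope has a line with three agreements, so at least two outside entries
are needed. A third one could be deleted by refilling the six columns with a pattern having at most
three agreements and small coordinates above ξ. -/
theorem outWeight_eq_two (hF : IsTwisted F ξ η κ) (h : IsFiveStep F ξ η e τ)
    (hlin : IsLinearCode (lexCode F 5 2)) (hw : w ∈ farSet 5 (lexCode F 5 2))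
    (hmin : ∀ z ∈ farSet 5 (lexCode F 5 2), ¬ BasisLT F z w) : outWeight (cols e τ) w = 2 := by
  have h2 := h.two_le_outWeight hlin hw
  by_contra hne
  obtain ⟨A, hA, hA0, -⟩ := exists_of_lt_outWeight (S := cols e τ) (v := w) (B := ∅)
    (by rw [empty_sdiff, card_empty]; omega)
  have hτA := h.lt_of_notMem hA
  have hAη := h.ne_of_notMem hA
  have htop := h.top
  have htop' := h.top_lt
  obtain ⟨φ, h0, h1, h2', hφ⟩ := exists_lineAgree_le
  set z := fill e τ φ 0 w with hz
  have hzA : z A ≠ 0 := by rwa [hz, fill_of_notMem hA]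
  have hout := outWeight_update_zero hA hzA
  rw [hz, outWeight_fill, ← hz] at hout
  have hcol : ∀ x ∈ cols e τ, z.update A 0 x = z x := fun x hx =>
    update_apply_of_ne _ _ fun e' => hA (e' ▸ hx)
  refine hmin (z.update A 0) ((h.mem_farSet_iff hlin).2 fun m n => ?_)
    (basisLT_of_le_above A ?_ fun i hi => ?_)
  · have e1 : (fun a => z.update A 0 (e a)) = φ := funext fun a => by
      rw [hcol _ (mem_cols.2 (Or.inr ⟨a, rfl⟩)), hz, h.fill_apply]
    rw [e1, hcol τ (mem_cols.2 (Or.inl rfl)), hz, fill_out, ← hz]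
    exact (hφ m n).trans (by omega)
  · rw [hF.repr_of_ne hAη, hF.repr_of_ne hAη, update_apply_self, ZMod.val_zero]
    exact val_pos_of_ne_zero hA0
  · rw [hF.repr_congr (x := z.update A 0) (y := z) (update_apply_of_ne _ _ hi.ne')
      fun _ => update_apply_of_ne _ _ (by omega)]
    exact h.repr_fill_le hF h0 (h1.trans h2'.symm) (by omega)

/-- The values of the third basis word. -/
theorem values (hF : IsTwisted F ξ η κ) (h : IsFiveStep F ξ η e τ)
    (hlin : IsLinearCode (lexCode F 5 2)) (hw : w ∈ farSet 5 (lexCode F 5 2))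
    (hmin : ∀ z ∈ farSet 5 (lexCode F 5 2), ¬ BasisLT F z w) :
    w τ = 0 ∧ w (e 0) = 0 ∧ w ξ = 1 ∧ w η = 1 := by
  obtain ⟨φ, h0, h1, h2, hφ⟩ := exists_lineAgree_le
  have hout := h.outWeight_eq_two hF hlin hw hmin
  have htop := h.top
  have htop' := h.top_lt
  have hlt := h.lt
  have hle : ∀ N, ξ ≤ N →
      ¬ (F.repr (fill e τ φ 0 w) N).val < (F.repr w N).val := fun N hN hN' =>
    hmin _ (h.fill_mem_farSet hlin hφ hout.ge) (basisLT_of_le_above N hN' fun i hi =>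
      h.repr_fill_le hF h0 (h1.trans h2.symm) (by omega))
  have hτη : τ ≠ η := h.right ▸ (h.out 2).symm
  have hτ : w τ = 0 := by
    by_contra hne
    refine hle τ (by omega) ?_
    rw [hF.repr_of_ne hτη, hF.repr_of_ne hτη, fill_out, ZMod.val_zero]
    exact val_pos_of_ne_zero hne
  have he0 : w (e 0) = 0 := by
    by_contra hne
    have h0η : e 0 ≠ η := fun e' => absurd (h.inj (e'.trans h.right.symm)) (by decide)
    refine hle (e 0) htop.le ?_
    rw [hF.repr_of_ne h0η, hF.repr_of_ne h0η, h.fill_apply, h0, ZMod.val_zero]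
    exact val_pos_of_ne_zero hne
  have hη : w η = w ξ := by
    by_contra hne
    refine hle η hlt.le ?_
    rw [h.repr_fill_eta hF, h1, h2, sub_self, ZMod.val_zero, hF.repr_eta_of_lt hlt]
    exact val_pos_of_ne_zero (sub_ne_zero.2 hne)
  have hξ : w ξ = 1 := by
    by_contra hne
    by_cases hξ0 : w ξ = 0
    -- If the entry at ξ were 0, the zero line would agree at e 0, ξ, η and τ, which is once more
    -- than permitted.
    · have h3 := (h.mem_farSet_iff hlin).1 hw 0 0
      rw [lineAgree_eq, h.left, h.right, hη, hξ0, hτ, he0, hout] at h3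
      simp only [zero_mul, add_zero, if_true] at h3
      omega
    · refine hle ξ le_rfl ?_
      rw [hF.repr_of_ne hlt.ne, hF.repr_of_ne hlt.ne, ← h.left, h.fill_apply, h1, h.left]
      exact val_one_lt hξ0 hne
  exact ⟨hτ, he0, hξ, hη.trans hξ⟩

end IsFiveStep

/-- The third basis word has entries 0 at e 0 and τ and 1 at ξ and η. Refilling its six columns with
1 at e 0, 0 at ξ, η and τ, and two further values agrees with w(25) + w(1) above ξ and is smaller at
ξ, with 0 against 2. -/
theorem not_isLinearCode_five (hF : IsTwisted F ξ η κ) : ¬ IsLinearCode (lexCode F 5 3) := by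
  intro hlin3
  have hlin := isLinearCode_of_succ (by norm_num) hlin3
  obtain ⟨e, τ, h⟩ := exists_isFiveStep hF hlin
  have hw := word_pow_mem_farSet (F := F) (d := 5) 2
  have hmin : ∀ z ∈ farSet 5 (lexCode F 5 2), ¬ BasisLT F z (word F 5 (5 ^ 2)) := fun z hz =>
    word_pow_min hz
  set w := word F 5 (5 ^ 2) with hwdef
  have hout := h.outWeight_eq_two hF hlin hw hmin
  obtain ⟨hτ, he0, hξ, hη⟩ := h.values hF hlin hw hmin
  obtain ⟨φ, h0, h1, h2, h3, h4, hφ⟩ := exists_lineAgree_le_of_ne (w (e 3)) (w (e 4))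
  have hlt := h.lt
  refine not_lt_add_word (by norm_num) hlin3 (i := 1) (by norm_num)
    (h.fill_mem_farSet hlin hφ hout.ge) (fun i' hi' => ?_) ⟨ξ, ?_, fun i hi => ?_⟩
  · obtain rfl : i' = 0 := by omega
    rw [word_zero, add_zero, ← hwdef, hdist_eq_card_support]
    have hcard : #(univ.image e) = 5 := by
      rw [card_image_of_injective _ h.inj, card_univ, ZMod.card]
    refine hcard.ge.trans (card_le_card fun x hx => ?_)
    obtain ⟨a, -, rfl⟩ := mem_image.1 hx
    rw [Finsupp.mem_support_iff, Finsupp.sub_apply, h.fill_apply, sub_ne_zero]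
    have ha : ∀ a : ZMod 5, a = 0 ∨ a = 1 ∨ a = 2 ∨ a = 3 ∨ a = 4 := by decide
    rcases ha a with rfl | rfl | rfl | rfl | rfl
    · rw [h0, he0]; exact one_ne_zero
    · rw [h1, h.left, hξ]; exact zero_ne_one
    · rw [h2, h.right, hη]; exact zero_ne_one
    · exact h3
    · exact h4
  · rw [hF.repr_of_ne hlt.ne, hF.repr_of_ne hlt.ne, Finsupp.add_apply, hξ, ← h.left, h.fill_apply,
      h.one, h1]
    decide
  · by_cases hiη : i = η
    · rw [hiη, h.repr_fill_eta hF, h1, h2, hF.repr_eta_of_lt hlt, Finsupp.add_apply,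
        Finsupp.add_apply, hξ, hη, ← h.left, ← h.right, h.one, h.one, sub_self, sub_self]
    · rw [hF.repr_of_ne hiη, hF.repr_of_ne hiη, Finsupp.add_apply]
      by_cases hic : i ∈ cols e τ
      · rcases h.eq_of_mem_cols hic hi with rfl | rfl | rfl
        · rw [IsFiveStep.fill_out, hτ, h.one_of_ne _ h.out, add_zero]
        · rw [h.fill_apply, h0, he0, h.one, zero_add]
        · exact absurd rfl hiη
      · rw [IsFiveStep.fill_of_notMem hic, h.one_of_ne i fun a e' =>
          hic (mem_cols.2 (Or.inr ⟨a, e'⟩)), add_zero]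

end LexCode

/-! ### Distance two -/

namespace LexCode

open Finset

variable {p : ℕ} [Fact p.Prime] {F : OrdBasis p}

theorem two_le_hdist {x y : Vec p} {i j : ℕ} (hij : i ≠ j) (hi : x i ≠ y i) (hj : x j ≠ y j) :
    2 ≤ hdist x y := by
  rw [hdist, ← card_pair hij]
  refine card_le_card fun k hk => ?_
  rw [Finsupp.mem_neLocus]
  rcases mem_insert.1 hk with rfl | hk
  · exact hi
  · rw [mem_singleton.1 hk]
    exact hj

theorem hdist_add_single_le_one (c : Vec p) (i : ℕ) (x : ZMod p) :
    hdist (c + Finsupp.single i x) c ≤ 1 := by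
  rw [hdist_eq_card_support, add_sub_cancel_left]
  exact (card_le_card Finsupp.support_single_subset).trans (card_singleton i).le

/-- For d = 2 a vector is excluded exactly when it differs from a codeword in at most one entry. So
the next basis word is identified by presenting every smaller vector in this form. -/
theorem word_pow_eq_of_close {k : ℕ} {t : Vec p} (hfar : t ∈ farSet 2 (lexCode F 2 k))
    (hclose : ∀ z, BasisLT F z t → ∃ c ∈ lexCode F 2 k, ∃ i x, z = c + Finsupp.single i x) :
    word F 2 (p ^ k) = t := by
  by_contra hne
  rcases basisLT_or_of_ne F hne with h | h
  · obtain ⟨c, hc, i, x, e⟩ := hclose _ h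
    have h1 := word_pow_mem_farSet (F := F) (d := 2) k c hc
    rw [e] at h1
    exact absurd (h1.trans (hdist_add_single_le_one c i x)) (by norm_num)
  · exact word_pow_min hfar h

theorem mem_lexCode_two_iff {d : ℕ} (hd : 0 < d) (hlin : IsLinearCode (lexCode F d 2)) {x : Vec p} :
    x ∈ lexCode F d 2 ↔ ∃ a b : ZMod p, x = a • word F d p + b • word F d 1 := by
  rw [mem_lexCode_succ_iff hd hlin, pow_one]
  simp only [mem_lexCode_one_iff hd (isLinearCode_of_succ hd hlin)]
  constructor
  · rintro ⟨a, -, ⟨b, rfl⟩, h⟩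
    exact ⟨a, b, h⟩
  · rintro ⟨a, b, h⟩
    exact ⟨a, _, ⟨b, rfl⟩, h⟩

/-- A combination of the first four basis vectors. -/
noncomputable def quad (F : OrdBasis p) (a b c e : ZMod p) : Vec p :=
  a • F 0 + b • F 1 + c • F 2 + e • F 3

theorem eq_quad_of_repr_eq_zero {z : Vec p} (h : ∀ i, 4 ≤ i → F.repr z i = 0) :
    z = quad F (F.repr z 0) (F.repr z 1) (F.repr z 2) (F.repr z 3) := by
  refine F.repr.injective (Finsupp.ext fun i => ?_)
  simp only [quad, map_add, map_smul, Module.Basis.repr_self, Finsupp.add_apply, Finsupp.smul_apply,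
    smul_eq_mul]
  rcases lt_or_ge i 4 with hi | hi
  · interval_cases i <;> simp [Finsupp.single_apply]
  · rw [h i hi]
    simp [Finsupp.single_apply, show ¬ 0 = i by omega, show ¬ 1 = i by omega,
      show ¬ 2 = i by omega, show ¬ 3 = i by omega]

theorem repr_quad (a b c e : ZMod p) (i : ℕ) :
    F.repr (quad F a b c e) i =
      if i = 0 then a else if i = 1 then b else if i = 2 then c else if i = 3 then e else 0 := by
  simp only [quad, map_add, map_smul, Module.Basis.repr_self, Finsupp.add_apply, Finsupp.smul_apply,
    smul_eq_mul]
  rcases lt_or_ge i 4 with hi | hi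
  · interval_cases i <;> simp [Finsupp.single_apply]
  · simp [Finsupp.single_apply, show ¬ 0 = i by omega, show ¬ 1 = i by omega,
      show ¬ 2 = i by omega, show ¬ 3 = i by omega, show ¬ i = 0 by omega, show ¬ i = 1 by omega,
      show ¬ i = 2 by omega, show ¬ i = 3 by omega]

/-- The vectors below a combination of the first four basis vectors. -/
theorem exists_of_basisLT {z : Vec p} {a b c e : ZMod p}
    (h : BasisLT F z (quad F a b c e)) : ∃ a' b' c' e' : ZMod p,
      z = quad F a' b' c' e' ∧
      (e'.val < e.val ∨ e' = e ∧ (c'.val < c.val ∨ c' = c ∧ (b'.val < b.val ∨ b' = b ∧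
        a'.val < a.val))) := by
  obtain ⟨N, hN, hab⟩ := h
  rw [repr_quad] at hN
  simp only [repr_quad] at hab
  have hN4 : N < 4 := by
    by_contra hge
    simp [show ¬ N = 0 by omega, show ¬ N = 1 by omega, show ¬ N = 2 by omega,
      show ¬ N = 3 by omega] at hN
  refine ⟨_, _, _, _, eq_quad_of_repr_eq_zero fun i hi => ?_, ?_⟩
  · rw [hab i (by omega)]
    simp [show ¬ i = 0 by omega, show ¬ i = 1 by omega, show ¬ i = 2 by omega,
      show ¬ i = 3 by omega]
  · interval_cases N
    · have h1 := hab 1 (by norm_num)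
      have h2 := hab 2 (by norm_num)
      have h3 := hab 3 (by norm_num)
      simp at hN h1 h2 h3
      exact Or.inr ⟨h3, Or.inr ⟨h2, Or.inr ⟨h1, hN⟩⟩⟩
    · have h2 := hab 2 (by norm_num)
      have h3 := hab 3 (by norm_num)
      simp at hN h2 h3
      exact Or.inr ⟨h3, Or.inr ⟨h2, Or.inl hN⟩⟩
    · have h3 := hab 3 (by norm_num)
      simp at hN h3
      exact Or.inr ⟨h3, Or.inl hN⟩
    · simp at hN
      exact Or.inl hN

theorem basisLT_quad {a b c e a' b' c' e' : ZMod p}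
    (h : e'.val < e.val ∨ e' = e ∧ (c'.val < c.val ∨ c' = c ∧ (b'.val < b.val ∨ b' = b ∧
        a'.val < a.val))) : BasisLT F (quad F a' b' c' e')
      (quad F a b c e) := by
  rcases h with h | ⟨rfl, h | ⟨rfl, h | ⟨rfl, h⟩⟩⟩
  · exact ⟨3, by simpa [repr_quad] using h, fun i hi => by
      simp [repr_quad, show ¬ i = 0 by omega, show ¬ i = 1 by omega, show ¬ i = 2 by omega,
        show ¬ i = 3 by omega]⟩
  · exact ⟨2, by simpa [repr_quad] using h, fun i hi => by
      simp [repr_quad, show ¬ i = 0 by omega, show ¬ i = 1 by omega, show ¬ i = 2 by omega]⟩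
  · exact ⟨1, by simpa [repr_quad] using h, fun i hi => by
      simp [repr_quad, show ¬ i = 0 by omega, show ¬ i = 1 by omega]⟩
  · exact ⟨0, by simpa [repr_quad] using h, fun i hi => by
      simp [repr_quad, show ¬ i = 0 by omega]⟩

theorem quad_add (a b c e a' b' c' e' : ZMod p) :
    quad F a b c e + quad F a' b' c' e' = quad F (a + a') (b + b') (c + c') (e + e') := by
  simp only [quad, add_smul]
  abel

theorem smul_quad (r a b c e : ZMod p) :
    r • quad F a b c e = quad F (r * a) (r * b) (r * c) (r * e) := by
  simp only [quad, smul_add, smul_smul]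

theorem not_val_lt_zero (a : ZMod p) : ¬ a.val < (0 : ZMod p).val := by simp

theorem eq_zero_of_val_lt_one {a : ZMod p} (h : a.val < (1 : ZMod p).val) : a = 0 := by
  rw [ZMod.val_one''] at h
  · exact (ZMod.val_eq_zero a).1 (by omega)
  · exact (Fact.out : p.Prime).ne_one

theorem mem_farSet_zero {d : ℕ} {z : Vec p} : z ∈ farSet d (lexCode F d 0) ↔ d ≤ hdist z 0 :=
  ⟨fun h => h 0 (mem_lexCode_zero.2 rfl), fun h c hc => by rwa [mem_lexCode_zero.1 hc]⟩

theorem word_one_of_standard (h0 : F 0 = Finsupp.single 0 1) (h1 : F 1 = Finsupp.single 1 1) :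
    word F 2 1 = quad F 1 1 0 0 := by
  refine word_pow_eq_of_close (k := 0) (mem_farSet_zero.2 ?_) fun z hz => ?_
  · exact two_le_hdist zero_ne_one (by simp [quad, h0, h1]) (by simp [quad, h0, h1])
  · obtain ⟨a, b, c, e, rfl, h⟩ := exists_of_basisLT hz
    refine ⟨0, mem_lexCode_zero.2 rfl, ?_⟩
    simp only [not_val_lt_zero, false_or] at h
    obtain ⟨rfl, rfl, h⟩ := h
    rcases h with h | ⟨rfl, h⟩
    · exact ⟨0, a, by simp [quad, h0, eq_zero_of_val_lt_one h]⟩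
    · exact ⟨1, 1, by simp [quad, h1, eq_zero_of_val_lt_one h]⟩

theorem mem_lexCode_one_of_standard (h0 : F 0 = Finsupp.single 0 1)
    (h1 : F 1 = Finsupp.single 1 1) (hlin : IsLinearCode (lexCode F 2 1)) {x : Vec p} :
    x ∈ lexCode F 2 1 ↔ ∃ b, x = quad F b b 0 0 := by
  rw [mem_lexCode_one_iff (by norm_num) hlin, word_one_of_standard h0 h1]
  simp only [smul_quad, mul_one, mul_zero]

/-- In coordinates the basis words are (1, 1, 0) and (1, 0, 1). Their sum (2, 1, 1) is undercut by
(0, 1, 1). -/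
theorem not_isLinearCode_of_standard (hp : 5 ≤ p) (h0 : F 0 = Finsupp.single 0 1)
    (h1 : F 1 = Finsupp.single 1 1) (h2 : F 2 = Finsupp.single 2 1) :
    ¬ IsLinearCode (lexCode F 2 2) := by
  intro hlin
  have hlin1 := isLinearCode_of_succ (by norm_num) hlin
  have n2 := two_ne_zero_of_le hp
  have c0 : ∀ a b c, quad F a b c 0 0 = a := fun a b c => by simp [quad, h0, h1, h2]
  have c1 : ∀ a b c, quad F a b c 0 1 = b := fun a b c => by simp [quad, h0, h1, h2]
  have c2 : ∀ a b c, quad F a b c 0 2 = c := fun a b c => by simp [quad, h0, h1, h2]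
  have hu := word_one_of_standard h0 h1
  have hL1 := fun {x} => mem_lexCode_one_of_standard h0 h1 hlin1 (x := x)
  have hv : word F 2 p = quad F 1 0 1 0 := by
    have := word_pow_eq_of_close (F := F) (k := 1) (t := quad F 1 0 1 0) (fun c hc => ?_)
      fun z hz => ?_
    · rwa [pow_one] at this
    · obtain ⟨b, rfl⟩ := hL1.1 hc
      by_cases hb : b = 0
      · exact two_le_hdist (i := 0) (j := 2) (by norm_num) (by simp [c0, hb]) (by simp [c2])
      · exact two_le_hdist (i := 1) (j := 2) (by norm_num) (by simp [c1, Ne.symm hb])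
          (by simp [c2])
    · obtain ⟨a, b, c, e, rfl, h⟩ := exists_of_basisLT hz
      simp only [not_val_lt_zero, false_or] at h
      obtain ⟨rfl, h⟩ := h
      rcases h with h | ⟨rfl, rfl, h⟩
      · refine ⟨_, hL1.2 ⟨b, rfl⟩, 0, a - b, ?_⟩
        simp [quad, h0, h1, eq_zero_of_val_lt_one h]
        abel
      · exact ⟨_, hL1.2 ⟨0, rfl⟩, 2, 1, by simp [quad, h2, eq_zero_of_val_lt_one h]⟩
  refine not_lt_add_word (F := F) (by norm_num) hlin (i := 1) (z := quad F 0 1 1 0)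
    (by rw [pow_one]; exact (Fact.out : p.Prime).one_lt) (fun c hc => ?_) (fun i' hi' => ?_) ?_
  · obtain ⟨b, rfl⟩ := hL1.1 hc
    by_cases hb : b = 0
    · exact two_le_hdist (i := 1) (j := 2) (by norm_num) (by simp [c1, hb]) (by simp [c2])
    · exact two_le_hdist (i := 0) (j := 2) (by norm_num) (by simp [c0, Ne.symm hb]) (by simp [c2])
  · obtain rfl : i' = 0 := by omega
    rw [word_zero, add_zero, pow_one, hv]
    exact two_le_hdist (i := 0) (j := 1) (by norm_num) (by simp [c0]) (by simp [c1])
  · rw [pow_one, hv, hu, quad_add]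
    refine basisLT_quad (Or.inr ⟨by norm_num, Or.inr ⟨by norm_num, Or.inr ⟨by norm_num, ?_⟩⟩⟩)
    rw [ZMod.val_zero, one_add_one_eq_two]
    exact val_pos_of_ne_zero n2

/-- Here the second basis word is f_2, which has weight two by itself. The third one is (1, 0, 0, 1)
in the basis F, and its sum (2, 1, 0, 1) with the first one is undercut by (0, 1, 0, 1). -/
theorem not_isLinearCode_of_two (hp : 5 ≤ p) {η : ℕ} (hη : η ≠ 2)
    (h0 : F 0 = Finsupp.single 0 1) (h1 : F 1 = Finsupp.single 1 1)
    (h2 : F 2 = Finsupp.single 2 1 + Finsupp.single η 1) (h3 : F 3 = Finsupp.single 3 1) :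
    ¬ IsLinearCode (lexCode F 2 3) := by
  intro hlin3
  have hlin := isLinearCode_of_succ (by norm_num) hlin3
  have hlin1 := isLinearCode_of_succ (by norm_num) hlin
  have hu := word_one_of_standard h0 h1
  have hL1 := fun {x} => mem_lexCode_one_of_standard h0 h1 hlin1 (x := x)
  have c0 : ∀ a b c e, quad F a b c e 0 = a + if η = 0 then c else 0 := fun a b c e => by
    simp [quad, h0, h1, h2, h3, Finsupp.single_apply]
  have c1 : ∀ a b c e, quad F a b c e 1 = b + if η = 1 then c else 0 := fun a b c e => by
    simp [quad, h0, h1, h2, h3, Finsupp.single_apply]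
  have c2 : ∀ a b c e, quad F a b c e 2 = c := fun a b c e => by
    simp [quad, h0, h1, h2, h3, Finsupp.single_apply, hη]
  have c3 : ∀ a b c e, quad F a b c e 3 = e + if η = 3 then c else 0 := fun a b c e => by
    simp [quad, h0, h1, h2, h3, Finsupp.single_apply, add_comm]
  have hv : word F 2 p = quad F 0 0 1 0 := by
    have := word_pow_eq_of_close (F := F) (k := 1) (t := quad F 0 0 1 0) (fun c hc => ?_)
      fun z hz => ?_
    · rwa [pow_one] at this
    · obtain ⟨b, rfl⟩ := hL1.1 hc
      have h2' : quad F 0 0 1 0 2 ≠ quad F b b 0 0 2 := by simp [c2]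
      by_cases hη0 : η = 0
      · by_cases hb : b = 0
        · exact two_le_hdist (i := 0) (by norm_num) (by simp [c0, hb, hη0]) h2'
        · exact two_le_hdist (i := 1) (by norm_num) (by simp [c1, Ne.symm hb, hη0]) h2'
      by_cases hη1 : η = 1
      · by_cases hb : b = 0
        · exact two_le_hdist (i := 1) (by norm_num) (by simp [c1, hb, hη1]) h2'
        · exact two_le_hdist (i := 0) (by norm_num) (by simp [c0, Ne.symm hb, hη1]) h2'
      · refine two_le_hdist (i := η) hη ?_ h2'
        simp [quad, h0, h1, h2, Finsupp.single_apply, Ne.symm hη0, Ne.symm hη1, Ne.symm hη]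
    · obtain ⟨a, b, c, e, rfl, h⟩ := exists_of_basisLT hz
      simp only [not_val_lt_zero, false_or, and_false, or_false] at h
      obtain ⟨rfl, h⟩ := h
      refine ⟨_, hL1.2 ⟨b, rfl⟩, 0, a - b, ?_⟩
      simp [quad, h0, eq_zero_of_val_lt_one h]
      abel
  have hL2 : ∀ {x}, x ∈ lexCode F 2 2 ↔ ∃ a b, x = quad F b b a 0 := fun {x} => by
    rw [mem_lexCode_two_iff (by norm_num) hlin, hu, hv]
    simp only [smul_quad, quad_add, mul_one, mul_zero, zero_add, add_zero]
  have hfar : ∀ x y : ZMod p, x ≠ y → quad F x y 0 1 ∈ farSet 2 (lexCode F 2 2) := by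
    intro x y hxy c hc
    obtain ⟨a, b, rfl⟩ := hL2.1 hc
    have h01 : a = 0 ∨ η = 3 → ∃ i < 2, quad F x y 0 1 i ≠ quad F b b a 0 i := fun ha => by
      by_cases hx : x = b
      · refine ⟨1, by norm_num, ?_⟩
        rcases ha with rfl | rfl <;> simp [c1, ← hx, Ne.symm hxy]
      · refine ⟨0, by norm_num, ?_⟩
        rcases ha with rfl | rfl <;> simp [c0, hx]
    by_cases ha : a = 0
    · obtain ⟨i, hi, h⟩ := h01 (Or.inl ha)
      exact two_le_hdist (j := 3) (by omega) h (by simp [c3, ha])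
    · have h2' : quad F x y 0 1 2 ≠ quad F b b a 0 2 := by simp [c2, Ne.symm ha]
      by_cases hη3 : η = 3
      · obtain ⟨i, hi, h⟩ := h01 (Or.inr hη3)
        exact two_le_hdist (by omega) h h2'
      · exact two_le_hdist (i := 3) (by norm_num) (by simp [c3, hη3]) h2'
  have hw : word F 2 (p ^ 2) = quad F 1 0 0 1 := by
    refine word_pow_eq_of_close (hfar 1 0 one_ne_zero) fun z hz => ?_
    obtain ⟨a, b, c, e, rfl, h⟩ := exists_of_basisLT hz
    simp only [not_val_lt_zero, false_or] at h
    rcases h with h | ⟨rfl, rfl, rfl, h⟩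
    · refine ⟨_, hL2.2 ⟨c, b, rfl⟩, 0, a - b, ?_⟩
      simp [quad, h0, eq_zero_of_val_lt_one h]
      abel
    · exact ⟨_, hL2.2 ⟨0, 0, rfl⟩, 3, 1, by simp [quad, h3, eq_zero_of_val_lt_one h]⟩
  refine not_lt_add_word (F := F) (by norm_num) hlin3 (i := 1) (z := quad F 0 1 0 1)
    (Nat.one_lt_pow (by norm_num) (Fact.out : p.Prime).one_lt) (hfar 0 1 zero_ne_one)
    (fun i' hi' => ?_) ?_
  · obtain rfl : i' = 0 := by omega
    rw [word_zero, add_zero, hw]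
    exact two_le_hdist (i := 0) (j := 1) (by norm_num) (by simp [c0]) (by simp [c1])
  · rw [hw, hu, quad_add]
    refine basisLT_quad (Or.inr ⟨by norm_num, Or.inr ⟨by norm_num, Or.inr ⟨by norm_num, ?_⟩⟩⟩)
    rw [ZMod.val_zero, one_add_one_eq_two]
    exact val_pos_of_ne_zero (two_ne_zero_of_le hp)

/-- A combination of `F ξ`, `F g` and the third and fourth basis vectors. -/
noncomputable def pairQuad (F : OrdBasis p) (ξ g : ℕ) (x y c e : ZMod p) : Vec p :=
  x • F ξ + y • F g + c • F 2 + e • F 3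

section PairQuad

variable {ξ g : ℕ}

theorem pairQuad_add (x y c e x' y' c' e' : ZMod p) : pairQuad F ξ g x y c e +
    pairQuad F ξ g x' y' c' e' = pairQuad F ξ g (x + x') (y + y') (c + c') (e + e') := by
  simp only [pairQuad, add_smul]
  abel

theorem smul_pairQuad (r x y c e : ZMod p) :
    r • pairQuad F ξ g x y c e = pairQuad F ξ g (r * x) (r * y) (r * c) (r * e) := by
  simp only [pairQuad, smul_add, smul_smul]

theorem pairQuad_eq (x y c e : ZMod p) : pairQuad F 0 1 x y c e = quad F x y c e ∧
    pairQuad F 1 0 x y c e = quad F y x c e :=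
  ⟨rfl, by rw [pairQuad, quad, add_comm (x • F 1)]⟩

theorem exists_of_basisLT_pairQuad (hg : ξ = 0 ∧ g = 1 ∨ ξ = 1 ∧ g = 0) {z : Vec p}
    {x y c e : ZMod p} (h : BasisLT F z (pairQuad F ξ g x y c e)) : ∃ x' y' c' e' : ZMod p,
      z = pairQuad F ξ g x' y' c' e' ∧ (e'.val < e.val ∨ e' = e ∧
        (c'.val < c.val ∨ c' = c ∧ (y'.val < y.val ∨ x'.val < x.val))) := by
  rcases hg with ⟨rfl, rfl⟩ | ⟨rfl, rfl⟩
  · rw [(pairQuad_eq _ _ _ _).1] at h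
    obtain ⟨a, b, c', e', rfl, h⟩ := exists_of_basisLT h
    exact ⟨a, b, c', e', (pairQuad_eq _ _ _ _).1.symm, by tauto⟩
  · rw [(pairQuad_eq _ _ _ _).2] at h
    obtain ⟨a, b, c', e', rfl, h⟩ := exists_of_basisLT h
    exact ⟨b, a, c', e', (pairQuad_eq _ _ _ _).2.symm, by tauto⟩

theorem basisLT_pairQuad (hg : ξ = 0 ∧ g = 1 ∨ ξ = 1 ∧ g = 0) {x y y' c e : ZMod p}
    (h : y'.val < y.val) : BasisLT F (pairQuad F ξ g x y' c e) (pairQuad F ξ g x y c e) := by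
  rcases hg with ⟨rfl, rfl⟩ | ⟨rfl, rfl⟩
  · rw [(pairQuad_eq _ _ _ _).1, (pairQuad_eq _ _ _ _).1]
    exact basisLT_quad (Or.inr ⟨rfl, Or.inr ⟨rfl, Or.inl h⟩⟩)
  · rw [(pairQuad_eq _ _ _ _).2, (pairQuad_eq _ _ _ _).2]
    exact basisLT_quad (Or.inr ⟨rfl, Or.inr ⟨rfl, Or.inr ⟨rfl, h⟩⟩⟩)

/-- The first basis word is f_ξ, of weight two, and the next ones are f_g + f_2 and f_g + f_3. The
sum 2 f_g + f_2 + f_3 of the latter two is undercut by f_2 + f_3. -/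
theorem not_isLinearCode_of_le_one (hp : 5 ≤ p) {η : ℕ} (hg : ξ = 0 ∧ g = 1 ∨ ξ = 1 ∧ g = 0)
    (hη : η ≠ ξ) (hξ : F ξ = Finsupp.single ξ 1 + Finsupp.single η 1)
    (hFg : F g = Finsupp.single g 1) (h2 : F 2 = Finsupp.single 2 1)
    (h3 : F 3 = Finsupp.single 3 1) : ¬ IsLinearCode (lexCode F 2 3) := by
  intro hlin3
  have hlin := isLinearCode_of_succ (by norm_num) hlin3
  have hlin1 := isLinearCode_of_succ (by norm_num) hlin
  have d1 : ξ ≠ g := by omega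
  have d2 : ξ ≠ 2 := by omega
  have d3 : ξ ≠ 3 := by omega
  have d4 : g ≠ 2 := by omega
  have d5 : g ≠ 3 := by omega
  have cξ : ∀ x y c e, pairQuad F ξ g x y c e ξ = x := fun x y c e => by
    simp [pairQuad, hξ, hFg, h2, h3, Finsupp.single_apply, hη, d1.symm, d2.symm, d3.symm]
  have cg : ∀ x y c e, pairQuad F ξ g x y c e g = y + if η = g then x else 0 := fun x y c e => by
    simp [pairQuad, hξ, hFg, h2, h3, Finsupp.single_apply, d1, d4.symm, d5.symm, add_comm]
  have c2 : ∀ x y c e, pairQuad F ξ g x y c e 2 = c + if η = 2 then x else 0 := fun x y c e => by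
    simp [pairQuad, hξ, hFg, h2, h3, Finsupp.single_apply, d2, d4, add_comm]
  have c3 : ∀ x y c e, pairQuad F ξ g x y c e 3 = e + if η = 3 then x else 0 := fun x y c e => by
    simp [pairQuad, hξ, hFg, h2, h3, Finsupp.single_apply, d3, d5, add_comm]
  have hu : word F 2 1 = pairQuad F ξ g 1 0 0 0 := by
    refine word_pow_eq_of_close (k := 0) (mem_farSet_zero.2 ?_) fun z hz => ?_
    · refine two_le_hdist hη ?_ (by simp [cξ])
      simp [pairQuad, hξ, Finsupp.single_apply, hη.symm]
    · obtain ⟨x, y, c, e, rfl, h⟩ := exists_of_basisLT_pairQuad hg hz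
      simp only [not_val_lt_zero, false_or] at h
      obtain ⟨rfl, rfl, h⟩ := h
      exact ⟨0, mem_lexCode_zero.2 rfl, g, y, by simp [pairQuad, hFg, eq_zero_of_val_lt_one h]⟩
  have hL1 : ∀ {z}, z ∈ lexCode F 2 1 ↔ ∃ a, z = pairQuad F ξ g a 0 0 0 := fun {z} => by
    rw [mem_lexCode_one_iff (by norm_num) hlin1, hu]
    simp only [smul_pairQuad, mul_one, mul_zero]
  have hv : word F 2 p = pairQuad F ξ g 0 1 1 0 := by
    have := word_pow_eq_of_close (F := F) (k := 1) (t := pairQuad F ξ g 0 1 1 0) (fun c hc => ?_)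
      fun z hz => ?_
    · rwa [pow_one] at this
    · obtain ⟨a, rfl⟩ := hL1.1 hc
      by_cases ha : a = 0
      · exact two_le_hdist d4 (by simp [cg, ha]) (by simp [c2, ha])
      · have hξ' : pairQuad F ξ g 0 1 1 0 ξ ≠ pairQuad F ξ g a 0 0 0 ξ := by
          simp [cξ, Ne.symm ha]
        by_cases hηg : η = g
        · exact two_le_hdist d2 hξ' (by simp [c2, hηg, d4])
        · exact two_le_hdist d1 hξ' (by simp [cg, hηg])
    · obtain ⟨x, y, c, e, rfl, h⟩ := exists_of_basisLT_pairQuad hg hz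
      simp only [not_val_lt_zero, false_or, or_false] at h
      obtain ⟨rfl, h⟩ := h
      rcases h with h | ⟨rfl, h⟩
      · exact ⟨_, hL1.2 ⟨x, rfl⟩, g, y, by simp [pairQuad, hFg, eq_zero_of_val_lt_one h]⟩
      · exact ⟨_, hL1.2 ⟨x, rfl⟩, 2, 1, by simp [pairQuad, h2, eq_zero_of_val_lt_one h]⟩
  have hL2 : ∀ {z}, z ∈ lexCode F 2 2 ↔ ∃ a b, z = pairQuad F ξ g b a a 0 := fun {z} => by
    rw [mem_lexCode_two_iff (by norm_num) hlin, hu, hv]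
    simp only [smul_pairQuad, pairQuad_add, mul_one, mul_zero, zero_add, add_zero]
  have hfar : ∀ y c : ZMod p, y ≠ c → pairQuad F ξ g 0 y c 1 ∈ farSet 2 (lexCode F 2 2) := by
    intro y c hyc w hw
    obtain ⟨b, a, rfl⟩ := hL2.1 hw
    have hg2 : a = 0 ∨ η = 3 → ∃ i, i ≠ ξ ∧ i ≠ 3 ∧
        pairQuad F ξ g 0 y c 1 i ≠ pairQuad F ξ g a b b 0 i := fun ha => by
      by_cases hy : y = b
      · refine ⟨2, d2.symm, by norm_num, ?_⟩
        rcases ha with rfl | rfl <;> simp [c2, ← hy, Ne.symm hyc]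
      · refine ⟨g, d1.symm, d5, ?_⟩
        rcases ha with rfl | rfl
        · simp [cg, hy]
        · simp [cg, hy, d5.symm]
    by_cases ha : a = 0
    · obtain ⟨i, -, hi, h⟩ := hg2 (Or.inl ha)
      exact two_le_hdist hi h (by simp [c3, ha])
    · have hξ' : pairQuad F ξ g 0 y c 1 ξ ≠ pairQuad F ξ g a b b 0 ξ := by simp [cξ, Ne.symm ha]
      by_cases hη3 : η = 3
      · obtain ⟨i, hi, -, h⟩ := hg2 (Or.inr hη3)
        exact two_le_hdist hi h hξ'
      · exact two_le_hdist d3 hξ' (by simp [c3, hη3])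
  have hw : word F 2 (p ^ 2) = pairQuad F ξ g 0 1 0 1 := by
    refine word_pow_eq_of_close (hfar 1 0 one_ne_zero) fun z hz => ?_
    obtain ⟨x, y, c, e, rfl, h⟩ := exists_of_basisLT_pairQuad hg hz
    simp only [not_val_lt_zero, false_or, or_false] at h
    rcases h with h | ⟨rfl, rfl, h⟩
    · refine ⟨_, hL2.2 ⟨c, x, rfl⟩, g, y - c, ?_⟩
      simp [pairQuad, hFg, eq_zero_of_val_lt_one h]
      abel
    · exact ⟨_, hL2.2 ⟨0, x, rfl⟩, 3, 1, by simp [pairQuad, h3, eq_zero_of_val_lt_one h]⟩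
  have hpp : p < p ^ 2 := by
    rw [pow_two]
    exact lt_mul_of_one_lt_left (by omega) (by omega)
  -- The translate is by the second basis word w(p), so the competitor has to be far from the third
  -- basis word plus every multiple of f_ξ.
  refine not_lt_add_word (F := F) (by norm_num) hlin3 (i := p) (z := pairQuad F ξ g 0 0 1 1) hpp
    (hfar 0 1 zero_ne_one) (fun i' hi' => ?_) ?_
  · rw [hw, word_eq_smul (by norm_num) hlin1 hi', hu, smul_pairQuad, pairQuad_add]
    generalize (i' : ZMod p) = a
    simp only [mul_one, mul_zero, add_zero, zero_add]
    by_cases ha : a = 0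
    · exact two_le_hdist d4 (by simp [cg, ha]) (by simp [c2, ha])
    · have hξ' : pairQuad F ξ g 0 0 1 1 ξ ≠ pairQuad F ξ g a 1 0 1 ξ := by simp [cξ, Ne.symm ha]
      by_cases hηg : η = g
      · exact two_le_hdist d2 hξ' (by simp [c2, hηg, d4])
      · exact two_le_hdist d1 hξ' (by simp [cg, hηg])
  · rw [hw, hv, pairQuad_add, add_zero, zero_add, add_zero]
    refine basisLT_pairQuad hg ?_
    rw [ZMod.val_zero, one_add_one_eq_two]
    exact val_pos_of_ne_zero (two_ne_zero_of_le hp)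

end PairQuad

theorem not_isLinearCode_two (hp : 5 ≤ p) (hF : F ∈ basisFamily p) :
    ¬ IsLinearCode (lexCode F 2 3) := by
  rcases hF with rfl | ⟨ξ, η, h, rfl⟩
  · exact fun hlin => not_isLinearCode_of_standard hp (stdBasis_apply p 0) (stdBasis_apply p 1)
      (stdBasis_apply p 2) (isLinearCode_of_succ (by norm_num) hlin)
  · have hself : twistBasis p ξ η h ξ = Finsupp.single ξ 1 + Finsupp.single η 1 := by
      rw [twistBasis_apply, if_pos rfl, stdBasis_apply, stdBasis_apply]
    have hne : ∀ i, i ≠ ξ → twistBasis p ξ η h i = Finsupp.single i 1 := fun i hi => by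
      rw [twistBasis_apply, if_neg hi, stdBasis_apply]
    obtain hξ | rfl | hξ : ξ ≤ 1 ∨ ξ = 2 ∨ 3 ≤ ξ := by omega
    · exact not_isLinearCode_of_le_one hp (g := 1 - ξ) (by omega) h.symm hself (hne _ (by omega))
        (hne 2 (by omega)) (hne 3 (by omega))
    · exact not_isLinearCode_of_two hp h.symm (hne 0 (by omega)) (hne 1 (by omega)) hself
        (hne 3 (by omega))
    · exact fun hlin => not_isLinearCode_of_standard hp (hne 0 (by omega)) (hne 1 (by omega))
        (hne 2 (by omega)) (isLinearCode_of_succ (by norm_num) hlin)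

/-- For `p ≥ 5`, the third code is not linear. -/
theorem not_isLinearCode_three (hp : 5 ≤ p) (hF : F ∈ basisFamily p) {d : ℕ} (hd : 2 ≤ d) :
    ¬ IsLinearCode (lexCode F d 3) := by
  rcases hd.eq_or_lt with rfl | hd3
  · exact not_isLinearCode_two hp hF
  intro hlin
  obtain ⟨ξ, η, κ, hF'⟩ := exists_isTwisted hF
  obtain ⟨S, hS, -, h⟩ := exists_isSecondStep hF' hd3 (isLinearCode_of_succ (by omega) hlin)
  have h' := h.isTwistedStep hp hF'
  obtain rfl := h'.eq_five hp hF'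
  have hd5 : d = 5 := hS.symm.trans (IsTwistedStep.card_eq_five hF' h')
  subst hd5
  exact not_isLinearCode_five hF' hlin

end LexCode

/-! ### The three cases combined -/

theorem theorem1p7 (p : ℕ) [Fact p.Prime] (F : LexCode.OrdBasis p)
    (hF : F ∈ LexCode.basisFamily p) (d : ℕ) (hd : 2 ≤ d) :
    (p = 2 → LexCode.IsMaxLinearDim F d ⊤) ∧
    (p = 3 → ∀ k d' : ℕ, 1 ≤ k → d = 3 ^ (k - 1) * d' → 2 ≤ d' →
      (∃ m : ℕ∞, LexCode.IsMaxLinearDim F d m ∧ (k : ℕ∞) ≤ m) ∧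
      (padicValNat 3 d = k - 1 → 8 ≤ d' → LexCode.IsMaxLinearDim F d (k : ℕ∞))) ∧
    (5 ≤ p → ∃ m : ℕ∞, LexCode.IsMaxLinearDim F d m ∧ m ≤ 2) := by
  have hd0 : 0 < d := by omega
  refine ⟨?_, ?_, fun hp => ?_⟩
  · rintro rfl
    exact Or.inl ⟨rfl, fun k => LexCode.isLinearCode_lexCode_two k⟩
  · rintro rfl k d' hk rfl hd'
    have hlin := LexCode.isLinearCode_lexCode_three hF (k := k) hd'
    constructor
    · obtain ⟨m, hm⟩ := LexCode.exists_isMaxLinearDim (F := F) hd0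
      exact ⟨m, hm, hm.le_of_isLinearCode hlin⟩
    · intro hval hd8
      refine LexCode.isMaxLinearDim_of_isLinearCode hd0 hlin
        (LexCode.not_isLinearCode_lexCode_three hF hk hd8 fun h3 => ?_)
      -- If 3 divided d', the 3-adic order of d would be at least k.
      have hdvd : 3 ^ k ∣ 3 ^ (k - 1) * d' := by
        obtain ⟨j, rfl⟩ : ∃ j, k = j + 1 := ⟨k - 1, by omega⟩
        rw [pow_succ, Nat.add_sub_cancel]
        exact mul_dvd_mul_left _ h3
      have := (padicValNat_dvd_iff_le hd0.ne').1 hdvd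
      omega
  · obtain ⟨m, hm⟩ := LexCode.exists_isMaxLinearDim (F := F) hd0
    exact ⟨m, hm, hm.le_of_not_isLinearCode hd0 (k := 2)
      (LexCode.not_isLinearCode_three hp hF hd)⟩
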